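/- **Proposition 3.7.** Conventions. An *orbifold structure* of dimension $n$ is a proper étale Lie groupoid (ep-groupoid) $(O,\boldsymbol O)$: a groupoid whose object and morphism sets are smooth Hausdorff paracompact $n$-manifolds without boundary, with smooth structure maps, whose source and target maps are surjective local diffeomorphisms, and such that each $x\in O$ has an open neighbourhood $V$ with $t:s^{-1}(\overline V)\to O$ proper; its orbit space $\mathcal O=|O|$, with projection $\pi:O\to|O|$, is assumed Hausdorff, second countable and paracompact. A *polyfold structure* $(Z,\boldsymbol Z)$ is the analogous notion in which objects and morphisms form M-polyfolds and smoothness is sc-smoothness. An *embedded full suborbifold* $\mathcal X=\pi(X)\subset\mathcal O$ of dimension $k$ is given by the full subgroupoid on a saturated set $X\subset O$ that is mapped, in suitable charts of $O$ around each of its points, to a $k$-dimensional plane. Its normal bundle has *fiberwise trivial isotropy action* if for each $x\in X$ the isotropy group $\boldsymbol G(x)$ acts trivially on $T_xO/T_xX$. A *weighted branched suborbifold* $\mathcal S\subset\mathcal Z=|Z|$ is given by a morphism-invariant function $\hat\theta:Z\to\mathbb Q\cap[0,\infty)$ whose support $S=\{\hat\theta>0\}$ consists of smooth points and such that every $x\in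 S$ has a *local branching structure*: an open $U\ni x$, finitely many finite-dimensional submanifolds $M_i\subset U$ (the branches) of one dimension, without boundary and properly included in $U$, with $S\cap U=\bigcup_iM_i$, and rational weights $w_i>0$ with $\hat\theta(y)=\sum_{i:\,y\in M_i}w_i$ for $y\in S\cap U$. It is compact if $\mathcal S=\pi_Z(S)\subset|Z|$ is compact, $\pi_Z:Z\to|Z|$ being the projection. Let $\mathcal S$ be a compact weighted branched suborbifold, let $\mathcal O$ be an $n$-dimensional orbifold with orbifold structure $(O,\boldsymbol O)$, and let $\mathcal X\subset\mathcal O$ be a compact embedded full suborbifold of dimension $k$ whose normal bundle has fiberwise trivial isotropy action. Let $f:\mathcal S\to\mathcal O$ be a smooth map with associated smooth functor $\hat f:(S,\boldsymbol S)\to(O,\boldsymbol O)$, where $(S,\boldsymbol S)$ is the full subgroupoid of $(Z,\boldsymbol Z)$ on $S$; that is, $\hat f$ is a functor, continuous on objects and morphisms, which around each object of $S$ is smooth on the branches of some local branching structure. Then there is a continuous map $i':\mathcal X\to\mathcal O$, homotopic to the inclusion $i:\mathcal X\hookrightarrow\mathcal O$, such that: 1. $i'$ is a smooth inclusion: its image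 $i'(\mathcal X)$ is again a $k$-dimensional embedded full suborbifold of $\mathcal O$ whose normal bundle has fiberwise trivial isotropy action, and $i'$ is an orbifold diffeomorphism from $\mathcal X$ onto $i'(\mathcal X)$, i.e. it is induced by a pair of smooth functors $X\leftarrow P\to X'$ from an ep-groupoid $P$ which are equivalences onto the full subgroupoids on $X$ and on $X'=\pi^{-1}(i'(\mathcal X))$; 2. $f\pitchfork i'(\mathcal X)$: for every $x\in S$ with $\hat f(x)\in X'$, every local branching structure at $x$ on whose branches $\hat f$ is smooth, and every branch $M_i$ of it containing $x$, $$D\hat f_x(T_xM_i)+T_{\hat f(x)}X'=T_{\hat f(x)}O .$$ -/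

import Mathlib

open Set Filter Topology Asymptotics
open scoped Manifold ContDiff

universe a b c d e

/-! ## Groupoids presented by objects and morphisms -/

/-- A groupoid (small category with invertible morphisms) with object set `Ob` and morphism set
`Mo`.  The composite `comp g f` (first `f`, then `g`) is meaningful only if `src g = tgt f`;
no law constrains it otherwise. -/
structure GroupoidOn (Ob : Type a) (Mo : Type b) where
  src : Mo → Ob
  tgt : Mo → Ob
  unit : Ob → Mo
  inv : Mo → Mo
  comp : Mo → Mo → Mo
  src_unit : ∀ x, src (unit x) = x
  tgt_unit : ∀ x, tgt (unit x) = x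
  src_inv : ∀ g, src (inv g) = tgt g
  tgt_inv : ∀ g, tgt (inv g) = src g
  src_comp : ∀ g f, src g = tgt f → src (comp g f) = src f
  tgt_comp : ∀ g f, src g = tgt f → tgt (comp g f) = tgt g
  comp_assoc : ∀ h g f, src h = tgt g → src g = tgt f → comp (comp h g) f = comp h (comp g f)
  comp_unit : ∀ g, comp g (unit (src g)) = g
  unit_comp : ∀ g, comp (unit (tgt g)) g = g
  comp_inv : ∀ g, comp g (inv g) = unit (tgt g)
  inv_comp : ∀ g, comp (inv g) g = unit (src g)

namespace GroupoidOn

variable {Ob : Type a} {Mo : Type b}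

/-- Two objects are equivalent if there is a morphism between them. -/
def orbitRel (G : GroupoidOn Ob Mo) : Setoid Ob where
  r x y := ∃ g, G.src g = x ∧ G.tgt g = y
  iseqv :=
    { refl := fun x => ⟨G.unit x, G.src_unit x, G.tgt_unit x⟩
      symm := by
        rintro x y ⟨g, hs, ht⟩
        exact ⟨G.inv g, (G.src_inv g).trans ht, (G.tgt_inv g).trans hs⟩
      trans := by
        rintro x y z ⟨f, hfs, hft⟩ ⟨g, hgs, hgt⟩
        have h : G.src g = G.tgt f := hgs.trans hft.symm
        exact ⟨G.comp g f, (G.src_comp g f h).trans hfs, (G.tgt_comp g f h).trans hgt⟩ }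

/-- The orbit space, with the quotient topology (when `Ob` has a topology). -/
def Orbit (G : GroupoidOn Ob Mo) : Type a := Quotient G.orbitRel

instance [TopologicalSpace Ob] (G : GroupoidOn Ob Mo) : TopologicalSpace G.Orbit :=
  inferInstanceAs (TopologicalSpace (Quotient G.orbitRel))

/-- The projection of objects to the orbit space. -/
def proj (G : GroupoidOn Ob Mo) (x : Ob) : G.Orbit := Quotient.mk G.orbitRel x

/-- Properness of a topological groupoid: every object has an open neighbourhood `V` such that
the target map restricted to the morphisms with source in the closure of `V` is proper. -/
def IsProper [TopologicalSpace Ob] [TopologicalSpace Mo] (G : GroupoidOn Ob Mo) : Prop :=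
  ∀ x : Ob, ∃ V : Set Ob, IsOpen V ∧ x ∈ V ∧
    IsProperMap (fun g : {g : Mo // G.src g ∈ closure V} => G.tgt g.1)

end GroupoidOn

/-! ## Finite-dimensional ep-groupoids, i.e. orbifold structures -/

/-- An ep-groupoid of dimension `n`: a groupoid whose object and morphism sets are smooth
`n`-manifolds (without boundary), with smooth structure maps, which is étale and proper. -/
structure EpGroupoid (n : ℕ) where
  Obj : Type a
  Mor : Type b
  [topObj : TopologicalSpace Obj]
  [chartObj : ChartedSpace (EuclideanSpace ℝ (Fin n)) Obj]
  [mfdObj : IsManifold (𝓡 n) ∞ Obj]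
  [t2Obj : T2Space Obj]
  [paraObj : ParacompactSpace Obj]
  [topMor : TopologicalSpace Mor]
  [chartMor : ChartedSpace (EuclideanSpace ℝ (Fin n)) Mor]
  [mfdMor : IsManifold (𝓡 n) ∞ Mor]
  [t2Mor : T2Space Mor]
  [paraMor : ParacompactSpace Mor]
  gr : GroupoidOn Obj Mor
  smooth_unit : ContMDiff (𝓡 n) (𝓡 n) ∞ gr.unit
  smooth_inv : ContMDiff (𝓡 n) (𝓡 n) ∞ gr.inv
  smooth_comp : ContMDiffOn ((𝓡 n).prod (𝓡 n)) (𝓡 n) ∞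
    (fun p : Mor × Mor => gr.comp p.1 p.2) {p | gr.src p.1 = gr.tgt p.2}
  etale_src : IsLocalDiffeomorph (𝓡 n) (𝓡 n) ∞ gr.src
  etale_tgt : IsLocalDiffeomorph (𝓡 n) (𝓡 n) ∞ gr.tgt
  proper : gr.IsProper

attribute [instance] EpGroupoid.topObj EpGroupoid.chartObj EpGroupoid.mfdObj EpGroupoid.t2Obj
  EpGroupoid.paraObj EpGroupoid.topMor EpGroupoid.chartMor EpGroupoid.mfdMor EpGroupoid.t2Mor
  EpGroupoid.paraMor

/-- A smooth functor between ep-groupoids: a functor which is smooth on objects and morphisms. -/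
structure SmoothFunctor {k n : ℕ} (P : EpGroupoid.{a, b} k) (O : EpGroupoid.{c, d} n) where
  obj : P.Obj → O.Obj
  mor : P.Mor → O.Mor
  smooth_obj : ContMDiff (𝓡 k) (𝓡 n) ∞ obj
  smooth_mor : ContMDiff (𝓡 k) (𝓡 n) ∞ mor
  src_mor : ∀ g, O.gr.src (mor g) = obj (P.gr.src g)
  tgt_mor : ∀ g, O.gr.tgt (mor g) = obj (P.gr.tgt g)
  mor_unit : ∀ x, mor (P.gr.unit x) = O.gr.unit (obj x)
  mor_comp : ∀ g f, P.gr.src g = P.gr.tgt f →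
    mor (P.gr.comp g f) = O.gr.comp (mor g) (mor f)

/-! ## Embedded full suborbifolds -/

section Suborbifold

variable {n : ℕ} (O : EpGroupoid.{a, b} n)

/-- The set of objects `X` spans an embedded full suborbifold of dimension `k`: `X` is saturated,
and near each of its points some chart of the object manifold `O` maps it to a `k`-dimensional
plane.  The subgroupoid is the full one on `X`, so it is determined by `X`.  The domain of
the chart can be shrunk to a neighbourhood which is invariant under the isotropy group. -/
structure IsEmbeddedFullSuborbifold (k : ℕ) (X : Set O.Obj) : Prop where
  saturated : X = O.gr.proj ⁻¹' (O.gr.proj '' X)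
  slice : ∀ x ∈ X, ∃ φ ∈ IsManifold.maximalAtlas (𝓡 n) ∞ O.Obj, x ∈ φ.source ∧
    ∃ L : AffineSubspace ℝ (EuclideanSpace ℝ (Fin n)), Module.finrank ℝ L.direction = k ∧
      φ '' (X ∩ φ.source) = (L : Set (EuclideanSpace ℝ (Fin n))) ∩ φ.target

/-- The tangent space `T_x X ⊆ T_x O` of a submanifold `X`: it consists of the velocities at `x`
of the smooth curves in `X`. -/
noncomputable def tangentAlong (X : Set O.Obj) (x : O.Obj) :
    Submodule ℝ (TangentSpace (𝓡 n) x) :=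
  Submodule.span ℝ {v | ∃ γ : ℝ → O.Obj, ContMDiff 𝓘(ℝ, ℝ) (𝓡 n) ∞ γ ∧ (∀ τ, γ τ ∈ X) ∧
    γ 0 = x ∧ v = (mfderiv 𝓘(ℝ, ℝ) (𝓡 n) γ 0 (1 : ℝ) : EuclideanSpace ℝ (Fin n))}

/-- The differential of the source map at `g`, a map `T_g 𝐎 → T_{src g} O`.  (In Mathlib every
tangent space of an `n`-manifold is a copy of `ℝ^n`.) -/
noncomputable def dSrc (g : O.Mor) : EuclideanSpace ℝ (Fin n) →L[ℝ] EuclideanSpace ℝ (Fin n) :=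
  mfderiv (𝓡 n) (𝓡 n) O.gr.src g

/-- The differential of the target map at `g`, a map `T_g 𝐎 → T_{tgt g} O`. -/
noncomputable def dTgt (g : O.Mor) : EuclideanSpace ℝ (Fin n) →L[ℝ] EuclideanSpace ℝ (Fin n) :=
  mfderiv (𝓡 n) (𝓡 n) O.gr.tgt g

/-- The normal bundle of `X` has fiberwise trivial isotropy action.  An isotropy morphism `g` at
`x` acts on `T_x O` by `D tgt_g ∘ (D src_g)⁻¹`; the induced action on `N_x X = T_x O / T_x X` is
trivial iff this differs from the identity by a map with values in `T_x X`. -/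
def HasTrivialNormalIsotropy (X : Set O.Obj) : Prop :=
  ∀ x ∈ X, ∀ g : O.Mor, O.gr.src g = x → O.gr.tgt g = x →
    ∀ w : EuclideanSpace ℝ (Fin n), dTgt O g w - dSrc O g w ∈ tangentAlong O X x

/-- The underlying topological space of the suborbifold, a subspace of the orbit space. -/
abbrev underlying (X : Set O.Obj) : Type a := ↥(O.gr.proj '' X)

/-- The inclusion of underlying topological spaces. -/
def inclusionMap (X : Set O.Obj) : C(underlying O X, O.gr.Orbit) :=
  ⟨Subtype.val, continuous_subtype_val⟩

end Suborbifold

/-- `F` is an equivalence of ep-groupoids from `P` onto the full subgroupoid of `O` on `X`,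
where `X` is an embedded full suborbifold of dimension `k = dim P`: it is fully faithful,
essentially surjective, and a local diffeomorphism onto `X` on objects (as the dimensions agree,
this says that `F` is an immersion with values in `X`). -/
structure IsEquivalenceOnto {k n : ℕ} {P : EpGroupoid.{a, b} k} {O : EpGroupoid.{c, d} n}
    (F : SmoothFunctor P O) (X : Set O.Obj) : Prop where
  maps : ∀ p, F.obj p ∈ X
  immersion : ∀ p, Function.Injective (mfderiv (𝓡 k) (𝓡 n) F.obj p)
  essSurj : ∀ x ∈ X, ∃ p, ∃ g, O.gr.src g = F.obj p ∧ O.gr.tgt g = x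
  fullyFaithful : ∀ p q, ∀ g, O.gr.src g = F.obj p → O.gr.tgt g = F.obj q →
    ∃! h, P.gr.src h = p ∧ P.gr.tgt h = q ∧ F.mor h = g

/-- `i : 𝒳 → 𝒪` is a smooth inclusion of the `k`-dimensional embedded full suborbifold `𝒳` as
another one, `i(𝒳)`: the image spans an embedded full suborbifold, and `i` is induced by smooth
functors on a representative `P` of the Morita class of `𝒳`, namely by a span `X ← P → O`
whose first arrow is an equivalence onto `X` and whose second arrow is an equivalence onto the
full subgroupoid over the image of `i`. -/
structure IsSmoothInclusion {n : ℕ} (O : EpGroupoid.{a, b} n) (k : ℕ) (X : Set O.Obj)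
    (i : C(underlying O X, O.gr.Orbit)) : Prop where
  image_suborbifold : IsEmbeddedFullSuborbifold O k (O.gr.proj ⁻¹' range i)
  induced : ∃ (P : EpGroupoid.{a, b} k) (F G : SmoothFunctor P O),
    IsEquivalenceOnto F X ∧ IsEquivalenceOnto G (O.gr.proj ⁻¹' range i) ∧
      ∀ (p : P.Obj) (hp : O.gr.proj (F.obj p) ∈ O.gr.proj '' X),
        i ⟨O.gr.proj (F.obj p), hp⟩ = O.gr.proj (G.obj p)

/-! ## sc-calculus -/

/-- A scale of Banach spaces `E_0 ← E_1 ← E_2 ← ⋯` with bounded connecting maps. -/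
structure BanachScale where
  lvl : ℕ → Type a
  [normed : ∀ m, NormedAddCommGroup (lvl m)]
  [space : ∀ m, NormedSpace ℝ (lvl m)]
  [complete : ∀ m, CompleteSpace (lvl m)]
  incl : ∀ m, lvl (m + 1) →L[ℝ] lvl m

attribute [instance] BanachScale.normed BanachScale.space BanachScale.complete

namespace BanachScale

/-- The connecting map `E_m → E_0`. -/
noncomputable def toZero (E : BanachScale.{a}) : ∀ m, E.lvl m →L[ℝ] E.lvl 0
  | 0 => ContinuousLinearMap.id ℝ (E.lvl 0)
  | m + 1 => (toZero E m).comp (E.incl m)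

/-- The scale is an sc-Banach space: the connecting maps are injective and compact, and
`E_∞ = ⋂ E_m` is dense in every level. -/
structure IsScBanach (E : BanachScale.{a}) : Prop where
  injective : ∀ m, Function.Injective (E.incl m)
  compact : ∀ m, IsCompactOperator (E.incl m)
  dense : ∀ m, Dense {y : E.lvl m | ∃ x : ∀ j, E.lvl j, (∀ j, E.incl j (x (j + 1)) = x j) ∧ x m = y}

/-- The tangent `T E`, with levels `(T E)_m = E_{m+1} ⊕ E_m`. -/
noncomputable def tangent (E : BanachScale.{a}) : BanachScale.{a} where
  lvl m := E.lvl (m + 1) × E.lvl m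
  incl m := (E.incl (m + 1)).prodMap (E.incl m)

/-- `ℝ^n` with the constant sc-structure. -/
noncomputable def euclid (n : ℕ) : BanachScale.{0} where
  lvl _ := EuclideanSpace ℝ (Fin n)
  incl _ := ContinuousLinearMap.id ℝ _

/-- `f : U → F` is `sc⁰`: it maps `U ∩ E_m` into `F_m`, continuously for the topologies of the
levels. -/
def Sc0On (E : BanachScale.{a}) (F : BanachScale.{b}) (U : Set (E.lvl 0))
    (f : E.lvl 0 → F.lvl 0) : Prop :=
  ∀ m, ∃ fm : E.lvl m → F.lvl m, ContinuousOn fm (E.toZero m ⁻¹' U) ∧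
    ∀ x, E.toZero m x ∈ U → F.toZero m (fm x) = f (E.toZero m x)

/-- `f : U → F` is `sc^k`.  It is `sc^{k+1}` if it is `sc⁰`, if for all `x ∈ U_1` there is a
bounded operator `Df(x) : E_0 → F_0` with
`‖f(x+h) - f(x) - Df(x)h‖_0 / ‖h‖_1 → 0` as `h → 0` in `E_1` with `x + h ∈ U`, and if the tangent
map `Tf(x,h) = (f(x), Df(x)h)` from `TU = U_1 ⊕ E_0` to `TF = F_1 ⊕ F_0` is `sc^k`. -/
def ScOn : ∀ (_ : ℕ) (E : BanachScale.{a}) (F : BanachScale.{b}) (_ : Set (E.lvl 0))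
    (_ : E.lvl 0 → F.lvl 0), Prop
  | 0, E, F, U, f => Sc0On E F U f
  | k + 1, E, F, U, f => Sc0On E F U f ∧
      ∃ (f₁ : E.lvl 1 → F.lvl 1) (D : E.lvl 1 → (E.lvl 0 →L[ℝ] F.lvl 0)),
        (∀ x, E.incl 0 x ∈ U → F.incl 0 (f₁ x) = f (E.incl 0 x)) ∧
        (∀ x, E.incl 0 x ∈ U →
          (fun h : E.lvl 1 => f (E.incl 0 (x + h)) - f (E.incl 0 x) - D x (E.incl 0 h))
            =o[𝓝[{h | E.incl 0 (x + h) ∈ U}] 0] (fun h : E.lvl 1 => h)) ∧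
        ScOn k E.tangent F.tangent
          {p : E.lvl 1 × E.lvl 0 | E.incl 0 p.1 ∈ U}
          (fun p : E.lvl 1 × E.lvl 0 => (f₁ p.1, D p.1 p.2))

/-- sc-smooth maps `U → F`, for `U` relatively open in a partial quadrant. -/
def ScSmoothOn (E : BanachScale.{a}) (F : BanachScale.{b}) (U : Set (E.lvl 0))
    (f : E.lvl 0 → F.lvl 0) : Prop :=
  ∀ k, ScOn k E F U f

/-- Partial quadrants of `E`: the subsets which a linear sc-isomorphism `E ≅ ℝ^l ⊕ W` takes to
`[0,∞)^l ⊕ W`.  The first component `q : E → ℝ^l` of such an isomorphism is bounded on `E_0`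
and onto; conversely each such `q` is a first component since `E_∞` is dense. -/
def IsPartialQuadrant (E : BanachScale.{a}) (C : Set (E.lvl 0)) : Prop :=
  ∃ (l : ℕ) (q : E.lvl 0 →L[ℝ] EuclideanSpace ℝ (Fin l)), Function.Surjective q ∧
    C = {x | ∀ j, 0 ≤ q x j}

/-- `r` is an sc-smooth retraction of `U`, relatively open in `C`, onto `A`. -/
structure IsScRetraction (E : BanachScale.{a}) (C U A : Set (E.lvl 0))
    (r : E.lvl 0 → E.lvl 0) : Prop where
  relOpen : ∃ W : Set (E.lvl 0), IsOpen W ∧ U = C ∩ W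
  mapsTo : MapsTo r U U
  idem : ∀ x ∈ U, r (r x) = r x
  image : r '' U = A
  smooth : ScSmoothOn E E U r

/-- `(A, C, E)` is an sc-smooth retract. -/
def IsScRetract (E : BanachScale.{a}) (C A : Set (E.lvl 0)) : Prop :=
  ∃ U r, IsScRetraction E C U A r

/-- `f : A → F` is sc-smooth on the sc-smooth retract `(A, C, E)`: the composite `f ∘ r` is
sc-smooth on `U`, for an sc-smooth retraction `r : U → U` onto `A`.  (By the chain rule the
choice of `r` does not matter.) -/
def ScSmoothOnRetract (E : BanachScale.{a}) (F : BanachScale.{b}) (C A : Set (E.lvl 0))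
    (f : E.lvl 0 → F.lvl 0) : Prop :=
  ∃ U r, IsScRetraction E C U A r ∧ ScSmoothOn E F U (f ∘ r)

end BanachScale

/-! ## M-polyfolds -/

/-- An sc-chart of a topological space: a homeomorphism from an open subset to an sc-smooth
retract `(φ.target, C, E)` in a partial quadrant `C` of an sc-Banach space `E`. -/
structure ScChart (X : Type a) [TopologicalSpace X] where
  E : BanachScale.{c}
  isSc : E.IsScBanach
  C : Set (E.lvl 0)
  quadrant : E.IsPartialQuadrant C
  φ : PartialEquiv X (E.lvl 0)
  open_source : IsOpen φ.source
  continuousOn : ContinuousOn φ φ.source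
  continuousOn_symm : ContinuousOn φ.symm φ.target
  retract : E.IsScRetract C φ.target

/-- An sc-smooth atlas: charts cover the space and transition maps are sc-smooth. -/
structure ScAtlas (X : Type a) [TopologicalSpace X] where
  charts : Set (ScChart.{a, c} X)
  cover : ∀ x, ∃ κ ∈ charts, x ∈ κ.φ.source
  compatible : ∀ κ ∈ charts, ∀ κ' ∈ charts,
    κ.E.ScSmoothOnRetract κ'.E κ.C (κ.φ '' (κ.φ.source ∩ κ'.φ.source)) (κ'.φ ∘ κ.φ.symm)

section MPolyfold

variable {X : Type a} [TopologicalSpace X] {Y : Type b} [TopologicalSpace Y]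

/-- `h` is sc-smooth on the open subset `W` of the M-polyfold `X`, with values in `Y`. -/
def MScSmoothOn (A : ScAtlas.{a, c} X) (B : ScAtlas.{b, d} Y) (W : Set X) (h : X → Y) : Prop :=
  ContinuousOn h W ∧ ∀ κ ∈ A.charts, ∀ κ' ∈ B.charts,
    κ.E.ScSmoothOnRetract κ'.E κ.C (κ.φ '' (κ.φ.source ∩ (W ∩ h ⁻¹' κ'.φ.source)))
      (κ'.φ ∘ h ∘ κ.φ.symm)

/-- `h` is a local sc-diffeomorphism. -/
def IsLocalScDiffeo (A : ScAtlas.{a, c} X) (B : ScAtlas.{b, d} Y) (h : X → Y) : Prop :=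
  ∀ x, ∃ ψ : OpenPartialHomeomorph X Y, x ∈ ψ.source ∧ EqOn h ψ ψ.source ∧
    MScSmoothOn A B ψ.source ψ ∧ MScSmoothOn B A ψ.target ψ.symm

/-- sc-smoothness of a map `Φ : Q → X` from an open subset `Q` of `ℝ^k`. -/
def ScSmoothFromEuclid (A : ScAtlas.{a, c} X) {k : ℕ} (Q : Set (EuclideanSpace ℝ (Fin k)))
    (Φ : EuclideanSpace ℝ (Fin k) → X) : Prop :=
  ContinuousOn Φ Q ∧ ∀ κ ∈ A.charts,
    (BanachScale.euclid k).ScSmoothOn κ.E (Q ∩ Φ ⁻¹' κ.φ.source) (κ.φ ∘ Φ)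

/-- sc-smoothness of a map `ρ : V → ℝ^k` on an open subset `V` of `X`. -/
def ScSmoothToEuclid (A : ScAtlas.{a, c} X) {k : ℕ} (V : Set X)
    (ρ : X → EuclideanSpace ℝ (Fin k)) : Prop :=
  ContinuousOn ρ V ∧ ∀ κ ∈ A.charts,
    κ.E.ScSmoothOnRetract (BanachScale.euclid k) κ.C (κ.φ '' (κ.φ.source ∩ V)) (ρ ∘ κ.φ.symm)

/-- `x` lies in `X_∞`, the set of points which are smooth, i.e. on every level, in charts. -/
def ScAtlas.IsSmoothPoint (A : ScAtlas.{a, c} X) (x : X) : Prop :=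
  ∀ κ ∈ A.charts, x ∈ κ.φ.source → ∀ m, κ.φ x ∈ range (κ.E.toZero m)

/-- A local parametrization of a `k`-dimensional submanifold `M` of an M-polyfold: an sc-smooth
map `Φ` from an open `Q ⊆ ℝ^k` onto the piece `M ∩ V` of `M` in an open `V ⊆ X`, which has an
sc-smooth left inverse `ρ` on `V`.  So `Φ : Q → M ∩ V` is a homeomorphism and `Φ ∘ ρ` is,
on `ρ⁻¹(Q)`, an `sc⁺`-smooth retraction onto `M ∩ V`
(it factors through `ℝ^k`, all of whose levels agree). -/
structure SubmanifoldParam (A : ScAtlas.{a, c} X) (k : ℕ) (M : Set X) where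
  Q : Set (EuclideanSpace ℝ (Fin k))
  V : Set X
  Φ : EuclideanSpace ℝ (Fin k) → X
  ρ : X → EuclideanSpace ℝ (Fin k)
  openQ : IsOpen Q
  openV : IsOpen V
  smoothΦ : ScSmoothFromEuclid A Q Φ
  smoothρ : ScSmoothToEuclid A V ρ
  image : Φ '' Q = M ∩ V
  left_inv : ∀ q ∈ Q, ρ (Φ q) = q

/-- `M` is a `k`-dimensional submanifold (without boundary) of the M-polyfold `X`. -/
def IsSubmanifold (A : ScAtlas.{a, c} X) (k : ℕ) (M : Set X) : Prop :=
  ∀ x ∈ M, ∃ p : SubmanifoldParam A k M, x ∈ p.V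

end MPolyfold

/-! ## Polyfold structures -/

/-- An ep-groupoid whose object and morphism spaces are M-polyfolds, with sc-smooth structure
maps, étale (source and target are surjective local sc-diffeomorphisms) and proper. -/
structure ScEpGroupoid where
  Obj : Type a
  Mor : Type b
  [topObj : TopologicalSpace Obj]
  [t2Obj : T2Space Obj]
  [paraObj : ParacompactSpace Obj]
  [topMor : TopologicalSpace Mor]
  [t2Mor : T2Space Mor]
  [paraMor : ParacompactSpace Mor]
  scObj : ScAtlas.{a, c} Obj
  scMor : ScAtlas.{b, c} Mor
  gr : GroupoidOn Obj Mor
  smooth_unit : MScSmoothOn scObj scMor univ gr.unit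
  smooth_inv : MScSmoothOn scMor scMor univ gr.inv
  /-- Composition is sc-smooth on the fibre product of composable pairs `(g, f)`.  Since the
  source map is étale, that fibre product is, near `(g₀, f₀)`, the graph `{(σ f, f)}` of the
  local lift `σ` of the target map, and the projection to `f` is a chart of it. -/
  smooth_comp : ∀ g₀ f₀, gr.src g₀ = gr.tgt f₀ → ∃ (W : Set Mor) (σ : Mor → Mor),
    IsOpen W ∧ f₀ ∈ W ∧ MScSmoothOn scMor scMor W σ ∧ σ f₀ = g₀ ∧
    (∀ f ∈ W, gr.src (σ f) = gr.tgt f) ∧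
    MScSmoothOn scMor scMor W (fun f => gr.comp (σ f) f)
  etale_src : IsLocalScDiffeo scMor scObj gr.src
  etale_tgt : IsLocalScDiffeo scMor scObj gr.tgt
  proper : gr.IsProper

attribute [instance] ScEpGroupoid.topObj ScEpGroupoid.t2Obj ScEpGroupoid.paraObj
  ScEpGroupoid.topMor ScEpGroupoid.t2Mor ScEpGroupoid.paraMor

/-! ## Weighted branched suborbifolds -/

/-- A local branching structure at `x` for the weight function `θ : Z → ℚ ∩ [0,∞)` with
`S = {θ > 0}`: finitely many submanifolds `M_i` of one dimension, properly included in an open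
neighbourhood `U` of `x`, with union `S ∩ U`, and positive weights `w_i` that sum up to `θ`. -/
structure LocalBranching (Z : ScEpGroupoid.{a, b, c}) (θ : Z.Obj → ℚ≥0) (x : Z.Obj) where
  U : Set Z.Obj
  openU : IsOpen U
  mem : x ∈ U
  N : ℕ
  dim : ℕ
  M : Fin N → Set Z.Obj
  w : Fin N → ℚ≥0
  submanifold : ∀ i, IsSubmanifold Z.scObj dim (M i)
  subset : ∀ i, M i ⊆ U
  union : {y | 0 < θ y} ∩ U = ⋃ i, M i
  w_pos : ∀ i, 0 < w i
  weight : ∀ y ∈ {y | 0 < θ y} ∩ U, θ y = ∑ i, (M i).indicator (fun _ => w i) y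
  proper : ∀ i, IsProperMap (Set.inclusion (subset i))

/-- A weighted branched suborbifold structure in `Z`: a functor `θ` from `Z` to `ℚ ∩ [0,∞)` (with
only identity morphisms) whose support consists of smooth points and has a local branching
structure at each of its points. -/
structure WeightedBranchedSuborbifold (Z : ScEpGroupoid.{a, b, c}) where
  θ : Z.Obj → ℚ≥0
  invariant : ∀ g, θ (Z.gr.src g) = θ (Z.gr.tgt g)
  smoothPoint : ∀ x, 0 < θ x → Z.scObj.IsSmoothPoint x
  branching : ∀ x, 0 < θ x → Nonempty (LocalBranching Z θ x)

/-- The object set `S` of a weighted branched suborbifold. -/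
def WeightedBranchedSuborbifold.S {Z : ScEpGroupoid.{a, b, c}}
    (B : WeightedBranchedSuborbifold Z) : Set Z.Obj := {x | 0 < B.θ x}

/-- `h` is smooth on every branch of the local branching structure `β`. -/
def SmoothOnBranches {Z : ScEpGroupoid.{a, b, c}} {θ : Z.Obj → ℚ≥0} {x : Z.Obj} {n : ℕ}
    (O : EpGroupoid.{d, e} n) (β : LocalBranching Z θ x) (h : Z.Obj → O.Obj) : Prop :=
  ∀ i, ∀ p : SubmanifoldParam Z.scObj β.dim (β.M i),
    ContMDiffOn (𝓡 β.dim) (𝓡 n) ∞ (fun q => h (p.Φ q)) p.Q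

/-- A smooth functor from the full subgroupoid of `Z` on `S` to an ep-groupoid `O`, i.e. a smooth
map `𝒮 → 𝒪` together with an associated smooth functor.  Only the values on `S` and on the
morphisms between objects of `S` matter.  Smoothness on objects means that around each object of
`S` the functor is smooth on the branches of a local branching structure; smoothness on morphisms
then amounts to continuity because the source maps are étale. -/
structure BranchedSmoothFunctor {Z : ScEpGroupoid.{a, b, c}} {n : ℕ}
    (B : WeightedBranchedSuborbifold Z) (O : EpGroupoid.{d, e} n) where
  obj : Z.Obj → O.Obj
  mor : Z.Mor → O.Mor
  src_mor : ∀ g, Z.gr.src g ∈ B.S → O.gr.src (mor g) = obj (Z.gr.src g)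
  tgt_mor : ∀ g, Z.gr.src g ∈ B.S → O.gr.tgt (mor g) = obj (Z.gr.tgt g)
  mor_unit : ∀ x ∈ B.S, mor (Z.gr.unit x) = O.gr.unit (obj x)
  mor_comp : ∀ g f, Z.gr.src f ∈ B.S → Z.gr.src g = Z.gr.tgt f →
    mor (Z.gr.comp g f) = O.gr.comp (mor g) (mor f)
  cont_obj : ContinuousOn obj B.S
  cont_mor : ContinuousOn mor (Z.gr.src ⁻¹' B.S)
  smooth : ∀ x ∈ B.S, ∃ β : LocalBranching Z B.θ x, SmoothOnBranches O β obj

/-- Transversality of `f : 𝒮 → 𝒪` to the embedded full suborbifold with object set `X`: for each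
object `x ∈ S` with `f(x) ∈ X` and each branch `M_i` through `x` of each local branching structure
at `x` (on which `f` is smooth), `Df_x(T_x M_i) + T_{f(x)} X = T_{f(x)} O`. -/
def Transverse {Z : ScEpGroupoid.{a, b, c}} {n : ℕ} {B : WeightedBranchedSuborbifold Z}
    {O : EpGroupoid.{d, e} n} (f : BranchedSmoothFunctor B O) (X : Set O.Obj) : Prop :=
  ∀ x ∈ B.S, f.obj x ∈ X → ∀ β : LocalBranching Z B.θ x, SmoothOnBranches O β f.obj →
    ∀ i, ∀ p : SubmanifoldParam Z.scObj β.dim (β.M i), ∀ q ∈ p.Q, p.Φ q = x →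
      LinearMap.range (mfderiv (𝓡 β.dim) (𝓡 n) (fun q => f.obj (p.Φ q)) q).toLinearMap ⊔
        tangentAlong O X (f.obj (p.Φ q)) = ⊤

/-!
The perturbed suborbifold is the image of `X` under a self-map of the orbit space of `O` which is
homotopic to the identity and comes from a *generalised automorphism* of the ep-groupoid `O`: a
cocycle `CocycleAut` of partial diffeomorphisms `G i` of the objects, compatible with maps `μ i j`
of the morphisms.  Such an automorphism maps embedded full suborbifolds to embedded full
suborbifolds (`CocycleAut.isEmbeddedFullSuborbifold_image`) and preserves the triviality of the
isotropy action on the normal spaces (`CocycleAut.hasTrivialNormalIsotropy_image`).  The two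
equivalences which exhibit the new inclusion as smooth start from the ep-groupoid of a finite
family of slice charts of `X` (`SliceCover.epGroupoid`), whose object space is étale over `ℝ^k`.

The automorphism is a finite composite of localised translations.  Near `x ∈ X` the isotropy group
acts linearly in suitable coordinates in which `X` is a linear subspace `L`, by Bochner's averaging
(`exists_linearization`).  As it acts trivially on the quotient by `L`, it fixes pointwise a
complement `j (ℝ^r)` of `L`.  So the cut-off translation `e ↦ e + χ e • j t`, where `χ` is an
invariant bump function, commutes with the isotropy group.  It therefore extends to the morphisms
and defines a generalised automorphism, for small `t` (`exists_linearPatch`,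
`LinearPatch.IsSmall.cocycleAut`).  This is the point at which the hypothesis on the normal bundle
is needed: otherwise there are not enough equivariant translations in normal directions.

For generic `t` the graph of `χ • j t` over `L` is transverse to given smooth maps `v` over the set
`{χ > 0}`: it suffices that `t` is a regular value of the height `H v / χ`
(`LinearPatch.exists_add_eq_of_height`).  Such a `t` exists for countably many maps at once by
Sard's theorem (`exists_regular_value`), and countably many suffice, even though a map has to be
tested after transport along all morphisms (`CocycleAut.exists_countable_germs`).  Where `χ`
vanishes it has a minimum, so the translation is the identity to first order; as it is applied
before the automorphism already constructed, the transversality achieved earlier persists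
(`CocycleAut.exists_transverse_step`).  Induction over a finite family of patches which covers `X`
makes its image transverse to countably many test maps (`exists_cocycleAut_transverse`).

The test maps are the restrictions of `f` to the branches of finitely many local branching
structures, which reach all orbits of `S` by compactness.  The conclusion concerns every branch `M`
of every local branching structure, and such an `M` may agree with the chosen branches only in
part.  By the Baire category theorem, each point of `M` is a limit of interior points of the set
where `M`, moved by a morphism, lies in one of the chosen branches (`BranchFamily.exists_subset`).
By the chain rule of sc-calculus (`BanachScale.IsScOneOn.comp`), the transition maps between
parametrizations are `C¹` with injective differential also at the limit point
(`SubmanifoldParam.transition`).  So the two branches have the same dimension, and `D f` has the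
same image on their tangent spaces, up to transport
(`BranchedSmoothFunctor.exists_range_tderiv_eq`).  Hence `f` is transverse along `M` as well
(`BranchedSmoothFunctor.transverse_image`).
-/

/-! ### Regular values of smooth maps between finite-dimensional spaces -/

section Sard

open MeasureTheory Module

/-- The smooth inverse function theorem, with an inverse that is smooth on its whole domain. -/
theorem exists_smooth_openPartialHomeomorph {E F : Type*} [NormedAddCommGroup E] [NormedSpace ℝ E]
    [CompleteSpace E] [NormedAddCommGroup F] [NormedSpace ℝ F] {U : Set E} (hU : IsOpen U)
    {f : E → F} (hf : ContDiffOn ℝ ∞ f U) {x : E} (hx : x ∈ U) (f' : E ≃L[ℝ] F)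
    (hf' : HasFDerivAt f (f' : E →L[ℝ] F) x) :
    ∃ Φ : OpenPartialHomeomorph E F, x ∈ Φ.source ∧ Φ.source ⊆ U ∧ (Φ : E → F) = f ∧
      ContDiffOn ℝ ∞ f Φ.source ∧ ContDiffOn ℝ ∞ Φ.symm Φ.target := by
  have hne : (∞ : WithTop ℕ∞) ≠ 0 := by simp
  have hfx : ContDiffAt ℝ ∞ f x := hf.contDiffAt (hU.mem_nhds hx)
  set U' : Set E := U ∩ fderiv ℝ f ⁻¹' range ((↑) : (E ≃L[ℝ] F) → E →L[ℝ] F) with hU'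
  have hU'o : IsOpen U' :=
    (hf.continuousOn_fderiv_of_isOpen hU (by simp)).isOpen_inter_preimage hU
      ContinuousLinearEquiv.isOpen
  set Φ₀ := hfx.toOpenPartialHomeomorph f hf' hne
  have hx' : x ∈ U' := ⟨hx, f', hf'.fderiv.symm⟩
  have hsub : (Φ₀.restrOpen U' hU'o).source ⊆ U := by
    rw [Φ₀.restrOpen_source]
    exact fun y hy => hy.2.1
  refine ⟨Φ₀.restrOpen U' hU'o, ?_, hsub, rfl, hf.mono hsub, ?_⟩
  · rw [Φ₀.restrOpen_source]
    exact ⟨hfx.mem_toOpenPartialHomeomorph_source hf' hne, hx'⟩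
  · intro y hy
    have hs := (Φ₀.restrOpen U' hU'o).map_target hy
    have hs2 : (Φ₀.restrOpen U' hU'o).symm y ∈ U' := by
      rw [Φ₀.restrOpen_source] at hs
      exact hs.2
    obtain ⟨g', hg'⟩ := hs2.2
    have hd : ContDiffAt ℝ ∞ f ((Φ₀.restrOpen U' hU'o).symm y) :=
      hf.contDiffAt (hU.mem_nhds hs2.1)
    have hdd : HasFDerivAt f (g' : E →L[ℝ] F) ((Φ₀.restrOpen U' hU'o).symm y) := by
      rw [hg']
      exact (hd.differentiableAt hne).hasFDerivAt
    exact ((Φ₀.restrOpen U' hU'o).contDiffAt_symm (n := ∞) hy hdd hd).contDiffWithinAt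

/-- Near a point where its differential does not vanish, a level set of a smooth function is
parametrized smoothly by a space of one dimension less. -/
theorem exists_levelSet_param {E : Type} [NormedAddCommGroup E] [NormedSpace ℝ E]
    [FiniteDimensional ℝ E] {U : Set E} (hU : IsOpen U) {w : E → ℝ} (hw : ContDiffOn ℝ ∞ w U)
    {x : E} (hx : x ∈ U) (hv : fderiv ℝ w x ≠ 0) :
    ∃ K : Submodule ℝ E, finrank ℝ K + 1 = finrank ℝ E ∧ ∃ (V : Set K) (ψ : K → E), IsOpen V ∧
      ContDiffOn ℝ ∞ ψ V ∧ (∀ κ ∈ V, ψ κ ∈ U ∧ w (ψ κ) = w x) ∧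
      ∃ N ∈ 𝓝 x, ∀ y ∈ N, w y = w x → ∃ κ ∈ V, ψ κ = y := by
  have : CompleteSpace E := FiniteDimensional.complete ℝ E
  -- `w` is straightened by the coordinates `y ↦ (w y, pr y)`, where `pr` projects to `K = ker D`.
  set D : E →L[ℝ] ℝ := fderiv ℝ w x with hD
  obtain ⟨v, hv⟩ : ∃ v, D v ≠ 0 := by
    by_contra! h
    exact hv (ContinuousLinearMap.ext h)
  set K : Submodule ℝ E := LinearMap.ker D.toLinearMap with hK
  have hrank : finrank ℝ K + 1 = finrank ℝ E := by
    have h1 := LinearMap.finrank_range_add_finrank_ker D.toLinearMap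
    have h2 : LinearMap.range D.toLinearMap = ⊤ := by
      rw [LinearMap.range_eq_top]
      intro r
      exact ⟨(r / D v) • v, by simp [hv]⟩
    rw [h2, finrank_top] at h1
    rw [finrank_self] at h1
    rw [hK, ← h1]
    ring
  let pr₀ : E →L[ℝ] E := ContinuousLinearMap.id ℝ E - (D.smulRight ((D v)⁻¹ • v))
  have hpr₀ : ∀ y, pr₀ y ∈ K := by
    intro y
    simp only [hK, LinearMap.mem_ker, pr₀]
    simp [hv]
  let pr : E →L[ℝ] K := pr₀.codRestrict K hpr₀
  let inv : ℝ × K →L[ℝ] E := K.subtypeL.comp (ContinuousLinearMap.snd ℝ ℝ K) +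
    (ContinuousLinearMap.fst ℝ ℝ K).smulRight ((D v)⁻¹ • v)
  let Θ' : E ≃L[ℝ] ℝ × K := ContinuousLinearEquiv.equivOfInverse (D.prod pr) inv
    (by
      intro y
      simp [inv, pr, pr₀])
    (by
      rintro ⟨r, κ, hκ⟩
      have hκ' : D κ = 0 := hκ
      refine Prod.ext ?_ (Subtype.ext ?_)
      · simp [inv, hκ', hv]
      · simp [inv, pr, pr₀, hκ', hv])
  have hΘs : ContDiffOn ℝ ∞ (fun y => (w y, pr y)) U := hw.prodMk pr.contDiff.contDiffOn
  have hΘd : HasFDerivAt (fun y => (w y, pr y)) (Θ' : E →L[ℝ] ℝ × K) x := by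
    have h1 : HasFDerivAt w D x :=
      ((hw.contDiffAt (hU.mem_nhds hx)).differentiableAt (by simp)).hasFDerivAt
    exact h1.prodMk pr.hasFDerivAt
  obtain ⟨Φ, hxΦ, hΦU, hΦ, -, hΦs⟩ := exists_smooth_openPartialHomeomorph hU hΘs hx Θ' hΘd
  have hcont : Continuous (fun κ : K => (w x, κ)) := by fun_prop
  refine ⟨K, hrank, (fun κ : K => (w x, κ)) ⁻¹' Φ.target, fun κ => Φ.symm (w x, κ),
    Φ.open_target.preimage hcont, ?_, ?_, Φ.source, Φ.open_source.mem_nhds hxΦ, ?_⟩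
  · exact hΦs.comp (by fun_prop) (fun κ hκ => hκ)
  · intro κ hκ
    refine ⟨hΦU (Φ.map_target hκ), ?_⟩
    have h := Φ.right_inv hκ
    rw [hΦ] at h
    exact congrArg Prod.fst h
  · intro y hy hwy
    have h : Φ y = (w x, pr y) := by rw [hΦ, ← hwy]
    refine ⟨pr y, ?_, ?_⟩
    · change (w x, pr y) ∈ Φ.target
      rw [← h]
      exact Φ.map_source hy
    · change Φ.symm (w x, pr y) = y
      rw [← h]
      exact Φ.left_inv hy

/-- A function whose derivatives up to order `p` vanish at `x` is `O(|y - x| ^ (p + 1))`, with the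
bound on its derivative of order `p + 1` as constant. -/
theorem norm_sub_le_of_iteratedFDeriv_eq_zero {E : Type} [NormedAddCommGroup E] [NormedSpace ℝ E]
    {x : E} {r A : ℝ} (p : ℕ) :
    ∀ {F : Type} [NormedAddCommGroup F] [NormedSpace ℝ F] {f : E → F},
    ContDiffOn ℝ ∞ f (Metric.ball x r) →
    (∀ j, 1 ≤ j → j ≤ p → ‖iteratedFDeriv ℝ j f x‖ = 0) →
    (∀ y ∈ Metric.ball x r, ‖iteratedFDeriv ℝ (p + 1) f y‖ ≤ A) →
    ∀ y ∈ Metric.ball x r, ‖f y - f x‖ ≤ A * ‖y - x‖ ^ (p + 1) := by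
  induction p with
  | zero =>
    intro F _ _ f hf _ hA y hy
    have hx : x ∈ Metric.ball x r := Metric.mem_ball_self (Metric.pos_of_mem_ball hy)
    have := (convex_ball x r).norm_image_sub_le_of_norm_fderiv_le (𝕜 := ℝ) (f := f) (C := A)
      (fun z hz => (hf.contDiffAt (Metric.isOpen_ball.mem_nhds hz)).differentiableAt (by simp))
      (fun z hz => by
        have := hA z hz
        rwa [← norm_iteratedFDeriv_fderiv, norm_iteratedFDeriv_zero] at this) hx hy
    simpa using this
  | succ p ih =>
    intro F _ _ f hf h0 hA y hy
    have hA0 : 0 ≤ A := (norm_nonneg _).trans (hA y hy)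
    have hr : 0 < r := Metric.pos_of_mem_ball hy
    have hbound : ∀ z ∈ Metric.ball x r, ‖fderiv ℝ f z‖ ≤ A * ‖z - x‖ ^ (p + 1) := by
      intro z hz
      have h := ih (f := fderiv ℝ f) (hf.fderiv_of_isOpen Metric.isOpen_ball (by simp))
        (fun j hj hjp => by
          rw [norm_iteratedFDeriv_fderiv]
          exact h0 (j + 1) (by omega) (by omega))
        (fun z hz => by
          rw [norm_iteratedFDeriv_fderiv]
          exact hA z hz) z hz
      have hz0 : fderiv ℝ f x = 0 := by
        have := h0 1 le_rfl (by omega)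
        rw [show (1 : ℕ) = 0 + 1 from rfl, ← norm_iteratedFDeriv_fderiv,
          norm_iteratedFDeriv_zero] at this
        exact norm_eq_zero.mp this
      rwa [hz0, sub_zero] at h
    have hseg : segment ℝ x y ⊆ Metric.ball x r :=
      (convex_ball x r).segment_subset (Metric.mem_ball_self hr) hy
    have := (convex_segment x y).norm_image_sub_le_of_norm_fderiv_le (𝕜 := ℝ) (f := f)
      (C := A * ‖y - x‖ ^ (p + 1))
      (fun z hz => (hf.contDiffAt (Metric.isOpen_ball.mem_nhds (hseg hz))).differentiableAt
        (by simp))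
      (fun z hz => (hbound z (hseg hz)).trans (by
        have hzx : ‖z - x‖ ≤ ‖y - x‖ := by
          have h1 := norm_sub_le_of_mem_segment hz
          simpa using h1
        gcongr)) (left_mem_segment ℝ x y) (right_mem_segment ℝ x y)
    calc ‖f y - f x‖ ≤ A * ‖y - x‖ ^ (p + 1) * ‖y - x‖ := this
      _ = A * ‖y - x‖ ^ (p + 1 + 1) := by ring

/-- If the derivatives of `f` of orders `1, …, dim E` vanish on `C`, then `f` is Hölder of
exponent `dim E + 1` along `C`, so `f '' C` has Hausdorff dimension less than one. -/
theorem volume_image_eq_zero_of_flat {E : Type} [NormedAddCommGroup E] [NormedSpace ℝ E]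
    [FiniteDimensional ℝ E] {U : Set E} (hU : IsOpen U) {f : E → ℝ} (hf : ContDiffOn ℝ ∞ f U)
    {C : Set E} (hCU : C ⊆ U)
    (hC : ∀ x ∈ C, ∀ j, 1 ≤ j → j ≤ finrank ℝ E → iteratedFDeriv ℝ j f x = 0) :
    volume (f '' C) = 0 := by
  set m := finrank ℝ E
  have hdim : dimH (f '' C) ≤ dimH C / ((m + 1 : ℕ) : NNReal) := by
    refine dimH_image_le_of_locally_holder_on (by positivity) fun x hx => ?_
    have hcont : ContinuousOn (fun y => iteratedFDeriv ℝ (m + 1) f y) U := by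
      refine ContinuousOn.congr (hf.continuousOn_iteratedFDerivWithin (m := m + 1)
        (by exact_mod_cast le_top) hU.uniqueDiffOn) fun y hy => ?_
      exact (iteratedFDerivWithin_of_isOpen (m + 1) hU hy).symm
    have hcx := (hcont.continuousAt (hU.mem_nhds (hCU hx))).norm
    set A : ℝ := ‖iteratedFDeriv ℝ (m + 1) f x‖ + 1 with hAdef
    have hA1 : ∀ᶠ y in 𝓝 x, ‖iteratedFDeriv ℝ (m + 1) f y‖ < A :=
      hcx.eventually_lt continuousAt_const (by simp [hAdef])
    obtain ⟨r, hr, hball⟩ := Metric.eventually_nhds_iff_ball.mp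
      (hA1.and (hU.mem_nhds (hCU hx)))
    have hA0 : 0 ≤ A := by positivity
    refine ⟨A.toNNReal, C ∩ Metric.ball x (r / 4), inter_mem_nhdsWithin _
      (Metric.ball_mem_nhds x (by positivity)), ?_⟩
    have key : ∀ y ∈ C ∩ Metric.ball x (r / 4), ∀ z ∈ C ∩ Metric.ball x (r / 4),
        ‖f y - f z‖ ≤ A * ‖y - z‖ ^ (m + 1) := by
      intro y hy z hz
      have h1 := Metric.mem_ball.mp hy.2
      have h2 := Metric.mem_ball.mp hz.2
      have hsub : Metric.ball z (r / 2) ⊆ Metric.ball x r := by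
        intro u hu
        have h3 := Metric.mem_ball.mp hu
        have := dist_triangle u z x
        rw [Metric.mem_ball]
        linarith
      refine norm_sub_le_of_iteratedFDeriv_eq_zero (r := r / 2) m
        (hf.mono fun u hu => (hball u (hsub hu)).2)
        (fun j hj hjm => by rw [hC z hz.1 j hj hjm, norm_zero])
        (fun u hu => (hball u (hsub hu)).1.le) y ?_
      have := dist_triangle_right y z x
      rw [Metric.mem_ball]
      linarith
    intro y hy z hz
    rw [edist_nndist, edist_nndist]
    have h := key y hy z hz
    rw [← dist_eq_norm, ← dist_eq_norm] at h
    have h' : nndist (f y) (f z) ≤ A.toNNReal * nndist y z ^ (m + 1) := by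
      rw [← NNReal.coe_le_coe]
      simpa [Real.coe_toNNReal A hA0] using h
    have h2 : ((nndist y z : ENNReal)) ^ (((m + 1 : ℕ) : NNReal) : ℝ)
        = ((nndist y z ^ (m + 1) : NNReal) : ENNReal) := by
      rw [NNReal.coe_natCast, ENNReal.rpow_natCast, ENNReal.coe_pow]
    rw [h2]
    exact_mod_cast h'
  have hlt : dimH (f '' C) < ((1 : NNReal) : ENNReal) := by
    refine hdim.trans_lt ?_
    have h1 : dimH C ≤ (m : ENNReal) := by
      rw [← Real.dimH_univ_eq_finrank E]
      exact dimH_mono (subset_univ _)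
    rw [ENNReal.div_lt_iff (by simp) (by simp)]
    refine h1.trans_lt ?_
    simp only [ENNReal.coe_one, one_mul, ENNReal.coe_natCast]
    exact_mod_cast Nat.lt_succ_self m
  have := hausdorffMeasure_of_dimH_lt hlt
  rw [NNReal.coe_one, hausdorffMeasure_real] at this
  exact this

/-- By the Lindelöf property, it suffices to show locally that the image of `s` is a null set. -/
theorem measure_image_eq_zero_of_locally {E F : Type*} [TopologicalSpace E]
    [SecondCountableTopology E] [MeasurableSpace F] {μ : Measure F} {f : E → F} {s : Set E}
    (h : ∀ x ∈ s, ∃ N ∈ 𝓝 x, μ (f '' (s ∩ N)) = 0) : μ (f '' s) = 0 := by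
  choose! N hN hμ using h
  obtain ⟨t, hts, htc, hcov⟩ :=
    TopologicalSpace.countable_cover_nhdsWithin (s := s) (f := N)
      fun x hx => mem_nhdsWithin_of_mem_nhds (hN x hx)
  refine measure_mono_null (t := ⋃ x ∈ t, f '' (s ∩ N x)) ?_
    ((measure_biUnion_null_iff htc).mpr fun x hx => hμ x (hts hx))
  rintro _ ⟨y, hy, rfl⟩
  obtain ⟨x, hx, hyx⟩ := mem_iUnion₂.mp (hcov hy)
  exact mem_iUnion₂.mpr ⟨x, hx, y, ⟨hy, hyx⟩, rfl⟩

/-- **Morse's theorem**: the critical values of a smooth real-valued function form a null set.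
The points at which the derivatives of order up to `dim E` vanish are dealt with by
`volume_image_eq_zero_of_flat`.  The other critical points lie in countably many sets `T i`, where
`i + 1` is the order of the first nonzero derivative; locally `T i` is contained in a
hypersurface, and the theorem is applied to the restriction of `f` to this hypersurface. -/
theorem volume_criticalValues_eq_zero (m : ℕ) :
    ∀ {E : Type} [NormedAddCommGroup E] [NormedSpace ℝ E] [FiniteDimensional ℝ E],
    finrank ℝ E = m → ∀ {U : Set E}, IsOpen U → ∀ {f : E → ℝ}, ContDiffOn ℝ ∞ f U →
    volume (f '' {x ∈ U | fderiv ℝ f x = 0}) = 0 := by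
  induction m using Nat.strong_induction_on with
  | _ m ih =>
  intro E _ _ _ hE U hU f hf
  have : SecondCountableTopology E := by
    have : ProperSpace E := FiniteDimensional.proper ℝ E
    infer_instance
  set C : Set E := {x ∈ U | fderiv ℝ f x = 0} with hC
  let T : ℕ → Set E := fun i =>
    {x ∈ C | iteratedFDeriv ℝ i f x = 0 ∧ iteratedFDeriv ℝ (i + 1) f x ≠ 0}
  let C₀ : Set E := {x ∈ C | ∀ j, 1 ≤ j → j ≤ finrank ℝ E → iteratedFDeriv ℝ j f x = 0}
  have hcov : C ⊆ C₀ ∪ ⋃ i, T i := by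
    intro x hx
    by_cases h : x ∈ C₀
    · exact Or.inl h
    · right
      have hex : ∃ j, iteratedFDeriv ℝ (j + 1) f x ≠ 0 := by
        by_contra! hall
        refine h ⟨hx, fun j hj _ => ?_⟩
        obtain ⟨j, rfl⟩ := Nat.exists_eq_add_of_le' hj
        exact hall j
      classical
      rcases hj : Nat.find hex with _ | i
      · exfalso
        have h1 := Nat.find_spec hex
        rw [hj] at h1
        apply h1
        rw [← norm_eq_zero, ← norm_iteratedFDeriv_fderiv, norm_iteratedFDeriv_zero, hx.2,
          norm_zero]
      · have h1 := Nat.find_spec hex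
        have h2 := Nat.find_min hex (m := i) (by omega)
        rw [hj] at h1
        exact mem_iUnion.mpr ⟨i + 1, hx, not_not.mp h2, h1⟩
  refine measure_mono_null ((image_mono hcov).trans (image_union _ _ _).subset)
    (measure_union_null ?_ ?_)
  · exact volume_image_eq_zero_of_flat hU hf (fun x hx => hx.1.1) fun x hx => hx.2
  rw [image_iUnion]
  refine measure_iUnion_null fun i => measure_image_eq_zero_of_locally fun x hx => ?_
  obtain ⟨⟨hxU, -⟩, hxi, hxi1⟩ := hx
  -- some component of the derivative of order `i` is a local equation of a hypersurface
  obtain ⟨v, hv⟩ : ∃ v, iteratedFDeriv ℝ (i + 1) f x v ≠ 0 := by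
    by_contra! h
    exact hxi1 (ContinuousMultilinearMap.ext h)
  have hDs : ContDiffOn ℝ ∞ (iteratedFDeriv ℝ i f) U :=
    fun y hy =>
    ((hf.contDiffAt (hU.mem_nhds hy)).iteratedFDeriv_right (m := ∞)
      (by exact_mod_cast le_top)).contDiffWithinAt
  let w : E → ℝ := fun y => iteratedFDeriv ℝ i f y (Fin.tail v)
  let ev : (E [×i]→L[ℝ] ℝ) →L[ℝ] ℝ := ContinuousMultilinearMap.apply ℝ (fun _ => E) ℝ (Fin.tail v)
  have hw : ContDiffOn ℝ ∞ w U := ev.contDiff.comp_contDiffOn hDs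
  have hwx : fderiv ℝ w x ≠ 0 := by
    intro h0
    apply hv
    rw [iteratedFDeriv_succ_apply_left]
    have hd : HasFDerivAt w (ev.comp (fderiv ℝ (iteratedFDeriv ℝ i f) x)) x :=
      ev.hasFDerivAt.comp x
        ((hDs.contDiffAt (hU.mem_nhds hxU)).differentiableAt (by simp)).hasFDerivAt
    rw [hd.fderiv] at h0
    exact congrArg (fun L : E →L[ℝ] ℝ => L (v 0)) h0
  obtain ⟨K, hK, V, ψ, hV, hψ, hψU, N, hN, hNψ⟩ := exists_levelSet_param hU hw hxU hwx
  refine ⟨N, hN, measure_mono_null ?_ (ih (finrank ℝ K) (by omega) rfl hV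
    (f := f ∘ ψ) (hf.comp hψ fun κ hκ => (hψU κ hκ).1))⟩
  rintro _ ⟨y, ⟨hyT, hyN⟩, rfl⟩
  have hwy : w y = w x := by
    change iteratedFDeriv ℝ i f y _ = iteratedFDeriv ℝ i f x _
    rw [hyT.2.1, hxi]
  obtain ⟨κ, hκ, rfl⟩ := hNψ y hyN hwy
  refine ⟨κ, ⟨hκ, ?_⟩, rfl⟩
  have h1 : DifferentiableAt ℝ f (ψ κ) :=
    (hf.contDiffAt (hU.mem_nhds hyT.1.1)).differentiableAt (by simp)
  have h2 : DifferentiableAt ℝ ψ κ :=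
    (hψ.contDiffAt (hV.mem_nhds hκ)).differentiableAt (by simp)
  rw [fderiv_comp κ h1 h2, hyT.1.2, ContinuousLinearMap.zero_comp]

/-- A form of **Sard's theorem**: countably many smooth maps into `ℝ^c` have a common regular
value arbitrarily close to zero.  The coordinates of the value are chosen one after the other, by
Morse's theorem for the restrictions of the next coordinate function to the level sets of the
previous ones; so no measurability of the set of critical points is needed. -/
theorem exists_regular_value (c : ℕ) :
    ∀ {ι : Type a} [Countable ι] {E : ι → Type} [∀ i, NormedAddCommGroup (E i)]
      [∀ i, NormedSpace ℝ (E i)] [∀ i, FiniteDimensional ℝ (E i)] {U : ∀ i, Set (E i)}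
      (_ : ∀ i, IsOpen (U i)) {f : ∀ i, E i → Fin c → ℝ} (_ : ∀ i, ContDiffOn ℝ ∞ (f i) (U i))
      {ε : ℝ} (_ : 0 < ε),
    ∃ t : Fin c → ℝ, ‖t‖ < ε ∧
      ∀ i, ∀ x ∈ U i, f i x = t → Function.Surjective (fderiv ℝ (f i) x) := by
  induction c with
  | zero =>
    intro ι _ E _ _ _ U _ f _ ε hε
    exact ⟨0, by rwa [norm_zero], fun i x _ _ y => ⟨0, Subsingleton.elim _ _⟩⟩
  | succ c ih =>
    intro ι _ E _ _ _ U hU f hf ε hε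
    have : ∀ i, SecondCountableTopology (E i) := by
      intro i
      have : ProperSpace (E i) := FiniteDimensional.proper ℝ (E i)
      infer_instance
    let g : ∀ i, E i → ℝ := fun i x => f i x 0
    have hg : ∀ i, ContDiffOn ℝ ∞ (g i) (U i) := fun i => contDiffOn_pi.mp (hf i) 0
    -- a regular value of all first coordinates
    obtain ⟨t₀, ht₀, ht₀g⟩ : ∃ t₀ ∈ Ioo (-ε) ε,
        t₀ ∉ ⋃ i, g i '' {x ∈ U i | fderiv ℝ (g i) x = 0} := by
      have hnull : volume (⋃ i, g i '' {x ∈ U i | fderiv ℝ (g i) x = 0}) = 0 :=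
        measure_iUnion_null fun i => volume_criticalValues_eq_zero _ rfl (hU i) (hg i)
      by_contra! hall
      have : volume (Ioo (-ε) ε) = 0 := measure_mono_null hall hnull
      rw [Real.volume_Ioo] at this
      simp only [ENNReal.ofReal_eq_zero] at this
      linarith
    have hreg : ∀ i, ∀ x ∈ U i, g i x = t₀ → fderiv ℝ (g i) x ≠ 0 := fun i x hx hgx h0 =>
      ht₀g (mem_iUnion.mpr ⟨i, x, ⟨hx, h0⟩, hgx⟩)
    -- The level sets of the first coordinates are parametrized by countably many maps `ψ i z`,
    -- to which the induction hypothesis applies with the remaining coordinates.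
    have hpar := fun (i : ι) (x : {x : E i // x ∈ U i ∧ g i x = t₀}) =>
      exists_levelSet_param (hU i) (hg i) x.2.1 (hreg i x x.2.1 x.2.2)
    choose K hK V ψ hV hψ hψU N hN hNψ using hpar
    have hcov : ∀ i, ∃ s : Set {x : E i // x ∈ U i ∧ g i x = t₀}, s.Countable ∧
        (⋃ x ∈ s, ((↑) : {x : E i // x ∈ U i ∧ g i x = t₀} → E i) ⁻¹' N i x) = univ := fun i =>
      TopologicalSpace.countable_cover_nhds fun x =>
        continuous_subtype_val.continuousAt.preimage_mem_nhds (hN i x)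
    choose s hs hscov using hcov
    have : ∀ i, Countable (s i) := fun i => (hs i).to_subtype
    obtain ⟨t, ht, hreg'⟩ := ih (ι := Σ i, s i) (E := fun p => K p.1 p.2)
      (U := fun p => V p.1 p.2) (fun p => hV p.1 p.2)
      (f := fun p κ => Fin.tail (f p.1 (ψ p.1 p.2 κ)))
      (fun p => by
        rw [contDiffOn_pi]
        exact fun l => (contDiffOn_pi.mp (hf p.1) l.succ).comp (hψ p.1 p.2)
          fun κ hκ => (hψU p.1 p.2 κ hκ).1) hε
    refine ⟨Fin.cons t₀ t, ?_, ?_⟩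
    · rw [pi_norm_lt_iff hε]
      intro l
      refine Fin.cases ?_ (fun l => ?_) l
      · simpa [abs_lt] using ht₀
      · simpa using (pi_norm_lt_iff hε).mp ht l
    · intro i x hx hfx y
      have hgx : g i x = t₀ := by
        change f i x 0 = t₀
        rw [hfx, Fin.cons_zero]
      obtain ⟨z, hz, hxz⟩ := mem_iUnion₂.mp ((hscov i).symm ▸ mem_univ
        (⟨x, hx, hgx⟩ : {x : E i // x ∈ U i ∧ g i x = t₀}))
      obtain ⟨κ, hκ, hκx⟩ := hNψ i z x hxz (by rw [hgx, z.2.2])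
      have hκx' : ψ i z κ = x := hκx
      have hfd : HasFDerivAt (f i) (fderiv ℝ (f i) x) x :=
        (((hf i).contDiffAt ((hU i).mem_nhds hx)).differentiableAt (by simp)).hasFDerivAt
      have hψd : HasFDerivAt (ψ i z) (fderiv ℝ (ψ i z) κ) κ :=
        (((hψ i z).contDiffAt ((hV i z).mem_nhds hκ)).differentiableAt (by simp)).hasFDerivAt
      have hfd' := hfd
      rw [← hκx'] at hfd'
      have hcomp := hfd'.comp κ hψd
      rw [hκx'] at hcomp
      have hcomp' := hasFDerivAt_pi'.mp hcomp
      have hgd : HasFDerivAt (g i) ((ContinuousLinearMap.proj 0).comp (fderiv ℝ (f i) x)) x :=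
        hasFDerivAt_pi'.mp hfd 0
      have htail : HasFDerivAt (fun κ => Fin.tail (f i (ψ i z κ)))
          (ContinuousLinearMap.pi fun l : Fin c => (ContinuousLinearMap.proj l.succ).comp
            ((fderiv ℝ (f i) x).comp (fderiv ℝ (ψ i z) κ))) κ := by
        rw [hasFDerivAt_pi]
        exact fun l => hcomp' l.succ
      have hsurj := hreg' ⟨i, z, hz⟩ κ hκ (by
        change Fin.tail (f i (ψ i z κ)) = t
        rw [hκx', hfx, Fin.tail_cons])
      rw [show fderiv ℝ _ κ = _ from htail.fderiv] at hsurj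
      -- The differential of `ψ` takes values in the kernel of the first coordinate of `D (f i)`,
      -- and `v` is transverse to this kernel.
      have hker : ∀ u, fderiv ℝ (f i) x (fderiv ℝ (ψ i z) κ u) 0 = 0 := by
        intro u
        have h0 : HasFDerivAt (fun κ => f i (ψ i z κ) 0) (0 : K i z →L[ℝ] ℝ) κ := by
          refine (hasFDerivAt_const (g i z) κ).congr_of_eventuallyEq ?_
          filter_upwards [(hV i z).mem_nhds hκ] with κ' hκ'
          exact (hψU i z κ' hκ').2
        exact congrArg (fun L : K i z →L[ℝ] ℝ => L u) ((hcomp' 0).unique h0)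
      obtain ⟨v, hv⟩ : ∃ v, fderiv ℝ (f i) x v 0 ≠ 0 := by
        by_contra! h
        refine hreg i x hx hgx ?_
        rw [hgd.fderiv]
        exact ContinuousLinearMap.ext h
      set v' := (y 0 / fderiv ℝ (f i) x v 0) • v with hv'
      have hv0 : fderiv ℝ (f i) x v' 0 = y 0 := by
        rw [hv', map_smul, Pi.smul_apply, smul_eq_mul, div_mul_cancel₀ _ hv]
      obtain ⟨u, hu⟩ := hsurj (Fin.tail (y - fderiv ℝ (f i) x v'))
      refine ⟨v' + fderiv ℝ (ψ i z) κ u, funext fun l => ?_⟩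
      refine Fin.cases ?_ (fun l => ?_) l
      · rw [map_add, Pi.add_apply, hker u, hv0, add_zero]
      · have := congrFun hu l
        simp only [ContinuousLinearMap.coe_pi', ContinuousLinearMap.comp_apply,
          ContinuousLinearMap.proj_apply, Fin.tail, Pi.sub_apply] at this
        rw [map_add, Pi.add_apply, this]
        ring

end Sard

/-! ### The chain rule of sc-calculus for maps from `ℝ^d` -/

section ScCalculus

namespace BanachScale

/-- A map from the open set `Q ⊆ ℝ^d` to an sc-Banach space which is `sc¹`: it is differentiable
into `E_0`, and on every level `m` both the map and its differential, regarded as a map of two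
variables, lift to continuous maps into `E_m`. -/
def IsScOneOn {d : ℕ} (E : BanachScale.{a}) (Q : Set (EuclideanSpace ℝ (Fin d)))
    (u : EuclideanSpace ℝ (Fin d) → E.lvl 0) : Prop :=
  ∃ (ul : ∀ m, EuclideanSpace ℝ (Fin d) → E.lvl m)
    (Du : EuclideanSpace ℝ (Fin d) → EuclideanSpace ℝ (Fin d) →L[ℝ] E.lvl 0)
    (vl : ∀ m, EuclideanSpace ℝ (Fin d) × EuclideanSpace ℝ (Fin d) → E.lvl m),
    (∀ m, ContinuousOn (ul m) Q) ∧ (∀ m, ∀ q ∈ Q, E.toZero m (ul m q) = u q) ∧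
    (∀ q ∈ Q, HasFDerivAt u (Du q) q) ∧ (∀ m, ContinuousOn (vl m) (Q ×ˢ univ)) ∧
    ∀ m, ∀ q ∈ Q, ∀ h, E.toZero m (vl m (q, h)) = Du q h

theorem IsScOneOn.mono {d : ℕ} {E : BanachScale.{a}} {Q Q' : Set (EuclideanSpace ℝ (Fin d))}
    {u : EuclideanSpace ℝ (Fin d) → E.lvl 0} (hu : E.IsScOneOn Q u) (h : Q' ⊆ Q) :
    E.IsScOneOn Q' u := by
  obtain ⟨ul, Du, vl, h1, h2, h3, h4, h5⟩ := hu
  exact ⟨ul, Du, vl, fun m => (h1 m).mono h, fun m q hq => h2 m q (h hq), fun q hq => h3 q (h hq),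
    fun m => (h4 m).mono (prod_mono h subset_rfl), fun m q hq => h5 m q (h hq)⟩

theorem IsScOneOn.congr {d : ℕ} {E : BanachScale.{a}} {Q : Set (EuclideanSpace ℝ (Fin d))}
    (hQ : IsOpen Q) {u u' : EuclideanSpace ℝ (Fin d) → E.lvl 0} (hu : E.IsScOneOn Q u)
    (h : EqOn u' u Q) : E.IsScOneOn Q u' := by
  obtain ⟨ul, Du, vl, h1, h2, h3, h4, h5⟩ := hu
  exact ⟨ul, Du, vl, h1, fun m q hq => (h2 m q hq).trans (h hq).symm, fun q hq =>
    (h3 q hq).congr_of_eventuallyEq (h.eventuallyEq_of_mem (hQ.mem_nhds hq)), h4, h5⟩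

theorem IsScOneOn.continuousOn {d : ℕ} {E : BanachScale.{a}} {Q : Set (EuclideanSpace ℝ (Fin d))}
    {u : EuclideanSpace ℝ (Fin d) → E.lvl 0} (hu : E.IsScOneOn Q u) : ContinuousOn u Q := by
  obtain ⟨-, Du, -, -, -, h3, -, -⟩ := hu
  exact fun q hq => (h3 q hq).continuousAt.continuousWithinAt

theorem toZero_euclid (d m : ℕ) (x : EuclideanSpace ℝ (Fin d)) :
    (euclid d).toZero m x = x := by
  induction m with
  | zero => rfl
  | succ m ih => exact ih

theorem toZero_tangent_snd (E : BanachScale.{a}) (m : ℕ) (p : E.lvl (m + 1) × E.lvl m) :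
    (E.tangent.toZero m p).2 = E.toZero m p.2 := by
  induction m with
  | zero => rfl
  | succ m ih => exact ih (E.incl (m + 1) p.1, E.incl m p.2)

theorem incl_toZero_tangent_fst (E : BanachScale.{a}) (m : ℕ) (p : E.lvl (m + 1) × E.lvl m) :
    E.incl 0 (E.tangent.toZero m p).1 = E.toZero (m + 1) p.1 := by
  induction m with
  | zero => rfl
  | succ m ih => exact ih (E.incl (m + 1) p.1, E.incl m p.2)

/-- On level `1` an `sc¹` map is Lipschitz near every point: there it is the integral of its
differential, since this is so on level `0` and the connecting map is injective. -/
theorem IsScOneOn.lipschitz_level_one {d : ℕ} {E : BanachScale.{a}} (hE : E.IsScBanach)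
    {Q : Set (EuclideanSpace ℝ (Fin d))} (hQ : IsOpen Q)
    {u : EuclideanSpace ℝ (Fin d) → E.lvl 0} {u₁ : EuclideanSpace ℝ (Fin d) → E.lvl 1}
    {Du : EuclideanSpace ℝ (Fin d) → EuclideanSpace ℝ (Fin d) →L[ℝ] E.lvl 0}
    {v₁ : EuclideanSpace ℝ (Fin d) × EuclideanSpace ℝ (Fin d) → E.lvl 1}
    (h2 : ∀ q ∈ Q, E.incl 0 (u₁ q) = u q)
    (h3 : ∀ q ∈ Q, HasFDerivAt u (Du q) q) (h4 : ContinuousOn v₁ (Q ×ˢ univ))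
    (h5 : ∀ q ∈ Q, ∀ h, E.incl 0 (v₁ (q, h)) = Du q h) {q : EuclideanSpace ℝ (Fin d)}
    (hq : q ∈ Q) :
    (fun h => u₁ (q + h) - u₁ q) =O[𝓝 0] (fun h : EuclideanSpace ℝ (Fin d) => h) := by
  have hinj := hE.injective 0
  have hv0 : v₁ (q, 0) = 0 := hinj (by rw [h5 q hq, map_zero, map_zero])
  have hcont : ContinuousAt v₁ (q, 0) :=
    h4.continuousAt ((hQ.prod isOpen_univ).mem_nhds ⟨hq, mem_univ _⟩)
  have hev : ∀ᶠ p in 𝓝 (q, (0 : EuclideanSpace ℝ (Fin d))), ‖v₁ p‖ < 1 := by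
    refine hcont.norm.eventually_lt continuousAt_const ?_
    simp [hv0]
  obtain ⟨δ, hδ, hball⟩ := Metric.eventually_nhds_iff_ball.mp
    (hev.and ((hQ.prod isOpen_univ).mem_nhds (⟨hq, mem_univ _⟩ : (q, (0 :
      EuclideanSpace ℝ (Fin d))) ∈ Q ×ˢ univ)))
  have hQδ : ∀ z ∈ Metric.ball q δ, z ∈ Q := fun z hz => by
    have := (hball (z, 0) (by simpa [Prod.dist_eq, hδ] using hz)).2
    exact this.1
  -- `v₁` is bounded near `(q, 0)` and homogeneous in its second argument, hence `O(h)`.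
  have hbound : ∀ z ∈ Metric.ball q δ, ∀ h, ‖v₁ (z, h)‖ ≤ 2 / δ * ‖h‖ := by
    intro z hz h
    rcases eq_or_ne h 0 with rfl | hh
    · have : v₁ (z, 0) = 0 := hinj (by rw [h5 z (hQδ z hz), map_zero, map_zero])
      simp [this]
    · have hn : 0 < ‖h‖ := norm_pos_iff.mpr hh
      have hhom : v₁ (z, (δ / 2 / ‖h‖) • h) = (δ / 2 / ‖h‖) • v₁ (z, h) :=
        hinj (by rw [map_smul, h5 z (hQδ z hz), h5 z (hQδ z hz), map_smul])
      have h1 := (hball (z, (δ / 2 / ‖h‖) • h) (by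
        rw [mem_ball_iff_norm, Prod.norm_def, max_lt_iff]
        refine ⟨by simpa [dist_eq_norm] using hz, ?_⟩
        rw [Prod.snd_sub, sub_zero, norm_smul, Real.norm_of_nonneg (by positivity),
          div_mul_cancel₀ _ hn.ne']
        linarith)).1
      rw [hhom, norm_smul, Real.norm_of_nonneg (by positivity)] at h1
      have : ‖v₁ (z, h)‖ < 1 / (δ / 2 / ‖h‖) := by
        rw [lt_div_iff₀ (by positivity)]
        linarith
      refine this.le.trans (le_of_eq ?_)
      field_simp
  refine IsBigO.of_bound (2 / δ) ?_
  filter_upwards [Metric.ball_mem_nhds (0 : EuclideanSpace ℝ (Fin d)) hδ] with h hh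
  have hseg : ∀ s ∈ Icc (0 : ℝ) 1, q + s • h ∈ Metric.ball q δ := by
    intro s hs
    rw [mem_ball_iff_norm, add_sub_cancel_left, norm_smul, Real.norm_of_nonneg hs.1]
    have : ‖h‖ < δ := by simpa using hh
    exact (mul_le_of_le_one_left (norm_nonneg h) hs.2).trans_lt this
  have hwc : ContinuousOn (fun s : ℝ => v₁ (q + s • h, h)) (Icc 0 1) :=
    h4.comp (by fun_prop) fun s hs => ⟨hQδ _ (hseg s hs), mem_univ _⟩
  have hInt : IntervalIntegrable (fun s : ℝ => v₁ (q + s • h, h)) MeasureTheory.volume 0 1 := by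
    apply ContinuousOn.intervalIntegrable
    rwa [uIcc_of_le zero_le_one]
  have hI : u₁ (q + h) - u₁ q = ∫ s in (0 : ℝ)..1, v₁ (q + s • h, h) := by
    apply hinj
    rw [map_sub, h2 q hq, h2 (q + h) (hQδ _ (by simpa using hseg 1 (by simp))),
      ← (E.incl 0).intervalIntegral_comp_comm hInt]
    have hderiv : ∀ s ∈ uIcc (0 : ℝ) 1, HasDerivAt (fun s : ℝ => u (q + s • h))
        (E.incl 0 (v₁ (q + s • h, h))) s := by
      intro s hs
      rw [uIcc_of_le zero_le_one] at hs
      rw [h5 _ (hQδ _ (hseg s hs))]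
      have hl : HasDerivAt (fun s : ℝ => q + s • h) h s := by
        simpa using ((hasDerivAt_id s).smul_const h).const_add q
      exact (h3 _ (hQδ _ (hseg s hs))).comp_hasDerivAt s hl
    rw [intervalIntegral.integral_eq_sub_of_hasDerivAt hderiv (by
      apply ContinuousOn.intervalIntegrable
      rw [uIcc_of_le zero_le_one]
      exact (E.incl 0).continuous.comp_continuousOn hwc)]
    simp
  rw [hI]
  have := intervalIntegral.norm_integral_le_of_norm_le_const (a := (0 : ℝ)) (b := 1)
    (f := fun s : ℝ => v₁ (q + s • h, h)) (C := 2 / δ * ‖h‖) (fun s hs => by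
      rw [uIoc_of_le zero_le_one] at hs
      exact hbound _ (hseg s ⟨hs.1.le, hs.2⟩) h)
  simpa using this

/-- The chain rule: the composite of an `sc¹` map from `ℝ^d` with an `sc¹` map is `sc¹`.
The differentiability of the outer map bounds its remainder by the norm of level `1` of the
increment only, so the inner map has to be Lipschitz into level `1`. -/
theorem IsScOneOn.comp {d : ℕ} {E : BanachScale.{a}} {F : BanachScale.{b}} (hE : E.IsScBanach)
    {Q : Set (EuclideanSpace ℝ (Fin d))} (hQ : IsOpen Q)
    {u : EuclideanSpace ℝ (Fin d) → E.lvl 0} (hu : E.IsScOneOn Q u) {U : Set (E.lvl 0)}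
    {g : E.lvl 0 → F.lvl 0} (hg : ScOn 1 E F U g) (hQU : MapsTo u Q U) :
    F.IsScOneOn Q (g ∘ u) := by
  obtain ⟨ul, Du, vl, h1, h2, h3, h4, h5⟩ := hu
  obtain ⟨hg0, f₁, D, hf₁, ho, hT⟩ := hg
  choose gl hgl hgl' using hg0
  choose tl htl htl' using (hT : Sc0On _ _ _ _)
  have hinj := hE.injective 0
  have hbase : ∀ m, ∀ q ∈ Q, ∀ h, (E.tangent.toZero m (ul (m + 1) q, vl m (q, h))) =
      (ul 1 q, Du q h) := by
    intro m q hq h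
    refine Prod.ext (hinj ?_) ?_
    · rw [incl_toZero_tangent_fst, h2 (m + 1) q hq]
      exact (h2 1 q hq).symm
    · rw [toZero_tangent_snd]
      exact h5 m q hq h
  have hmem : ∀ q ∈ Q, E.incl 0 (ul 1 q) ∈ U := fun q hq => by
    rw [show E.incl 0 (ul 1 q) = u q from h2 1 q hq]
    exact hQU hq
  refine ⟨fun m q => gl m (ul m q), fun q => (D (ul 1 q)).comp (Du q),
    fun m p => (tl m (ul (m + 1) p.1, vl m p)).2, ?_, ?_, ?_, ?_, ?_⟩
  · intro m
    refine (hgl m).comp (h1 m) fun q hq => ?_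
    rw [mem_preimage, h2 m q hq]
    exact hQU hq
  · intro m q hq
    rw [hgl' m _ (by rw [h2 m q hq]; exact hQU hq), h2 m q hq]
    rfl
  · intro q hq
    have hO := IsScOneOn.lipschitz_level_one hE hQ (h2 1) h3 (h4 1) (h5 1) hq
    have hQ0 : ∀ᶠ h : EuclideanSpace ℝ (Fin d) in 𝓝 0, q + h ∈ Q := by
      have : ContinuousAt (fun h : EuclideanSpace ℝ (Fin d) => q + h) 0 := by fun_prop
      exact this.preimage_mem_nhds (hQ.mem_nhds (by simpa using hq))
    have htend : Tendsto (fun h => ul 1 (q + h) - ul 1 q) (𝓝 0)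
        (𝓝[{h | E.incl 0 (ul 1 q + h) ∈ U}] 0) := by
      refine tendsto_nhdsWithin_iff.mpr ⟨?_, ?_⟩
      · have hc : ContinuousAt (fun h : EuclideanSpace ℝ (Fin d) => ul 1 (q + h)) 0 :=
          ContinuousAt.comp (g := ul 1) (by
            rw [add_zero]
            exact (h1 1).continuousAt (hQ.mem_nhds hq)) (by fun_prop)
        have := hc.sub (continuousAt_const (y := ul 1 q))
        have h0 : ul 1 (q + 0) - ul 1 q = 0 := by rw [add_zero, sub_self]
        exact h0 ▸ this
      · filter_upwards [hQ0] with h hh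
        simpa using hmem _ hh
    have ho1 := ((ho (ul 1 q) (hmem q hq)).comp_tendsto htend).trans_isBigO hO
    have ho2 : (fun h => D (ul 1 q) (u (q + h) - u q - Du q h)) =o[𝓝 0]
        (fun h : EuclideanSpace ℝ (Fin d) => h) :=
      ((D (ul 1 q)).isBigO_comp _ _).trans_isLittleO (hasFDerivAt_iff_isLittleO_nhds_zero.mp
        (h3 q hq))
    rw [hasFDerivAt_iff_isLittleO_nhds_zero]
    refine (ho1.add ho2).congr' ?_ EventuallyEq.rfl
    filter_upwards [hQ0] with h hh
    have e1 : E.incl 0 (ul 1 q) = u q := h2 1 q hq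
    have e2 : E.incl 0 (ul 1 (q + h)) = u (q + h) := h2 1 _ hh
    simp only [Function.comp_apply, add_sub_cancel, map_sub, e1, e2,
      ContinuousLinearMap.comp_apply]
    abel
  · intro m
    refine continuous_snd.comp_continuousOn ((htl m).comp (ContinuousOn.prodMk
      ((h1 (m + 1)).comp continuousOn_fst fun p hp => hp.1) (h4 m)) fun p hp => ?_)
    change E.incl 0 (E.tangent.toZero m (ul (m + 1) p.1, vl m (p.1, p.2))).1 ∈ U
    rw [hbase m p.1 hp.1 p.2]
    exact hmem _ hp.1
  · intro m q hq h
    have hb := hbase m q hq h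
    have := htl' m (ul (m + 1) q, vl m (q, h)) (by
      change E.incl 0 (E.tangent.toZero m _).1 ∈ U
      rw [hb]
      exact hmem _ hq)
    rw [hb] at this
    exact (toZero_tangent_snd F m _).symm.trans (congrArg Prod.snd this)

/-- The scale of `ℝ^d` is constant, so an `sc¹` map on it is differentiable at all points. -/
theorem ScOn.isScOneOn {d : ℕ} {E : BanachScale.{a}} {Q : Set (EuclideanSpace ℝ (Fin d))}
    (hQ : IsOpen Q) {u : EuclideanSpace ℝ (Fin d) → E.lvl 0} (hu : ScOn 1 (euclid d) E Q u) :
    E.IsScOneOn Q u := by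
  obtain ⟨hu0, f₁, D, hf₁, ho, hT⟩ := hu
  choose ul hul hul' using hu0
  choose tl htl htl' using (hT : Sc0On _ _ _ _)
  have hpre : ∀ m, Q ⊆ (euclid d).toZero m ⁻¹' Q := fun m x hx => by
    change (euclid d).toZero m x ∈ Q
    exact (toZero_euclid d m x).symm ▸ hx
  have hbase : ∀ m (p : EuclideanSpace ℝ (Fin d) × EuclideanSpace ℝ (Fin d)),
      (euclid d).tangent.toZero m p = p := fun m p => Prod.ext
    ((incl_toZero_tangent_fst (euclid d) m p).trans (toZero_euclid d (m + 1) p.1))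
    ((toZero_tangent_snd (euclid d) m p).trans (toZero_euclid d m p.2))
  refine ⟨ul, D, fun m p => (tl m p).2, fun m => ?_, fun m q hq => ?_, fun q hq => ?_,
    fun m => ?_, fun m q hq h => ?_⟩
  · exact (hul m).mono (hpre m)
  · exact (hul' m q (hpre m hq)).trans (congrArg u (toZero_euclid d m q))
  · refine hasFDerivAt_iff_isLittleO_nhds_zero.mpr ?_
    have h : (fun h : EuclideanSpace ℝ (Fin d) => u (q + h) - u q - D q h)
      =o[𝓝[{h | q + h ∈ Q}] 0] (fun h : EuclideanSpace ℝ (Fin d) => h) := ho q hq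
    rwa [nhdsWithin_eq_nhds.mpr] at h
    have : ContinuousAt (fun h : EuclideanSpace ℝ (Fin d) => q + h) 0 := by fun_prop
    exact this.preimage_mem_nhds (hQ.mem_nhds (by simpa using hq))
  · refine continuous_snd.comp_continuousOn ((htl m).mono fun p hp => ?_)
    have h1 : ((euclid d).tangent.toZero m p).1 = p.1 := congrArg Prod.fst (hbase m p)
    change ((euclid d).tangent.toZero m p).1 ∈ Q
    exact h1.symm ▸ hp.1
  · have h1 : ((euclid d).tangent.toZero m (q, h)).1 = q := congrArg Prod.fst (hbase m (q, h))
    have h2 : ((euclid d).tangent.toZero m (q, h)).2 = h := congrArg Prod.snd (hbase m (q, h))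
    have h3 := congrArg Prod.snd (htl' m (q, h) (by
      change ((euclid d).tangent.toZero m (q, h)).1 ∈ Q
      exact h1.symm ▸ hq))
    refine (toZero_tangent_snd E m _).symm.trans (h3.trans ?_)
    change D ((euclid d).tangent.toZero m (q, h)).1 ((euclid d).tangent.toZero m (q, h)).2 = _
    exact (congrArg (fun z => D z ((euclid d).tangent.toZero m (q, h)).2) h1).trans
      (congrArg (D q) h2)

/-- Between Euclidean spaces, `sc¹` implies `C¹`. -/
theorem IsScOneOn.contDiffAt {d k : ℕ} {Q : Set (EuclideanSpace ℝ (Fin d))}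
    (hQ : IsOpen Q) {u : EuclideanSpace ℝ (Fin d) → EuclideanSpace ℝ (Fin k)}
    (hu : (euclid k).IsScOneOn Q u) {q : EuclideanSpace ℝ (Fin d)} (hq : q ∈ Q) :
    ContDiffAt ℝ 1 u q := by
  obtain ⟨-, Du, vl, -, -, h3, h4, h5⟩ := hu
  let Du' : EuclideanSpace ℝ (Fin d) → EuclideanSpace ℝ (Fin d) →L[ℝ] EuclideanSpace ℝ (Fin k) :=
    Du
  have hD : ContinuousOn Du' Q := by
    rw [continuousOn_clm_apply]
    intro h
    have : ContinuousOn (fun q => vl 0 (q, h)) Q :=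
      (h4 0).comp (by fun_prop) fun q hq => ⟨hq, mem_univ _⟩
    exact this.congr fun q hq => (h5 0 q hq h).symm
  exact contDiffAt_one_iff.mpr ⟨Du', Q, hQ.mem_nhds hq, hD, h3⟩

end BanachScale

variable {X : Type a} [TopologicalSpace X] {Y : Type b} [TopologicalSpace Y]

/-- The map `u : ℝ^d → X` to an M-polyfold is `sc¹` near `q`, in some chart at `u q`. -/
def IsScOneAt (A : ScAtlas.{a, c} X) {k : ℕ} (u : EuclideanSpace ℝ (Fin k) → X)
    (q : EuclideanSpace ℝ (Fin k)) : Prop :=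
  ∃ κ ∈ A.charts, ∃ Q, IsOpen Q ∧ q ∈ Q ∧ MapsTo u Q κ.φ.source ∧ κ.E.IsScOneOn Q (κ.φ ∘ u)

theorem IsScOneAt.continuousAt {A : ScAtlas.{a, c} X} {k : ℕ} {u : EuclideanSpace ℝ (Fin k) → X}
    {q : EuclideanSpace ℝ (Fin k)} (h : IsScOneAt A u q) : ContinuousAt u q := by
  obtain ⟨κ, -, Q, hQ, hq, hm, hu⟩ := h
  have h1 : ContinuousOn (κ.φ.symm ∘ (κ.φ ∘ u)) Q :=
    κ.continuousOn_symm.comp hu.continuousOn fun x hx => κ.φ.map_source (hm hx)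
  exact (h1.congr fun x hx => (κ.φ.left_inv (hm hx)).symm).continuousAt (hQ.mem_nhds hq)

theorem ScSmoothFromEuclid.isScOneAt {A : ScAtlas.{a, c} X} {k : ℕ}
    {Q : Set (EuclideanSpace ℝ (Fin k))} (hQ : IsOpen Q) {u : EuclideanSpace ℝ (Fin k) → X}
    (h : ScSmoothFromEuclid A Q u) {q : EuclideanSpace ℝ (Fin k)} (hq : q ∈ Q) :
    IsScOneAt A u q := by
  obtain ⟨κ, hκ, hqκ⟩ := A.cover (u q)
  have ho : IsOpen (Q ∩ u ⁻¹' κ.φ.source) := h.1.isOpen_inter_preimage hQ κ.open_source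
  exact ⟨κ, hκ, Q ∩ u ⁻¹' κ.φ.source, ho, ⟨hq, hqκ⟩, fun x hx => hx.2,
    (h.2 κ hκ 1).isScOneOn ho⟩

/-- Composition with an sc-smooth map on a retract: the retraction drops out. -/
theorem BanachScale.IsScOneOn.comp_retract {d : ℕ} {E : BanachScale.{a}} {F : BanachScale.{b}}
    (hE : E.IsScBanach) {Q : Set (EuclideanSpace ℝ (Fin d))} (hQ : IsOpen Q)
    {u : EuclideanSpace ℝ (Fin d) → E.lvl 0} (hu : E.IsScOneOn Q u) {C A : Set (E.lvl 0)}
    {g : E.lvl 0 → F.lvl 0} (hg : E.ScSmoothOnRetract F C A g) (hQA : MapsTo u Q A) :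
    F.IsScOneOn Q (g ∘ u) := by
  obtain ⟨U, r, hr, hgr⟩ := hg
  have hA : ∀ x ∈ A, x ∈ U ∧ r x = x := by
    intro x hx
    rw [← hr.image] at hx
    obtain ⟨y, hy, rfl⟩ := hx
    exact ⟨hr.mapsTo hy, hr.idem y hy⟩
  refine (hu.comp hE hQ (hgr 1) fun x hx => (hA _ (hQA hx)).1).congr hQ fun x hx => ?_
  simp only [Function.comp_apply, (hA _ (hQA hx)).2]

theorem IsScOneAt.comp {A : ScAtlas.{a, c} X} {B : ScAtlas.{b, d} Y} {k : ℕ}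
    {u : EuclideanSpace ℝ (Fin k) → X} {q : EuclideanSpace ℝ (Fin k)} (hu : IsScOneAt A u q)
    {W : Set X} (hW : IsOpen W) {h : X → Y} (hh : MScSmoothOn A B W h) (hq : u q ∈ W) :
    IsScOneAt B (h ∘ u) q := by
  obtain ⟨κ, hκ, Q, hQ, hqQ, hm, hκu⟩ := hu
  obtain ⟨κ', hκ', hqκ'⟩ := B.cover (h (u q))
  have hO : IsOpen (W ∩ h ⁻¹' κ'.φ.source) := hh.1.isOpen_inter_preimage hW κ'.open_source
  have huc : ContinuousOn u Q := fun x hx =>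
    (IsScOneAt.continuousAt ⟨κ, hκ, Q, hQ, hx, hm, hκu⟩).continuousWithinAt
  have hQ' : IsOpen (Q ∩ u ⁻¹' (W ∩ h ⁻¹' κ'.φ.source)) := huc.isOpen_inter_preimage hQ hO
  refine ⟨κ', hκ', _, hQ', ⟨hqQ, hq, hqκ'⟩, fun x hx => hx.2.2, ?_⟩
  refine (((hκu.mono inter_subset_left).comp_retract κ.isSc hQ' (hh.2 κ hκ κ' hκ')
    fun x hx => ⟨u x, ⟨hm hx.1, hx.2⟩, rfl⟩)).congr hQ' fun x hx => ?_
  simp only [Function.comp_apply, κ.φ.left_inv (hm hx.1)]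

theorem IsScOneAt.contDiffAt_comp {A : ScAtlas.{a, c} X} {k l : ℕ}
    {u : EuclideanSpace ℝ (Fin k) → X} {q : EuclideanSpace ℝ (Fin k)} (hu : IsScOneAt A u q)
    {V : Set X} (hV : IsOpen V) {ρ : X → EuclideanSpace ℝ (Fin l)} (hρ : ScSmoothToEuclid A V ρ)
    (hq : u q ∈ V) : ContDiffAt ℝ 1 (ρ ∘ u) q := by
  obtain ⟨κ, hκ, Q, hQ, hqQ, hm, hκu⟩ := hu
  have huc : ContinuousOn u Q := fun x hx =>
    (IsScOneAt.continuousAt ⟨κ, hκ, Q, hQ, hx, hm, hκu⟩).continuousWithinAt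
  have hQ' : IsOpen (Q ∩ u ⁻¹' V) := huc.isOpen_inter_preimage hQ hV
  have h1 : (BanachScale.euclid l).IsScOneOn (Q ∩ u ⁻¹' V) (ρ ∘ u) :=
    (((hκu.mono inter_subset_left).comp_retract κ.isSc hQ' (hρ.2 κ hκ)
      fun x hx => ⟨u x, ⟨hm hx.1, hx.2⟩, rfl⟩)).congr hQ' fun x hx =>
        congrArg ρ (κ.φ.left_inv (hm hx.1)).symm
  exact BanachScale.IsScOneOn.contDiffAt hQ' h1 ⟨hqQ, hq⟩

/-- A homeomorphism between open subsets of M-polyfolds which, in both directions, takes `sc¹` maps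
from Euclidean spaces to such maps. -/
def IsScOneEquiv (A : ScAtlas.{a, c} X) (B : ScAtlas.{b, d} Y) (σ : OpenPartialHomeomorph X Y) :
    Prop :=
  (∀ {k : ℕ} {u : EuclideanSpace ℝ (Fin k) → X} {q : EuclideanSpace ℝ (Fin k)}, IsScOneAt A u q →
    u q ∈ σ.source → IsScOneAt B (σ ∘ u) q) ∧
  ∀ {k : ℕ} {u : EuclideanSpace ℝ (Fin k) → Y} {q : EuclideanSpace ℝ (Fin k)}, IsScOneAt B u q →
    u q ∈ σ.target → IsScOneAt A (σ.symm ∘ u) q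

/-- Transition between local parametrizations of two submanifolds `M` and `M'`, the second one of
them transported by `σ`: at a parameter `q` which is a limit of interior points of the set where
`M` is contained in `M'`, the transition map is `C¹` with injective differential. -/
theorem SubmanifoldParam.transition {A : ScAtlas.{a, c} X} {B : ScAtlas.{b, d} Y} {k k' : ℕ}
    {M : Set X} {M' : Set Y} (p : SubmanifoldParam A k M) (p' : SubmanifoldParam B k' M')
    {σ : OpenPartialHomeomorph X Y} (hσ : IsScOneEquiv A B σ)
    {q : EuclideanSpace ℝ (Fin k)} (hq : q ∈ p.Q) (hqσ : p.Φ q ∈ σ.source)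
    (hqV : σ (p.Φ q) ∈ p'.V) (hqM : σ (p.Φ q) ∈ M')
    {I : Set (EuclideanSpace ℝ (Fin k))} (hI : IsOpen I)
    (hIM : ∀ z ∈ I, σ (p.Φ z) ∈ M') (hqI : q ∈ closure I) :
    ContDiffAt ℝ 1 (p'.ρ ∘ σ ∘ p.Φ) q ∧
    Function.Injective (fderiv ℝ (p'.ρ ∘ σ ∘ p.Φ) q) ∧
    (p'.ρ (σ (p.Φ q)) ∈ p'.Q ∧ p'.Φ (p'.ρ (σ (p.Φ q))) = σ (p.Φ q)) ∧
    ∀ᶠ z in 𝓝 q, z ∈ I → p'.Φ (p'.ρ (σ (p.Φ z))) = σ (p.Φ z) := by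
  have hback : ∀ y ∈ M' ∩ p'.V, p'.ρ y ∈ p'.Q ∧ p'.Φ (p'.ρ y) = y := by
    intro y hy
    rw [← p'.image] at hy
    obtain ⟨w, hw, rfl⟩ := hy
    rw [p'.left_inv w hw]
    exact ⟨hw, rfl⟩
  have h1 : IsScOneAt B (σ ∘ p.Φ) q := hσ.1 (p.smoothΦ.isScOneAt p.openQ hq) hqσ
  have hτ : ContDiffAt ℝ 1 (p'.ρ ∘ σ ∘ p.Φ) q := h1.contDiffAt_comp p'.openV p'.smoothρ hqV
  obtain ⟨hw, hΦw⟩ := hback _ ⟨hqM, hqV⟩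
  set w := p'.ρ (σ (p.Φ q)) with hwdef
  have h2 : IsScOneAt A (σ.symm ∘ p'.Φ) w := hσ.2 (p'.smoothΦ.isScOneAt p'.openQ hw) (by
    rw [hΦw]
    exact σ.map_source hqσ)
  have hpV : p.Φ q ∈ p.V := (p.image.subset (mem_image_of_mem _ hq)).2
  have hτ' : ContDiffAt ℝ 1 (p.ρ ∘ σ.symm ∘ p'.Φ) w := h2.contDiffAt_comp p.openV p.smoothρ (by
    rw [Function.comp_apply, hΦw, σ.left_inv hqσ]
    exact hpV)
  have hΦc : ContinuousAt p.Φ q := (p.smoothΦ.isScOneAt p.openQ hq).continuousAt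
  have hev : ∀ᶠ z in 𝓝 q, z ∈ p.Q ∧ p.Φ z ∈ σ.source ∧ σ (p.Φ z) ∈ p'.V :=
    (Filter.Eventually.and (p.openQ.mem_nhds hq : ∀ᶠ z in 𝓝 q, z ∈ p.Q)
      ((hΦc.eventually (σ.open_source.mem_nhds hqσ)).and
        (h1.continuousAt.eventually (p'.openV.mem_nhds hqV))))
  have hcomp : ∀ᶠ z in 𝓝 q, z ∈ I → (p.ρ ∘ σ.symm ∘ p'.Φ) ((p'.ρ ∘ σ ∘ p.Φ) z) = z := by
    filter_upwards [hev] with z hz hzI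
    simp only [Function.comp_apply]
    rw [(hback _ ⟨hIM z hzI, hz.2.2⟩).2, σ.left_inv hz.2.1, p.left_inv z hz.1]
  refine ⟨hτ, ?_, ⟨hw, hΦw⟩, ?_⟩
  -- The composite of the transition maps of both directions is the identity on `I`.  Hence so is
  -- its differential, at the points of `I` and, by continuity, at their limit `q`.
  · have hτev := hτ.eventually (by simp)
    have hτ'ev := hτ.continuousAt.eventually (hτ'.eventually (by simp))
    have hfreq : ∃ᶠ z in 𝓝 q, z ∈ I := mem_closure_iff_frequently.mp hqI
    have hcont : ContinuousAt (fun z => (fderiv ℝ (p.ρ ∘ σ.symm ∘ p'.Φ)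
        ((p'.ρ ∘ σ ∘ p.Φ) z)).comp (fderiv ℝ (p'.ρ ∘ σ ∘ p.Φ) z)) q :=
      (ContinuousAt.comp (f := p'.ρ ∘ σ ∘ p.Φ) (g := fderiv ℝ (p.ρ ∘ σ.symm ∘ p'.Φ))
        (hτ'.continuousAt_fderiv (by simp)) hτ.continuousAt).clm_comp
        (hτ.continuousAt_fderiv (by simp))
    have heq := tendsto_nhds_unique_of_frequently_eq hcont
      (tendsto_const_nhds (x := ContinuousLinearMap.id ℝ (EuclideanSpace ℝ (Fin k)))) (by
        refine (hfreq.and_eventually (hτev.and (hτ'ev.and hcomp.eventually_nhds))).mono ?_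
        rintro z ⟨hzI, hz1, hz2, hz3⟩
        rw [← fderiv_comp z (hz2.differentiableAt (by simp)) (hz1.differentiableAt (by simp))]
        have : (p.ρ ∘ σ.symm ∘ p'.Φ) ∘ (p'.ρ ∘ σ ∘ p.Φ) =ᶠ[𝓝 z] id := by
          filter_upwards [hz3, hI.mem_nhds hzI] with y hy hyI
          exact hy hyI
        rw [this.fderiv_eq, fderiv_id])
    intro v v' hvv'
    have := congrArg (fun L : EuclideanSpace ℝ (Fin k) →L[ℝ] EuclideanSpace ℝ (Fin k) =>
      (L v, L v')) heq
    simp only [ContinuousLinearMap.comp_apply, hvv', ContinuousLinearMap.id_apply,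
      Prod.mk.injEq] at this
    exact this.1.symm.trans this.2
  · filter_upwards [hev] with z hz hzI
    exact (hback _ ⟨hIM z hzI, hz.2.2⟩).2

end ScCalculus

/-! ### Differentials and partial diffeomorphisms -/

section PartialDiffeos

variable {E : Type*} [NormedAddCommGroup E] [NormedSpace ℝ E]
  {E' : Type*} [NormedAddCommGroup E'] [NormedSpace ℝ E']
  {E'' : Type*} [NormedAddCommGroup E''] [NormedSpace ℝ E'']
  {M : Type*} [TopologicalSpace M] [ChartedSpace E M]
  {N : Type*} [TopologicalSpace N] [ChartedSpace E' N]
  {P : Type*} [TopologicalSpace P] [ChartedSpace E'' P]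

variable (E E') in
/-- The differential of a map between boundaryless manifolds, regarded as a linear map between the
model spaces (to which the tangent spaces are equal by definition). -/
noncomputable def tderiv (f : M → N) (x : M) : E →L[ℝ] E' := mfderiv 𝓘(ℝ, E) 𝓘(ℝ, E') f x

theorem tderiv_comp {g : N → P} {f : M → N} {x : M}
    (hg : MDifferentiableAt 𝓘(ℝ, E') 𝓘(ℝ, E'') g (f x))
    (hf : MDifferentiableAt 𝓘(ℝ, E) 𝓘(ℝ, E') f x) :
    tderiv E E'' (g ∘ f) x = (tderiv E' E'' g (f x)).comp (tderiv E E' f x) :=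
  mfderiv_comp x hg hf

theorem tderiv_congr {f g : M → N} {x : M} (h : f =ᶠ[𝓝 x] g) :
    tderiv E E' f x = tderiv E E' g x := h.mfderiv_eq

theorem tderiv_id (x : M) : tderiv E E (id : M → M) x = ContinuousLinearMap.id ℝ E := mfderiv_id

theorem tderiv_eq_fderiv (f : E → E') (x : E) : tderiv E E' f x = fderiv ℝ f x := mfderiv_eq_fderiv

variable {N' : Type*} [TopologicalSpace N'] [ChartedSpace E N']
  {P' : Type*} [TopologicalSpace P'] [ChartedSpace E P']

/-- The homeomorphism `ψ` between open subsets of manifolds is a diffeomorphism. -/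
structure IsPartialDiffeo (ψ : OpenPartialHomeomorph M N') : Prop where
  smooth : ContMDiffOn 𝓘(ℝ, E) 𝓘(ℝ, E) ∞ ψ ψ.source
  smooth_symm : ContMDiffOn 𝓘(ℝ, E) 𝓘(ℝ, E) ∞ ψ.symm ψ.target

namespace IsPartialDiffeo

theorem symm {ψ : OpenPartialHomeomorph M N'} (h : IsPartialDiffeo (E := E) ψ) :
    IsPartialDiffeo (E := E) ψ.symm :=
  ⟨h.smooth_symm, h.smooth⟩

theorem trans {ψ : OpenPartialHomeomorph M N'} (h : IsPartialDiffeo (E := E) ψ)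
    {χ : OpenPartialHomeomorph N' P'} (h' : IsPartialDiffeo (E := E) χ) :
    IsPartialDiffeo (E := E) (ψ.trans χ) := by
  refine ⟨?_, ?_⟩
  · refine h'.smooth.comp (h.smooth.mono ?_) ?_
    · exact fun x hx => hx.1
    · exact fun x hx => hx.2
  · refine h.smooth_symm.comp (h'.smooth_symm.mono ?_) ?_
    · exact fun x hx => hx.1
    · exact fun x hx => hx.2

theorem restrOpen {ψ : OpenPartialHomeomorph M N'} (h : IsPartialDiffeo (E := E) ψ) (s : Set M)
    (hs : IsOpen s) : IsPartialDiffeo (E := E) (ψ.restrOpen s hs) := by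
  refine ⟨h.smooth.mono ?_, h.smooth_symm.mono ?_⟩
  · rw [ψ.restrOpen_source]
    exact inter_subset_left
  · exact fun x hx => hx.1

theorem refl : IsPartialDiffeo (E := E) (OpenPartialHomeomorph.refl M) :=
  ⟨contMDiffOn_id, contMDiffOn_id⟩

theorem contMDiffAt {ψ : OpenPartialHomeomorph M N'} (h : IsPartialDiffeo (E := E) ψ) {x : M}
    (hx : x ∈ ψ.source) : ContMDiffAt 𝓘(ℝ, E) 𝓘(ℝ, E) ∞ ψ x :=
  h.smooth.contMDiffAt (ψ.open_source.mem_nhds hx)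

theorem mdifferentiableAt {ψ : OpenPartialHomeomorph M N'} (h : IsPartialDiffeo (E := E) ψ) {x : M}
    (hx : x ∈ ψ.source) : MDifferentiableAt 𝓘(ℝ, E) 𝓘(ℝ, E) ψ x :=
  (h.contMDiffAt hx).mdifferentiableAt (by simp)

theorem tderiv_symm_comp {ψ : OpenPartialHomeomorph M N'} (h : IsPartialDiffeo (E := E) ψ) {x : M}
    (hx : x ∈ ψ.source) :
    (tderiv E E ψ.symm (ψ x)).comp (tderiv E E ψ x) = ContinuousLinearMap.id ℝ E := by
  rw [← tderiv_comp (h.symm.mdifferentiableAt (ψ.map_source hx)) (h.mdifferentiableAt hx),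
    ← tderiv_id x]
  refine tderiv_congr ?_
  filter_upwards [ψ.open_source.mem_nhds hx] with y hy
  exact ψ.left_inv hy

theorem tderiv_comp_symm {ψ : OpenPartialHomeomorph M N'} (h : IsPartialDiffeo (E := E) ψ) {x : M}
    (hx : x ∈ ψ.source) :
    (tderiv E E ψ x).comp (tderiv E E ψ.symm (ψ x)) = ContinuousLinearMap.id ℝ E := by
  have := h.symm.tderiv_symm_comp (ψ.map_source hx)
  rwa [ψ.symm_symm, ψ.left_inv hx] at this

theorem tderiv_symm_apply {ψ : OpenPartialHomeomorph M N'} (h : IsPartialDiffeo (E := E) ψ) {x : M}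
    (hx : x ∈ ψ.source) (v : E) : tderiv E E ψ.symm (ψ x) (tderiv E E ψ x v) = v :=
  congrArg (fun L : E →L[ℝ] E => L v) (h.tderiv_symm_comp hx)

theorem tderiv_apply_symm {ψ : OpenPartialHomeomorph M N'} (h : IsPartialDiffeo (E := E) ψ) {x : M}
    (hx : x ∈ ψ.source) (v : E) : tderiv E E ψ x (tderiv E E ψ.symm (ψ x) v) = v :=
  congrArg (fun L : E →L[ℝ] E => L v) (h.tderiv_comp_symm hx)

theorem tderiv_injective {ψ : OpenPartialHomeomorph M N'} (h : IsPartialDiffeo (E := E) ψ) {x : M}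
    (hx : x ∈ ψ.source) : Function.Injective (tderiv E E ψ x) :=
  Function.LeftInverse.injective (h.tderiv_symm_apply hx)

theorem tderiv_surjective {ψ : OpenPartialHomeomorph M N'} (h : IsPartialDiffeo (E := E) ψ) {x : M}
    (hx : x ∈ ψ.source) : Function.Surjective (tderiv E E ψ x) :=
  Function.RightInverse.surjective (h.tderiv_apply_symm hx)

end IsPartialDiffeo

theorem IsPartialDiffeo.of_mem_maximalAtlas [IsManifold 𝓘(ℝ, E) ∞ M]
    {φ : OpenPartialHomeomorph M E} (h : φ ∈ IsManifold.maximalAtlas 𝓘(ℝ, E) ∞ M) :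
    IsPartialDiffeo (E := E) φ :=
  ⟨contMDiffOn_of_mem_maximalAtlas h, contMDiffOn_symm_of_mem_maximalAtlas h⟩

theorem IsPartialDiffeo.mem_maximalAtlas [IsManifold 𝓘(ℝ, E) ∞ M]
    {φ : OpenPartialHomeomorph M E} (h : IsPartialDiffeo (E := E) φ) :
    φ ∈ IsManifold.maximalAtlas 𝓘(ℝ, E) ∞ M :=
  OpenPartialHomeomorph.mem_maximalAtlas_of_contMDiffOn _ h.smooth h.smooth_symm

theorem IsPartialDiffeo.exists_of_isLocalDiffeomorphAt {f : M → N'} {x : M}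
    (h : IsLocalDiffeomorphAt 𝓘(ℝ, E) 𝓘(ℝ, E) ∞ f x) :
    ∃ ψ : OpenPartialHomeomorph M N', x ∈ ψ.source ∧ (∀ y ∈ ψ.source, ψ y = f y) ∧
      IsPartialDiffeo (E := E) ψ := by
  obtain ⟨Φ, hx, hΦ⟩ := h
  exact ⟨Φ.toOpenPartialHomeomorph, hx, fun y hy => (hΦ hy).symm,
    ⟨Φ.contMDiffOn_toFun, Φ.contMDiffOn_invFun⟩⟩

/-- A continuous map is smooth if its composite with a local diffeomorphism is smooth. -/
theorem contMDiffWithinAt_of_comp_localDiffeo {F H : Type*} [NormedAddCommGroup F]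
    [NormedSpace ℝ F] [TopologicalSpace H] {J : ModelWithCorners ℝ F H} {Q : Type*}
    [TopologicalSpace Q] [ChartedSpace H Q] {f : Q → M} {g : M → N'} {s : Set Q} {x : Q}
    (hf : ContinuousWithinAt f s x) (hg : IsLocalDiffeomorphAt 𝓘(ℝ, E) 𝓘(ℝ, E) ∞ g (f x))
    (hgf : ContMDiffWithinAt J 𝓘(ℝ, E) ∞ (g ∘ f) s x) :
    ContMDiffWithinAt J 𝓘(ℝ, E) ∞ f s x := by
  obtain ⟨ψ, hx, hψ, hψs⟩ := IsPartialDiffeo.exists_of_isLocalDiffeomorphAt hg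
  have h1 : ContMDiffAt 𝓘(ℝ, E) 𝓘(ℝ, E) ∞ ψ.symm ((g ∘ f) x) := by
    rw [Function.comp_apply, ← hψ _ hx]
    exact hψs.symm.contMDiffAt (ψ.map_source hx)
  refine (h1.comp_contMDiffWithinAt x hgf).congr_of_eventuallyEq ?_ ?_
  · filter_upwards [hf (ψ.open_source.mem_nhds hx)] with y hy
    simp only [Function.comp_apply]
    rw [← hψ _ hy, ψ.left_inv hy]
  · simp only [Function.comp_apply]
    rw [← hψ _ hx, ψ.left_inv hx]

theorem contMDiff_of_comp_localDiffeo {F H : Type*} [NormedAddCommGroup F]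
    [NormedSpace ℝ F] [TopologicalSpace H] {J : ModelWithCorners ℝ F H} {Q : Type*}
    [TopologicalSpace Q] [ChartedSpace H Q] {f : Q → M} {g : M → N'}
    (hf : Continuous f) (hg : IsLocalDiffeomorph 𝓘(ℝ, E) 𝓘(ℝ, E) ∞ g)
    (hgf : ContMDiff J 𝓘(ℝ, E) ∞ (g ∘ f)) : ContMDiff J 𝓘(ℝ, E) ∞ f := fun x =>
  (contMDiffWithinAt_univ).mp (contMDiffWithinAt_of_comp_localDiffeo hf.continuousWithinAt (hg _)
    (contMDiffWithinAt_univ.mpr (hgf x)))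

end PartialDiffeos

/-! ### Transport along the morphisms of an étale groupoid -/

section Groupoids

namespace GroupoidOn

variable {Ob : Type a} {Mo : Type b} (G : GroupoidOn Ob Mo)

theorem proj_eq_iff {x y : Ob} : G.proj x = G.proj y ↔ ∃ g, G.src g = x ∧ G.tgt g = y :=
  Quotient.eq (r := G.orbitRel)

theorem proj_src_eq_proj_tgt (g : Mo) : G.proj (G.src g) = G.proj (G.tgt g) :=
  G.proj_eq_iff.mpr ⟨g, rfl, rfl⟩

theorem proj_surjective : Function.Surjective G.proj := Quotient.mk_surjective

theorem continuous_proj [TopologicalSpace Ob] : Continuous G.proj := continuous_quotient_mk'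

theorem isOpenMap_proj [TopologicalSpace Ob] [TopologicalSpace Mo] (hs : Continuous G.src)
    (ht : IsOpenMap G.tgt) : IsOpenMap G.proj := by
  intro U hU
  have : G.proj ⁻¹' (G.proj '' U) = G.tgt '' (G.src ⁻¹' U) := by
    ext y
    constructor
    · rintro ⟨x, hx, hxy⟩
      obtain ⟨g, hg, hg'⟩ := G.proj_eq_iff.mp hxy
      exact ⟨g, by rwa [mem_preimage, hg], hg'⟩
    · rintro ⟨g, hg, rfl⟩
      exact ⟨_, hg, G.proj_src_eq_proj_tgt g⟩
  exact isOpen_coinduced.mpr (this ▸ ht _ (hU.preimage hs))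

theorem comp_comp_inv_cancel {h g : Mo} (hg : G.src h = G.src g) :
    G.comp (G.comp h (G.inv g)) g = h := by
  rw [G.comp_assoc _ _ _ (by rw [G.tgt_inv, hg]) (G.src_inv g), G.inv_comp, ← hg, G.comp_unit]

theorem comp_inv_comp_cancel {h g : Mo} (hg : G.src h = G.tgt g) :
    G.comp (G.comp h g) (G.inv g) = h := by
  rw [G.comp_assoc _ _ _ hg (G.tgt_inv g).symm, G.comp_inv, ← hg, G.comp_unit]

theorem inv_comp_comp_cancel {h g : Mo} (hg : G.src h = G.tgt g) :
    G.comp (G.inv h) (G.comp h g) = g := by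
  rw [← G.comp_assoc _ _ _ (G.src_inv h) hg, G.inv_comp, hg, G.unit_comp]

theorem comp_inv_comp_cancel' {h g : Mo} (hg : G.tgt h = G.tgt g) :
    G.comp h (G.comp (G.inv h) g) = g := by
  rw [← G.comp_assoc _ _ _ (by rw [G.tgt_inv]) (by rw [G.src_inv, hg]), G.comp_inv, hg,
    G.unit_comp]

theorem comp_left_cancel {h g g' : Mo} (hg : G.src h = G.tgt g) (hg' : G.src h = G.tgt g')
    (e : G.comp h g = G.comp h g') : g = g' := by
  rw [← G.inv_comp_comp_cancel hg, e, G.inv_comp_comp_cancel hg']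

theorem comp_right_cancel {h h' g : Mo} (hg : G.src h = G.tgt g) (hg' : G.src h' = G.tgt g)
    (e : G.comp h g = G.comp h' g) : h = h' := by
  rw [← G.comp_inv_comp_cancel hg, e, G.comp_inv_comp_cancel hg']

theorem inv_inv (g : Mo) : G.inv (G.inv g) = g := by
  refine G.comp_right_cancel (g := G.inv g) (G.src_inv _) (G.tgt_inv g).symm ?_
  rw [G.inv_comp, G.comp_inv, G.src_inv]

end GroupoidOn

namespace EpGroupoid

variable {n : ℕ} (O : EpGroupoid.{a, b} n)

theorem continuous_src : Continuous O.gr.src := O.etale_src.contMDiff.continuous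

theorem continuous_tgt : Continuous O.gr.tgt := O.etale_tgt.contMDiff.continuous

theorem continuous_inv : Continuous O.gr.inv := O.smooth_inv.continuous

theorem continuous_unit : Continuous O.gr.unit := O.smooth_unit.continuous

theorem continuousOn_comp : ContinuousOn (fun p : O.Mor × O.Mor => O.gr.comp p.1 p.2)
    {p | O.gr.src p.1 = O.gr.tgt p.2} := O.smooth_comp.continuousOn

theorem isOpenMap_proj : IsOpenMap O.gr.proj :=
  O.gr.isOpenMap_proj O.continuous_src O.etale_tgt.isLocalHomeomorph.isOpenMap

theorem mdifferentiableAt_src (h : O.Mor) : MDifferentiableAt (𝓡 n) (𝓡 n) O.gr.src h :=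
  (O.etale_src.contMDiff h).mdifferentiableAt (by simp)

instance : LocallyCompactSpace O.Obj :=
  ChartedSpace.locallyCompactSpace (EuclideanSpace ℝ (Fin n)) O.Obj

/-- The source map near `h`, as a partial homeomorphism. -/
noncomputable def srcChart (h : O.Mor) : OpenPartialHomeomorph O.Mor O.Obj :=
  (IsPartialDiffeo.exists_of_isLocalDiffeomorphAt (O.etale_src h)).choose

/-- The target map near `h`, as a partial homeomorphism. -/
noncomputable def tgtChart (h : O.Mor) : OpenPartialHomeomorph O.Mor O.Obj :=
  (IsPartialDiffeo.exists_of_isLocalDiffeomorphAt (O.etale_tgt h)).choose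

theorem mem_srcChart (h : O.Mor) : h ∈ (O.srcChart h).source :=
  (IsPartialDiffeo.exists_of_isLocalDiffeomorphAt (O.etale_src h)).choose_spec.1

theorem srcChart_apply (h : O.Mor) {g : O.Mor} (hg : g ∈ (O.srcChart h).source) :
    O.srcChart h g = O.gr.src g :=
  (IsPartialDiffeo.exists_of_isLocalDiffeomorphAt (O.etale_src h)).choose_spec.2.1 g hg

theorem isPartialDiffeo_srcChart (h : O.Mor) :
    IsPartialDiffeo (E := EuclideanSpace ℝ (Fin n)) (O.srcChart h) :=
  (IsPartialDiffeo.exists_of_isLocalDiffeomorphAt (O.etale_src h)).choose_spec.2.2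

theorem mem_tgtChart (h : O.Mor) : h ∈ (O.tgtChart h).source :=
  (IsPartialDiffeo.exists_of_isLocalDiffeomorphAt (O.etale_tgt h)).choose_spec.1

theorem tgtChart_apply (h : O.Mor) {g : O.Mor} (hg : g ∈ (O.tgtChart h).source) :
    O.tgtChart h g = O.gr.tgt g :=
  (IsPartialDiffeo.exists_of_isLocalDiffeomorphAt (O.etale_tgt h)).choose_spec.2.1 g hg

theorem isPartialDiffeo_tgtChart (h : O.Mor) :
    IsPartialDiffeo (E := EuclideanSpace ℝ (Fin n)) (O.tgtChart h) :=
  (IsPartialDiffeo.exists_of_isLocalDiffeomorphAt (O.etale_tgt h)).choose_spec.2.2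

/-- The local section of the source map through `h`. -/
noncomputable def sec (h : O.Mor) : O.Obj → O.Mor := (O.srcChart h).symm

/-- Transport along the morphisms near `h`: the germ at the source of `h` of the local
diffeomorphism `tgt ∘ src⁻¹`. -/
noncomputable def transport (h : O.Mor) : OpenPartialHomeomorph O.Obj O.Obj :=
  (O.srcChart h).symm.trans (O.tgtChart h)

/-- A neighbourhood of `h` on which the source and target maps are injective. -/
def biNhd (h : O.Mor) : Set O.Mor := (O.srcChart h).source ∩ (O.tgtChart h).source

theorem isOpen_biNhd (h : O.Mor) : IsOpen (O.biNhd h) :=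
  (O.srcChart h).open_source.inter (O.tgtChart h).open_source

theorem mem_biNhd (h : O.Mor) : h ∈ O.biNhd h := ⟨O.mem_srcChart h, O.mem_tgtChart h⟩

theorem biNhd_mem_nhds (h : O.Mor) : O.biNhd h ∈ 𝓝 h := (O.isOpen_biNhd h).mem_nhds (O.mem_biNhd h)

theorem isPartialDiffeo_transport (h : O.Mor) :
    IsPartialDiffeo (E := EuclideanSpace ℝ (Fin n)) (O.transport h) :=
  (O.isPartialDiffeo_srcChart h).symm.trans (O.isPartialDiffeo_tgtChart h)

variable {O}

theorem sec_src {h g : O.Mor} (hg : g ∈ O.biNhd h) : O.sec h (O.gr.src g) = g := by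
  rw [← O.srcChart_apply h hg.1]
  exact (O.srcChart h).left_inv hg.1

theorem src_mem_transport {h g : O.Mor} (hg : g ∈ O.biNhd h) :
    O.gr.src g ∈ (O.transport h).source := by
  have h1 : O.gr.src g ∈ (O.srcChart h).target := by
    rw [← O.srcChart_apply h hg.1]
    exact (O.srcChart h).map_source hg.1
  refine ⟨h1, ?_⟩
  change O.sec h (O.gr.src g) ∈ (O.tgtChart h).source
  rw [sec_src hg]
  exact hg.2

theorem transport_src {h g : O.Mor} (hg : g ∈ O.biNhd h) :
    O.transport h (O.gr.src g) = O.gr.tgt g := by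
  change O.tgtChart h (O.sec h (O.gr.src g)) = _
  rw [sec_src hg, O.tgtChart_apply h hg.2]

theorem src_mem_transport_self (h : O.Mor) : O.gr.src h ∈ (O.transport h).source :=
  src_mem_transport (O.mem_biNhd h)

theorem transport_src_self (h : O.Mor) : O.transport h (O.gr.src h) = O.gr.tgt h :=
  transport_src (O.mem_biNhd h)

theorem sec_src_self (h : O.Mor) : O.sec h (O.gr.src h) = h := sec_src (O.mem_biNhd h)

theorem src_sec {h : O.Mor} {z : O.Obj} (hz : z ∈ (O.transport h).source) :
    O.gr.src (O.sec h z) = z := by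
  have h1 : O.sec h z ∈ (O.srcChart h).source := (O.srcChart h).map_target hz.1
  rw [← O.srcChart_apply h h1]
  exact (O.srcChart h).right_inv hz.1

theorem tgt_sec {h : O.Mor} {z : O.Obj} (hz : z ∈ (O.transport h).source) :
    O.gr.tgt (O.sec h z) = O.transport h z :=
  (O.tgtChart_apply h hz.2).symm

theorem continuousOn_sec (h : O.Mor) : ContinuousOn (O.sec h) (O.transport h).source :=
  (O.srcChart h).continuousOn_symm.mono fun _ hz => hz.1

theorem continuousAt_sec {h : O.Mor} {z : O.Obj} (hz : z ∈ (O.transport h).source) :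
    ContinuousAt (O.sec h) z :=
  (continuousOn_sec h).continuousAt ((O.transport h).open_source.mem_nhds hz)

theorem dSrc_eq (h : O.Mor) : dSrc O h = tderiv _ _ O.gr.src h := rfl

theorem dTgt_eq (h : O.Mor) : dTgt O h = tderiv _ _ O.gr.tgt h := rfl

theorem tderiv_transport_comp_dSrc (h : O.Mor) :
    (tderiv _ _ (O.transport h) (O.gr.src h)).comp (dSrc O h) = dTgt O h := by
  rw [dSrc_eq, dTgt_eq, ← tderiv_comp ((O.isPartialDiffeo_transport h).mdifferentiableAt
    (src_mem_transport_self h)) (O.mdifferentiableAt_src h)]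
  refine tderiv_congr ?_
  filter_upwards [O.biNhd_mem_nhds h] with g hg
  exact transport_src hg

theorem dSrc_surjective (h : O.Mor) : Function.Surjective (dSrc O h) := by
  have h1 := (O.isPartialDiffeo_srcChart h).tderiv_surjective (O.mem_srcChart h)
  rwa [tderiv_congr (g := O.gr.src)] at h1
  filter_upwards [(O.srcChart h).open_source.mem_nhds (O.mem_srcChart h)] with g hg
  exact O.srcChart_apply h hg

/-- The space of morphisms between two compact sets of objects is compact. -/
theorem isCompact_arrows {K K' : Set O.Obj} (hK : IsCompact K) (hK' : IsCompact K') :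
    IsCompact {h : O.Mor | O.gr.src h ∈ K ∧ O.gr.tgt h ∈ K'} := by
  choose V hV hxV hVp using O.proper
  obtain ⟨t, -, htK⟩ := hK.elim_nhds_subcover V fun x _ => (hV x).mem_nhds (hxV x)
  have h1 : ∀ x, IsCompact {h : O.Mor | O.gr.src h ∈ closure (V x) ∧ O.gr.tgt h ∈ K'} := by
    intro x
    have := ((hVp x).isCompact_preimage hK').image continuous_subtype_val
    convert this using 1
    ext h
    constructor
    · exact fun hh => ⟨⟨h, hh.1⟩, hh.2, rfl⟩
    · rintro ⟨⟨g, hg⟩, hg', rfl⟩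
      exact ⟨hg, hg'⟩
  refine (t.isCompact_biUnion fun x _ => h1 x).of_isClosed_subset ?_ ?_
  · exact (hK.isClosed.preimage O.continuous_src).inter (hK'.isClosed.preimage O.continuous_tgt)
  · intro h hh
    obtain ⟨x, hx, hhx⟩ := mem_iUnion₂.mp (htK hh.1)
    exact mem_iUnion₂.mpr ⟨x, hx, subset_closure hhx, hh.2⟩

theorem isSigmaCompact_arrows {K K' : Set O.Obj} (hK : IsSigmaCompact K) (hK' : IsSigmaCompact K') :
    IsSigmaCompact {h : O.Mor | O.gr.src h ∈ K ∧ O.gr.tgt h ∈ K'} := by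
  obtain ⟨L, hL, rfl⟩ := hK
  obtain ⟨L', hL', rfl⟩ := hK'
  have : {h : O.Mor | O.gr.src h ∈ ⋃ i, L i ∧ O.gr.tgt h ∈ ⋃ i, L' i} =
      ⋃ i : ℕ, ⋃ j : ℕ, {h : O.Mor | O.gr.src h ∈ L i ∧ O.gr.tgt h ∈ L' j} := by
    ext h
    simp only [mem_ofPred_eq, mem_iUnion]
    tauto
  rw [this]
  exact isSigmaCompact_iUnion _ fun i => isSigmaCompact_iUnion _ fun j =>
    (isCompact_arrows (hL i) (hL' j)).isSigmaCompact

end EpGroupoid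

end Groupoids

/-! ### Slice charts and tangent spaces of suborbifolds -/

section SliceCharts

variable {n : ℕ} {O : EpGroupoid.{a, b} n}

/-- `φ` is a chart of the object manifold which maps `X` to the `k`-dimensional plane `L`. -/
structure IsSliceChart (k : ℕ) (X : Set O.Obj)
    (φ : OpenPartialHomeomorph O.Obj (EuclideanSpace ℝ (Fin n)))
    (L : AffineSubspace ℝ (EuclideanSpace ℝ (Fin n))) : Prop where
  diffeo : IsPartialDiffeo (E := EuclideanSpace ℝ (Fin n)) φ
  finrank : Module.finrank ℝ L.direction = k
  image : φ '' (X ∩ φ.source) = (L : Set (EuclideanSpace ℝ (Fin n))) ∩ φ.target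

theorem IsEmbeddedFullSuborbifold.exists_sliceChart {k : ℕ} {X : Set O.Obj}
    (hX : IsEmbeddedFullSuborbifold O k X) {x : O.Obj} (hx : x ∈ X) :
    ∃ φ L, x ∈ φ.source ∧ IsSliceChart k X φ L := by
  obtain ⟨φ, hφ, hxφ, L, hL, himg⟩ := hX.slice x hx
  exact ⟨φ, L, hxφ, IsPartialDiffeo.of_mem_maximalAtlas hφ, hL, himg⟩

theorem IsSliceChart.mem_iff {k : ℕ} {X : Set O.Obj}
    {φ : OpenPartialHomeomorph O.Obj (EuclideanSpace ℝ (Fin n))}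
    {L : AffineSubspace ℝ (EuclideanSpace ℝ (Fin n))} (h : IsSliceChart k X φ L) {z : O.Obj}
    (hz : z ∈ φ.source) : z ∈ X ↔ φ z ∈ L := by
  constructor
  · intro hzX
    exact (h.image.subset ⟨z, ⟨hzX, hz⟩, rfl⟩).1
  · intro hzL
    obtain ⟨y, ⟨hyX, hy⟩, hyz⟩ := h.image.symm.subset ⟨hzL, φ.map_source hz⟩
    rwa [← φ.injOn hy hz hyz]

theorem IsSliceChart.restrOpen {k : ℕ} {X : Set O.Obj}
    {φ : OpenPartialHomeomorph O.Obj (EuclideanSpace ℝ (Fin n))}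
    {L : AffineSubspace ℝ (EuclideanSpace ℝ (Fin n))} (h : IsSliceChart k X φ L) (U : Set O.Obj)
    (hU : IsOpen U) : IsSliceChart k X (φ.restrOpen U hU) L := by
  refine ⟨h.diffeo.restrOpen U hU, h.finrank, ?_⟩
  ext e
  constructor
  · rintro ⟨z, ⟨hzX, hz⟩, rfl⟩
    refine ⟨(h.mem_iff ?_).mp hzX, (φ.restrOpen U hU).map_source hz⟩
    rw [φ.restrOpen_source] at hz
    exact hz.1
  · rintro ⟨heL, he⟩
    have hs := (φ.restrOpen U hU).map_target he
    have hs' := hs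
    rw [φ.restrOpen_source] at hs'
    refine ⟨(φ.restrOpen U hU).symm e, ⟨(h.mem_iff hs'.1).mpr ?_, hs⟩,
      (φ.restrOpen U hU).right_inv he⟩
    have := (φ.restrOpen U hU).right_inv he
    change φ _ = e at this
    rwa [this]

/-- The tangent space of `X` is the direction of the plane in a slice chart: velocities of curves
in the plane are parallel to it, and conversely a vector parallel to the plane is, up to scaling,
the velocity of a curve `τ ↦ φ⁻¹(φ z + ε sin τ • w)`, which is defined for all times. -/
theorem IsSliceChart.tangentAlong_eq {k : ℕ} {X : Set O.Obj}
    {φ : OpenPartialHomeomorph O.Obj (EuclideanSpace ℝ (Fin n))}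
    {L : AffineSubspace ℝ (EuclideanSpace ℝ (Fin n))} (h : IsSliceChart k X φ L) {z : O.Obj}
    (hz : z ∈ φ.source) (hzX : z ∈ X) :
    tangentAlong O X z = L.direction.comap (tderiv (EuclideanSpace ℝ (Fin n))
      (EuclideanSpace ℝ (Fin n)) φ z).toLinearMap := by
  apply le_antisymm
  · refine Submodule.span_le.mpr ?_
    rintro v ⟨γ, hγ, hγX, rfl, rfl⟩
    change tderiv (EuclideanSpace ℝ (Fin n)) (EuclideanSpace ℝ (Fin n)) φ (γ 0)
      (tderiv ℝ (EuclideanSpace ℝ (Fin n)) γ 0 1) ∈ L.direction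
    have hγd : MDifferentiableAt 𝓘(ℝ, ℝ) (𝓡 n) γ 0 := (hγ 0).mdifferentiableAt (by simp)
    have hcomp := tderiv_comp (h.diffeo.mdifferentiableAt hz) hγd
    have h1 : tderiv (EuclideanSpace ℝ (Fin n)) (EuclideanSpace ℝ (Fin n)) φ (γ 0)
        (tderiv ℝ (EuclideanSpace ℝ (Fin n)) γ 0 1) =
        tderiv ℝ (EuclideanSpace ℝ (Fin n)) (φ ∘ γ) 0 1 := by rw [hcomp]; rfl
    rw [h1, tderiv_eq_fderiv]
    have hd : DifferentiableAt ℝ (φ ∘ γ) 0 :=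
      mdifferentiableAt_iff_differentiableAt.mp ((h.diffeo.mdifferentiableAt hz).comp 0 hγd)
    have hd' : HasDerivAt (φ ∘ γ) (fderiv ℝ (φ ∘ γ) 0 1) 0 := hd.hasFDerivAt.hasDerivAt
    have hcl : IsClosed (L.direction : Set (EuclideanSpace ℝ (Fin n))) :=
      L.direction.closed_of_finiteDimensional
    refine hcl.mem_of_tendsto (hasDerivAt_iff_tendsto_slope.mp hd') ?_
    have hev : ∀ᶠ τ in 𝓝 (0 : ℝ), γ τ ∈ φ.source :=
      hγd.continuousAt.eventually (φ.open_source.mem_nhds hz)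
    filter_upwards [hev.filter_mono nhdsWithin_le_nhds] with τ hτ
    refine L.direction.smul_mem _ ?_
    exact L.vsub_mem_direction ((h.mem_iff hτ).mp (hγX τ)) ((h.mem_iff hz).mp (hγX 0))
  · intro (v : EuclideanSpace ℝ (Fin n)) hv
    have hv : tderiv (EuclideanSpace ℝ (Fin n)) (EuclideanSpace ℝ (Fin n)) φ z v ∈ L.direction :=
      hv
    set w := tderiv (EuclideanSpace ℝ (Fin n)) (EuclideanSpace ℝ (Fin n)) φ z v with hw
    obtain ⟨ε, hε, hball⟩ : ∃ ε : ℝ, 0 < ε ∧ ∀ τ : ℝ, φ z + (ε * Real.sin τ) • w ∈ φ.target := by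
      obtain ⟨δ, hδ, hb⟩ := Metric.isOpen_iff.mp φ.open_target _ (φ.map_source hz)
      refine ⟨δ / (2 * (‖w‖ + 1)), by positivity, fun τ => hb ?_⟩
      rw [mem_ball_iff_norm, add_sub_cancel_left, norm_smul, norm_mul, Real.norm_of_nonneg
        (show 0 ≤ δ / (2 * (‖w‖ + 1)) by positivity)]
      have h1 : ‖Real.sin τ‖ ≤ 1 := Real.abs_sin_le_one τ
      have h2 : δ / (2 * (‖w‖ + 1)) * ‖Real.sin τ‖ * ‖w‖ ≤ δ / (2 * (‖w‖ + 1)) * 1 * ‖w‖ := by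
        gcongr
      refine h2.trans_lt ?_
      rw [mul_one, div_mul_eq_mul_div, div_lt_iff₀ (by positivity)]
      nlinarith [norm_nonneg w]
    let c : ℝ → EuclideanSpace ℝ (Fin n) := fun τ => φ z + (ε * Real.sin τ) • w
    have hc : ContDiff ℝ ∞ c :=
      contDiff_const.add ((contDiff_const.mul Real.contDiff_sin).smul contDiff_const)
    have hc0 : c 0 = φ z := by simp [c]
    have hγ : ContMDiff 𝓘(ℝ, ℝ) (𝓡 n) ∞ (φ.symm ∘ c) :=
      h.diffeo.smooth_symm.comp_contMDiff hc.contMDiff hball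
    have hmem : (ε • v : EuclideanSpace ℝ (Fin n)) ∈ tangentAlong O X z := by
      refine Submodule.subset_span ⟨φ.symm ∘ c, hγ, ?_, ?_, ?_⟩
      · intro τ
        have hs := φ.map_target (hball τ)
        refine (h.mem_iff hs).mpr ?_
        rw [φ.right_inv (hball τ)]
        have := AffineSubspace.vadd_mem_of_mem_direction
          (L.direction.smul_mem (ε * Real.sin τ) hv) ((h.mem_iff hz).mp hzX)
        rwa [vadd_eq_add, add_comm] at this
      · rw [Function.comp_apply, hc0, φ.left_inv hz]
      · change ε • v = tderiv ℝ (EuclideanSpace ℝ (Fin n)) (φ.symm ∘ c) 0 1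
        have hcd : HasDerivAt c (ε • w) 0 := by
          have h1 := (((Real.hasDerivAt_sin 0).const_mul ε).smul_const w).const_add (φ z)
          rwa [Real.cos_zero, mul_one] at h1
        have hcd' : tderiv ℝ (EuclideanSpace ℝ (Fin n)) c 0 1 = ε • w := by
          rw [tderiv_eq_fderiv]
          exact hcd.deriv
        have hcmd : MDifferentiableAt 𝓘(ℝ, ℝ) (𝓡 n) c 0 :=
          (hc.contMDiff 0).mdifferentiableAt (by simp)
        rw [tderiv_comp (E' := EuclideanSpace ℝ (Fin n)) (h.diffeo.symm.mdifferentiableAt (by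
          rw [hc0]
          exact φ.map_source hz)) hcmd, ContinuousLinearMap.comp_apply, hcd', hc0, map_smul, hw,
          h.diffeo.tderiv_symm_apply hz]
    have h2 : ε⁻¹ • ε • v = v := inv_smul_smul₀ hε.ne' v
    rw [← h2]
    exact (tangentAlong O X z).smul_mem ε⁻¹ hmem

/-- A partial diffeomorphism which takes `X` to `Y` takes slice charts of `X` to slice charts
of `Y`. -/
theorem IsSliceChart.map {k : ℕ} {X Y : Set O.Obj}
    {φ : OpenPartialHomeomorph O.Obj (EuclideanSpace ℝ (Fin n))}
    {L : AffineSubspace ℝ (EuclideanSpace ℝ (Fin n))} (h : IsSliceChart k X φ L)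
    {Λ : OpenPartialHomeomorph O.Obj O.Obj}
    (hΛ : IsPartialDiffeo (E := EuclideanSpace ℝ (Fin n)) Λ)
    (hXY : ∀ z ∈ Λ.source, z ∈ X ↔ Λ z ∈ Y) : IsSliceChart k Y (Λ.symm.trans φ) L := by
  refine ⟨hΛ.symm.trans h.diffeo, h.finrank, ?_⟩
  ext e
  constructor
  · rintro ⟨y, ⟨hyY, hy⟩, rfl⟩
    refine ⟨?_, (Λ.symm.trans φ).map_source hy⟩
    refine (h.mem_iff hy.2).mp ((hXY _ (Λ.map_target hy.1)).mpr ?_)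
    rwa [Λ.right_inv hy.1]
  · rintro ⟨heL, he⟩
    have hs := (Λ.symm.trans φ).map_target he
    refine ⟨(Λ.symm.trans φ).symm e, ⟨?_, hs⟩, (Λ.symm.trans φ).right_inv he⟩
    change Λ (φ.symm e) ∈ Y
    refine (hXY _ he.2).mp ((h.mem_iff (φ.map_target he.1)).mpr ?_)
    rwa [φ.right_inv he.1]

theorem tangentAlong_map {k : ℕ} {X Y : Set O.Obj} (hX : IsEmbeddedFullSuborbifold O k X)
    {Λ : OpenPartialHomeomorph O.Obj O.Obj}
    (hΛ : IsPartialDiffeo (E := EuclideanSpace ℝ (Fin n)) Λ)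
    (hXY : ∀ z ∈ Λ.source, z ∈ X ↔ Λ z ∈ Y) {z : O.Obj} (hz : z ∈ Λ.source) (hzX : z ∈ X) :
    (tangentAlong O Y (Λ z) : Submodule ℝ (EuclideanSpace ℝ (Fin n))) =
      Submodule.map (tderiv (EuclideanSpace ℝ (Fin n))
        (EuclideanSpace ℝ (Fin n)) Λ z).toLinearMap (tangentAlong O X z) := by
  obtain ⟨φ, L, hzφ, h⟩ := hX.exists_sliceChart hzX
  have hz' : Λ z ∈ (Λ.symm.trans φ).source := by
    refine ⟨Λ.map_source hz, ?_⟩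
    change Λ.symm (Λ z) ∈ φ.source
    rwa [Λ.left_inv hz]
  rw [h.tangentAlong_eq hzφ hzX, (h.map hΛ hXY).tangentAlong_eq hz' ((hXY z hz).mp hzX)]
  have hD : tderiv (EuclideanSpace ℝ (Fin n)) (EuclideanSpace ℝ (Fin n)) (Λ.symm.trans φ) (Λ z) =
      (tderiv (EuclideanSpace ℝ (Fin n)) (EuclideanSpace ℝ (Fin n)) φ z).comp
        (tderiv (EuclideanSpace ℝ (Fin n)) (EuclideanSpace ℝ (Fin n)) Λ.symm (Λ z)) := by
    have h1 := tderiv_comp (x := Λ z) (f := Λ.symm) (g := φ) (E' := EuclideanSpace ℝ (Fin n))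
      (h.diffeo.mdifferentiableAt (by rwa [Λ.left_inv hz]))
      (hΛ.symm.mdifferentiableAt (Λ.map_source hz))
    rwa [Λ.left_inv hz] at h1
  ext v
  constructor
  · intro hv
    refine ⟨tderiv _ _ Λ.symm (Λ z) v, ?_, hΛ.tderiv_apply_symm hz v⟩
    have hv : tderiv (EuclideanSpace ℝ (Fin n)) _ (Λ.symm.trans φ) (Λ z) v ∈ L.direction := hv
    rwa [hD] at hv
  · rintro ⟨u, hu, rfl⟩
    change tderiv (EuclideanSpace ℝ (Fin n)) _ (Λ.symm.trans φ) (Λ z) (tderiv _ _ Λ z u)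
      ∈ L.direction
    rw [hD, ContinuousLinearMap.comp_apply, hΛ.tderiv_symm_apply hz]
    exact hu

theorem IsEmbeddedFullSuborbifold.mem_iff_of_proj_eq {k : ℕ} {X : Set O.Obj}
    (hX : IsEmbeddedFullSuborbifold O k X) {x y : O.Obj} (h : O.gr.proj x = O.gr.proj y) :
    x ∈ X ↔ y ∈ X := by
  rw [hX.saturated, mem_preimage, mem_preimage, h]

theorem IsEmbeddedFullSuborbifold.src_mem_iff {k : ℕ} {X : Set O.Obj}
    (hX : IsEmbeddedFullSuborbifold O k X) (h : O.Mor) : O.gr.src h ∈ X ↔ O.gr.tgt h ∈ X :=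
  hX.mem_iff_of_proj_eq (O.gr.proj_src_eq_proj_tgt h)

theorem EpGroupoid.proj_transport {h : O.Mor} {z : O.Obj} (hz : z ∈ (O.transport h).source) :
    O.gr.proj (O.transport h z) = O.gr.proj z := by
  rw [← EpGroupoid.tgt_sec hz, ← O.gr.proj_src_eq_proj_tgt, EpGroupoid.src_sec hz]

/-- The isotropy action on the normal spaces, in terms of transport. -/
theorem hasTrivialNormalIsotropy_iff {X : Set O.Obj} : HasTrivialNormalIsotropy O X ↔
    ∀ x ∈ X, ∀ g : O.Mor, O.gr.src g = x → O.gr.tgt g = x → ∀ v : EuclideanSpace ℝ (Fin n),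
      tderiv (EuclideanSpace ℝ (Fin n)) (EuclideanSpace ℝ (Fin n)) (O.transport g) x v - v ∈
        (tangentAlong O X x : Submodule ℝ (EuclideanSpace ℝ (Fin n))) := by
  refine forall_congr' fun x => forall_congr' fun hx => forall_congr' fun g =>
    forall_congr' fun hs => forall_congr' fun _ => ?_
  subst hs
  have h1 : ∀ w, dTgt O g w = tderiv (EuclideanSpace ℝ (Fin n)) (EuclideanSpace ℝ (Fin n))
      (O.transport g) (O.gr.src g) (dSrc O g w) := fun w => by
    rw [← EpGroupoid.tderiv_transport_comp_dSrc]
    rfl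
  constructor
  · intro h v
    obtain ⟨w, rfl⟩ := EpGroupoid.dSrc_surjective g v
    rw [← h1]
    exact h w
  · intro h w
    rw [h1]
    exact h _

end SliceCharts

/-! ### Linearisation of finite group germs -/

section Linearization

variable {E : Type*} [NormedAddCommGroup E] [NormedSpace ℝ E] [FiniteDimensional ℝ E]

/-- A local diffeomorphism with derivative the identity which maps a linear subspace `L` to itself
near `0` also maps the complement of `L` to itself: it coincides on `L` with the local
diffeomorphism `e ↦ F (p e) + (e - p e)`, `p` a projection to `L`, which has this property. -/
theorem eventually_mem_of_map_mem {U : Set E} (hU : IsOpen U) (h0 : (0 : E) ∈ U) {F : E → E}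
    (hF : ContDiffOn ℝ ∞ F U) (hF0 : F 0 = 0)
    (hF' : HasFDerivAt F (ContinuousLinearMap.id ℝ E) 0) (hinj : InjOn F U) (L : Submodule ℝ E)
    (hL : ∀ᶠ e in 𝓝 (0 : E), e ∈ L → F e ∈ L) : ∀ᶠ e in 𝓝 (0 : E), F e ∈ L → e ∈ L := by
  obtain ⟨p₁, hp₁⟩ := Submodule.ClosedComplemented.of_finiteDimensional_quotient (p := L)
    L.closed_of_finiteDimensional
  let p : E →L[ℝ] E := L.subtypeL.comp p₁
  have hpL : ∀ e, p e ∈ L := fun e => (p₁ e).2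
  have hp : ∀ e ∈ L, p e = e := fun e he => congrArg Subtype.val (hp₁ ⟨e, he⟩)
  let F' : E → E := fun e => F (p e) + (e - p e)
  have hU' : IsOpen (p ⁻¹' U) := hU.preimage p.continuous
  have h0' : (0 : E) ∈ p ⁻¹' U := by rwa [mem_preimage, map_zero]
  have hF's : ContDiffOn ℝ ∞ F' (p ⁻¹' U) :=
    (hF.comp p.contDiff.contDiffOn fun _ h => h).add
      (contDiff_id.sub p.contDiff).contDiffOn
  have hF'd : HasFDerivAt F' ((ContinuousLinearEquiv.refl ℝ E : E ≃L[ℝ] E) : E →L[ℝ] E) 0 := by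
    have h1 : HasFDerivAt (fun e => F (p e)) ((ContinuousLinearMap.id ℝ E).comp p) 0 :=
      HasFDerivAt.comp (0 : E) (by rwa [map_zero]) p.hasFDerivAt
    have h2 := h1.add ((hasFDerivAt_id (0 : E)).sub p.hasFDerivAt)
    refine h2.congr_fderiv ?_
    ext v
    simp
  obtain ⟨Ψ, h0Ψ, -, hΨ, -, -⟩ := exists_smooth_openPartialHomeomorph hU' hF's h0' _ hF'd
  have hΨ0 : Ψ 0 = 0 := by rw [hΨ]; simp [F', hF0]
  have hΨs0 : Ψ.symm 0 = 0 := by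
    have := Ψ.left_inv h0Ψ
    rwa [hΨ0] at this
  have h0t : (0 : E) ∈ Ψ.target := by
    have := Ψ.map_source h0Ψ
    rwa [hΨ0] at this
  have hFc : Tendsto F (𝓝 0) (𝓝 0) := by
    have := hF'.continuousAt.tendsto
    rwa [hF0] at this
  have hΨc : Tendsto (fun e => Ψ.symm (F e)) (𝓝 0) (𝓝 0) := by
    have h1 : Tendsto Ψ.symm (𝓝 0) (𝓝 0) := by
      have := (Ψ.symm.continuousAt h0t).tendsto
      rwa [hΨs0] at this
    exact h1.comp hFc
  have hpc : Tendsto p (𝓝 0) (𝓝 0) := by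
    have := p.continuous.tendsto 0
    rwa [map_zero] at this
  filter_upwards [hFc (Ψ.open_target.mem_nhds h0t), hΨc (hpc hL), hU.mem_nhds h0,
    hΨc (hU.mem_nhds h0)] with e heT heL heU heU' hFe
  simp only [mem_preimage] at heT heL heU'
  set e' := Ψ.symm (F e) with he'
  have h1 : F (p e') + (e' - p e') = F e := by
    have := Ψ.right_inv heT
    rwa [← he', hΨ] at this
  have h2 : F (p e') ∈ L := heL (hpL _)
  have h3 : e' - p e' ∈ L := by
    rw [← h1] at hFe
    exact (L.add_mem_iff_right h2).mp hFe
  have h4 : e' ∈ L := by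
    have := L.add_mem h3 (hpL e')
    rwa [sub_add_cancel] at this
  rw [hp _ h4, sub_self, add_zero] at h1
  exact hinj heU' heU h1 ▸ h4

/-- Bochner's linearisation: a finite group of germs of diffeomorphisms at a fixed point is
conjugate to its linear part by the average of the maps `A γ⁻¹ ∘ Θ γ`.  If the germs preserve a
linear subspace `L` then so does the conjugating diffeomorphism. -/
theorem exists_linearization {Γ : Type*} [Group Γ] [Fintype Γ] {U : Set E} (hU : IsOpen U)
    (h0 : (0 : E) ∈ U) {Θ : Γ → E → E} (hΘ : ∀ γ, ContDiffOn ℝ ∞ (Θ γ) U) (hΘ0 : ∀ γ, Θ γ 0 = 0)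
    (A : Γ → E →L[ℝ] E) (hA : ∀ γ δ, A (γ * δ) = (A γ).comp (A δ))
    (hA1 : A 1 = ContinuousLinearMap.id ℝ E)
    (hΘ' : ∀ γ, HasFDerivAt (Θ γ) (A γ) 0)
    (hmul : ∀ γ δ, ∀ᶠ e in 𝓝 (0 : E), Θ γ (Θ δ e) = Θ (γ * δ) e) (L : Submodule ℝ E)
    (hAL : ∀ γ, ∀ v ∈ L, A γ v ∈ L) (hΘL : ∀ γ, ∀ᶠ e in 𝓝 (0 : E), e ∈ L → Θ γ e ∈ L) :
    ∃ Φ : OpenPartialHomeomorph E E, (0 : E) ∈ Φ.source ∧ Φ 0 = 0 ∧ IsPartialDiffeo (E := E) Φ ∧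
      (∀ γ, ∀ᶠ e in 𝓝 (0 : E), Φ (Θ γ e) = A γ (Φ e)) ∧
      ∀ᶠ e in 𝓝 (0 : E), Φ e ∈ L ↔ e ∈ L := by
  -- the average, which has derivative the identity at `0`
  let F : E → E := fun e => (Fintype.card Γ : ℝ)⁻¹ • ∑ γ, A γ⁻¹ (Θ γ e)
  have hF : ContDiffOn ℝ ∞ F U := by
    refine contDiffOn_const.smul (ContDiffOn.sum fun γ _ => ?_)
    exact (A γ⁻¹).contDiff.comp_contDiffOn (hΘ γ)
  have hF0 : F 0 = 0 := by simp [F, hΘ0]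
  have hF' : HasFDerivAt F ((ContinuousLinearEquiv.refl ℝ E : E ≃L[ℝ] E) : E →L[ℝ] E) 0 := by
    have h1 : HasFDerivAt F ((Fintype.card Γ : ℝ)⁻¹ • ∑ γ, (A γ⁻¹).comp (A γ)) 0 :=
      (HasFDerivAt.fun_sum fun γ _ => (A γ⁻¹).hasFDerivAt.comp (0 : E) (hΘ' γ)).const_smul _
    refine h1.congr_fderiv ?_
    have h2 : ∀ γ, (A γ⁻¹).comp (A γ) = ContinuousLinearMap.id ℝ E := fun γ => by
      rw [← hA, inv_mul_cancel, hA1]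
    ext v
    simp [h2, ← Nat.cast_smul_eq_nsmul ℝ, smul_smul]
  obtain ⟨Φ, h0Φ, hΦU, hΦ, hΦs, hΦs'⟩ := exists_smooth_openPartialHomeomorph hU hF h0 _ hF'
  have hFL : ∀ᶠ e in 𝓝 (0 : E), e ∈ L → F e ∈ L := by
    filter_upwards [eventually_all.mpr hΘL] with e he heL
    exact L.smul_mem _ (L.sum_mem fun γ _ => hAL _ _ (he γ heL))
  refine ⟨Φ, h0Φ, by rw [hΦ, hF0], ⟨?_, hΦs'.contMDiffOn⟩, fun δ => ?_, ?_⟩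
  · rw [hΦ]
    exact hΦs.contMDiffOn
  · filter_upwards [eventually_all.mpr fun γ => hmul γ δ] with e he
    simp only [hΦ, F, map_smul, map_sum, he]
    congr 1
    refine Fintype.sum_equiv (Equiv.mulRight δ) _ _ fun γ => ?_
    simp only [Equiv.coe_mulRight, mul_inv_rev]
    rw [← ContinuousLinearMap.comp_apply, ← hA, mul_inv_cancel_left]
  · rw [hΦ]
    have hinj : InjOn F Φ.source := by
      have := Φ.injOn
      rwa [hΦ] at this
    filter_upwards [hFL, eventually_mem_of_map_mem Φ.open_source h0Φ hΦs hF0 hF' hinj L hFL]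
      with e h1 h2
    exact ⟨h2, h1⟩

end Linearization

/-! ### Isotropy groups -/

section Isotropy

variable {n : ℕ} (O : EpGroupoid.{a, b} n)

namespace EpGroupoid

variable {O}

/-- Local sections of the source map are determined by one value. -/
theorem eventually_eq_sec {σ : O.Obj → O.Mor} {x : O.Obj} (hσ : ContinuousAt σ x)
    (hs : ∀ᶠ u in 𝓝 x, O.gr.src (σ u) = u) : ∀ᶠ u in 𝓝 x, σ u = O.sec (σ x) u := by
  filter_upwards [hs, hσ (O.biNhd_mem_nhds (σ x))] with u hu hb
  have := sec_src hb
  rw [hu] at this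
  exact this.symm

theorem eventually_transport_mem {h : O.Mor} {z : O.Obj} (hz : O.gr.src h = z) :
    ∀ᶠ u in 𝓝 z, u ∈ (O.transport h).source :=
  (O.transport h).open_source.mem_nhds (hz ▸ src_mem_transport_self h)

theorem eventually_sec_comp {g f : O.Mor} (hgf : O.gr.src g = O.gr.tgt f) :
    ∀ᶠ u in 𝓝 (O.gr.src f),
      O.gr.comp (O.sec g (O.transport f u)) (O.sec f u) = O.sec (O.gr.comp g f) u := by
  have hf := src_mem_transport_self f
  have h1 : ContinuousAt (O.transport f) (O.gr.src f) := (O.transport f).continuousAt hf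
  have hm : ∀ᶠ u in 𝓝 (O.gr.src f), u ∈ (O.transport f).source ∧
      O.transport f u ∈ (O.transport g).source := by
    refine (eventually_transport_mem rfl).and (h1 ((O.transport g).open_source.mem_nhds ?_))
    rw [transport_src_self, ← hgf]
    exact src_mem_transport_self g
  have key := eventually_eq_sec (O := O) (x := O.gr.src f)
    (σ := fun u => O.gr.comp (O.sec g (O.transport f u)) (O.sec f u)) ?_ ?_
  · convert key using 4
    rw [transport_src_self, ← hgf, sec_src_self, sec_src_self]
  · have h2 : ContinuousAt (fun u => (O.sec g (O.transport f u), O.sec f u)) (O.gr.src f) := by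
      refine ContinuousAt.prodMk (ContinuousAt.comp (f := O.transport f)
        (continuousAt_sec ?_) h1) (continuousAt_sec hf)
      exact hm.self_of_nhds.2
    have h3 := (O.continuousOn_comp _ (show (O.sec g (O.transport f (O.gr.src f)),
      O.sec f (O.gr.src f)) ∈ {p : O.Mor × O.Mor | O.gr.src p.1 = O.gr.tgt p.2} from by
        rw [mem_ofPred_eq, src_sec hm.self_of_nhds.2, tgt_sec hf])).tendsto
    refine h3.comp (tendsto_nhdsWithin_iff.mpr ⟨h2, ?_⟩)
    filter_upwards [hm] with u hu
    rw [src_sec hu.2, tgt_sec hu.1]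
  · filter_upwards [hm] with u hu
    rw [O.gr.src_comp _ _ (by rw [src_sec hu.2, tgt_sec hu.1]), src_sec hu.1]

theorem eventually_transport_comp {g f : O.Mor} (hgf : O.gr.src g = O.gr.tgt f) :
    ∀ᶠ u in 𝓝 (O.gr.src f),
      O.transport g (O.transport f u) = O.transport (O.gr.comp g f) u := by
  have h1 : ContinuousAt (O.transport f) (O.gr.src f) :=
    (O.transport f).continuousAt (src_mem_transport_self f)
  filter_upwards [eventually_sec_comp hgf, eventually_transport_mem rfl,
    h1 ((O.transport g).open_source.mem_nhds (by
      rw [transport_src_self, ← hgf]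
      exact src_mem_transport_self g)),
    eventually_transport_mem (O.gr.src_comp g f hgf)] with u h2 h3 h4 h5
  rw [← tgt_sec h5, ← h2, O.gr.tgt_comp _ _ (by rw [src_sec h4, tgt_sec h3]), tgt_sec h4]

theorem eventually_sec_unit (x : O.Obj) : ∀ᶠ u in 𝓝 x, O.sec (O.gr.unit x) u = O.gr.unit u := by
  filter_upwards [eventually_eq_sec (O := O) (σ := O.gr.unit) (x := x)
    O.continuous_unit.continuousAt (Eventually.of_forall O.gr.src_unit)] with u hu
  exact hu.symm

theorem eventually_transport_unit (x : O.Obj) : ∀ᶠ u in 𝓝 x, O.transport (O.gr.unit x) u = u := by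
  filter_upwards [eventually_sec_unit x, eventually_transport_mem (O.gr.src_unit x)] with u h1 h2
  rw [← tgt_sec h2, h1, O.gr.tgt_unit]

theorem tderiv_transport_comp {g f : O.Mor} (hgf : O.gr.src g = O.gr.tgt f) :
    tderiv (EuclideanSpace ℝ (Fin n)) (EuclideanSpace ℝ (Fin n)) (O.transport (O.gr.comp g f))
      (O.gr.src f) = (tderiv (EuclideanSpace ℝ (Fin n)) (EuclideanSpace ℝ (Fin n)) (O.transport g)
        (O.gr.src g)).comp (tderiv _ _ (O.transport f) (O.gr.src f)) := by
  have h1 := tderiv_comp (E' := EuclideanSpace ℝ (Fin n)) (x := O.gr.src f)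
    ((O.isPartialDiffeo_transport g).mdifferentiableAt (x := O.transport f (O.gr.src f)) (by
      rw [transport_src_self, ← hgf]
      exact src_mem_transport_self g))
    ((O.isPartialDiffeo_transport f).mdifferentiableAt (src_mem_transport_self f))
  rw [transport_src_self, ← hgf] at h1
  rw [← h1]
  refine tderiv_congr ?_
  filter_upwards [eventually_transport_comp hgf] with u hu
  exact hu.symm

end EpGroupoid

/-- The isotropy group of an object. -/
def Isotropy (x : O.Obj) : Type b := {g : O.Mor // O.gr.src g = x ∧ O.gr.tgt g = x}

variable {O}

instance (x : O.Obj) : Group (Isotropy O x) where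
  mul g f := ⟨O.gr.comp g.1 f.1, by
    have h : O.gr.src g.1 = O.gr.tgt f.1 := g.2.1.trans f.2.2.symm
    exact ⟨(O.gr.src_comp _ _ h).trans f.2.1, (O.gr.tgt_comp _ _ h).trans g.2.2⟩⟩
  one := ⟨O.gr.unit x, O.gr.src_unit x, O.gr.tgt_unit x⟩
  inv g := ⟨O.gr.inv g.1, (O.gr.src_inv _).trans g.2.2, (O.gr.tgt_inv _).trans g.2.1⟩
  mul_assoc h g f := Subtype.ext
    (O.gr.comp_assoc _ _ _ (h.2.1.trans g.2.2.symm) (g.2.1.trans f.2.2.symm))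
  one_mul f := Subtype.ext (by
    have := O.gr.unit_comp f.1
    rwa [f.2.2] at this)
  mul_one f := Subtype.ext (by
    have := O.gr.comp_unit f.1
    rwa [f.2.1] at this)
  inv_mul_cancel f := Subtype.ext (by
    have := O.gr.inv_comp f.1
    rwa [f.2.1] at this)

theorem Isotropy.val_mul {x : O.Obj} (g f : Isotropy O x) : (g * f).1 = O.gr.comp g.1 f.1 := rfl

theorem Isotropy.val_one {x : O.Obj} : (1 : Isotropy O x).1 = O.gr.unit x := rfl

instance (x : O.Obj) : Finite (Isotropy O x) := by
  have hc : IsCompact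
      {h : O.Mor | O.gr.src h ∈ ({x} : Set O.Obj) ∧ O.gr.tgt h ∈ ({x} : Set O.Obj)} :=
    EpGroupoid.isCompact_arrows isCompact_singleton isCompact_singleton
  refine Set.Finite.to_subtype (s := {h : O.Mor | O.gr.src h = x ∧ O.gr.tgt h = x}) ?_
  obtain ⟨t, -, ht⟩ := hc.elim_nhds_subcover O.biNhd fun h _ => O.biNhd_mem_nhds h
  refine (t.finite_toSet.image fun g => O.sec g x).subset ?_
  rintro h hh
  obtain ⟨g, hg, hhg⟩ := mem_iUnion₂.mp (ht hh)
  refine ⟨g, hg, ?_⟩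
  have := EpGroupoid.sec_src hhg
  rwa [hh.1] at this

/-- Near an object `x`, all morphisms lie on the local sections through the isotropy group. -/
theorem EpGroupoid.exists_nhds_arrows (x : O.Obj) : ∃ V : Set O.Obj, IsOpen V ∧ x ∈ V ∧
    ∀ h : O.Mor, O.gr.src h ∈ V → O.gr.tgt h ∈ V →
      ∃ γ : Isotropy O x, O.sec γ.1 (O.gr.src h) = h := by
  obtain ⟨K, hK, hxK⟩ := exists_compact_mem_nhds x
  let N : Set O.Mor := ⋃ γ : Isotropy O x, O.biNhd γ.1
  have hN : IsOpen N := isOpen_iUnion fun γ => O.isOpen_biNhd _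
  have hC : IsCompact ({h : O.Mor | O.gr.src h ∈ K ∧ O.gr.tgt h ∈ K} \ N) :=
    (isCompact_arrows hK hK).diff hN
  have hI := (hC.image (O.continuous_src.prodMk O.continuous_tgt)).isClosed
  have hx : (x, x) ∈ ((fun h => (O.gr.src h, O.gr.tgt h)) ''
      ({h : O.Mor | O.gr.src h ∈ K ∧ O.gr.tgt h ∈ K} \ N))ᶜ := by
    rintro ⟨h, ⟨-, hh⟩, hhx⟩
    refine hh (mem_iUnion.mpr ⟨⟨h, congrArg Prod.fst hhx, congrArg Prod.snd hhx⟩, ?_⟩)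
    exact O.mem_biNhd h
  obtain ⟨V₁, V₂, hV₁, hxV₁, hV₂, hxV₂, hV⟩ := mem_nhds_prod_iff'.mp (hI.isOpen_compl.mem_nhds hx)
  refine ⟨V₁ ∩ V₂ ∩ interior K, (hV₁.inter hV₂).inter isOpen_interior,
    ⟨⟨hxV₁, hxV₂⟩, mem_interior_iff_mem_nhds.mpr hxK⟩, fun h hs ht => ?_⟩
  by_contra hcon
  refine hV (show (O.gr.src h, O.gr.tgt h) ∈ V₁ ×ˢ V₂ from ⟨hs.1.1, ht.1.2⟩)
    ⟨h, ⟨⟨interior_subset hs.2, interior_subset ht.2⟩, fun hN' => hcon ?_⟩, rfl⟩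
  obtain ⟨γ, hγ⟩ := mem_iUnion.mp hN'
  exact ⟨γ, sec_src hγ⟩

end Isotropy

/-! ### Linear patches of a suborbifold -/

section Patches

variable {n : ℕ} {O : EpGroupoid.{a, b} n}

/-- A linear patch of the suborbifold `X` of dimension `k`: a chart `φ` in which `X` is the kernel
of a linear map `H` with right inverse `j`, such that the morphisms between points of the domain
form finitely many sections `s γ` acting by linear maps `A γ` which fix the range of `j`; and an
invariant bump function `χ` in this chart. -/
structure LinearPatch (O : EpGroupoid.{a, b} n) (k : ℕ) (X : Set O.Obj) (r : ℕ) where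
  Γ : Type b
  mul : Γ → Γ → Γ
  φ : OpenPartialHomeomorph O.Obj (EuclideanSpace ℝ (Fin n))
  s : Γ → O.Obj → O.Mor
  A : Γ → EuclideanSpace ℝ (Fin n) →L[ℝ] EuclideanSpace ℝ (Fin n)
  H : EuclideanSpace ℝ (Fin n) →L[ℝ] (Fin r → ℝ)
  j : (Fin r → ℝ) →L[ℝ] EuclideanSpace ℝ (Fin n)
  χ : EuclideanSpace ℝ (Fin n) → ℝ
  slice : IsSliceChart k X φ (LinearMap.ker H.toLinearMap).toAffineSubspace
  continuousOn_s : ∀ γ, ContinuousOn (s γ) φ.source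
  src_s : ∀ γ, ∀ u ∈ φ.source, O.gr.src (s γ u) = u
  tgt_mem : ∀ γ, ∀ u ∈ φ.source, O.gr.tgt (s γ u) ∈ φ.source
  φ_tgt : ∀ γ, ∀ u ∈ φ.source, φ (O.gr.tgt (s γ u)) = A γ (φ u)
  exists_s : ∀ h, O.gr.src h ∈ φ.source → O.gr.tgt h ∈ φ.source → ∃ γ, s γ (O.gr.src h) = h
  s_injective : ∀ u ∈ φ.source, ∀ γ δ, s γ u = s δ u → γ = δ
  s_mul : ∀ γ δ, ∀ u ∈ φ.source,
    O.gr.comp (s γ (O.gr.tgt (s δ u))) (s δ u) = s (mul γ δ) u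
  H_j : ∀ t, H (j t) = t
  A_j : ∀ γ t, A γ (j t) = j t
  χ_smooth : ContDiff ℝ ∞ χ
  χ_nonneg : ∀ e, 0 ≤ χ e
  χ_compact : HasCompactSupport χ
  χ_subset : tsupport χ ⊆ φ.target
  χ_A : ∀ γ e, χ (A γ e) = χ e

/-- The data of an isotropy-equivariant slice chart at a point of `X`, before shrinking it to an
invariant domain. -/
theorem exists_equivariant_sliceChart {k : ℕ} {X : Set O.Obj}
    (hX : IsEmbeddedFullSuborbifold O k X) (hN : HasTrivialNormalIsotropy O X) {x : O.Obj}
    (hx : x ∈ X) :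
    ∃ (φ : OpenPartialHomeomorph O.Obj (EuclideanSpace ℝ (Fin n)))
      (L : Submodule ℝ (EuclideanSpace ℝ (Fin n)))
      (A : Isotropy O x → EuclideanSpace ℝ (Fin n) →L[ℝ] EuclideanSpace ℝ (Fin n)),
      x ∈ φ.source ∧ φ x = 0 ∧ IsPartialDiffeo (E := EuclideanSpace ℝ (Fin n)) φ ∧
      Module.finrank ℝ L = k ∧ (∀ γ δ, A (γ * δ) = (A γ).comp (A δ)) ∧
      A 1 = ContinuousLinearMap.id ℝ _ ∧ (∀ γ v, A γ v - v ∈ L) ∧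
      (∀ γ, ∀ᶠ u in 𝓝 x, φ (O.transport γ.1 u) = A γ (φ u)) ∧
      ∀ᶠ u in 𝓝 x, φ u ∈ L ↔ u ∈ X := by
  obtain ⟨φ₀, L₀, hxφ₀, h₀⟩ := hX.exists_sliceChart hx
  have : Fintype (Isotropy O x) := Fintype.ofFinite _
  -- translate the slice chart so that `x` corresponds to `0`
  set τ : OpenPartialHomeomorph (EuclideanSpace ℝ (Fin n)) (EuclideanSpace ℝ (Fin n)) :=
    (Homeomorph.addRight (-φ₀ x)).toOpenPartialHomeomorph with hτ
  have hτd : IsPartialDiffeo (E := EuclideanSpace ℝ (Fin n)) τ :=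
    ⟨(contDiff_id.add contDiff_const).contMDiff.contMDiffOn,
      (contDiff_id.add contDiff_const).contMDiff.contMDiffOn⟩
  set φ := φ₀.trans τ with hφ
  have hφs : φ.source = φ₀.source := by
    rw [hφ, OpenPartialHomeomorph.trans_source, hτ]
    simp
  have hφd : IsPartialDiffeo (E := EuclideanSpace ℝ (Fin n)) φ := h₀.diffeo.trans hτd
  have hφa : ∀ z, φ z = φ₀ z - φ₀ x := fun z => by
    rw [sub_eq_add_neg]
    rfl
  set L := L₀.direction with hL
  have hxL₀ : φ₀ x ∈ L₀ := (h₀.mem_iff hxφ₀).mp hx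
  have hmem : ∀ z ∈ φ.source, z ∈ X ↔ φ z ∈ L := by
    intro z hz
    rw [h₀.mem_iff (hφs ▸ hz), hφa]
    exact (AffineSubspace.vsub_right_mem_direction_iff_mem hxL₀ _).symm
  have hsl : IsSliceChart k X φ L.toAffineSubspace := by
    refine ⟨hφd, by rw [Submodule.toAffineSubspace_direction]; exact h₀.finrank, ?_⟩
    ext e
    constructor
    · rintro ⟨z, ⟨hzX, hz⟩, rfl⟩
      exact ⟨(hmem z hz).mp hzX, φ.map_source hz⟩
    · rintro ⟨he, het⟩
      refine ⟨φ.symm e, ⟨(hmem _ (φ.map_target het)).mpr ?_, φ.map_target het⟩, φ.right_inv het⟩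
      rw [φ.right_inv het]
      exact he
  have hxφ : x ∈ φ.source := hφs ▸ hxφ₀
  have hφx : φ x = 0 := by rw [hφa, sub_self]
  have h0t : (0 : EuclideanSpace ℝ (Fin n)) ∈ φ.target := hφx ▸ φ.map_source hxφ
  have hφs0 : φ.symm 0 = x := by rw [← hφx, φ.left_inv hxφ]
  have hsymm : Tendsto φ.symm (𝓝 0) (𝓝 x) := by
    have := (φ.symm.continuousAt h0t).tendsto
    rwa [hφs0] at this
  -- the isotropy group acts by germs of diffeomorphisms in the chart
  let T : Isotropy O x →
      OpenPartialHomeomorph (EuclideanSpace ℝ (Fin n)) (EuclideanSpace ℝ (Fin n)) :=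
    fun γ => (φ.symm.trans (O.transport γ.1)).trans φ
  have hTd : ∀ γ, IsPartialDiffeo (E := EuclideanSpace ℝ (Fin n)) (T γ) := fun γ =>
    (hφd.symm.trans (O.isPartialDiffeo_transport _)).trans hφd
  have htr : ∀ γ : Isotropy O x, O.transport γ.1 x = x := fun γ => by
    have := EpGroupoid.transport_src_self γ.1
    rwa [γ.2.1, γ.2.2] at this
  have hxtr : ∀ γ : Isotropy O x, x ∈ (O.transport γ.1).source := fun γ => by
    have := EpGroupoid.src_mem_transport_self γ.1
    rwa [γ.2.1] at this
  have htrc : ∀ γ : Isotropy O x, Tendsto (O.transport γ.1) (𝓝 x) (𝓝 x) := fun γ => by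
    have := ((O.transport γ.1).continuousAt (hxtr γ)).tendsto
    rwa [htr] at this
  have hT0s : ∀ γ, (0 : EuclideanSpace ℝ (Fin n)) ∈ (T γ).source := fun γ => by
    refine ⟨⟨h0t, ?_⟩, ?_⟩
    · change φ.symm 0 ∈ (O.transport γ.1).source
      rw [hφs0]
      exact hxtr γ
    · change O.transport γ.1 (φ.symm 0) ∈ φ.source
      rw [hφs0, htr]
      exact hxφ
  have hT0 : ∀ γ, T γ 0 = 0 := fun γ => by
    change φ (O.transport γ.1 (φ.symm 0)) = 0
    rw [hφs0, htr, hφx]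
  let A : Isotropy O x → EuclideanSpace ℝ (Fin n) →L[ℝ] EuclideanSpace ℝ (Fin n) :=
    fun γ => fderiv ℝ (T γ) 0
  have hTA : ∀ γ, HasFDerivAt (T γ) (A γ) 0 := fun γ =>
    (mdifferentiableAt_iff_differentiableAt.mp ((hTd γ).mdifferentiableAt (hT0s γ))).hasFDerivAt
  have hmul : ∀ γ δ, ∀ᶠ e in 𝓝 (0 : EuclideanSpace ℝ (Fin n)), T γ (T δ e) = T (γ * δ) e := by
    intro γ δ
    have h1 := EpGroupoid.eventually_transport_comp (O := O) (g := γ.1) (f := δ.1)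
      (γ.2.1.trans δ.2.2.symm)
    rw [δ.2.1] at h1
    filter_upwards [hsymm.eventually h1,
      hsymm.eventually ((htrc δ) (φ.open_source.mem_nhds hxφ))] with e he he'
    change φ (O.transport γ.1 (φ.symm (φ (O.transport δ.1 (φ.symm e))))) =
      φ (O.transport (γ * δ).1 (φ.symm e))
    rw [φ.left_inv he', he, Isotropy.val_mul]
  have hA : ∀ γ δ, A (γ * δ) = (A γ).comp (A δ) := by
    intro γ δ
    have h1 : HasFDerivAt (T γ ∘ T δ) ((A γ).comp (A δ)) 0 :=
      HasFDerivAt.comp (0 : EuclideanSpace ℝ (Fin n)) (by rw [hT0]; exact hTA γ) (hTA δ)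
    exact (h1.congr_of_eventuallyEq ((hmul γ δ).mono fun e he => he.symm)).fderiv
  have hA1 : A 1 = ContinuousLinearMap.id ℝ _ := by
    refine ((hasFDerivAt_id (0 : EuclideanSpace ℝ (Fin n))).congr_of_eventuallyEq ?_).fderiv
    filter_upwards [hsymm.eventually (EpGroupoid.eventually_transport_unit x),
      φ.open_target.mem_nhds h0t] with e he het
    change φ (O.transport (1 : Isotropy O x).1 (φ.symm e)) = e
    rw [Isotropy.val_one, he, φ.right_inv het]
  -- This is the triviality of the isotropy action on the normal space.
  have hAL : ∀ γ v, A γ v - v ∈ L := by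
    intro γ v
    have h1 := hasTrivialNormalIsotropy_iff.mp hN x hx γ.1 γ.2.1 γ.2.2
      (tderiv _ (EuclideanSpace ℝ (Fin n)) φ.symm 0 v)
    rw [hsl.tangentAlong_eq hxφ hx, Submodule.toAffineSubspace_direction] at h1
    have h1 : tderiv (EuclideanSpace ℝ (Fin n)) (EuclideanSpace ℝ (Fin n)) φ x
      (tderiv _ (EuclideanSpace ℝ (Fin n)) (O.transport γ.1) x
        (tderiv _ (EuclideanSpace ℝ (Fin n)) φ.symm 0 v) -
        tderiv _ (EuclideanSpace ℝ (Fin n)) φ.symm 0 v) ∈ L := h1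
    rw [map_sub] at h1
    have h2 : tderiv (EuclideanSpace ℝ (Fin n)) (EuclideanSpace ℝ (Fin n)) φ x
        (tderiv _ (EuclideanSpace ℝ (Fin n)) φ.symm 0 v) = v := by
      have := hφd.tderiv_apply_symm hxφ v
      rwa [hφx] at this
    have h3 : A γ = (tderiv (EuclideanSpace ℝ (Fin n)) (EuclideanSpace ℝ (Fin n)) φ x).comp
        ((tderiv (EuclideanSpace ℝ (Fin n)) (EuclideanSpace ℝ (Fin n)) (O.transport γ.1) x).comp
          (tderiv _ (EuclideanSpace ℝ (Fin n)) φ.symm 0)) := by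
      have h4 := tderiv_comp (x := (0 : EuclideanSpace ℝ (Fin n))) (f := φ.symm)
        (g := O.transport γ.1) (E' := EuclideanSpace ℝ (Fin n)) (E'' := EuclideanSpace ℝ (Fin n))
        ((O.isPartialDiffeo_transport _).mdifferentiableAt (by rw [hφs0]; exact hxtr γ))
        (hφd.symm.mdifferentiableAt h0t)
      have h5 := tderiv_comp (x := (0 : EuclideanSpace ℝ (Fin n)))
        (f := φ.symm.trans (O.transport γ.1))
        (g := φ) (E' := EuclideanSpace ℝ (Fin n)) (E'' := EuclideanSpace ℝ (Fin n))
        (hφd.mdifferentiableAt (hT0s γ).2)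
        ((hφd.symm.trans (O.isPartialDiffeo_transport _)).mdifferentiableAt (hT0s γ).1)
      rw [hφs0] at h4
      rw [show (φ.symm.trans (O.transport γ.1)) 0 = x by
        change O.transport γ.1 (φ.symm 0) = x
        rw [hφs0, htr]] at h5
      rw [← h4]
      exact (tderiv_eq_fderiv _ _).symm.trans h5
    rw [h2] at h1
    rw [h3]
    exact h1
  have hTL : ∀ γ, ∀ᶠ e in 𝓝 (0 : EuclideanSpace ℝ (Fin n)), e ∈ L → T γ e ∈ L := by
    intro γ
    filter_upwards [(T γ).open_source.mem_nhds (hT0s γ)] with e he heL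
    refine (hmem _ he.2).mp ?_
    change O.transport γ.1 (φ.symm e) ∈ X
    refine (hX.mem_iff_of_proj_eq (EpGroupoid.proj_transport he.1.2)).mpr ?_
    refine (hmem _ (φ.map_target he.1.1)).mpr ?_
    rwa [φ.right_inv he.1.1]
  obtain ⟨Φ, h0Φ, hΦ0, hΦd, hΦA, hΦL⟩ := exists_linearization (Θ := fun γ => T γ)
    (U := ⋂ γ, (T γ).source) (isOpen_iInter_of_finite fun γ => (T γ).open_source)
    (mem_iInter.mpr hT0s)
    (fun γ => contMDiffOn_iff_contDiffOn.mp ((hTd γ).smooth.mono (iInter_subset _ γ))) hT0 A hA hA1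
    hTA hmul L (fun γ v hv => by simpa using L.add_mem (hAL γ v) hv) hTL
  have hφc : Tendsto φ (𝓝 x) (𝓝 0) := by
    have := (φ.continuousAt hxφ).tendsto
    rwa [hφx] at this
  refine ⟨φ.trans Φ, L, A, ⟨hxφ, by change φ x ∈ Φ.source; rwa [hφx]⟩, ?_, hφd.trans hΦd,
    h₀.finrank, hA, hA1, hAL, fun γ => ?_, ?_⟩
  · change Φ (φ x) = 0
    rw [hφx, hΦ0]
  · filter_upwards [hφc.eventually (hΦA γ), φ.open_source.mem_nhds hxφ] with u hu hus
    change Φ (φ (O.transport γ.1 (φ.symm (φ u)))) = _ at hu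
    rwa [φ.left_inv hus] at hu
  · filter_upwards [hφc.eventually hΦL, φ.open_source.mem_nhds hxφ] with u hu hus
    exact hu.trans (hmem u hus).symm

/-- Every point of `X` has a linear patch whose bump function is positive there. -/
theorem exists_linearPatch {k : ℕ} {X : Set O.Obj}
    (hX : IsEmbeddedFullSuborbifold O k X) (hN : HasTrivialNormalIsotropy O X) {x : O.Obj}
    (hx : x ∈ X) :
    ∃ P : LinearPatch O k X (n - k), x ∈ P.φ.source ∧ 0 < P.χ (P.φ x) := by
  obtain ⟨φ, L, A, hxφ, hφx, hφd, hfin, hA, hA1, hAL, hφA, hφL⟩ :=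
    exists_equivariant_sliceChart hX hN hx
  have : Fintype (Isotropy O x) := Fintype.ofFinite _
  have hcard : (Fintype.card (Isotropy O x) : ℝ) ≠ 0 := Nat.cast_ne_zero.mpr Fintype.card_ne_zero
  obtain ⟨V', hV', hxV', harr⟩ := EpGroupoid.exists_nhds_arrows (O := O) x
  -- a neighbourhood of `x` on which the local sections have all required properties
  have htr : ∀ γ : Isotropy O x, O.transport γ.1 x = x := fun γ => by
    have := EpGroupoid.transport_src_self γ.1
    rwa [γ.2.1, γ.2.2] at this
  have hxtr : ∀ γ : Isotropy O x, x ∈ (O.transport γ.1).source := fun γ => by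
    have := EpGroupoid.src_mem_transport_self γ.1
    rwa [γ.2.1] at this
  have htrc : ∀ γ : Isotropy O x, Tendsto (O.transport γ.1) (𝓝 x) (𝓝 x) := fun γ => by
    have := ((O.transport γ.1).continuousAt (hxtr γ)).tendsto
    rwa [htr] at this
  have hmulev : ∀ γ δ : Isotropy O x, ∀ᶠ u in 𝓝 x,
      O.gr.comp (O.sec γ.1 (O.transport δ.1 u)) (O.sec δ.1 u) = O.sec (γ * δ).1 u := by
    intro γ δ
    have h1 := EpGroupoid.eventually_sec_comp (O := O) (g := γ.1) (f := δ.1)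
      (γ.2.1.trans δ.2.2.symm)
    rwa [δ.2.1] at h1
  have hne : ∀ γ δ : Isotropy O x, ∀ᶠ u in 𝓝 x, O.sec γ.1 u = O.sec δ.1 u → γ = δ := by
    intro γ δ
    by_cases h : γ = δ
    · exact Eventually.of_forall fun _ _ => h
    · have hs : ∀ ε : Isotropy O x, O.sec ε.1 x = ε.1 := fun ε => by
        have := EpGroupoid.sec_src_self ε.1
        rwa [ε.2.1] at this
      have h1 : O.sec γ.1 x ≠ O.sec δ.1 x := by
        rw [hs, hs]
        exact fun h' => h (Subtype.ext h')
      filter_upwards [((EpGroupoid.continuousAt_sec (hxtr γ)).tendsto.prodMk_nhds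
        (EpGroupoid.continuousAt_sec (hxtr δ)).tendsto) (isClosed_diagonal.isOpen_compl.mem_nhds
          (show (O.sec γ.1 x, O.sec δ.1 x) ∈ (diagonal O.Mor)ᶜ from h1))] with u hu hu'
      exact absurd hu' hu
  have hP : ∀ᶠ u in 𝓝 x, (u ∈ φ.source ∧ u ∈ V' ∧ (u ∈ X ↔ φ u ∈ L)) ∧
      ((∀ γ : Isotropy O x, u ∈ (O.transport γ.1).source ∧
        φ (O.transport γ.1 u) = A γ (φ u)) ∧
      ∀ γ δ : Isotropy O x, (O.sec γ.1 u = O.sec δ.1 u → γ = δ) ∧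
        O.gr.comp (O.sec γ.1 (O.transport δ.1 u)) (O.sec δ.1 u) = O.sec (γ * δ).1 u) := by
    refine ((φ.open_source.eventually_mem hxφ).and ((hV'.eventually_mem hxV').and
      (hφL.mono fun u hu => hu.symm))).and ?_
    refine (eventually_all.mpr fun γ => ?_).and
      (eventually_all.mpr fun γ => eventually_all.mpr fun δ => (hne γ δ).and (hmulev γ δ))
    exact ((O.transport γ.1).open_source.eventually_mem (hxtr γ)).and (hφA γ)
  have hP2 : ∀ᶠ u in 𝓝 x, ∀ γ : Isotropy O x, O.transport γ.1 u ∈ φ.source :=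
    eventually_all.mpr fun γ => (htrc γ) (φ.open_source.mem_nhds hxφ)
  have h0t : (0 : EuclideanSpace ℝ (Fin n)) ∈ φ.target := hφx ▸ φ.map_source hxφ
  have hsymm : Tendsto φ.symm (𝓝 0) (𝓝 x) := by
    have := (φ.symm.continuousAt h0t).tendsto
    rwa [← hφx, φ.left_inv hxφ, hφx] at this
  obtain ⟨ρ, hρ, hball⟩ := Metric.eventually_nhds_iff_ball.mp
    ((hsymm.eventually (hP.and hP2)).and (φ.open_target.eventually_mem h0t))
  -- an invariant quadratic form
  let ψ : EuclideanSpace ℝ (Fin n) → ℝ := fun e => ∑ γ, ‖A γ e‖ ^ 2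
  have hψ : ContDiff ℝ ∞ ψ := ContDiff.sum fun γ _ => (A γ).contDiff.norm_sq ℝ
  have hψA : ∀ γ e, ψ (A γ e) = ψ e := by
    intro γ e
    refine Fintype.sum_equiv (Equiv.mulRight γ) _ _ fun δ => ?_
    rw [Equiv.coe_mulRight, hA, ContinuousLinearMap.comp_apply]
  have hψn : ∀ e, ‖e‖ ^ 2 ≤ ψ e := by
    intro e
    have := Finset.single_le_sum (f := fun γ : Isotropy O x => ‖A γ e‖ ^ 2)
      (fun γ _ => by positivity) (Finset.mem_univ 1)
    simpa only [hA1, ContinuousLinearMap.id_apply] using this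
  have hψ0 : ψ 0 = 0 := by simp [ψ]
  have hψball : ∀ e, ψ e < ρ ^ 2 → e ∈ Metric.ball (0 : EuclideanSpace ℝ (Fin n)) ρ := by
    intro e he
    rw [mem_ball_zero_iff]
    exact lt_of_pow_lt_pow_left₀ 2 hρ.le ((hψn e).trans_lt he)
  -- Sublevel sets of `ψ` are invariant under the isotropy group.
  set W : Set O.Obj := φ.source ∩ φ ⁻¹' {e | ψ e < ρ ^ 2} with hW
  have hWo : IsOpen W := φ.continuousOn.isOpen_inter_preimage φ.open_source
    (isOpen_lt hψ.continuous continuous_const)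
  have hsrc : (φ.restrOpen W hWo).source = W := by
    rw [φ.restrOpen_source, hW, ← inter_assoc, inter_self]
  have hprop : ∀ u ∈ W, ((u ∈ φ.source ∧ u ∈ V' ∧ (u ∈ X ↔ φ u ∈ L)) ∧
      ((∀ γ : Isotropy O x, u ∈ (O.transport γ.1).source ∧
        φ (O.transport γ.1 u) = A γ (φ u)) ∧
      ∀ γ δ : Isotropy O x, (O.sec γ.1 u = O.sec δ.1 u → γ = δ) ∧
        O.gr.comp (O.sec γ.1 (O.transport δ.1 u)) (O.sec δ.1 u) = O.sec (γ * δ).1 u)) ∧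
      ∀ γ : Isotropy O x, O.transport γ.1 u ∈ φ.source := by
    intro u hu
    have := (hball _ (hψball _ hu.2)).1
    rwa [φ.left_inv hu.1] at this
  have htgt : ∀ γ : Isotropy O x, ∀ u ∈ W, O.gr.tgt (O.sec γ.1 u) = O.transport γ.1 u :=
    fun γ u hu => EpGroupoid.tgt_sec ((hprop u hu).1.2.1 γ).1
  have htgtW : ∀ γ : Isotropy O x, ∀ u ∈ W, O.gr.tgt (O.sec γ.1 u) ∈ W := by
    intro γ u hu
    rw [htgt γ u hu]
    refine ⟨(hprop u hu).2 γ, ?_⟩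
    rw [mem_preimage, ((hprop u hu).1.2.1 γ).2, mem_ofPred_eq, hψA]
    exact hu.2
  -- the normal coordinate, and a complement of `L` on which the isotropy group acts trivially
  have hk : Module.finrank ℝ (EuclideanSpace ℝ (Fin n) ⧸ L) =
      Module.finrank ℝ (Fin (n - k) → ℝ) := by
    have := L.finrank_quotient_add_finrank
    rw [hfin, finrank_euclideanSpace_fin] at this
    rw [Module.finrank_fin_fun]
    omega
  let η : (EuclideanSpace ℝ (Fin n) ⧸ L) ≃ₗ[ℝ] (Fin (n - k) → ℝ) := LinearEquiv.ofFinrankEq _ _ hk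
  let H₀ : EuclideanSpace ℝ (Fin n) →ₗ[ℝ] (Fin (n - k) → ℝ) := η.toLinearMap ∘ₗ L.mkQ
  have hH₀ : LinearMap.ker H₀ = L := by
    rw [LinearEquiv.ker_comp, Submodule.ker_mkQ]
  obtain ⟨j₀, hj₀⟩ := H₀.exists_rightInverse_of_surjective
    (LinearMap.range_eq_top.mpr (η.surjective.comp L.mkQ_surjective))
  -- The average of a right inverse of `H₀` over the group is still a right inverse, because `H₀` is
  -- invariant, the action on the quotient by `L` being trivial.
  let j : (Fin (n - k) → ℝ) →L[ℝ] EuclideanSpace ℝ (Fin n) :=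
    (Fintype.card (Isotropy O x) : ℝ)⁻¹ • ∑ γ, (A γ).comp j₀.toContinuousLinearMap
  have hjA : ∀ γ t, A γ (j t) = j t := by
    intro γ t
    simp only [j, smul_apply, sum_apply, map_smul, map_sum]
    congr 1
    refine Fintype.sum_equiv (Equiv.mulLeft γ) _ _ fun δ => ?_
    rw [Equiv.coe_mulLeft, hA, ContinuousLinearMap.comp_apply, ContinuousLinearMap.comp_apply,
      ContinuousLinearMap.comp_apply]
  have hH₀A : ∀ γ v, H₀ (A γ v) = H₀ v := by
    intro γ v
    rw [← sub_eq_zero, ← map_sub, ← LinearMap.mem_ker, hH₀]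
    exact hAL γ v
  have hH₀j : ∀ t, H₀ (j t) = t := by
    intro t
    have h1 : H₀ (j₀ t) = t :=
      congrArg (fun l : (Fin (n - k) → ℝ) →ₗ[ℝ] (Fin (n - k) → ℝ) => l t) hj₀
    simp only [j, smul_apply, sum_apply, map_smul, map_sum,
      ContinuousLinearMap.comp_apply, LinearMap.coe_toContinuousLinearMap', hH₀A, h1,
      Finset.sum_const, Finset.card_univ]
    rw [← Nat.cast_smul_eq_nsmul ℝ, smul_smul, inv_mul_cancel₀ hcard, one_smul]
  have hkerH : LinearMap.ker H₀.toContinuousLinearMap.toLinearMap = L := hH₀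
  -- an invariant bump function, as a function of `ψ`
  let χ : EuclideanSpace ℝ (Fin n) → ℝ := fun e => Real.smoothTransition (ρ ^ 2 / 2 - ψ e)
  have hχs : tsupport χ ⊆ {e | ψ e ≤ ρ ^ 2 / 2} := by
    refine closure_minimal ?_ (isClosed_le hψ.continuous continuous_const)
    intro e he
    by_contra hcon
    rw [mem_ofPred_eq, not_le] at hcon
    exact he (Real.smoothTransition.zero_of_nonpos (by linarith))
  have hρ2 : 0 < ρ ^ 2 := by positivity
  refine ⟨
    { Γ := Isotropy O x
      mul := (· * ·)
      φ := φ.restrOpen W hWo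
      s := fun γ => O.sec γ.1
      A := A
      H := H₀.toContinuousLinearMap
      j := j
      χ := χ
      slice := ?_
      continuousOn_s := ?_
      src_s := ?_
      tgt_mem := ?_
      φ_tgt := ?_
      exists_s := ?_
      s_injective := ?_
      s_mul := ?_
      H_j := hH₀j
      A_j := hjA
      χ_smooth := Real.smoothTransition.contDiff.comp (contDiff_const.sub hψ)
      χ_nonneg := fun e => Real.smoothTransition.nonneg _
      χ_compact := ?_
      χ_subset := ?_
      χ_A := fun γ e => by simp only [χ, hψA] }, ?_, ?_⟩
  · rw [hkerH]
    refine ⟨hφd.restrOpen W hWo, by rw [Submodule.toAffineSubspace_direction]; exact hfin, ?_⟩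
    ext e
    constructor
    · rintro ⟨z, ⟨hzX, hz⟩, rfl⟩
      refine ⟨?_, (φ.restrOpen W hWo).map_source hz⟩
      rw [hsrc] at hz
      exact (hprop z hz).1.1.2.2.mp hzX
    · rintro ⟨he, het⟩
      have hz := (φ.restrOpen W hWo).map_target het
      refine ⟨_, ⟨?_, hz⟩, (φ.restrOpen W hWo).right_inv het⟩
      have hr := (φ.restrOpen W hWo).right_inv het
      rw [hsrc] at hz
      refine (hprop _ hz).1.1.2.2.mpr ?_
      change φ _ = e at hr
      rw [hr]
      exact he
  · rw [hsrc]
    exact fun γ => (EpGroupoid.continuousOn_sec γ.1).mono fun u hu => ((hprop u hu).1.2.1 γ).1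
  · rw [hsrc]
    exact fun γ u hu => EpGroupoid.src_sec ((hprop u hu).1.2.1 γ).1
  · rw [hsrc]
    exact htgtW
  · rw [hsrc]
    intro γ u hu
    change φ (O.gr.tgt (O.sec γ.1 u)) = A γ (φ u)
    rw [htgt γ u hu]
    exact ((hprop u hu).1.2.1 γ).2
  · rw [hsrc]
    exact fun h hs ht => harr h (hprop _ hs).1.1.2.1 (hprop _ ht).1.1.2.1
  · rw [hsrc]
    exact fun u hu γ δ => ((hprop u hu).1.2.2 γ δ).1
  · rw [hsrc]
    intro γ δ u hu
    rw [htgt δ u hu]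
    exact ((hprop u hu).1.2.2 γ δ).2
  · refine HasCompactSupport.of_support_subset_isCompact
      (isCompact_closedBall (0 : EuclideanSpace ℝ (Fin n)) ρ) fun e he => ?_
    refine Metric.ball_subset_closedBall (hψball e ?_)
    have := hχs (subset_tsupport _ he)
    rw [mem_ofPred_eq] at this
    linarith
  · intro e he
    have h1 := hχs he
    have h2 : ψ e < ρ ^ 2 := by
      rw [mem_ofPred_eq] at h1
      linarith
    have h3 : e ∈ φ.target := (hball e (hψball e h2)).2
    have h4 : φ.symm e ∈ (φ.restrOpen W hWo).source := by
      rw [hsrc]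
      refine ⟨φ.map_target h3, ?_⟩
      rw [mem_preimage, φ.right_inv h3]
      exact h2
    have h5 := (φ.restrOpen W hWo).map_source h4
    change φ (φ.symm e) ∈ _ at h5
    rwa [φ.right_inv h3] at h5
  · rw [hsrc]
    refine ⟨hxφ, ?_⟩
    rw [mem_preimage, hφx, mem_ofPred_eq, hψ0]
    exact hρ2
  · change 0 < Real.smoothTransition (ρ ^ 2 / 2 - ψ (φ x))
    rw [hφx, hψ0, sub_zero]
    exact Real.smoothTransition.pos_of_pos (by positivity)

end Patches

/-! ### Localised translations -/

section Shift

variable {E : Type*} [NormedAddCommGroup E] [NormedSpace ℝ E]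

/-- Translations cut off by a bump function are diffeomorphisms if the translation is small. -/
theorem exists_homeomorph_add_smul [FiniteDimensional ℝ E] {F : Type*}
    [NormedAddCommGroup F] [NormedSpace ℝ F]
    {χ : E → ℝ} (hχ : ContDiff ℝ ∞ χ) (hχc : HasCompactSupport χ) (j : F →L[ℝ] E) :
    ∃ δ : ℝ, 0 < δ ∧ ∀ t, ‖t‖ < δ → ∃ Φ : E ≃ₜ E, (∀ e, Φ e = e + χ e • j t) ∧
      ContDiff ℝ ∞ Φ ∧ ContDiff ℝ ∞ Φ.symm := by
  obtain ⟨C, hC⟩ := hχ.lipschitzWith_of_hasCompactSupport hχc (by simp)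
  refine ⟨((C + 1) * (‖j‖ + 1))⁻¹, by positivity, fun t ht => ?_⟩
  have hlt : (C : ℝ) * ‖j t‖ < 1 := by
    have h1 : ‖j t‖ ≤ ‖j‖ * ‖t‖ := j.le_opNorm t
    have h2 : ‖t‖ * ((C + 1) * (‖j‖ + 1)) < 1 := by
      have := mul_lt_mul_of_pos_right ht (show 0 < ((C : ℝ) + 1) * (‖j‖ + 1) by positivity)
      rwa [inv_mul_cancel₀ (by positivity)] at this
    have h3 : (C : ℝ) * (‖j‖ * ‖t‖) ≤ ‖t‖ * ((C + 1) * (‖j‖ + 1)) := by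
      have hC0 : (0 : ℝ) ≤ C := C.2
      nlinarith [norm_nonneg j, norm_nonneg t, mul_nonneg (norm_nonneg j) (norm_nonneg t),
        mul_nonneg hC0 (norm_nonneg t)]
    calc (C : ℝ) * ‖j t‖ ≤ C * (‖j‖ * ‖t‖) := by gcongr
      _ < 1 := h3.trans_lt h2
  let f : E → E := fun e => e + χ e • j t
  have hf : ContDiff ℝ ∞ f := contDiff_id.add (hχ.smul contDiff_const)
  have happ : ApproximatesLinearOn f ((ContinuousLinearEquiv.refl ℝ E : E ≃L[ℝ] E) : E →L[ℝ] E)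
      univ (C * ‖j t‖₊) := by
    intro x _ y _
    have h1 : f x - f y - ((ContinuousLinearEquiv.refl ℝ E : E ≃L[ℝ] E) : E →L[ℝ] E) (x - y) =
        (χ x - χ y) • j t := by
      simp only [f, ContinuousLinearEquiv.coe_refl, ContinuousLinearMap.id_apply, sub_smul]
      abel
    have h2 := hC.dist_le_mul x y
    rw [dist_eq_norm, dist_eq_norm] at h2
    rw [h1, norm_smul, NNReal.coe_mul, coe_nnnorm]
    calc ‖χ x - χ y‖ * ‖j t‖ ≤ C * ‖x - y‖ * ‖j t‖ := by gcongr
      _ = C * ‖j t‖ * ‖x - y‖ := by ring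
  have hcond : Subsingleton E ∨ C * ‖j t‖₊ <
      ‖((ContinuousLinearEquiv.refl ℝ E).symm : E →L[ℝ] E)‖₊⁻¹ := by
    rcases subsingleton_or_nontrivial E with h | h
    · exact Or.inl h
    · refine Or.inr ?_
      have h1 : ‖((ContinuousLinearEquiv.refl ℝ E).symm : E →L[ℝ] E)‖₊ = 1 := by
        rw [ContinuousLinearEquiv.refl_symm, ContinuousLinearEquiv.coe_refl]
        exact NNReal.eq ContinuousLinearMap.norm_id
      rw [h1, inv_one]
      exact_mod_cast hlt
  let Φ := happ.toHomeomorph f hcond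
  have hΦ : ∀ e, Φ e = f e := fun e => rfl
  refine ⟨Φ, hΦ, hf, ?_⟩
  -- the differentials are invertible, being small perturbations of the identity
  have hder : ∀ e, ∃ D : E ≃L[ℝ] E, HasFDerivAt f (D : E →L[ℝ] E) e := by
    intro e
    have h1 : HasFDerivAt f (ContinuousLinearMap.id ℝ E + (fderiv ℝ χ e).smulRight (j t)) e :=
      (hasFDerivAt_id e).add (((hχ.differentiable (by simp)) e).hasFDerivAt.smul_const (j t))
    have hinj : Function.Injective
        (ContinuousLinearMap.id ℝ E + (fderiv ℝ χ e).smulRight (j t)).toLinearMap := by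
      rw [← LinearMap.ker_eq_bot, LinearMap.ker_eq_bot']
      intro v hv
      have h2 : v = -(fderiv ℝ χ e v • j t) := eq_neg_of_add_eq_zero_left hv
      have h3 : ‖fderiv ℝ χ e v‖ ≤ C * ‖v‖ :=
        (ContinuousLinearMap.le_opNorm _ v).trans (by
          gcongr
          exact norm_fderiv_le_of_lipschitz ℝ hC)
      have h4 : ‖v‖ ≤ (C * ‖j t‖) * ‖v‖ := by
        calc ‖v‖ = ‖fderiv ℝ χ e v‖ * ‖j t‖ := by
              conv_lhs => rw [h2]
              rw [norm_neg, norm_smul]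
          _ ≤ C * ‖v‖ * ‖j t‖ := by gcongr
          _ = (C * ‖j t‖) * ‖v‖ := by ring
      by_contra hv0
      have : 0 < ‖v‖ := norm_pos_iff.mpr hv0
      nlinarith
    refine ⟨(LinearEquiv.ofInjectiveEndo _ hinj).toContinuousLinearEquiv, ?_⟩
    refine h1.congr_fderiv ?_
    ext v
    rfl
  choose D hD using hder
  exact Φ.contDiff_symm hD hf

/-- The extension by the identity of a map which is given in the chart `φ`. -/
noncomputable def chartExtend {M E : Type*} [TopologicalSpace M] [TopologicalSpace E]
    (φ : OpenPartialHomeomorph M E) (f : E → E) (z : M) : M :=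
  open Classical in if z ∈ φ.source then φ.symm (f (φ z)) else z

theorem chartExtend_of_mem {M E : Type*} [TopologicalSpace M] [TopologicalSpace E]
    (φ : OpenPartialHomeomorph M E) (f : E → E) {z : M} (hz : z ∈ φ.source) :
    chartExtend φ f z = φ.symm (f (φ z)) := if_pos hz

theorem chartExtend_of_fixed {M E : Type*} [TopologicalSpace M] [TopologicalSpace E]
    (φ : OpenPartialHomeomorph M E) {f : E → E} {z : M}
    (hz : z ∈ φ.source → f (φ z) = φ z) : chartExtend φ f z = z := by
  by_cases h : z ∈ φ.source
  · rw [chartExtend_of_mem φ f h, hz h, φ.left_inv h]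
  · exact if_neg h

variable {M : Type*} [TopologicalSpace M] [ChartedSpace E M] [T2Space M]

theorem contMDiff_chartExtend {φ : OpenPartialHomeomorph M E} (hφ : IsPartialDiffeo (E := E) φ)
    {f : E → E} (hf : ContDiff ℝ ∞ f) {K : Set E} (hK : IsCompact K) (hKφ : K ⊆ φ.target)
    (hfK : ∀ e, e ∉ K → f e = e) (hft : MapsTo f φ.target φ.target) :
    ContMDiff 𝓘(ℝ, E) 𝓘(ℝ, E) ∞ (chartExtend φ f) := by
  intro z
  by_cases hz : z ∈ φ.source
  · have h1 : ContMDiffAt 𝓘(ℝ, E) 𝓘(ℝ, E) ∞ (φ.symm ∘ f ∘ φ) z := by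
      refine ContMDiffAt.comp z (hφ.symm.contMDiffAt (hft (φ.map_source hz))) ?_
      exact ContMDiffAt.comp z hf.contMDiff.contMDiffAt (hφ.contMDiffAt hz)
    refine h1.congr_of_eventuallyEq ?_
    filter_upwards [φ.open_source.mem_nhds hz] with y hy
    exact chartExtend_of_mem φ f hy
  · have hc : IsClosed (φ.symm '' K) :=
      (hK.image_of_continuousOn (φ.continuousOn_symm.mono hKφ)).isClosed
    have hz' : z ∈ (φ.symm '' K)ᶜ := by
      rintro ⟨e, he, rfl⟩
      exact hz (φ.map_target (hKφ he))
    refine contMDiffAt_id.congr_of_eventuallyEq ?_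
    filter_upwards [hc.isOpen_compl.mem_nhds hz'] with y hy
    refine chartExtend_of_fixed φ fun hys => hfK _ fun hcon => hy ⟨_, hcon, φ.left_inv hys⟩

/-- The extension by the identity of a diffeomorphism which is given in the chart `φ`. -/
noncomputable def chartExtendHomeomorph {φ : OpenPartialHomeomorph M E}
    (hφ : IsPartialDiffeo (E := E) φ) (Φ : E ≃ₜ E) (hΦ : ContDiff ℝ ∞ Φ)
    (hΦs : ContDiff ℝ ∞ Φ.symm) {K : Set E} (hK : IsCompact K) (hKφ : K ⊆ φ.target)
    (hΦK : ∀ e, e ∉ K → Φ e = e) (hΦt : MapsTo Φ φ.target φ.target)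
    (hΦst : MapsTo Φ.symm φ.target φ.target) : M ≃ₜ M where
  toFun := chartExtend φ Φ
  invFun := chartExtend φ Φ.symm
  left_inv z := by
    by_cases hz : z ∈ φ.source
    · have h1 := hΦt (φ.map_source hz)
      rw [chartExtend_of_mem φ Φ hz, chartExtend_of_mem φ _ (φ.map_target h1), φ.right_inv h1,
        Φ.symm_apply_apply, φ.left_inv hz]
    · rw [chartExtend_of_fixed φ fun h => absurd h hz, chartExtend_of_fixed φ fun h => absurd h hz]
  right_inv z := by
    by_cases hz : z ∈ φ.source
    · have h1 := hΦst (φ.map_source hz)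
      rw [chartExtend_of_mem φ Φ.symm hz, chartExtend_of_mem φ _ (φ.map_target h1),
        φ.right_inv h1, Φ.apply_symm_apply, φ.left_inv hz]
    · rw [chartExtend_of_fixed φ fun h => absurd h hz, chartExtend_of_fixed φ fun h => absurd h hz]
  continuous_toFun := (contMDiff_chartExtend hφ hΦ hK hKφ hΦK hΦt).continuous
  continuous_invFun := (contMDiff_chartExtend hφ hΦs hK hKφ
    (fun e he => by rw [Φ.symm_apply_eq, hΦK e he]) hΦst).continuous

end Shift

/-! ### The perturbation of an orbifold in a linear patch -/

namespace LinearPatch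

variable {n : ℕ} {O : EpGroupoid.{a, b} n} {k r : ℕ} {X : Set O.Obj} (P : LinearPatch O k X r)

/-- The translation by `j t`, cut off by the bump function. -/
noncomputable def shift (t : Fin r → ℝ) (e : EuclideanSpace ℝ (Fin n)) :
    EuclideanSpace ℝ (Fin n) := e + P.χ e • P.j t

/-- The parameter `t` is so small that all translations by `τ t`, `0 ≤ τ ≤ 1`, are
diffeomorphisms. -/
def IsSmall (t : Fin r → ℝ) : Prop := ∀ τ ∈ Icc (0 : ℝ) 1,
  ∃ Φ : EuclideanSpace ℝ (Fin n) ≃ₜ EuclideanSpace ℝ (Fin n), (∀ e, Φ e = P.shift (τ • t) e) ∧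
    ContDiff ℝ ∞ Φ ∧ ContDiff ℝ ∞ Φ.symm

theorem exists_isSmall : ∃ δ : ℝ, 0 < δ ∧ ∀ t, ‖t‖ < δ → P.IsSmall t := by
  obtain ⟨δ, hδ, h⟩ := exists_homeomorph_add_smul P.χ_smooth P.χ_compact P.j
  refine ⟨δ, hδ, fun t ht τ hτ => h (τ • t) ?_⟩
  rw [norm_smul, Real.norm_of_nonneg hτ.1]
  exact (mul_le_of_le_one_left (norm_nonneg t) hτ.2).trans_lt ht

/-- The extension of `shift` to all objects by the identity. -/
noncomputable def push (t : Fin r → ℝ) : O.Obj → O.Obj := chartExtend P.φ (P.shift t)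

/-- The support of the perturbation. -/
def supp : Set O.Obj := P.φ.symm '' tsupport P.χ

/-- The saturation of the support of the perturbation. -/
def satSupp : Set O.Obj := O.gr.proj ⁻¹' (O.gr.proj '' P.supp)

/-- The set of objects on which the perturbation is a functor: the points of the chart, and those
not equivalent to a point of the support.  (No point outside of the chart is moved, even if it is
equivalent to a point which is.)  The set meets every orbit. -/
def dom : Set O.Obj := P.φ.source ∪ P.satSuppᶜ

variable {P}

theorem shift_of_notMem {t : Fin r → ℝ} {e : EuclideanSpace ℝ (Fin n)} (he : e ∉ tsupport P.χ) :
    P.shift t e = e := by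
  rw [shift, image_eq_zero_of_notMem_tsupport he, zero_smul, add_zero]

/-- The translations commute with the linear isotropy action, as `χ` is invariant and `j t` is
fixed. -/
theorem shift_A (t : Fin r → ℝ) (γ : P.Γ) (e : EuclideanSpace ℝ (Fin n)) :
    P.shift t (P.A γ e) = P.A γ (P.shift t e) := by
  rw [shift, shift, P.χ_A, map_add, map_smul, P.A_j]

theorem supp_subset : P.supp ⊆ P.φ.source := by
  rintro _ ⟨e, he, rfl⟩
  exact P.φ.map_target (P.χ_subset he)

theorem mem_supp_iff {z : O.Obj} (hz : z ∈ P.φ.source) : z ∈ P.supp ↔ P.φ z ∈ tsupport P.χ := by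
  constructor
  · rintro ⟨e, he, rfl⟩
    rwa [P.φ.right_inv (P.χ_subset he)]
  · exact fun h => ⟨_, h, P.φ.left_inv hz⟩

theorem isCompact_supp : IsCompact P.supp :=
  IsCompact.image_of_continuousOn P.χ_compact (P.φ.continuousOn_symm.mono P.χ_subset)

theorem isClosed_satSupp [T2Space O.gr.Orbit] : IsClosed P.satSupp :=
  (isCompact_supp.image O.gr.continuous_proj).isClosed.preimage O.gr.continuous_proj

theorem supp_subset_satSupp : P.supp ⊆ P.satSupp := subset_preimage_image _ _

theorem A_mem_tsupport (γ : P.Γ) {e : EuclideanSpace ℝ (Fin n)} (he : e ∈ tsupport P.χ) :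
    P.A γ e ∈ tsupport P.χ := by
  refine map_mem_closure (P.A γ).continuous he fun e' he' => ?_
  rwa [Function.mem_support, P.χ_A]

theorem mem_supp_of_mem_satSupp {z : O.Obj} (hz : z ∈ P.φ.source) (hzs : z ∈ P.satSupp) :
    z ∈ P.supp := by
  obtain ⟨z', hz', he⟩ := hzs
  obtain ⟨h, rfl, rfl⟩ := O.gr.proj_eq_iff.mp he
  obtain ⟨γ, hγ⟩ := P.exists_s h (supp_subset hz') hz
  rw [mem_supp_iff hz, ← hγ, P.φ_tgt γ _ (supp_subset hz')]
  exact A_mem_tsupport γ ((mem_supp_iff (supp_subset hz')).mp hz')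

theorem src_mem_satSupp_iff (h : O.Mor) : O.gr.src h ∈ P.satSupp ↔ O.gr.tgt h ∈ P.satSupp := by
  rw [satSupp, mem_preimage, mem_preimage, O.gr.proj_src_eq_proj_tgt]

theorem mem_source_of_mem_dom {z : O.Obj} (hz : z ∈ P.dom) (hzs : z ∈ P.satSupp) :
    z ∈ P.φ.source := hz.resolve_right fun h => h hzs

theorem isOpen_dom [T2Space O.gr.Orbit] : IsOpen P.dom :=
  P.φ.open_source.union isClosed_satSupp.isOpen_compl

theorem exists_mem_dom (z : O.Obj) : ∃ h, O.gr.src h = z ∧ O.gr.tgt h ∈ P.dom := by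
  by_cases hz : z ∈ P.satSupp
  · obtain ⟨z', hz', he⟩ := hz
    obtain ⟨h, rfl, rfl⟩ := O.gr.proj_eq_iff.mp he.symm
    exact ⟨h, rfl, Or.inl (supp_subset hz')⟩
  · exact ⟨O.gr.unit z, O.gr.src_unit z, Or.inr (by rwa [O.gr.tgt_unit])⟩

theorem push_of_notMem_supp (t : Fin r → ℝ) {z : O.Obj} (hz : z ∉ P.supp) : P.push t z = z :=
  chartExtend_of_fixed _ fun hzs => shift_of_notMem fun h => hz ((mem_supp_iff hzs).mpr h)

theorem push_of_mem (t : Fin r → ℝ) {z : O.Obj} (hz : z ∈ P.φ.source) :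
    P.push t z = P.φ.symm (P.shift t (P.φ z)) := chartExtend_of_mem _ _ hz

/-- The translation `shift t` is a diffeomorphism of `ℝ^n`. -/
structure IsDiffeoShift (P : LinearPatch O k X r) (t : Fin r → ℝ) : Prop where
  exists_homeomorph : ∃ Φ : EuclideanSpace ℝ (Fin n) ≃ₜ EuclideanSpace ℝ (Fin n),
    (∀ e, Φ e = P.shift t e) ∧ ContDiff ℝ ∞ Φ ∧ ContDiff ℝ ∞ Φ.symm

theorem IsSmall.isDiffeoShift {t : Fin r → ℝ} (h : P.IsSmall t) {τ : ℝ} (hτ : τ ∈ Icc (0 : ℝ) 1) :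
    P.IsDiffeoShift (τ • t) := ⟨h τ hτ⟩

theorem IsSmall.isDiffeoShift_one {t : Fin r → ℝ} (h : P.IsSmall t) : P.IsDiffeoShift t := by
  have := h.isDiffeoShift (τ := 1) (by simp)
  rwa [one_smul] at this

namespace IsDiffeoShift

variable {t : Fin r → ℝ} (h : P.IsDiffeoShift t)
include h

theorem injective : Function.Injective (P.shift t) := by
  obtain ⟨Φ, hΦ, -, -⟩ := h.exists_homeomorph
  intro e e' he
  rw [← hΦ, ← hΦ] at he
  exact Φ.injective he

/-- An injective map which is the identity outside of a set maps this set to itself. -/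
theorem shift_mem_tsupport_iff {e : EuclideanSpace ℝ (Fin n)} :
    P.shift t e ∈ tsupport P.χ ↔ e ∈ tsupport P.χ := by
  constructor
  · intro he
    by_contra hcon
    rw [shift_of_notMem hcon] at he
    exact hcon he
  · intro he
    by_contra hcon
    have h1 := h.injective (shift_of_notMem (t := t) hcon)
    rw [h1] at hcon
    exact hcon he

theorem mapsTo_target : MapsTo (P.shift t) P.φ.target P.φ.target := by
  intro e he
  by_cases hs : e ∈ tsupport P.χ
  · exact P.χ_subset (h.shift_mem_tsupport_iff.mpr hs)
  · rwa [shift_of_notMem hs]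

theorem push_mem_source {z : O.Obj} (hz : z ∈ P.φ.source) : P.push t z ∈ P.φ.source := by
  rw [push_of_mem t hz]
  exact P.φ.map_target (h.mapsTo_target (P.φ.map_source hz))

theorem φ_push {z : O.Obj} (hz : z ∈ P.φ.source) : P.φ (P.push t z) = P.shift t (P.φ z) := by
  rw [push_of_mem t hz, P.φ.right_inv (h.mapsTo_target (P.φ.map_source hz))]

theorem push_mem_supp_iff {z : O.Obj} : P.push t z ∈ P.supp ↔ z ∈ P.supp := by
  by_cases hz : z ∈ P.φ.source
  · rw [mem_supp_iff hz, mem_supp_iff (h.push_mem_source hz), h.φ_push hz,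
      h.shift_mem_tsupport_iff]
  · rw [push_of_notMem_supp t fun hcon => hz (supp_subset hcon)]

theorem push_mem_satSupp_iff {z : O.Obj} (hz : z ∈ P.dom) :
    P.push t z ∈ P.satSupp ↔ z ∈ P.satSupp := by
  rcases hz with hz | hz
  · constructor
    · exact fun hs => supp_subset_satSupp (h.push_mem_supp_iff.mp
        (mem_supp_of_mem_satSupp (h.push_mem_source hz) hs))
    · exact fun hs => supp_subset_satSupp (h.push_mem_supp_iff.mpr
        (mem_supp_of_mem_satSupp hz hs))
  · rw [push_of_notMem_supp t fun hcon => hz (supp_subset_satSupp hcon)]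

theorem push_tgt_s (γ : P.Γ) {u : O.Obj} (hu : u ∈ P.φ.source) :
    P.push t (O.gr.tgt (P.s γ u)) = O.gr.tgt (P.s γ (P.push t u)) := by
  have h1 := P.tgt_mem γ u hu
  have h2 := h.push_mem_source hu
  refine P.φ.injOn (h.push_mem_source h1) (P.tgt_mem γ _ h2) ?_
  rw [h.φ_push h1, P.φ_tgt γ u hu, P.φ_tgt γ _ h2, h.φ_push hu, shift_A]

/-- `push` is a diffeomorphism of the object manifold. -/
theorem exists_homeomorph_push : ∃ Ψ : O.Obj ≃ₜ O.Obj, (∀ z, Ψ z = P.push t z) ∧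
    ContMDiff (𝓡 n) (𝓡 n) ∞ Ψ ∧ ContMDiff (𝓡 n) (𝓡 n) ∞ Ψ.symm := by
  obtain ⟨Φ, hΦ, hΦs, hΦs'⟩ := h.exists_homeomorph
  have hfun : (Φ : EuclideanSpace ℝ (Fin n) → EuclideanSpace ℝ (Fin n)) = P.shift t := funext hΦ
  have hK : ∀ e, e ∉ tsupport P.χ → Φ e = e := fun e he => by rw [hΦ, shift_of_notMem he]
  have hK' : ∀ e, e ∉ tsupport P.χ → Φ.symm e = e := fun e he => by
    rw [Φ.symm_apply_eq, hK e he]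
  have ht : MapsTo Φ P.φ.target P.φ.target := by
    rw [hfun]
    exact h.mapsTo_target
  have ht' : MapsTo Φ.symm P.φ.target P.φ.target := by
    intro e he
    by_cases hs : e ∈ tsupport P.χ
    · refine P.χ_subset (h.shift_mem_tsupport_iff.mp ?_)
      rwa [← hΦ, Φ.apply_symm_apply]
    · rwa [hK' e hs]
  refine ⟨chartExtendHomeomorph P.slice.diffeo Φ hΦs hΦs' P.χ_compact P.χ_subset hK ht ht',
    fun z => ?_, contMDiff_chartExtend P.slice.diffeo hΦs P.χ_compact P.χ_subset hK ht,
    contMDiff_chartExtend P.slice.diffeo hΦs' P.χ_compact P.χ_subset hK' ht'⟩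
  change chartExtend P.φ Φ z = P.push t z
  rw [hfun]
  rfl

theorem contMDiff_push : ContMDiff (𝓡 n) (𝓡 n) ∞ (P.push t) := by
  obtain ⟨Ψ, hΨ, hs, -⟩ := h.exists_homeomorph_push
  rwa [show (Ψ : O.Obj → O.Obj) = P.push t from funext hΨ] at hs

end IsDiffeoShift

/-- The perturbation on morphisms: it preserves the sections `s γ`. -/
noncomputable def pushMor (P : LinearPatch O k X r) (t : Fin r → ℝ) (h : O.Mor) : O.Mor :=
  open Classical in
  if hh : O.gr.src h ∈ P.φ.source ∧ O.gr.tgt h ∈ P.φ.source then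
    P.s (P.exists_s h hh.1 hh.2).choose (P.push t (O.gr.src h)) else h

theorem pushMor_s (t : Fin r → ℝ) (γ : P.Γ) {u : O.Obj} (hu : u ∈ P.φ.source) :
    P.pushMor t (P.s γ u) = P.s γ (P.push t u) := by
  have hh : O.gr.src (P.s γ u) ∈ P.φ.source ∧ O.gr.tgt (P.s γ u) ∈ P.φ.source :=
    ⟨by rwa [P.src_s γ u hu], P.tgt_mem γ u hu⟩
  rw [pushMor, dif_pos hh]
  have h1 := (P.exists_s _ hh.1 hh.2).choose_spec
  have h2 : (P.exists_s _ hh.1 hh.2).choose = γ := by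
    exact P.s_injective u hu _ _ ((congrArg (P.s _) (P.src_s γ u hu)).symm.trans h1)
  exact congrArg₂ (fun δ v => P.s δ (P.push t v)) h2 (P.src_s γ u hu)

theorem exists_s_eq {h : O.Mor} (hs : O.gr.src h ∈ P.φ.source) (ht : O.gr.tgt h ∈ P.φ.source) :
    ∃ γ, ∃ u ∈ P.φ.source, P.s γ u = h :=
  let ⟨γ, hγ⟩ := P.exists_s h hs ht
  ⟨γ, _, hs, hγ⟩

theorem pushMor_of_notMem (t : Fin r → ℝ) {h : O.Mor} (hh : O.gr.src h ∉ P.satSupp) :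
    P.pushMor t h = h := by
  by_cases hst : O.gr.src h ∈ P.φ.source ∧ O.gr.tgt h ∈ P.φ.source
  · obtain ⟨γ, u, hu, rfl⟩ := exists_s_eq hst.1 hst.2
    rw [P.src_s γ u hu] at hh
    rw [pushMor_s t γ hu, push_of_notMem_supp t fun hc => hh (supp_subset_satSupp hc)]
  · rw [pushMor, dif_neg hst]

/-- Morphisms between objects of the domain of the perturbation either avoid its support, or belong
to one of the sections. -/
theorem mor_cases {h : O.Mor} (hs : O.gr.src h ∈ P.dom) (ht : O.gr.tgt h ∈ P.dom) :
    (O.gr.src h ∉ P.satSupp ∧ O.gr.tgt h ∉ P.satSupp) ∨ ∃ γ, ∃ u ∈ P.φ.source, P.s γ u = h := by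
  by_cases hh : O.gr.src h ∈ P.satSupp
  · exact Or.inr (exists_s_eq (mem_source_of_mem_dom hs hh)
      (mem_source_of_mem_dom ht ((src_mem_satSupp_iff h).mp hh)))
  · exact Or.inl ⟨hh, fun hc => hh ((src_mem_satSupp_iff h).mpr hc)⟩

theorem push_of_notMem_satSupp (t : Fin r → ℝ) {z : O.Obj} (hz : z ∉ P.satSupp) :
    P.push t z = z := push_of_notMem_supp t fun hc => hz (supp_subset_satSupp hc)

namespace IsDiffeoShift

variable {t : Fin r → ℝ} (h : P.IsDiffeoShift t)
include h

theorem src_pushMor {g : O.Mor} (hs : O.gr.src g ∈ P.dom) (ht : O.gr.tgt g ∈ P.dom) :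
    O.gr.src (P.pushMor t g) = P.push t (O.gr.src g) := by
  rcases mor_cases hs ht with hg | ⟨γ, u, hu, rfl⟩
  · rw [pushMor_of_notMem t hg.1, push_of_notMem_satSupp t hg.1]
  · rw [pushMor_s t γ hu, P.src_s γ _ (h.push_mem_source hu), P.src_s γ u hu]

theorem tgt_pushMor {g : O.Mor} (hs : O.gr.src g ∈ P.dom) (ht : O.gr.tgt g ∈ P.dom) :
    O.gr.tgt (P.pushMor t g) = P.push t (O.gr.tgt g) := by
  rcases mor_cases hs ht with hg | ⟨γ, u, hu, rfl⟩
  · rw [pushMor_of_notMem t hg.1, push_of_notMem_satSupp t hg.2]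
  · rw [pushMor_s t γ hu, h.push_tgt_s γ hu]

/-- Functoriality: if the morphisms meet the support of the perturbation, they belong to sections
`s γ`, which are composed by the rule `s_mul`. -/
theorem pushMor_comp {g f : O.Mor} (hgf : O.gr.src g = O.gr.tgt f) (hf : O.gr.src f ∈ P.dom)
    (hft : O.gr.tgt f ∈ P.dom) (hg : O.gr.tgt g ∈ P.dom) :
    P.pushMor t (O.gr.comp g f) = O.gr.comp (P.pushMor t g) (P.pushMor t f) := by
  by_cases hs : O.gr.src f ∈ P.satSupp
  · have h1 := (src_mem_satSupp_iff f).mp hs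
    have h2 := h1
    rw [← hgf, src_mem_satSupp_iff] at h2
    obtain ⟨γ, u, hu, rfl⟩ := exists_s_eq (mem_source_of_mem_dom hf hs)
      (mem_source_of_mem_dom hft h1)
    have hv := P.tgt_mem γ u hu
    obtain ⟨δ, v, hv', rfl⟩ := exists_s_eq (h := g) (hgf ▸ hv) (mem_source_of_mem_dom hg h2)
    rw [P.src_s δ v hv'] at hgf
    subst hgf
    rw [P.s_mul δ γ u hu, pushMor_s t _ hu, pushMor_s t _ hu, pushMor_s t _ hv, h.push_tgt_s γ hu,
      P.s_mul δ γ _ (h.push_mem_source hu)]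
  · have h1 := hs
    rw [src_mem_satSupp_iff, ← hgf] at h1
    rw [pushMor_of_notMem t hs, pushMor_of_notMem t h1, pushMor_of_notMem]
    rwa [O.gr.src_comp g f hgf]

theorem continuousOn_pushMor [T2Space O.gr.Orbit] :
    ContinuousOn (P.pushMor t) {g | O.gr.src g ∈ P.dom ∧ O.gr.tgt g ∈ P.dom} := by
  intro g hg
  refine ContinuousAt.continuousWithinAt ?_
  by_cases hs : O.gr.src g ∈ P.satSupp
  · obtain ⟨γ, u, hu, rfl⟩ := exists_s_eq (mem_source_of_mem_dom hg.1 hs)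
      (mem_source_of_mem_dom hg.2 ((src_mem_satSupp_iff g).mp hs))
    -- near `s γ u` all morphisms belong to the section `s γ`
    have hsrc : ContinuousAt O.gr.src (P.s γ u) := O.continuous_src.continuousAt
    have hc : ContinuousAt (P.s γ) u := (P.continuousOn_s γ).continuousAt
      (P.φ.open_source.mem_nhds hu)
    have hc' : ContinuousAt (fun g => P.s γ (O.gr.src g)) (P.s γ u) :=
      ContinuousAt.comp (f := O.gr.src) (by rwa [P.src_s γ u hu]) hsrc
    have hev : ∀ᶠ g in 𝓝 (P.s γ u), O.gr.src g ∈ P.φ.source ∧ P.s γ (O.gr.src g) = g := by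
      have hN := O.biNhd_mem_nhds (P.s γ u)
      have h1 : ∀ᶠ g in 𝓝 (P.s γ u), P.s γ (O.gr.src g) ∈ O.biNhd (P.s γ u) :=
        hc' (by
          change O.biNhd (P.s γ u) ∈ 𝓝 (P.s γ (O.gr.src (P.s γ u)))
          rwa [P.src_s γ u hu])
      have h2 : ∀ᶠ g in 𝓝 (P.s γ u), O.gr.src g ∈ P.φ.source :=
        hsrc (P.φ.open_source.mem_nhds (by rwa [P.src_s γ u hu]))
      filter_upwards [h1, h2, hN] with g h1 h2 h3
      refine ⟨h2, ?_⟩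
      rw [← EpGroupoid.sec_src h1, P.src_s γ _ h2, EpGroupoid.sec_src h3]
    have hp := h.contMDiff_push.continuous
    have h3 : ContinuousAt (fun g => P.s γ (P.push t (O.gr.src g))) (P.s γ u) := by
      refine ContinuousAt.comp (f := fun g => P.push t (O.gr.src g)) ?_
        (hp.comp O.continuous_src).continuousAt
      rw [P.src_s γ u hu]
      exact (P.continuousOn_s γ).continuousAt (P.φ.open_source.mem_nhds (h.push_mem_source hu))
    refine h3.congr ?_
    filter_upwards [hev] with g hg
    rw [← pushMor_s t γ hg.1, hg.2]
  · refine continuousAt_id.congr ?_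
    filter_upwards [(isClosed_satSupp.isOpen_compl.preimage O.continuous_src).mem_nhds hs]
      with g' hg'
    exact (pushMor_of_notMem t hg').symm

theorem existsUnique_pushMor {z z' : O.Obj} (hz : z ∈ P.dom) (hz' : z' ∈ P.dom) {g : O.Mor}
    (hs : O.gr.src g = P.push t z) (ht : O.gr.tgt g = P.push t z') :
    ∃! f, O.gr.src f = z ∧ O.gr.tgt f = z' ∧ P.pushMor t f = g := by
  by_cases hzs : z ∈ P.satSupp
  · have h1 : z ∈ P.φ.source := mem_source_of_mem_dom hz hzs
    have h2 : z' ∈ P.satSupp := by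
      rwa [← h.push_mem_satSupp_iff hz', ← ht, ← src_mem_satSupp_iff, hs,
        h.push_mem_satSupp_iff hz]
    have h3 : z' ∈ P.φ.source := mem_source_of_mem_dom hz' h2
    obtain ⟨γ, hγ⟩ := P.exists_s g (hs ▸ h.push_mem_source h1) (ht ▸ h.push_mem_source h3)
    rw [hs] at hγ
    obtain ⟨Ψ, hΨ, -, -⟩ := h.exists_homeomorph_push
    refine ⟨P.s γ z, ⟨P.src_s γ z h1, Ψ.injective ?_, ?_⟩, ?_⟩
    · rw [hΨ, hΨ, h.push_tgt_s γ h1, hγ, ht]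
    · rw [pushMor_s t γ h1, hγ]
    · rintro f ⟨rfl, rfl, hf⟩
      obtain ⟨δ, hδ⟩ := P.exists_s f h1 h3
      rw [← hδ, pushMor_s t δ h1, ← hγ] at hf
      rw [← P.s_injective _ (h.push_mem_source h1) δ γ hf, hδ]
  · have h2 : z' ∉ P.satSupp := by
      rwa [← h.push_mem_satSupp_iff hz', ← ht, ← src_mem_satSupp_iff, hs,
        h.push_mem_satSupp_iff hz]
    rw [push_of_notMem_satSupp t hzs] at hs
    rw [push_of_notMem_satSupp t h2] at ht
    refine ⟨g, ⟨hs, ht, pushMor_of_notMem t (by rwa [hs])⟩, ?_⟩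
    rintro f ⟨hfs, -, hf⟩
    rwa [pushMor_of_notMem t (by rwa [hfs])] at hf

end IsDiffeoShift

end LinearPatch

/-! ### Generalised automorphisms of ep-groupoids -/

namespace GroupoidOn

variable {Ob : Type a} {Mo : Type b} (G : GroupoidOn Ob Mo)

/-- The composite `q h p⁻¹`. -/
def conj (p q h : Mo) : Mo := G.comp (G.comp q h) (G.inv p)

variable {G} {p q h : Mo}

theorem src_conj (hp : G.src p = G.src h) (hq : G.src q = G.tgt h) :
    G.src (G.conj p q h) = G.tgt p := by
  rw [conj, G.src_comp _ _ (by rw [G.src_comp _ _ hq, G.tgt_inv, hp]), G.src_inv]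

theorem tgt_conj (hp : G.src p = G.src h) (hq : G.src q = G.tgt h) :
    G.tgt (G.conj p q h) = G.tgt q := by
  rw [conj, G.tgt_comp _ _ (by rw [G.src_comp _ _ hq, G.tgt_inv, hp]), G.tgt_comp _ _ hq]

theorem conj_comp {r g f : Mo} (hgf : G.src g = G.tgt f) (hp : G.src p = G.src f)
    (hq : G.src q = G.tgt f) (hr : G.src r = G.tgt g) :
    G.conj p r (G.comp g f) = G.comp (G.conj q r g) (G.conj p q f) := by
  have h1 : G.src (G.comp r g) = G.tgt f := by rw [G.src_comp _ _ hr, hgf]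
  have h2 : G.src (G.comp q f) = G.tgt (G.inv p) := by rw [G.src_comp _ _ hq, G.tgt_inv, hp]
  have h3 : G.src (G.comp r g) = G.tgt (G.inv q) := by rw [h1, G.tgt_inv, hq]
  have h4 : G.src (G.comp (G.comp r g) (G.inv q)) = G.tgt (G.comp q f) := by
    rw [G.src_comp _ _ h3, G.src_inv, G.tgt_comp _ _ hq]
  rw [conj, conj, conj, ← G.comp_assoc _ _ _ h4 h2,
    G.comp_assoc _ _ (G.comp q f) h3 (by rw [G.src_inv, G.tgt_comp _ _ hq]),
    G.inv_comp_comp_cancel hq, G.comp_assoc _ _ _ hr hgf]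

theorem conj_injective {h' : Mo} (hp : G.src p = G.src h) (hq : G.src q = G.tgt h)
    (hp' : G.src p = G.src h') (hq' : G.src q = G.tgt h') (he : G.conj p q h = G.conj p q h') :
    h = h' := by
  refine G.comp_left_cancel hq hq' (G.comp_right_cancel ?_ ?_ he)
  · rw [G.src_comp _ _ hq, G.tgt_inv, hp]
  · rw [G.src_comp _ _ hq', G.tgt_inv, hp']

theorem exists_conj_eq {g : Mo} (hs : G.src g = G.tgt p) (ht : G.tgt g = G.tgt q) :
    ∃ h, G.src h = G.src p ∧ G.tgt h = G.src q ∧ G.conj p q h = g := by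
  have h1 : G.src (G.inv q) = G.tgt g := by rw [G.src_inv, ht]
  have h2 : G.src (G.comp (G.inv q) g) = G.tgt p := by rw [G.src_comp _ _ h1, hs]
  refine ⟨G.comp (G.comp (G.inv q) g) p, G.src_comp _ _ h2, ?_, ?_⟩
  · rw [G.tgt_comp _ _ h2, G.tgt_comp _ _ h1, G.tgt_inv]
  · rw [conj, G.comp_assoc _ _ _ h1 hs, G.comp_inv_comp_cancel' (by rw [G.tgt_comp _ _ hs, ht]),
      G.comp_inv_comp_cancel hs]

end GroupoidOn

/-- A generalised automorphism of an ep-groupoid, as a cocycle: an open cover of the object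
manifold by the sources of partial diffeomorphisms `G i`, and maps `μ i j` on the morphisms from
the source of `G i` to the source of `G j` which are compatible with composition, such that the
whole is fully faithful.  It induces a self-map `orb` of the orbit space, which is required to be
homotopic to the identity. -/
structure CocycleAut {n : ℕ} (O : EpGroupoid.{a, b} n) where
  ι : Type b
  G : ι → OpenPartialHomeomorph O.Obj O.Obj
  μ : ι → ι → O.Mor → O.Mor
  orb : C(O.gr.Orbit, O.gr.Orbit)
  diffeo : ∀ i, IsPartialDiffeo (E := EuclideanSpace ℝ (Fin n)) (G i)
  cover : ∀ z, ∃ i, z ∈ (G i).source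
  src_μ : ∀ i j h, O.gr.src h ∈ (G i).source → O.gr.tgt h ∈ (G j).source →
    O.gr.src (μ i j h) = G i (O.gr.src h)
  tgt_μ : ∀ i j h, O.gr.src h ∈ (G i).source → O.gr.tgt h ∈ (G j).source →
    O.gr.tgt (μ i j h) = G j (O.gr.tgt h)
  comp_μ : ∀ i j l g f, O.gr.src g = O.gr.tgt f → O.gr.src f ∈ (G i).source →
    O.gr.tgt f ∈ (G j).source → O.gr.tgt g ∈ (G l).source →
    μ i l (O.gr.comp g f) = O.gr.comp (μ j l g) (μ i j f)
  continuousOn_μ : ∀ i j, ContinuousOn (μ i j)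
    {h | O.gr.src h ∈ (G i).source ∧ O.gr.tgt h ∈ (G j).source}
  existsUnique_μ : ∀ i j, ∀ z ∈ (G i).source, ∀ z' ∈ (G j).source, ∀ g,
    O.gr.src g = G i z → O.gr.tgt g = G j z' →
    ∃! h, O.gr.src h = z ∧ O.gr.tgt h = z' ∧ μ i j h = g
  orb_proj : ∀ i, ∀ z ∈ (G i).source, orb (O.gr.proj z) = O.gr.proj (G i z)
  homotopic : (ContinuousMap.id O.gr.Orbit).Homotopic orb

namespace CocycleAut

variable {n : ℕ} {O : EpGroupoid.{a, b} n}

variable (O) in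
/-- The identity. -/
noncomputable def refl : CocycleAut O where
  ι := PUnit
  G _ := OpenPartialHomeomorph.refl _
  μ _ _ h := h
  orb := ContinuousMap.id _
  diffeo _ := .refl
  cover _ := ⟨⟨⟩, mem_univ _⟩
  src_μ _ _ _ _ _ := rfl
  tgt_μ _ _ _ _ _ := rfl
  comp_μ _ _ _ _ _ _ _ _ _ := rfl
  continuousOn_μ _ _ := continuousOn_id
  existsUnique_μ := by
    rintro - - z - z' - g hs ht
    exact ⟨g, ⟨hs, ht, rfl⟩, fun h hh => hh.2.2⟩
  orb_proj _ _ _ := rfl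
  homotopic := .refl _

/-- The composite of generalised automorphisms, first `Φ`, then `Ψ`. -/
noncomputable def trans (Φ Ψ : CocycleAut O) : CocycleAut O where
  ι := Φ.ι × Ψ.ι
  G i := (Φ.G i.1).trans (Ψ.G i.2)
  μ i j h := Ψ.μ i.2 j.2 (Φ.μ i.1 j.1 h)
  orb := Ψ.orb.comp Φ.orb
  diffeo i := (Φ.diffeo i.1).trans (Ψ.diffeo i.2)
  cover z := by
    obtain ⟨i, hi⟩ := Φ.cover z
    obtain ⟨j, hj⟩ := Ψ.cover (Φ.G i z)
    exact ⟨(i, j), hi, hj⟩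
  src_μ i j h hs ht := by
    have h1 := Φ.src_μ i.1 j.1 h hs.1 ht.1
    have h2 := Φ.tgt_μ i.1 j.1 h hs.1 ht.1
    rw [Ψ.src_μ i.2 j.2 _ (h1 ▸ hs.2) (h2 ▸ ht.2), h1]
    rfl
  tgt_μ i j h hs ht := by
    have h1 := Φ.src_μ i.1 j.1 h hs.1 ht.1
    have h2 := Φ.tgt_μ i.1 j.1 h hs.1 ht.1
    rw [Ψ.tgt_μ i.2 j.2 _ (h1 ▸ hs.2) (h2 ▸ ht.2), h2]
    rfl
  comp_μ i j l g f hgf hi hj hl := by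
    have hj' : O.gr.src g ∈ (Φ.G j.1).source := hgf ▸ hj.1
    have h1 := Φ.src_μ i.1 j.1 f hi.1 hj.1
    have h2 := Φ.tgt_μ i.1 j.1 f hi.1 hj.1
    have h3 := Φ.src_μ j.1 l.1 g hj' hl.1
    have h4 := Φ.tgt_μ j.1 l.1 g hj' hl.1
    rw [Φ.comp_μ i.1 j.1 l.1 g f hgf hi.1 hj.1 hl.1, Ψ.comp_μ i.2 j.2 l.2 _ _ (by rw [h2, h3, hgf])
      (h1 ▸ hi.2) (h2 ▸ hj.2) (h4 ▸ hl.2)]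
  continuousOn_μ i j := by
    refine (Ψ.continuousOn_μ i.2 j.2).comp ((Φ.continuousOn_μ i.1 j.1).mono
      fun h hh => ⟨hh.1.1, hh.2.1⟩) fun h hh => ⟨?_, ?_⟩
    · rw [Φ.src_μ i.1 j.1 h hh.1.1 hh.2.1]
      exact hh.1.2
    · rw [Φ.tgt_μ i.1 j.1 h hh.1.1 hh.2.1]
      exact hh.2.2
  existsUnique_μ i j z hz z' hz' g hs ht := by
    obtain ⟨g', ⟨hs', ht', rfl⟩, hu'⟩ := Ψ.existsUnique_μ i.2 j.2 _ hz.2 _ hz'.2 g hs ht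
    obtain ⟨h, ⟨rfl, rfl, rfl⟩, hu⟩ := Φ.existsUnique_μ i.1 j.1 _ hz.1 _ hz'.1 g' hs' ht'
    refine ⟨h, ⟨rfl, rfl, rfl⟩, ?_⟩
    rintro f ⟨hfs, hft, hf⟩
    refine hu f ⟨hfs, hft, hu' _ ⟨?_, ?_, hf⟩⟩
    · rw [Φ.src_μ _ _ _ (hfs ▸ hz.1) (hft ▸ hz'.1), hfs]
      rfl
    · rw [Φ.tgt_μ _ _ _ (hfs ▸ hz.1) (hft ▸ hz'.1), hft]
      rfl
  orb_proj i z hz := by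
    rw [ContinuousMap.comp_apply, Φ.orb_proj i.1 z hz.1, Ψ.orb_proj i.2 (Φ.G i.1 z) hz.2]
    rfl
  homotopic := by
    have := Ψ.homotopic.comp Φ.homotopic
    rwa [ContinuousMap.id_comp] at this

variable (Ψ : CocycleAut O)

/-- The partial diffeomorphisms `G i` commute with transport along morphisms: `μ i j` maps the local
section of the source map through `g` to a local section, which is that through `μ i j g`. -/
theorem eventually_transport_G {i j : Ψ.ι} {g : O.Mor} (hs : O.gr.src g ∈ (Ψ.G i).source)
    (ht : O.gr.tgt g ∈ (Ψ.G j).source) : ∀ᶠ u in 𝓝 (O.gr.src g),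
      O.transport (Ψ.μ i j g) (Ψ.G i u) = Ψ.G j (O.transport g u) := by
  have hG : Ψ.G i (O.gr.src g) ∈ (Ψ.G i).target := (Ψ.G i).map_source hs
  have hinv : Tendsto (Ψ.G i).symm (𝓝 (Ψ.G i (O.gr.src g))) (𝓝 (O.gr.src g)) := by
    have := ((Ψ.G i).symm.continuousAt hG).tendsto
    rwa [(Ψ.G i).left_inv hs] at this
  have hsrc := EpGroupoid.src_mem_transport_self g
  have hsec : Tendsto (O.sec g) (𝓝 (O.gr.src g)) (𝓝 g) := by
    have := (EpGroupoid.continuousAt_sec hsrc).tendsto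
    rwa [EpGroupoid.sec_src_self] at this
  have htr : Tendsto (O.transport g) (𝓝 (O.gr.src g)) (𝓝 (O.gr.tgt g)) := by
    have := ((O.transport g).continuousAt hsrc).tendsto
    rwa [EpGroupoid.transport_src_self] at this
  have hev : ∀ᶠ u in 𝓝 (O.gr.src g), u ∈ (O.transport g).source ∧ u ∈ (Ψ.G i).source ∧
      O.transport g u ∈ (Ψ.G j).source :=
    ((O.transport g).open_source.eventually_mem hsrc).and
      (((Ψ.G i).open_source.eventually_mem hs).and
        (htr.eventually ((Ψ.G j).open_source.eventually_mem ht)))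
  have hμsrc : ∀ u, u ∈ (O.transport g).source ∧ u ∈ (Ψ.G i).source ∧
      O.transport g u ∈ (Ψ.G j).source → O.gr.src (Ψ.μ i j (O.sec g u)) = Ψ.G i u ∧
        O.gr.tgt (Ψ.μ i j (O.sec g u)) = Ψ.G j (O.transport g u) := by
    intro u hu
    have h1 := EpGroupoid.src_sec hu.1
    have h2 := EpGroupoid.tgt_sec hu.1
    rw [Ψ.src_μ i j _ (h1.symm ▸ hu.2.1) (h2.symm ▸ hu.2.2),
      Ψ.tgt_μ i j _ (h1.symm ▸ hu.2.1) (h2.symm ▸ hu.2.2), h1, h2]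
    exact ⟨rfl, rfl⟩
  have hN : ContinuousAt (Ψ.μ i j) g := (Ψ.continuousOn_μ i j).continuousAt
    ((((Ψ.G i).open_source.preimage O.continuous_src).inter
      ((Ψ.G j).open_source.preimage O.continuous_tgt)).mem_nhds ⟨hs, ht⟩)
  have key := EpGroupoid.eventually_eq_sec (O := O) (x := Ψ.G i (O.gr.src g))
    (σ := fun v => Ψ.μ i j (O.sec g ((Ψ.G i).symm v))) ?_ ?_
  · have hμg : Ψ.μ i j (O.sec g ((Ψ.G i).symm (Ψ.G i (O.gr.src g)))) = Ψ.μ i j g := by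
      rw [(Ψ.G i).left_inv hs, EpGroupoid.sec_src_self]
    rw [hμg] at key
    have hGc : Tendsto (Ψ.G i) (𝓝 (O.gr.src g)) (𝓝 (Ψ.G i (O.gr.src g))) :=
      (Ψ.G i).continuousAt hs
    filter_upwards [hGc.eventually key, hev, hGc.eventually
      (EpGroupoid.eventually_transport_mem (Ψ.src_μ i j g hs ht))] with u h1 h2 h3
    rw [(Ψ.G i).left_inv h2.2.1] at h1
    rw [← EpGroupoid.tgt_sec h3, ← h1, (hμsrc u h2).2]
  · have h1 : Tendsto (fun v => Ψ.μ i j (O.sec g ((Ψ.G i).symm v))) (𝓝 (Ψ.G i (O.gr.src g)))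
        (𝓝 (Ψ.μ i j g)) := hN.tendsto.comp (hsec.comp hinv)
    have h2 : Ψ.μ i j (O.sec g ((Ψ.G i).symm (Ψ.G i (O.gr.src g)))) = Ψ.μ i j g := by
      rw [(Ψ.G i).left_inv hs, EpGroupoid.sec_src_self]
    rw [ContinuousAt, h2]
    exact h1
  · filter_upwards [hinv.eventually hev, (Ψ.G i).open_target.mem_nhds hG] with v hv hvt
    rw [(hμsrc _ hv).1, (Ψ.G i).right_inv hvt]

theorem tderiv_transport_comp_G {i j : Ψ.ι} {g : O.Mor} (hs : O.gr.src g ∈ (Ψ.G i).source)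
    (ht : O.gr.tgt g ∈ (Ψ.G j).source) :
    (tderiv (EuclideanSpace ℝ (Fin n)) (EuclideanSpace ℝ (Fin n)) (O.transport (Ψ.μ i j g))
        (Ψ.G i (O.gr.src g))).comp
      (tderiv (EuclideanSpace ℝ (Fin n)) (EuclideanSpace ℝ (Fin n)) (Ψ.G i) (O.gr.src g)) =
      (tderiv (EuclideanSpace ℝ (Fin n)) (EuclideanSpace ℝ (Fin n)) (Ψ.G j) (O.gr.tgt g)).comp
        (tderiv (EuclideanSpace ℝ (Fin n)) (EuclideanSpace ℝ (Fin n)) (O.transport g)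
          (O.gr.src g)) := by
  have h1 := tderiv_comp (E := EuclideanSpace ℝ (Fin n)) (E' := EuclideanSpace ℝ (Fin n))
    (E'' := EuclideanSpace ℝ (Fin n)) (x := O.gr.src g)
    ((O.isPartialDiffeo_transport (Ψ.μ i j g)).mdifferentiableAt (x := Ψ.G i (O.gr.src g)) (by
      rw [← Ψ.src_μ i j g hs ht]
      exact EpGroupoid.src_mem_transport_self _))
    ((Ψ.diffeo i).mdifferentiableAt hs)
  have h2 := tderiv_comp (E := EuclideanSpace ℝ (Fin n)) (E' := EuclideanSpace ℝ (Fin n))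
    (E'' := EuclideanSpace ℝ (Fin n)) (x := O.gr.src g)
    ((Ψ.diffeo j).mdifferentiableAt (x := O.transport g (O.gr.src g)) (by
      rwa [EpGroupoid.transport_src_self]))
    ((O.isPartialDiffeo_transport g).mdifferentiableAt (EpGroupoid.src_mem_transport_self g))
  rw [EpGroupoid.transport_src_self] at h2
  rw [← h1, ← h2]
  exact tderiv_congr (Ψ.eventually_transport_G hs ht)

end CocycleAut

namespace LinearPatch

variable {n : ℕ} {O : EpGroupoid.{a, b} n} {k r : ℕ} {X : Set O.Obj} {P : LinearPatch O k X r}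

/-- The self-map of the orbit space which is induced by `push`. -/
noncomputable def orbMap (P : LinearPatch O k X r) (t : Fin r → ℝ) (y : O.gr.Orbit) : O.gr.Orbit :=
  O.gr.proj (P.push t (O.gr.tgt (P.exists_mem_dom (O.gr.proj_surjective y).choose).choose))

theorem IsDiffeoShift.orbMap_proj {t : Fin r → ℝ} (h : P.IsDiffeoShift t) {z : O.Obj}
    (hz : z ∈ P.dom) : P.orbMap t (O.gr.proj z) = O.gr.proj (P.push t z) := by
  set z₁ := (O.gr.proj_surjective (O.gr.proj z)).choose with hz₁
  have h1 : O.gr.proj z₁ = O.gr.proj z := (O.gr.proj_surjective (O.gr.proj z)).choose_spec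
  have h2 := (P.exists_mem_dom z₁).choose_spec
  set g := (P.exists_mem_dom z₁).choose with hg
  have h3 : O.gr.proj (O.gr.tgt g) = O.gr.proj z := by
    rw [← O.gr.proj_src_eq_proj_tgt, h2.1, h1]
  obtain ⟨f, hf, rfl⟩ := O.gr.proj_eq_iff.mp h3
  change O.gr.proj (P.push t (O.gr.tgt g)) = _
  rw [← hf, ← h.src_pushMor (hf ▸ h2.2) hz, O.gr.proj_src_eq_proj_tgt,
    h.tgt_pushMor (hf ▸ h2.2) hz]

theorem exists_mem_dom_proj (P : LinearPatch O k X r) (y : O.gr.Orbit) :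
    ∃ z ∈ P.dom, O.gr.proj z = y := by
  obtain ⟨z, rfl⟩ := O.gr.proj_surjective y
  obtain ⟨g, rfl, hg⟩ := P.exists_mem_dom z
  exact ⟨_, hg, (O.gr.proj_src_eq_proj_tgt g).symm⟩

theorem IsSmall.continuous_push {t : Fin r → ℝ} (h : P.IsSmall t) :
    Continuous fun p : unitInterval × O.Obj => P.push ((p.1 : ℝ) • t) p.2 := by
  rw [continuous_iff_continuousAt]
  rintro ⟨τ, z⟩
  by_cases hz : z ∈ P.φ.source
  · have h1 : ContinuousAt (fun p : unitInterval × O.Obj =>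
        P.shift ((p.1 : ℝ) • t) (P.φ p.2)) (τ, z) := by
      have hφ : ContinuousAt (fun p : unitInterval × O.Obj => P.φ p.2) (τ, z) :=
        ContinuousAt.comp (f := Prod.snd) (P.φ.continuousAt hz) continuousAt_snd
      have hτ : ContinuousAt (fun p : unitInterval × O.Obj => P.j ((p.1 : ℝ) • t)) (τ, z) := by
        fun_prop
      exact hφ.add ((P.χ_smooth.continuous.continuousAt.comp' hφ).smul hτ)
    have h2 : ContinuousAt (fun p : unitInterval × O.Obj =>
        P.φ.symm (P.shift ((p.1 : ℝ) • t) (P.φ p.2))) (τ, z) := by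
      refine ContinuousAt.comp (g := P.φ.symm) (P.φ.symm.continuousAt ?_) h1
      exact (h.isDiffeoShift τ.2).mapsTo_target (P.φ.map_source hz)
    refine h2.congr ?_
    filter_upwards [continuousAt_snd (P.φ.open_source.mem_nhds hz)] with p hp
    exact (push_of_mem _ hp).symm
  · refine (continuousAt_snd (p := (τ, z))).congr ?_
    filter_upwards [continuousAt_snd (isCompact_supp.isClosed.isOpen_compl.mem_nhds
      fun hc => hz (supp_subset hc))] with p hp
    exact (push_of_notMem_supp _ hp).symm

theorem IsSmall.continuous_orbMap [T2Space O.gr.Orbit] {t : Fin r → ℝ} (h : P.IsSmall t) :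
    Continuous fun p : unitInterval × O.gr.Orbit => P.orbMap ((p.1 : ℝ) • t) p.2 := by
  let π : unitInterval × P.dom → unitInterval × O.gr.Orbit :=
    Prod.map id fun z : P.dom => O.gr.proj z
  have hπ : IsQuotientMap π := by
    refine IsOpenMap.isQuotientMap (IsOpenMap.id.prodMap ?_) ?_ ?_
    · exact O.isOpenMap_proj.comp isOpen_dom.isOpenEmbedding_subtypeVal.isOpenMap
    · exact continuous_id.prodMap (O.gr.continuous_proj.comp continuous_subtype_val)
    · rintro ⟨τ, y⟩
      obtain ⟨z, hz, rfl⟩ := P.exists_mem_dom_proj y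
      exact ⟨(τ, ⟨z, hz⟩), rfl⟩
  rw [hπ.continuous_iff]
  have h1 : (fun p : unitInterval × O.gr.Orbit => P.orbMap ((p.1 : ℝ) • t) p.2) ∘ π =
      fun p => O.gr.proj (P.push ((p.1 : ℝ) • t) p.2) := by
    funext p
    exact (h.isDiffeoShift p.1.2).orbMap_proj p.2.2
  rw [h1]
  exact O.gr.continuous_proj.comp (h.continuous_push.comp
    (continuous_fst.prodMk (continuous_subtype_val.comp continuous_snd)))

theorem orbMap_zero (P : LinearPatch O k X r) (y : O.gr.Orbit) : P.orbMap 0 y = y := by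
  have h0 : P.IsDiffeoShift 0 := ⟨Homeomorph.refl _, fun e => by simp [shift], contDiff_id,
    contDiff_id⟩
  obtain ⟨z, hz, rfl⟩ := P.exists_mem_dom_proj y
  rw [h0.orbMap_proj hz, push, chartExtend_of_fixed]
  intro _
  simp [shift]

/-- `push`, as a partial homeomorphism with source `dom`. -/
noncomputable def IsSmall.pushHomeomorph [T2Space O.gr.Orbit] {t : Fin r → ℝ} (h : P.IsSmall t) :
    OpenPartialHomeomorph O.Obj O.Obj :=
  (h.isDiffeoShift_one.exists_homeomorph_push.choose.toOpenPartialHomeomorph).restrOpen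
    P.dom isOpen_dom

theorem IsSmall.pushHomeomorph_apply [T2Space O.gr.Orbit] {t : Fin r → ℝ} (h : P.IsSmall t)
    (z : O.Obj) : h.pushHomeomorph z = P.push t z :=
  h.isDiffeoShift_one.exists_homeomorph_push.choose_spec.1 z

theorem IsSmall.pushHomeomorph_source [T2Space O.gr.Orbit] {t : Fin r → ℝ} (h : P.IsSmall t) :
    h.pushHomeomorph.source = P.dom := by
  rw [pushHomeomorph, OpenPartialHomeomorph.restrOpen_source]
  exact univ_inter _

theorem IsSmall.isPartialDiffeo_pushHomeomorph [T2Space O.gr.Orbit] {t : Fin r → ℝ}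
    (h : P.IsSmall t) :
    IsPartialDiffeo (E := EuclideanSpace ℝ (Fin n)) h.pushHomeomorph := by
  have hs := h.isDiffeoShift_one.exists_homeomorph_push.choose_spec.2
  refine IsPartialDiffeo.restrOpen ?_ _ _
  exact ⟨hs.1.contMDiffOn, hs.2.contMDiffOn⟩

/-- The generalised automorphism which the perturbation by `t` defines: it is indexed by the
morphisms `g` with target in `dom` (for other `g` the source of `G g` may be empty), and `G g` is
transport along `g` followed by `push`.  On morphisms `f`, the map `μ g g'` is conjugation by the
local sections through `g` and `g'`, which leads to a morphism between objects of `dom`, followed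
by `pushMor`. -/
noncomputable def IsSmall.cocycleAut [T2Space O.gr.Orbit] {t : Fin r → ℝ} (h : P.IsSmall t) :
    CocycleAut O where
  ι := O.Mor
  G g := (O.transport g).trans h.pushHomeomorph
  μ g g' f := P.pushMor t
    (O.gr.conj (O.sec g (O.gr.src f)) (O.sec g' (O.gr.tgt f)) f)
  orb := ⟨P.orbMap t, by
    have h1 : Continuous fun y : O.gr.Orbit => ((1 : unitInterval), y) :=
      continuous_const.prodMk continuous_id
    have h2 := h.continuous_orbMap.comp h1
    simpa [Function.comp_def] using h2⟩
  diffeo g := (O.isPartialDiffeo_transport g).trans h.isPartialDiffeo_pushHomeomorph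
  cover z := by
    obtain ⟨g, rfl, hg⟩ := P.exists_mem_dom z
    refine ⟨g, EpGroupoid.src_mem_transport_self g, ?_⟩
    change O.transport g (O.gr.src g) ∈ h.pushHomeomorph.source
    rwa [EpGroupoid.transport_src_self, h.pushHomeomorph_source]
  src_μ i j f hs ht := by
    have hs1 := EpGroupoid.src_sec hs.1
    have ht1 := EpGroupoid.src_sec ht.1
    have hs2 : O.transport i (O.gr.src f) ∈ P.dom := h.pushHomeomorph_source ▸ hs.2
    have ht2 : O.transport j (O.gr.tgt f) ∈ P.dom := h.pushHomeomorph_source ▸ ht.2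
    have h1 : O.gr.src (O.gr.conj (O.sec i (O.gr.src f)) (O.sec j (O.gr.tgt f)) f) =
        O.transport i (O.gr.src f) := by
      rw [GroupoidOn.src_conj hs1 ht1, EpGroupoid.tgt_sec hs.1]
    have h2 : O.gr.tgt (O.gr.conj (O.sec i (O.gr.src f)) (O.sec j (O.gr.tgt f)) f) =
        O.transport j (O.gr.tgt f) := by
      rw [GroupoidOn.tgt_conj hs1 ht1, EpGroupoid.tgt_sec ht.1]
    rw [h.isDiffeoShift_one.src_pushMor (h1 ▸ hs2) (h2 ▸ ht2), h1]
    exact (h.pushHomeomorph_apply _).symm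
  tgt_μ i j f hs ht := by
    have hs1 := EpGroupoid.src_sec hs.1
    have ht1 := EpGroupoid.src_sec ht.1
    have hs2 : O.transport i (O.gr.src f) ∈ P.dom := h.pushHomeomorph_source ▸ hs.2
    have ht2 : O.transport j (O.gr.tgt f) ∈ P.dom := h.pushHomeomorph_source ▸ ht.2
    have h1 : O.gr.src (O.gr.conj (O.sec i (O.gr.src f)) (O.sec j (O.gr.tgt f)) f) =
        O.transport i (O.gr.src f) := by
      rw [GroupoidOn.src_conj hs1 ht1, EpGroupoid.tgt_sec hs.1]
    have h2 : O.gr.tgt (O.gr.conj (O.sec i (O.gr.src f)) (O.sec j (O.gr.tgt f)) f) =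
        O.transport j (O.gr.tgt f) := by
      rw [GroupoidOn.tgt_conj hs1 ht1, EpGroupoid.tgt_sec ht.1]
    rw [h.isDiffeoShift_one.tgt_pushMor (h1 ▸ hs2) (h2 ▸ ht2), h2]
    exact (h.pushHomeomorph_apply _).symm
  comp_μ i j l g f hgf hi hj hl := by
    have hi1 := EpGroupoid.src_sec hi.1
    have hj1 := EpGroupoid.src_sec hj.1
    have hl1 := EpGroupoid.src_sec hl.1
    have hi2 : O.transport i (O.gr.src f) ∈ P.dom := h.pushHomeomorph_source ▸ hi.2
    have hj2 : O.transport j (O.gr.tgt f) ∈ P.dom := h.pushHomeomorph_source ▸ hj.2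
    have hl2 : O.transport l (O.gr.tgt g) ∈ P.dom := h.pushHomeomorph_source ▸ hl.2
    rw [O.gr.src_comp g f hgf, O.gr.tgt_comp g f hgf,
      GroupoidOn.conj_comp (q := O.sec j (O.gr.tgt f)) hgf hi1 hj1 hl1, hgf]
    have hj1' : O.gr.src (O.sec j (O.gr.tgt f)) = O.gr.src g := hj1.trans hgf.symm
    refine h.isDiffeoShift_one.pushMor_comp ?_ ?_ ?_ ?_
    · rw [GroupoidOn.src_conj hj1' hl1, GroupoidOn.tgt_conj hi1 hj1]
    · rwa [GroupoidOn.src_conj hi1 hj1, EpGroupoid.tgt_sec hi.1]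
    · rwa [GroupoidOn.tgt_conj hi1 hj1, EpGroupoid.tgt_sec hj.1]
    · rwa [GroupoidOn.tgt_conj hj1' hl1, EpGroupoid.tgt_sec hl.1]
  continuousOn_μ i j := by
    refine h.isDiffeoShift_one.continuousOn_pushMor.comp
      (t := {g | O.gr.src g ∈ P.dom ∧ O.gr.tgt g ∈ P.dom}) ?_ ?_
    · have h1 : ContinuousOn (fun f => O.sec i (O.gr.src f)) {f | O.gr.src f ∈
          ((O.transport i).trans h.pushHomeomorph).source ∧ O.gr.tgt f ∈
          ((O.transport j).trans h.pushHomeomorph).source} :=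
        (EpGroupoid.continuousOn_sec i).comp O.continuous_src.continuousOn fun f hf => hf.1.1
      have h2 : ContinuousOn (fun f => O.sec j (O.gr.tgt f)) {f | O.gr.src f ∈
          ((O.transport i).trans h.pushHomeomorph).source ∧ O.gr.tgt f ∈
          ((O.transport j).trans h.pushHomeomorph).source} :=
        (EpGroupoid.continuousOn_sec j).comp O.continuous_tgt.continuousOn fun f hf => hf.2.1
      have h3 := O.continuousOn_comp.comp (h2.prodMk continuousOn_id)
        (fun f hf => EpGroupoid.src_sec hf.2.1)
      refine O.continuousOn_comp.comp (h3.prodMk (O.continuous_inv.comp_continuousOn h1)) ?_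
      intro f hf
      change O.gr.src (O.gr.comp (O.sec j (O.gr.tgt f)) f) = O.gr.tgt (O.gr.inv _)
      rw [O.gr.src_comp _ _ (EpGroupoid.src_sec hf.2.1), O.gr.tgt_inv, EpGroupoid.src_sec hf.1.1]
    · intro f hf
      have hs1 := EpGroupoid.src_sec hf.1.1
      have ht1 := EpGroupoid.src_sec hf.2.1
      refine ⟨?_, ?_⟩
      · rw [GroupoidOn.src_conj hs1 ht1, EpGroupoid.tgt_sec hf.1.1]
        exact h.pushHomeomorph_source ▸ hf.1.2
      · rw [GroupoidOn.tgt_conj hs1 ht1, EpGroupoid.tgt_sec hf.2.1]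
        exact h.pushHomeomorph_source ▸ hf.2.2
  existsUnique_μ i j z hz z' hz' g hs ht := by
    have hz1 : O.transport i z ∈ P.dom := h.pushHomeomorph_source ▸ hz.2
    have hz2 : O.transport j z' ∈ P.dom := h.pushHomeomorph_source ▸ hz'.2
    have hs' : O.gr.src g = P.push t (O.transport i z) := hs.trans (h.pushHomeomorph_apply _)
    have ht' : O.gr.tgt g = P.push t (O.transport j z') := ht.trans (h.pushHomeomorph_apply _)
    have e1 := EpGroupoid.src_sec hz.1
    have e2 := EpGroupoid.src_sec hz'.1
    have e3 := EpGroupoid.tgt_sec hz.1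
    have e4 := EpGroupoid.tgt_sec hz'.1
    obtain ⟨g', ⟨hg1, hg2, hg3⟩, hu⟩ := h.isDiffeoShift_one.existsUnique_pushMor hz1 hz2 hs' ht'
    obtain ⟨f, hf1, hf2, hf3⟩ := GroupoidOn.exists_conj_eq (G := O.gr) (g := g')
      (p := O.sec i z) (q := O.sec j z') (hg1.trans e3.symm) (hg2.trans e4.symm)
    rw [e1] at hf1
    rw [e2] at hf2
    refine ⟨f, ⟨hf1, hf2, ?_⟩, ?_⟩
    · simp only [hf1, hf2, hf3, hg3]
    · rintro f' ⟨hf1', hf2', hf3'⟩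
      simp only [hf1', hf2'] at hf3'
      refine GroupoidOn.conj_injective (G := O.gr) (p := O.sec i z) (q := O.sec j z')
        (e1.trans hf1'.symm) (e2.trans hf2'.symm) (e1.trans hf1.symm) (e2.trans hf2.symm) ?_
      rw [hf3]
      refine hu _ ⟨?_, ?_, hf3'⟩
      · rw [GroupoidOn.src_conj (e1.trans hf1'.symm) (e2.trans hf2'.symm), e3]
      · rw [GroupoidOn.tgt_conj (e1.trans hf1'.symm) (e2.trans hf2'.symm), e4]
  orb_proj g z hz := by
    have hz1 : O.transport g z ∈ P.dom := h.pushHomeomorph_source ▸ hz.2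
    change P.orbMap t (O.gr.proj z) = O.gr.proj (h.pushHomeomorph (O.transport g z))
    rw [h.pushHomeomorph_apply, ← h.isDiffeoShift_one.orbMap_proj hz1,
      EpGroupoid.proj_transport hz.1]
  homotopic := ⟨{
    toFun := fun p => P.orbMap ((p.1 : ℝ) • t) p.2
    continuous_toFun := h.continuous_orbMap
    map_zero_left := fun y => by
      simp [orbMap_zero]
    map_one_left := fun y => by
      simp }⟩

end LinearPatch

/-! ### Countability of the germs of morphisms -/

theorem IsOpen.isSigmaCompact {E : Type*} [TopologicalSpace E] [LocallyCompactSpace E]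
    [SecondCountableTopology E] {U : Set E} (hU : IsOpen U) : IsSigmaCompact U := by
  have : LocallyCompactSpace U := hU.locallyCompactSpace
  rw [isSigmaCompact_iff_sigmaCompactSpace]
  infer_instance

section Germs

variable {n : ℕ} {O : EpGroupoid.{a, b} n}

theorem EpGroupoid.tderiv_transport_eq {h h' : O.Mor} (hh : h' ∈ O.biNhd h) :
    tderiv (EuclideanSpace ℝ (Fin n)) (EuclideanSpace ℝ (Fin n)) (O.transport h) (O.gr.src h') =
      tderiv (EuclideanSpace ℝ (Fin n)) (EuclideanSpace ℝ (Fin n)) (O.transport h')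
        (O.gr.src h') := by
  have hs := src_mem_transport hh
  have hev : ∀ᶠ u in 𝓝 (O.gr.src h'), u ∈ (O.transport h).source :=
    (O.transport h).open_source.eventually_mem hs
  have key := eventually_eq_sec (continuousAt_sec hs) (hev.mono fun u hu => src_sec hu)
  rw [sec_src hh] at key
  refine tderiv_congr ?_
  filter_upwards [key, hev, eventually_transport_mem (h := h') rfl] with u h1 h2 h3
  rw [← tgt_sec h2, ← tgt_sec h3, h1]

/-- Countably many partial diffeomorphisms suffice to describe the composites of the cocycle of a
generalised automorphism, over a σ-compact set `U`, with the morphisms into a σ-compact set `V`: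
the spaces of morphisms between σ-compact sets are Lindelöf. -/
theorem CocycleAut.exists_countable_germs (Ψ : CocycleAut O) {U V : Set O.Obj}
    (hU : IsSigmaCompact U) (hV : IsSigmaCompact V) :
    ∃ T : Set (OpenPartialHomeomorph O.Obj O.Obj), T.Countable ∧
      (∀ Λ ∈ T, IsPartialDiffeo (E := EuclideanSpace ℝ (Fin n)) Λ) ∧
      ∀ y ∈ U, ∀ i, y ∈ (Ψ.G i).source → ∀ h, O.gr.src h = Ψ.G i y → O.gr.tgt h ∈ V →
        ∃ Λ ∈ T, y ∈ Λ.source ∧ Λ y = O.gr.tgt h ∧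
          tderiv (EuclideanSpace ℝ (Fin n)) (EuclideanSpace ℝ (Fin n)) Λ y =
            (tderiv (EuclideanSpace ℝ (Fin n)) (EuclideanSpace ℝ (Fin n)) (O.transport h)
              (Ψ.G i y)).comp
              (tderiv (EuclideanSpace ℝ (Fin n)) (EuclideanSpace ℝ (Fin n)) (Ψ.G i) y) := by
  choose i₀ hi₀ using Ψ.cover
  choose C hCn hCs hCc using fun y => local_compact_nhds ((Ψ.G (i₀ y)).open_source.mem_nhds (hi₀ y))
  obtain ⟨t, htc, -, htU⟩ := hU.isLindelof.elim_nhds_subcover C fun y _ => hCn y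
  have hA : ∀ y, IsLindelof {h : O.Mor | O.gr.src h ∈ Ψ.G (i₀ y) '' C y ∧ O.gr.tgt h ∈ V} :=
    fun y => (EpGroupoid.isSigmaCompact_arrows
      ((hCc y).image_of_continuousOn ((Ψ.G (i₀ y)).continuousOn.mono (hCs y))).isSigmaCompact
      hV).isLindelof
  choose t' htc' _ hts' using fun y => (hA y).elim_nhds_subcover O.biNhd fun h _ =>
    O.biNhd_mem_nhds h
  refine ⟨⋃ y ∈ t, (fun h => (Ψ.G (i₀ y)).trans (O.transport h)) '' t' y,
    htc.biUnion fun y _ => (htc' y).image _, ?_, ?_⟩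
  · intro Λ hΛ
    obtain ⟨y, -, h, -, rfl⟩ := mem_iUnion₂.mp hΛ
    exact (Ψ.diffeo _).trans (O.isPartialDiffeo_transport h)
  · intro y hy i hyi h hh hhV
    obtain ⟨y₀, hy₀, hyC⟩ := mem_iUnion₂.mp (htU hy)
    set i' := i₀ y₀ with hi'
    have hyi' : y ∈ (Ψ.G i').source := hCs y₀ hyC
    -- pass from the index `i` to the index `i'` of the countable cover
    set κ := Ψ.μ i i' (O.gr.unit y) with hκ
    have hus : O.gr.src (O.gr.unit y) ∈ (Ψ.G i).source := by rwa [O.gr.src_unit]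
    have hut : O.gr.tgt (O.gr.unit y) ∈ (Ψ.G i').source := by rwa [O.gr.tgt_unit]
    have hκs : O.gr.src κ = Ψ.G i y := by rw [hκ, Ψ.src_μ i i' _ hus hut, O.gr.src_unit]
    have hκt : O.gr.tgt κ = Ψ.G i' y := by rw [hκ, Ψ.tgt_μ i i' _ hus hut, O.gr.tgt_unit]
    have hhκ : O.gr.src h = O.gr.src κ := hh.trans hκs.symm
    set h' := O.gr.comp h (O.gr.inv κ) with hh'
    have hc : O.gr.src h = O.gr.tgt (O.gr.inv κ) := by rw [O.gr.tgt_inv, hhκ]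
    have hs' : O.gr.src h' = Ψ.G i' y := by rw [hh', O.gr.src_comp _ _ hc, O.gr.src_inv, hκt]
    have ht' : O.gr.tgt h' = O.gr.tgt h := O.gr.tgt_comp _ _ hc
    have hcomp : O.gr.comp h' κ = h := O.gr.comp_comp_inv_cancel hhκ
    have hmem : h' ∈ {h : O.Mor | O.gr.src h ∈ Ψ.G i' '' C y₀ ∧ O.gr.tgt h ∈ V} :=
      ⟨⟨y, hyC, hs'.symm⟩, ht' ▸ hhV⟩
    obtain ⟨h₁, hh₁, hb⟩ := mem_iUnion₂.mp (hts' y₀ hmem)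
    have hsrc := EpGroupoid.src_mem_transport hb
    have htr := EpGroupoid.transport_src hb
    have hD := EpGroupoid.tderiv_transport_eq hb
    rw [hs'] at hsrc htr hD
    refine ⟨(Ψ.G i').trans (O.transport h₁), mem_iUnion₂.mpr ⟨y₀, hy₀, h₁, hh₁, rfl⟩,
      ⟨hyi', hsrc⟩, htr.trans ht', ?_⟩
    have e1 := tderiv_comp (E := EuclideanSpace ℝ (Fin n)) (E' := EuclideanSpace ℝ (Fin n))
      (E'' := EuclideanSpace ℝ (Fin n)) (x := y) (f := Ψ.G i') (g := O.transport h₁)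
      ((O.isPartialDiffeo_transport h₁).mdifferentiableAt hsrc)
      ((Ψ.diffeo i').mdifferentiableAt hyi')
    have e2 := Ψ.tderiv_transport_comp_G hus hut
    have e3 : tderiv (EuclideanSpace ℝ (Fin n)) (EuclideanSpace ℝ (Fin n))
        (O.transport (O.gr.unit y)) y = ContinuousLinearMap.id ℝ _ := by
      rw [← tderiv_id y]
      exact tderiv_congr (EpGroupoid.eventually_transport_unit y)
    rw [O.gr.src_unit, O.gr.tgt_unit, e3, ContinuousLinearMap.comp_id, ← hκ] at e2
    have e4 := EpGroupoid.tderiv_transport_comp (O := O) (g := h') (f := κ) (hs'.trans hκt.symm)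
    rw [hcomp, hκs, hs'] at e4
    rw [e4, ContinuousLinearMap.comp_assoc, e2, ← hD]
    exact e1

end Germs

/-! ### Parametric transversality in a linear patch -/

/-- A smooth map from an open subset of a Euclidean space to the object manifold. -/
structure TestMap {n : ℕ} (O : EpGroupoid.{a, b} n) where
  m : ℕ
  Q : Set (EuclideanSpace ℝ (Fin m))
  u : EuclideanSpace ℝ (Fin m) → O.Obj
  isOpen : IsOpen Q
  smooth : ContMDiffOn (𝓡 m) (𝓡 n) ∞ u Q

section Transversality

variable {n : ℕ} {O : EpGroupoid.{a, b} n}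

/-- At the points which are equivalent to the image of `z ∈ X` under `Ψ`, the test map `u` is
transverse to the image of `X` under `Ψ`, transported to these points. -/
def CocycleAut.TransverseAt (Ψ : CocycleAut O) (X : Set O.Obj) (u : TestMap O) (z : O.Obj) : Prop :=
  ∀ i, z ∈ (Ψ.G i).source → ∀ h, O.gr.src h = Ψ.G i z → ∀ q ∈ u.Q, O.gr.tgt h = u.u q →
    LinearMap.range (tderiv (EuclideanSpace ℝ (Fin u.m)) (EuclideanSpace ℝ (Fin n))
      u.u q).toLinearMap ⊔
    Submodule.map (tderiv (EuclideanSpace ℝ (Fin n)) (EuclideanSpace ℝ (Fin n)) (O.transport h)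
      (Ψ.G i z)).toLinearMap (Submodule.map (tderiv (EuclideanSpace ℝ (Fin n))
        (EuclideanSpace ℝ (Fin n)) (Ψ.G i) z).toLinearMap (tangentAlong O X z)) = ⊤

/-- The linear algebra behind the parametric transversality theorem.  If `t = H v / χ (p v)`, with
`p = 1 - j H`, is a regular value, then `v` is transverse to the graph
`{w + χ w • j t | H w = 0}`. -/
theorem exists_add_eq_of_surjective {F E T : Type*} [AddCommGroup F] [Module ℝ F]
    [AddCommGroup E] [Module ℝ E] [AddCommGroup T] [Module ℝ T] {V : F →ₗ[ℝ] E} {H : E →ₗ[ℝ] T}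
    {j : T →ₗ[ℝ] E} (hHj : ∀ t, H (j t) = t) {χ' : E →ₗ[ℝ] ℝ} {t : T} {c : ℝ} (hc : c ≠ 0)
    {R : F →ₗ[ℝ] T} (hR : Function.Surjective R)
    (hRV : ∀ ξ, χ' (V ξ - j (H (V ξ))) • t + c • R ξ = H (V ξ)) (η : E) :
    ∃ ξ w, H w = 0 ∧ V ξ + (w + χ' w • j t) = η := by
  obtain ⟨ξ, hξ⟩ := hR (c⁻¹ • (H η - χ' (η - j (H η)) • t))
  have h1 : H (V ξ) = χ' (V ξ - j (H (V ξ))) • t + (H η - χ' (η - j (H η)) • t) := by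
    have h := hRV ξ
    rw [hξ, smul_smul, mul_inv_cancel₀ hc, one_smul] at h
    exact h.symm
  refine ⟨ξ, (η - V ξ) - j (H (η - V ξ)), by rw [map_sub, hHj, sub_self], ?_⟩
  have h2 : χ' ((η - V ξ) - j (H (η - V ξ))) • t = H (η - V ξ) := by
    have h3 : (η - V ξ) - j (H (η - V ξ)) = (η - j (H η)) - (V ξ - j (H (V ξ))) := by
      simp only [map_sub]
      abel
    rw [h3, map_sub χ', sub_smul, map_sub H]
    conv_rhs => rw [h1]
    abel
  rw [← map_smul, h2]
  abel

namespace LinearPatch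

variable {k r : ℕ} {X : Set O.Obj} {P : LinearPatch O k X r}

/-- The set of objects which are equivalent to a point at which the bump function is positive. -/
def posSet (P : LinearPatch O k X r) : Set O.Obj :=
  O.gr.proj ⁻¹' (O.gr.proj '' {z ∈ P.φ.source | 0 < P.χ (P.φ z)})

theorem posSet_subset_satSupp : P.posSet ⊆ P.satSupp := by
  refine preimage_mono (image_mono ?_)
  rintro z ⟨hz, hχ⟩
  exact (mem_supp_iff hz).mpr (subset_tsupport _ hχ.ne')

theorem mem_posSet_iff {z : O.Obj} (hz : z ∈ P.φ.source) : z ∈ P.posSet ↔ 0 < P.χ (P.φ z) := by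
  constructor
  · rintro ⟨z', ⟨hz', hχ⟩, he⟩
    obtain ⟨h, rfl, rfl⟩ := O.gr.proj_eq_iff.mp he
    obtain ⟨γ, u, hu, rfl⟩ := exists_s_eq hz' hz
    rw [P.src_s γ u hu] at hχ
    rwa [P.φ_tgt γ u hu, P.χ_A]
  · exact fun h => ⟨z, ⟨hz, h⟩, rfl⟩

theorem mem_posSet_congr {z z' : O.Obj} (h : O.gr.proj z = O.gr.proj z') :
    z ∈ P.posSet ↔ z' ∈ P.posSet := by
  rw [posSet, mem_preimage, mem_preimage, h]

theorem isOpen_posSet : IsOpen P.posSet := by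
  refine (O.isOpenMap_proj _ ?_).preimage O.gr.continuous_proj
  exact P.φ.continuousOn.isOpen_inter_preimage P.φ.open_source
    (isOpen_lt continuous_const P.χ_smooth.continuous)

theorem mem_tangentAlong_iff {z : O.Obj} (hz : z ∈ P.φ.source) (hzX : z ∈ X)
    {v : EuclideanSpace ℝ (Fin n)} :
    v ∈ (tangentAlong O X z : Submodule ℝ (EuclideanSpace ℝ (Fin n))) ↔
      P.H (tderiv (EuclideanSpace ℝ (Fin n)) (EuclideanSpace ℝ (Fin n)) P.φ z v) = 0 := by
  rw [P.slice.tangentAlong_eq hz hzX, Submodule.toAffineSubspace_direction]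
  exact Iff.rfl

theorem H_eq_zero {z : O.Obj} (hz : z ∈ P.φ.source) (hzX : z ∈ X) : P.H (P.φ z) = 0 :=
  (P.slice.mem_iff hz).mp hzX

theorem hasFDerivAt_shift (t : Fin r → ℝ) (e : EuclideanSpace ℝ (Fin n)) :
    HasFDerivAt (P.shift t) (ContinuousLinearMap.id ℝ _ +
      (fderiv ℝ P.χ e).smulRight (P.j t)) e :=
  (hasFDerivAt_id e).add (((P.χ_smooth.differentiable (by simp)) e).hasFDerivAt.smul_const (P.j t))

namespace IsDiffeoShift

variable {t : Fin r → ℝ} (h : P.IsDiffeoShift t)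
include h

theorem tderiv_φ_push {z : O.Obj} (hz : z ∈ P.φ.source) (v : EuclideanSpace ℝ (Fin n)) :
    tderiv (EuclideanSpace ℝ (Fin n)) (EuclideanSpace ℝ (Fin n)) P.φ (P.push t z)
      (tderiv (EuclideanSpace ℝ (Fin n)) (EuclideanSpace ℝ (Fin n)) (P.push t) z v) =
      tderiv (EuclideanSpace ℝ (Fin n)) (EuclideanSpace ℝ (Fin n)) P.φ z v +
      fderiv ℝ P.χ (P.φ z) (tderiv (EuclideanSpace ℝ (Fin n)) (EuclideanSpace ℝ (Fin n)) P.φ z v) •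
        P.j t := by
  have h1 := tderiv_comp (E := EuclideanSpace ℝ (Fin n)) (E' := EuclideanSpace ℝ (Fin n))
    (E'' := EuclideanSpace ℝ (Fin n)) (x := z) (f := P.push t) (g := P.φ)
    (P.slice.diffeo.mdifferentiableAt (h.push_mem_source hz))
    ((h.contMDiff_push z).mdifferentiableAt (by simp))
  have h2 := tderiv_comp (E := EuclideanSpace ℝ (Fin n)) (E' := EuclideanSpace ℝ (Fin n))
    (E'' := EuclideanSpace ℝ (Fin n)) (x := z) (f := P.φ) (g := P.shift t)
    (mdifferentiableAt_iff_differentiableAt.mpr (P.hasFDerivAt_shift t _).differentiableAt)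
    (P.slice.diffeo.mdifferentiableAt hz)
  have h3 : P.φ ∘ P.push t =ᶠ[𝓝 z] P.shift t ∘ P.φ := by
    filter_upwards [P.φ.open_source.mem_nhds hz] with y hy
    exact h.φ_push hy
  rw [← ContinuousLinearMap.comp_apply, ← h1, tderiv_congr h3, h2, tderiv_eq_fderiv,
    (P.hasFDerivAt_shift t _).fderiv]
  rfl

/-- Where the bump function vanishes, the differential of the perturbation is the identity. -/
theorem tderiv_push_of_notMem {z : O.Obj} (hzp : z ∉ P.posSet) :
    P.push t z = z ∧ tderiv (EuclideanSpace ℝ (Fin n)) (EuclideanSpace ℝ (Fin n)) (P.push t) z =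
      ContinuousLinearMap.id ℝ _ := by
  by_cases hzs : z ∈ P.φ.source
  · have h0 : P.χ (P.φ z) = 0 :=
      le_antisymm (not_lt.mp fun hc => hzp ((mem_posSet_iff hzs).mpr hc)) (P.χ_nonneg _)
    have hpz : P.push t z = z := by
      refine chartExtend_of_fixed _ fun _ => ?_
      rw [shift, h0, zero_smul, add_zero]
    have hmin : IsLocalMin P.χ (P.φ z) := Eventually.of_forall fun e => by
      rw [h0]
      exact P.χ_nonneg e
    refine ⟨hpz, ?_⟩
    ext1 v
    have h1 := h.tderiv_φ_push hzs v
    rw [hmin.fderiv_eq_zero, zero_apply, zero_smul, add_zero, hpz] at h1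
    exact P.slice.diffeo.tderiv_injective hzs h1
  · have hz' : z ∈ P.suppᶜ := fun hc => hzs (supp_subset hc)
    refine ⟨push_of_notMem_supp t hz', ?_⟩
    rw [← tderiv_id z]
    refine tderiv_congr ?_
    filter_upwards [isCompact_supp.isClosed.isOpen_compl.mem_nhds hz'] with y hy
    exact push_of_notMem_supp t hy

end IsDiffeoShift

/-- The parameter `t` for which the graph of `χ • j t` over `ker H` passes through `e`. -/
noncomputable def height (P : LinearPatch O k X r) (e : EuclideanSpace ℝ (Fin n)) : Fin r → ℝ :=
  (P.χ (e - P.j (P.H e)))⁻¹ • P.H e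

theorem height_shift {t : Fin r → ℝ} {e : EuclideanSpace ℝ (Fin n)} (he : P.H e = 0)
    (hχ : 0 < P.χ e) : P.shift t e - P.j (P.H (P.shift t e)) = e ∧ P.height (P.shift t e) = t := by
  have h1 : P.H (P.shift t e) = P.χ e • t := by
    rw [shift, map_add, map_smul, P.H_j, he, zero_add]
  have h2 : P.shift t e - P.j (P.H (P.shift t e)) = e := by
    rw [h1, map_smul, shift, add_sub_cancel_right]
  refine ⟨h2, ?_⟩
  rw [height, h2, h1, smul_smul, inv_mul_cancel₀ hχ.ne', one_smul]

/-- The set on which the denominator in `height` is positive. -/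
def heightDom (P : LinearPatch O k X r) : Set (EuclideanSpace ℝ (Fin n)) :=
  {e | 0 < P.χ (e - P.j (P.H e))}

theorem isOpen_heightDom : IsOpen P.heightDom := by
  have := P.χ_smooth.continuous
  exact isOpen_lt continuous_const (by fun_prop)

theorem contDiffOn_height : ContDiffOn ℝ ∞ P.height P.heightDom := by
  have h1 : ContDiff ℝ ∞ fun e => P.χ (e - P.j (P.H e)) :=
    P.χ_smooth.comp (contDiff_id.sub (P.j.contDiff.comp P.H.contDiff))
  exact (h1.contDiffOn.inv fun e he => ne_of_gt he).smul P.H.contDiff.contDiffOn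

/-- If `height ∘ v` is regular at a point, then `v` is transverse there to the graph of `χ • j t`,
where `t` is the value of the height. -/
theorem exists_add_eq_of_height {F : Type*} [NormedAddCommGroup F] [NormedSpace ℝ F]
    {v : F → EuclideanSpace ℝ (Fin n)} {q : F} (hv : DifferentiableAt ℝ v q)
    {e : EuclideanSpace ℝ (Fin n)} (hχ : 0 < P.χ e) (he : P.H e = 0) {t : Fin r → ℝ}
    (hvq : v q = P.shift t e) (hR : Function.Surjective (fderiv ℝ (P.height ∘ v) q))
    (η : EuclideanSpace ℝ (Fin n)) : ∃ ξ w, P.H w = 0 ∧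
      fderiv ℝ v q ξ + (w + fderiv ℝ P.χ e w • P.j t) = η := by
  obtain ⟨hs1, hs2⟩ := P.height_shift (t := t) he hχ
  rw [← hvq] at hs1 hs2
  have hdom : v q ∈ P.heightDom := by
    rw [heightDom, mem_ofPred_eq, hs1]
    exact hχ
  have hRd : DifferentiableAt ℝ (P.height ∘ v) q :=
    ((P.contDiffOn_height.contDiffAt (P.isOpen_heightDom.mem_nhds hdom)).differentiableAt
      (by simp)).comp q hv
  -- differentiate the identity `χ (p v) • height v = H v`
  have h1 : HasFDerivAt (fun x => P.χ (v x - P.j (P.H (v x)))) ((fderiv ℝ P.χ e).comp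
      (fderiv ℝ v q - P.j.comp (P.H.comp (fderiv ℝ v q)))) q := by
    refine HasFDerivAt.comp q ?_ (hv.hasFDerivAt.sub
      (P.j.hasFDerivAt.comp q (P.H.hasFDerivAt.comp q hv.hasFDerivAt)))
    change HasFDerivAt P.χ (fderiv ℝ P.χ e) (v q - P.j (P.H (v q)))
    rw [hs1]
    exact ((P.χ_smooth.differentiable (by simp)) e).hasFDerivAt
  have h2 := h1.smul hRd.hasFDerivAt
  have h3 : HasFDerivAt (fun x => P.H (v x)) (P.H.comp (fderiv ℝ v q)) q :=
    P.H.hasFDerivAt.comp q hv.hasFDerivAt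
  have h4 : (fun x => P.H (v x)) =ᶠ[𝓝 q]
      fun x => P.χ (v x - P.j (P.H (v x))) • (P.height ∘ v) x := by
    filter_upwards [hv.continuousAt (P.isOpen_heightDom.mem_nhds hdom)] with x hx
    rw [Function.comp_apply, height, smul_smul, mul_inv_cancel₀ (ne_of_gt hx), one_smul]
  have h5 := h3.unique (h2.congr_of_eventuallyEq h4)
  refine exists_add_eq_of_surjective (V := (fderiv ℝ v q).toLinearMap) (H := P.H.toLinearMap)
    (j := P.j.toLinearMap) P.H_j (χ' := (fderiv ℝ P.χ e).toLinearMap) hχ.ne'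
    (R := (fderiv ℝ (P.height ∘ v) q).toLinearMap) hR (fun ξ => ?_) η
  have h6 := congrArg (fun L : F →L[ℝ] (Fin r → ℝ) => L ξ) h5
  simp only [hs1] at h6
  rw [Function.comp_apply, hs2] at h6
  refine Eq.trans ?_ h6.symm
  rw [add_comm]
  rfl

end LinearPatch

end Transversality

/-! ### Perturbing a compact suborbifold into general position -/

section Induction

variable {n : ℕ} {O : EpGroupoid.{a, b} n}

theorem TestMap.mdifferentiableAt (u : TestMap O) {q : EuclideanSpace ℝ (Fin u.m)} (hq : q ∈ u.Q) :
    MDifferentiableAt (𝓡 u.m) (𝓡 n) u.u q :=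
  (u.smooth.contMDiffAt (u.isOpen.mem_nhds hq)).mdifferentiableAt (by simp)

/-- A generic small perturbation in the patch `P`, applied before `Ψ`, achieves transversality over
the part of `X` on which the bump function of `P` is positive; it does not destroy transversality
over the rest of `X`, where the perturbation is the identity to first order. -/
theorem CocycleAut.exists_transverse_step [T2Space O.gr.Orbit] {k r : ℕ} {X : Set O.Obj}
    (hX : IsEmbeddedFullSuborbifold O k X) (Ψ : CocycleAut O) (P : LinearPatch O k X r)
    {κ : Type} [Countable κ] (u : κ → TestMap O) {S : Set O.Obj}
    (hS : ∀ z z', O.gr.proj z = O.gr.proj z' → (z ∈ S ↔ z' ∈ S))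
    (hΨ : ∀ z ∈ X, z ∈ S → ∀ l, Ψ.TransverseAt X (u l) z) :
    ∃ Ψ' : CocycleAut O, ∀ z ∈ X, z ∈ S ∪ P.posSet → ∀ l, Ψ'.TransverseAt X (u l) z := by
  have hU : IsSigmaCompact P.φ.source := by
    rw [← P.φ.symm_image_target_eq_source]
    exact P.φ.open_target.isSigmaCompact.image_of_continuousOn P.φ.continuousOn_symm
  choose T hTc hTd hT using fun l => Ψ.exists_countable_germs (V := (u l).u '' (u l).Q) hU
    ((u l).isOpen.isSigmaCompact.image_of_continuousOn (u l).smooth.continuousOn)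
  have : ∀ l, Countable (T l) := fun l => (hTc l).to_subtype
  let W : (Σ l, T l) → OpenPartialHomeomorph O.Obj (EuclideanSpace ℝ (Fin n)) :=
    fun i => i.2.1.symm.trans P.φ
  have hW : ∀ i, IsPartialDiffeo (E := EuclideanSpace ℝ (Fin n)) (W i) := fun i =>
    (hTd i.1 _ i.2.2).symm.trans P.slice.diffeo
  let v : ∀ i : (Σ l, T l), EuclideanSpace ℝ (Fin (u i.1).m) → EuclideanSpace ℝ (Fin n) :=
    fun i => W i ∘ (u i.1).u
  let N₀ : ∀ i : (Σ l, T l), Set (EuclideanSpace ℝ (Fin (u i.1).m)) :=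
    fun i => (u i.1).Q ∩ (u i.1).u ⁻¹' (W i).source
  have hN₀ : ∀ i, IsOpen (N₀ i) := fun i =>
    (u i.1).smooth.continuousOn.isOpen_inter_preimage (u i.1).isOpen (W i).open_source
  have hv : ∀ i, ContDiffOn ℝ ∞ (v i) (N₀ i) := fun i => contMDiffOn_iff_contDiffOn.mp
    ((hW i).smooth.comp ((u i.1).smooth.mono inter_subset_left) inter_subset_right)
  obtain ⟨δ, hδ, hsmall⟩ := P.exists_isSmall
  -- Each germ `Λ` of the countable family pulls the test map back to the patch, where its height is
  -- required to have `t` as a regular value.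
  obtain ⟨t, htδ, hreg⟩ := exists_regular_value r (ι := Σ l, T l)
    (E := fun i => EuclideanSpace ℝ (Fin (u i.1).m))
    (U := fun i => N₀ i ∩ v i ⁻¹' P.heightDom)
    (fun i => (hv i).continuousOn.isOpen_inter_preimage (hN₀ i) P.isOpen_heightDom)
    (f := fun i => P.height ∘ v i)
    (fun i => P.contDiffOn_height.comp ((hv i).mono inter_subset_left) inter_subset_right) hδ
  have h := hsmall t htδ
  have hd := h.isDiffeoShift_one
  refine ⟨h.cocycleAut.trans Ψ, ?_⟩
  rintro z hzX hz l ⟨(g : O.Mor), (i : Ψ.ι)⟩ hzs f hfs q hq hft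
  have hGfun : (((h.cocycleAut.trans Ψ).G (g, i) : OpenPartialHomeomorph O.Obj O.Obj) :
      O.Obj → O.Obj) = Ψ.G i ∘ (P.push t ∘ O.transport g) := by
    funext x
    change Ψ.G i (h.pushHomeomorph (O.transport g x)) = _
    rw [h.pushHomeomorph_apply]
    rfl
  have hz1 : z ∈ (O.transport g).source := hzs.1.1
  set z₁ := O.transport g z with hz₁
  have hz₁d : z₁ ∈ P.dom := h.pushHomeomorph_source ▸ hzs.1.2
  have hpr : O.gr.proj z₁ = O.gr.proj z := EpGroupoid.proj_transport hz1
  have hz₁X : z₁ ∈ X := (hX.mem_iff_of_proj_eq hpr).mpr hzX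
  set y := P.push t z₁ with hy
  have hyi : y ∈ (Ψ.G i).source := by
    have : h.pushHomeomorph z₁ ∈ (Ψ.G i).source := hzs.2
    rwa [h.pushHomeomorph_apply] at this
  have hpd : MDifferentiableAt (𝓡 n) (𝓡 n) (P.push t) z₁ :=
    (hd.contMDiff_push z₁).mdifferentiableAt (by simp)
  have htd := (O.isPartialDiffeo_transport g).mdifferentiableAt hz1
  have hDG : tderiv (EuclideanSpace ℝ (Fin n)) (EuclideanSpace ℝ (Fin n))
      ((h.cocycleAut.trans Ψ).G (g, i)) z =
      (tderiv (EuclideanSpace ℝ (Fin n)) (EuclideanSpace ℝ (Fin n)) (Ψ.G i) y).comp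
      ((tderiv (EuclideanSpace ℝ (Fin n)) (EuclideanSpace ℝ (Fin n)) (P.push t) z₁).comp
        (tderiv (EuclideanSpace ℝ (Fin n)) (EuclideanSpace ℝ (Fin n)) (O.transport g) z)) := by
    have e1 := tderiv_comp (E := EuclideanSpace ℝ (Fin n)) (E' := EuclideanSpace ℝ (Fin n))
      (E'' := EuclideanSpace ℝ (Fin n)) (x := z) (f := P.push t ∘ O.transport g) (g := Ψ.G i)
      ((Ψ.diffeo i).mdifferentiableAt hyi) (MDifferentiableAt.comp z hpd htd)
    have e2 := tderiv_comp (E := EuclideanSpace ℝ (Fin n)) (E' := EuclideanSpace ℝ (Fin n))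
      (E'' := EuclideanSpace ℝ (Fin n)) (x := z) (f := O.transport g) (g := P.push t) hpd htd
    rw [hGfun, e1, e2]
    rfl
  have hTan := tangentAlong_map hX (O.isPartialDiffeo_transport g)
    (fun z hz => hX.mem_iff_of_proj_eq (EpGroupoid.proj_transport hz).symm) hz1 hzX
  have hGz : (h.cocycleAut.trans Ψ).G (g, i) z = Ψ.G i y := by
    rw [hGfun]
    rfl
  rw [hGz] at hfs
  have hmap : Submodule.map (tderiv (EuclideanSpace ℝ (Fin n)) (EuclideanSpace ℝ (Fin n))
      ((h.cocycleAut.trans Ψ).G (g, i)) z).toLinearMap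
        (tangentAlong O X z : Submodule ℝ (EuclideanSpace ℝ (Fin n))) =
      Submodule.map (tderiv (EuclideanSpace ℝ (Fin n)) (EuclideanSpace ℝ (Fin n))
        (Ψ.G i) y).toLinearMap (Submodule.map (tderiv (EuclideanSpace ℝ (Fin n))
          (EuclideanSpace ℝ (Fin n)) (P.push t) z₁).toLinearMap
            (tangentAlong O X z₁ : Submodule ℝ (EuclideanSpace ℝ (Fin n)))) := by
    rw [hDG, hTan]
    ext v
    constructor
    · rintro ⟨w, hw, rfl⟩
      exact ⟨_, ⟨_, ⟨w, hw, rfl⟩, rfl⟩, rfl⟩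
    · rintro ⟨_, ⟨_, ⟨w, hw, rfl⟩, rfl⟩, rfl⟩
      exact ⟨w, hw, rfl⟩
  rw [hGz]
  refine Eq.trans (congrArg (fun A => _ ⊔ Submodule.map _ A) hmap) ?_
  -- At points where the bump function is positive, transversality holds by the choice of `t`.
  by_cases hzp : z ∈ P.posSet
  · have hz₁p : z₁ ∈ P.posSet := (LinearPatch.mem_posSet_congr hpr).mpr hzp
    have hz₁s : z₁ ∈ P.φ.source := LinearPatch.mem_source_of_mem_dom hz₁d
      (LinearPatch.posSet_subset_satSupp hz₁p)
    have hχ : 0 < P.χ (P.φ z₁) := (LinearPatch.mem_posSet_iff hz₁s).mp hz₁p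
    have hys : y ∈ P.φ.source := hd.push_mem_source hz₁s
    have hφy : P.φ y = P.shift t (P.φ z₁) := hd.φ_push hz₁s
    have hH := P.H_eq_zero hz₁s hz₁X
    obtain ⟨hs1, hs2⟩ := P.height_shift (t := t) hH hχ
    obtain ⟨Λ, hΛT, hyΛ, hΛy, hDΛ⟩ := hT l y hys i hyi f hfs (hft ▸ mem_image_of_mem _ hq)
    have hΛd := hTd l Λ hΛT
    rw [hft] at hΛy
    set i' : Σ l, T l := ⟨l, Λ, hΛT⟩ with hi'
    have hus : (u l).u q ∈ Λ.target := hΛy ▸ Λ.map_source hyΛ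
    have hΛs : Λ.symm ((u l).u q) = y := by rw [← hΛy, Λ.left_inv hyΛ]
    have huW : (u l).u q ∈ (W i').source := by
      refine ⟨hus, ?_⟩
      change Λ.symm ((u l).u q) ∈ P.φ.source
      rw [hΛs]
      exact hys
    have hvq : v i' q = P.shift t (P.φ z₁) := by
      rw [← hφy, ← hΛs]
      rfl
    have hvd : DifferentiableAt ℝ (v i') q :=
      ((hv i').contDiffAt ((hN₀ i').mem_nhds ⟨hq, huW⟩)).differentiableAt (by simp)
    have hsurj : Function.Surjective (fderiv ℝ (P.height ∘ v i') q) := by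
      refine hreg i' q ⟨⟨hq, huW⟩, ?_⟩ ?_
      · rw [mem_preimage, hvq, LinearPatch.heightDom, mem_ofPred_eq, hs1]
        exact hχ
      · rw [Function.comp_apply, hvq, hs2]
    rw [eq_top_iff]
    rintro ζ -
    obtain ⟨ξ, w, hw, hξw⟩ := P.exists_add_eq_of_height hvd hχ hH hvq hsurj
      (tderiv (EuclideanSpace ℝ (Fin n)) (EuclideanSpace ℝ (Fin n)) (W i') ((u l).u q) ζ)
    have hDv : fderiv ℝ (v i') q =
        (tderiv (EuclideanSpace ℝ (Fin n)) (EuclideanSpace ℝ (Fin n)) (W i') ((u l).u q)).comp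
        (tderiv (EuclideanSpace ℝ (Fin (u l).m)) (EuclideanSpace ℝ (Fin n)) (u l).u q) := by
      rw [← tderiv_eq_fderiv]
      exact tderiv_comp (E' := EuclideanSpace ℝ (Fin n)) ((hW i').mdifferentiableAt huW)
        ((u l).mdifferentiableAt hq)
    have hDW : tderiv (EuclideanSpace ℝ (Fin n)) (EuclideanSpace ℝ (Fin n)) (W i') ((u l).u q) =
        (tderiv (EuclideanSpace ℝ (Fin n)) (EuclideanSpace ℝ (Fin n)) P.φ y).comp
        (tderiv (EuclideanSpace ℝ (Fin n)) (EuclideanSpace ℝ (Fin n)) Λ.symm ((u l).u q)) := by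
      have := tderiv_comp (E := EuclideanSpace ℝ (Fin n)) (E' := EuclideanSpace ℝ (Fin n))
        (E'' := EuclideanSpace ℝ (Fin n)) (x := (u l).u q) (f := Λ.symm) (g := P.φ)
        (P.slice.diffeo.mdifferentiableAt (by rw [hΛs]; exact hys))
        (hΛd.symm.mdifferentiableAt hus)
      rw [hΛs] at this
      exact this
    obtain ⟨α, hα⟩ := P.slice.diffeo.tderiv_surjective hz₁s w
    have hαT : α ∈ (tangentAlong O X z₁ : Submodule ℝ (EuclideanSpace ℝ (Fin n))) := by
      rw [LinearPatch.mem_tangentAlong_iff hz₁s hz₁X, hα, hw]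
    have h1 := hd.tderiv_φ_push hz₁s α
    rw [hα, ← hy] at h1
    set β := tderiv (EuclideanSpace ℝ (Fin n)) (EuclideanSpace ℝ (Fin n)) (P.push t) z₁ α with hβ
    set Dξ := tderiv (EuclideanSpace ℝ (Fin (u l).m)) (EuclideanSpace ℝ (Fin n)) (u l).u q ξ
      with hDξ
    have h2 : tderiv (EuclideanSpace ℝ (Fin n)) (EuclideanSpace ℝ (Fin n)) Λ.symm ((u l).u q)
        (ζ - Dξ) = β := by
      refine P.slice.diffeo.tderiv_injective hys ?_
      rw [h1, ← ContinuousLinearMap.comp_apply, ← hDW, map_sub, ← hξw, hDv,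
        ContinuousLinearMap.comp_apply, add_sub_cancel_left]
    have h3 : tderiv (EuclideanSpace ℝ (Fin n)) (EuclideanSpace ℝ (Fin n)) Λ y β = ζ - Dξ := by
      have := hΛd.tderiv_apply_symm hyΛ (ζ - Dξ)
      rwa [hΛy, h2] at this
    rw [hDΛ] at h3
    rw [← add_sub_cancel Dξ ζ, ← h3]
    exact Submodule.add_mem_sup ⟨ξ, rfl⟩ ⟨_, ⟨β, ⟨α, hαT, rfl⟩, rfl⟩, rfl⟩
  -- Elsewhere the perturbation fixes `z₁` and has the identity as its differential there, so that
  -- transversality of `Ψ` at `z₁` is all that is needed.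
  · have hz₁p : z₁ ∉ P.posSet := fun hc => hzp ((LinearPatch.mem_posSet_congr hpr).mp hc)
    obtain ⟨hp, hDp⟩ := hd.tderiv_push_of_notMem hz₁p
    have hz₁S : z₁ ∈ S := (hS _ _ hpr).mpr (hz.resolve_right hzp)
    rw [hDp]
    rw [← hy] at hp
    rw [hp] at hfs hyi ⊢
    have := hΨ z₁ hz₁X hz₁S l i hyi f hfs q hq hft
    refine Eq.trans (congrArg (fun A => _ ⊔ Submodule.map _ (Submodule.map _ A)) ?_) this
    exact Submodule.map_id (tangentAlong O X z₁ : Submodule ℝ (EuclideanSpace ℝ (Fin n)))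

/-- A generalised automorphism makes `X` transverse to countably many test maps. -/
theorem exists_cocycleAut_transverse [T2Space O.gr.Orbit] {k : ℕ} {X : Set O.Obj}
    (hX : IsEmbeddedFullSuborbifold O k X) (hXc : IsCompact (O.gr.proj '' X))
    (hN : HasTrivialNormalIsotropy O X) {κ : Type} [Countable κ] (u : κ → TestMap O) :
    ∃ Ψ : CocycleAut O, ∀ z ∈ X, ∀ l, Ψ.TransverseAt X (u l) z := by
  classical
  choose P hPs hPχ using fun x : X => exists_linearPatch hX hN x.2
  -- induction on the number of patches; finitely many suffice as the orbit space of `X` is compact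
  have hfin : ∀ s : Finset X, ∃ Ψ : CocycleAut O,
      ∀ z ∈ X, z ∈ ⋃ x ∈ s, (P x).posSet → ∀ l, Ψ.TransverseAt X (u l) z := by
    intro s
    induction s using Finset.induction_on with
    | empty => exact ⟨CocycleAut.refl O, fun z _ hz => by simp at hz⟩
    | insert x s _ ih =>
      obtain ⟨Ψ, hΨ⟩ := ih
      obtain ⟨Ψ', hΨ'⟩ := Ψ.exists_transverse_step hX (P x) u (S := ⋃ x ∈ s, (P x).posSet)
        (fun z z' h => by simp only [mem_iUnion, LinearPatch.mem_posSet_congr h]) hΨ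
      refine ⟨Ψ', fun z hzX hz => hΨ' z hzX ?_⟩
      rwa [Finset.set_biUnion_insert, union_comm] at hz
  have hmem : ∀ x : X, x.1 ∈ (P x).posSet := fun x =>
    (LinearPatch.mem_posSet_iff (hPs x)).mpr (hPχ x)
  obtain ⟨s, hs⟩ := hXc.elim_finite_subcover (fun x => O.gr.proj '' (P x).posSet)
    (fun x => O.isOpenMap_proj _ LinearPatch.isOpen_posSet) (by
      rintro _ ⟨x, hx, rfl⟩
      exact mem_iUnion.mpr ⟨⟨x, hx⟩, x, hmem ⟨x, hx⟩, rfl⟩)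
  obtain ⟨Ψ, hΨ⟩ := hfin s
  refine ⟨Ψ, fun z hzX => hΨ z hzX ?_⟩
  obtain ⟨x, hx, z', hz', he⟩ := mem_iUnion₂.mp (hs ⟨z, hzX, rfl⟩)
  exact mem_iUnion₂.mpr ⟨x, hx, (LinearPatch.mem_posSet_congr he).mp hz'⟩

end Induction

/-! ### The image of a suborbifold under a generalised automorphism -/

section Image

variable {n : ℕ} {O : EpGroupoid.{a, b} n} (Ψ : CocycleAut O)

namespace CocycleAut

/-- The object set of the image of the suborbifold `X` under `Ψ`. -/
def image (X : Set O.Obj) : Set O.Obj := O.gr.proj ⁻¹' (Ψ.orb '' (O.gr.proj '' X))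

theorem orb_injective : Function.Injective Ψ.orb := by
  intro x y hxy
  obtain ⟨z, rfl⟩ := O.gr.proj_surjective x
  obtain ⟨z', rfl⟩ := O.gr.proj_surjective y
  obtain ⟨i, hi⟩ := Ψ.cover z
  obtain ⟨j, hj⟩ := Ψ.cover z'
  rw [Ψ.orb_proj i z hi, Ψ.orb_proj j z' hj] at hxy
  obtain ⟨g, hs, ht⟩ := O.gr.proj_eq_iff.mp hxy
  obtain ⟨h, ⟨rfl, rfl, -⟩, -⟩ := Ψ.existsUnique_μ i j z hi z' hj g hs ht
  exact O.gr.proj_src_eq_proj_tgt h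

variable {Ψ} {k : ℕ} {X : Set O.Obj}

theorem G_mem_image_iff (hX : IsEmbeddedFullSuborbifold O k X) {i : Ψ.ι} {z : O.Obj}
    (hz : z ∈ (Ψ.G i).source) : Ψ.G i z ∈ Ψ.image X ↔ z ∈ X := by
  rw [image, mem_preimage, ← Ψ.orb_proj i z hz, Ψ.orb_injective.mem_set_image]
  nth_rewrite 2 [hX.saturated]
  rfl

theorem mem_image_congr {z z' : O.Obj} (h : O.gr.proj z = O.gr.proj z') :
    z ∈ Ψ.image X ↔ z' ∈ Ψ.image X := by
  rw [image, mem_preimage, mem_preimage, h]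

theorem exists_of_mem_image {z' : O.Obj} (hz' : z' ∈ Ψ.image X) :
    ∃ z ∈ X, ∃ i, z ∈ (Ψ.G i).source ∧ ∃ g, O.gr.src g = Ψ.G i z ∧ O.gr.tgt g = z' := by
  obtain ⟨_, ⟨z, hz, rfl⟩, he⟩ := hz'
  obtain ⟨i, hi⟩ := Ψ.cover z
  rw [Ψ.orb_proj i z hi] at he
  exact ⟨z, hz, i, hi, O.gr.proj_eq_iff.mp he⟩

/-- The partial diffeomorphism `G i`, followed by transport along `g`, takes `X` to its image. -/
theorem mem_iff_G_transport_mem (hX : IsEmbeddedFullSuborbifold O k X) (i : Ψ.ι) (g : O.Mor)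
    {w : O.Obj} (hw : w ∈ ((Ψ.G i).trans (O.transport g)).source) :
    w ∈ X ↔ (Ψ.G i).trans (O.transport g) w ∈ Ψ.image X := by
  rw [← G_mem_image_iff hX hw.1]
  exact (mem_image_congr (EpGroupoid.proj_transport hw.2)).symm

theorem isEmbeddedFullSuborbifold_image (hX : IsEmbeddedFullSuborbifold O k X) :
    IsEmbeddedFullSuborbifold O k (Ψ.image X) := by
  refine ⟨?_, fun z' hz' => ?_⟩
  · rw [image, image_preimage_eq _ O.gr.proj_surjective]
  · obtain ⟨z, hz, i, hi, g, hs, rfl⟩ := exists_of_mem_image hz'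
    obtain ⟨φ, L, hzφ, h⟩ := hX.exists_sliceChart hz
    have hzs : z ∈ ((Ψ.G i).trans (O.transport g)).source := by
      refine ⟨hi, ?_⟩
      change Ψ.G i z ∈ (O.transport g).source
      rw [← hs]
      exact EpGroupoid.src_mem_transport_self g
    have hzΛ : (Ψ.G i).trans (O.transport g) z = O.gr.tgt g := by
      change O.transport g (Ψ.G i z) = _
      rw [← hs, EpGroupoid.transport_src_self]
    have h' := h.map (((Ψ.diffeo i).trans (O.isPartialDiffeo_transport g)))
      (fun w hw => mem_iff_G_transport_mem hX i g hw)
    refine ⟨_, h'.diffeo.mem_maximalAtlas, ?_, L, h'.finrank, h'.image⟩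
    rw [← hzΛ]
    refine ⟨OpenPartialHomeomorph.map_source _ hzs, ?_⟩
    change ((Ψ.G i).trans (O.transport g)).symm ((Ψ.G i).trans (O.transport g) z) ∈ φ.source
    rw [OpenPartialHomeomorph.left_inv _ hzs]
    exact hzφ

/-- The tangent spaces of the image suborbifold. -/
theorem tangentAlong_image (hX : IsEmbeddedFullSuborbifold O k X) {z : O.Obj} (hz : z ∈ X)
    {i : Ψ.ι} (hi : z ∈ (Ψ.G i).source) {g : O.Mor} (hs : O.gr.src g = Ψ.G i z) :
    (tangentAlong O (Ψ.image X) (O.gr.tgt g) : Submodule ℝ (EuclideanSpace ℝ (Fin n))) =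
      Submodule.map ((tderiv (EuclideanSpace ℝ (Fin n)) (EuclideanSpace ℝ (Fin n)) (O.transport g)
        (Ψ.G i z)).comp (tderiv (EuclideanSpace ℝ (Fin n)) (EuclideanSpace ℝ (Fin n)) (Ψ.G i)
          z)).toLinearMap (tangentAlong O X z) := by
  have hg : Ψ.G i z ∈ (O.transport g).source := by
    rw [← hs]
    exact EpGroupoid.src_mem_transport_self g
  have hzs : z ∈ ((Ψ.G i).trans (O.transport g)).source := ⟨hi, hg⟩
  have hzΛ : (Ψ.G i).trans (O.transport g) z = O.gr.tgt g := by
    change O.transport g (Ψ.G i z) = _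
    rw [← hs, EpGroupoid.transport_src_self]
  have h1 := tangentAlong_map hX ((Ψ.diffeo i).trans (O.isPartialDiffeo_transport g))
    (fun w hw => mem_iff_G_transport_mem hX i g hw) hzs hz
  rw [hzΛ] at h1
  have h2 := tderiv_comp (E := EuclideanSpace ℝ (Fin n)) (E' := EuclideanSpace ℝ (Fin n))
    (E'' := EuclideanSpace ℝ (Fin n)) (x := z) (f := Ψ.G i) (g := O.transport g)
    ((O.isPartialDiffeo_transport g).mdifferentiableAt hg) ((Ψ.diffeo i).mdifferentiableAt hi)
  rw [← h2]
  exact h1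

/-- The isotropy at a point of the image is conjugate to the isotropy at a point of `X`. -/
theorem hasTrivialNormalIsotropy_image (hX : IsEmbeddedFullSuborbifold O k X)
    (hN : HasTrivialNormalIsotropy O X) : HasTrivialNormalIsotropy O (Ψ.image X) := by
  rw [hasTrivialNormalIsotropy_iff]
  intro z' hz' g' hs' ht' v
  obtain ⟨z, hz, i, hi, g, hs, rfl⟩ := exists_of_mem_image hz'
  have h1 : O.gr.src g' = O.gr.tgt g := hs'
  set h := O.gr.comp (O.gr.inv g) (O.gr.comp g' g) with hh
  have h2 : O.gr.tgt g = O.gr.tgt (O.gr.comp g' g) := by rw [O.gr.tgt_comp _ _ h1, ht']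
  have h2' : O.gr.src (O.gr.inv g) = O.gr.tgt (O.gr.comp g' g) := by rw [O.gr.src_inv, h2]
  have hhs : O.gr.src h = Ψ.G i z := by
    rw [hh, O.gr.src_comp _ _ h2', O.gr.src_comp _ _ h1, hs]
  have hht : O.gr.tgt h = Ψ.G i z := by
    rw [hh, O.gr.tgt_comp _ _ h2', O.gr.tgt_inv, hs]
  have hgh : O.gr.comp g h = O.gr.comp g' g := O.gr.comp_inv_comp_cancel' h2
  obtain ⟨h₀, ⟨hs₀, ht₀, hμ⟩, -⟩ := Ψ.existsUnique_μ i i z hi z hi h hhs hht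
  have e1 := EpGroupoid.tderiv_transport_comp h1
  have e2 := EpGroupoid.tderiv_transport_comp (O := O) (g := g) (f := h) (hs.trans hht.symm)
  have e3 := Ψ.tderiv_transport_comp_G (i := i) (j := i) (g := h₀) (by rwa [hs₀]) (by rwa [ht₀])
  rw [hμ, hs₀, ht₀] at e3
  rw [hgh, hhs, hs] at e2
  rw [hs, hs', e2] at e1
  rw [tangentAlong_image hX hz hi hs]
  set Dg := tderiv (EuclideanSpace ℝ (Fin n)) (EuclideanSpace ℝ (Fin n)) (O.transport g) (Ψ.G i z)
    with hDg
  set DG := tderiv (EuclideanSpace ℝ (Fin n)) (EuclideanSpace ℝ (Fin n)) (Ψ.G i) z with hDG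
  have hgs : Ψ.G i z ∈ (O.transport g).source := by
    rw [← hs]
    exact EpGroupoid.src_mem_transport_self g
  obtain ⟨v₁, rfl⟩ := (O.isPartialDiffeo_transport g).tderiv_surjective hgs v
  obtain ⟨w, rfl⟩ := (Ψ.diffeo i).tderiv_surjective hi v₁
  refine ⟨_, hasTrivialNormalIsotropy_iff.mp hN z hz h₀ hs₀ ht₀ w, ?_⟩
  have e4 := congrArg (fun L : EuclideanSpace ℝ (Fin n) →L[ℝ] EuclideanSpace ℝ (Fin n) => L (DG w))
    e1
  have e5 := congrArg (fun L : EuclideanSpace ℝ (Fin n) →L[ℝ] EuclideanSpace ℝ (Fin n) => L w) e3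
  simp only [ContinuousLinearMap.comp_apply] at e4 e5
  rw [← e4, e5, ContinuousLinearMap.coe_coe, map_sub]
  rfl

end CocycleAut

end Image

/-! ### Manifolds étale over a Euclidean space -/

section Etale

variable {k : ℕ} {Y : Type*} [TopologicalSpace Y] {f : Y → EuclideanSpace ℝ (Fin k)}

/-- The manifold structure on a space over `ℝ^k` for which the local homeomorphism `f` to `ℝ^k` is
a local diffeomorphism: all charts are restrictions of `f`. -/
@[reducible] noncomputable def IsLocalHomeomorph.etaleChartedSpace (hf : IsLocalHomeomorph f) :
    ChartedSpace (EuclideanSpace ℝ (Fin k)) Y where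
  atlas := {e | f = e}
  chartAt x := (hf x).choose
  mem_chart_source x := (hf x).choose_spec.1
  chart_mem_atlas x := (hf x).choose_spec.2

theorem IsLocalHomeomorph.isManifold_etale (hf : IsLocalHomeomorph f) :
    letI := hf.etaleChartedSpace
    IsManifold (𝓡 k) ∞ Y := by
  let := hf.etaleChartedSpace
  refine isManifold_of_contDiffOn (𝓡 k) ∞ Y ?_
  intro e e' he he'
  refine contDiffOn_id.congr ?_
  rintro x ⟨hx, -⟩
  have he : f = e := he
  have he' : f = e' := he'
  change e' (e.symm x) = x
  rw [← he', he]
  exact e.right_inv hx.1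

theorem IsPartialDiffeo.isLocalDiffeomorphAt {E : Type*} [NormedAddCommGroup E] [NormedSpace ℝ E]
    {M : Type*} [TopologicalSpace M] [ChartedSpace E M]
    {N : Type*} [TopologicalSpace N] [ChartedSpace E N] {ψ : OpenPartialHomeomorph M N}
    (h : IsPartialDiffeo (E := E) ψ) {x : M} (hx : x ∈ ψ.source) {g : M → N}
    (hg : EqOn g ψ ψ.source) : IsLocalDiffeomorphAt 𝓘(ℝ, E) 𝓘(ℝ, E) ∞ g x :=
  ⟨{ toPartialEquiv := ψ.toPartialEquiv
     open_source := ψ.open_source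
     open_target := ψ.open_target
     contMDiffOn_toFun := h.smooth
     contMDiffOn_invFun := h.smooth_symm }, hx, hg⟩

theorem IsLocalHomeomorph.isLocalDiffeomorph_etale (hf : IsLocalHomeomorph f) :
    letI := hf.etaleChartedSpace
    IsLocalDiffeomorph (𝓡 k) (𝓡 k) ∞ f := by
  let := hf.etaleChartedSpace
  have := hf.isManifold_etale
  intro x
  obtain ⟨e, hx, he⟩ := hf x
  have h1 : e ∈ IsManifold.maximalAtlas (𝓡 k) ∞ Y := IsManifold.subset_maximalAtlas he
  exact (IsPartialDiffeo.of_mem_maximalAtlas h1).isLocalDiffeomorphAt hx fun y _ => congrFun he y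

/-- A local homeomorphism between manifolds which becomes a local diffeomorphism after composition
with a local diffeomorphism is a local diffeomorphism. -/
theorem IsLocalHomeomorph.isLocalDiffeomorph_of_comp {E : Type*} [NormedAddCommGroup E]
    [NormedSpace ℝ E] {M : Type*} [TopologicalSpace M] [ChartedSpace E M] {N : Type*}
    [TopologicalSpace N] [ChartedSpace E N] {P : Type*} [TopologicalSpace P] [ChartedSpace E P]
    {s : M → N} {g : N → P} (hs : IsLocalHomeomorph s)
    (hg : IsLocalDiffeomorph 𝓘(ℝ, E) 𝓘(ℝ, E) ∞ g)
    (hgs : IsLocalDiffeomorph 𝓘(ℝ, E) 𝓘(ℝ, E) ∞ (g ∘ s)) :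
    IsLocalDiffeomorph 𝓘(ℝ, E) 𝓘(ℝ, E) ∞ s := by
  intro x
  obtain ⟨e, hx, rfl⟩ := hs x
  refine IsPartialDiffeo.isLocalDiffeomorphAt (ψ := e) ⟨?_, ?_⟩ hx fun y _ => rfl
  · exact fun y hy => contMDiffWithinAt_of_comp_localDiffeo (e.continuousOn y hy) (hg _)
      (hgs.contMDiff y).contMDiffWithinAt
  · intro y hy
    refine contMDiffWithinAt_of_comp_localDiffeo (e.continuousOn_symm y hy) (hgs _) ?_
    refine (hg.contMDiff y).contMDiffWithinAt.congr (fun z hz => ?_) ?_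
    · simp only [Function.comp_apply, e.right_inv hz]
    · simp only [Function.comp_apply, e.right_inv hy]

/-- A criterion for a map on a subspace to be a local homeomorphism, in terms of a local inverse
with values in the ambient space. -/
theorem exists_openPartialHomeomorph_of_inverse {A B : Type*} [TopologicalSpace A]
    [TopologicalSpace B] {s : Set A} {f : s → B} {U : Set s} (hU : IsOpen U) {V : Set B}
    (hV : IsOpen V) (g : B → A) (hf : ContinuousOn f U) (hg : ContinuousOn g V)
    (hfUV : MapsTo f U V) (hgs : ∀ y ∈ V, ∃ h : g y ∈ s, (⟨g y, h⟩ : s) ∈ U ∧ f ⟨g y, h⟩ = y)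
    (hgf : ∀ x ∈ U, g (f x) = x) {x₀ : s} (hx₀ : x₀ ∈ U) :
    ∃ e : OpenPartialHomeomorph s B, x₀ ∈ e.source ∧ f = e := by
  classical
  let g' : B → s := fun y => if h : g y ∈ s then ⟨g y, h⟩ else x₀
  have hg' : ∀ y ∈ V, (g' y : A) = g y ∧ g' y ∈ U ∧ f (g' y) = y := by
    intro y hy
    obtain ⟨h, hyU, hfy⟩ := hgs y hy
    have h1 : g' y = ⟨g y, h⟩ := dif_pos h
    rw [h1]
    exact ⟨rfl, hyU, hfy⟩
  refine ⟨{ toFun := f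
            invFun := g'
            source := U
            target := V
            map_source' := hfUV
            map_target' := fun y hy => (hg' y hy).2.1
            left_inv' := fun x hx => Subtype.ext (((hg' _ (hfUV hx)).1).trans (hgf x hx))
            right_inv' := fun y hy => (hg' y hy).2.2
            open_source := hU
            open_target := hV
            continuousOn_toFun := hf
            continuousOn_invFun := ?_ }, hx₀, funext fun _ => by rfl⟩
  exact IsInducing.subtypeVal.continuousOn_iff.mpr (hg.congr fun y hy => (hg' y hy).1)

end Etale

/-! ### The ep-groupoid of a finite family of slice charts -/

section SliceCover

variable {n : ℕ}

/-- Finitely many slice charts which meet all orbits of `X`.  The linear maps `κ m` and `ι m`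
identify the directions of the planes with `ℝ^k`. -/
structure SliceCover (O : EpGroupoid.{a, b} n) (k : ℕ) (X : Set O.Obj) where
  N : ℕ
  φ : Fin N → OpenPartialHomeomorph O.Obj (EuclideanSpace ℝ (Fin n))
  L : Fin N → AffineSubspace ℝ (EuclideanSpace ℝ (Fin n))
  slice : ∀ m, IsSliceChart k X (φ m) (L m)
  embedded : IsEmbeddedFullSuborbifold O k X
  κ : Fin N → EuclideanSpace ℝ (Fin n) →L[ℝ] EuclideanSpace ℝ (Fin k)
  ι : Fin N → EuclideanSpace ℝ (Fin k) →L[ℝ] EuclideanSpace ℝ (Fin n)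
  κ_ι : ∀ m e, κ m (ι m e) = e
  ι_mem : ∀ m e, ι m e ∈ (L m).direction
  ι_κ : ∀ m, ∀ v ∈ (L m).direction, ι m (κ m v) = v
  meets : ∀ x ∈ X, ∃ m, ∃ z ∈ (φ m).source, O.gr.proj z = O.gr.proj x

namespace SliceCover

variable {O : EpGroupoid.{a, b} n} {k : ℕ} {X : Set O.Obj} (C : SliceCover O k X)

/-- The objects: the disjoint union of the pieces of `X` in the slice charts. -/
def Obj : Type a := ↥{p : Fin C.N × O.Obj | p.2 ∈ (C.φ p.1).source ∧ p.2 ∈ X}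

/-- The morphisms: those of `O`, with a choice of the pieces which contain source and target. -/
def Mor : Type b := ↥{q : (Fin C.N × Fin C.N) × O.Mor | O.gr.src q.2 ∈ (C.φ q.1.1).source ∧
  O.gr.tgt q.2 ∈ (C.φ q.1.2).source ∧ O.gr.src q.2 ∈ X}

instance : TopologicalSpace C.Obj :=
  inferInstanceAs (TopologicalSpace ↥{p : Fin C.N × O.Obj | p.2 ∈ (C.φ p.1).source ∧ p.2 ∈ X})

instance : TopologicalSpace C.Mor := inferInstanceAs (TopologicalSpace
  ↥{q : (Fin C.N × Fin C.N) × O.Mor | O.gr.src q.2 ∈ (C.φ q.1.1).source ∧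
    O.gr.tgt q.2 ∈ (C.φ q.1.2).source ∧ O.gr.src q.2 ∈ X})

instance : T2Space C.Obj :=
  inferInstanceAs (T2Space ↥{p : Fin C.N × O.Obj | p.2 ∈ (C.φ p.1).source ∧ p.2 ∈ X})

instance : T2Space C.Mor := inferInstanceAs (T2Space
  ↥{q : (Fin C.N × Fin C.N) × O.Mor | O.gr.src q.2 ∈ (C.φ q.1.1).source ∧
    O.gr.tgt q.2 ∈ (C.φ q.1.2).source ∧ O.gr.src q.2 ∈ X})

variable {C}

/-- The inclusion on objects. -/
def incl (p : C.Obj) : O.Obj := p.1.2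

/-- The inclusion on morphisms. -/
def inclMor (q : C.Mor) : O.Mor := q.1.2

/-- The index of the slice chart. -/
def idx (p : C.Obj) : Fin C.N := p.1.1

theorem incl_mem_source (p : C.Obj) : incl p ∈ (C.φ (idx p)).source := p.2.1

theorem incl_mem (p : C.Obj) : incl p ∈ X := p.2.2

/-- The source of a morphism. -/
def srcMap (q : C.Mor) : C.Obj := ⟨(q.1.1.1, O.gr.src q.1.2), q.2.1, q.2.2.2⟩

/-- The target of a morphism. -/
def tgtMap (q : C.Mor) : C.Obj :=
  ⟨(q.1.1.2, O.gr.tgt q.1.2), q.2.2.1, (C.embedded.src_mem_iff _).mp q.2.2.2⟩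

/-- The inverse of a morphism. -/
def invMap (q : C.Mor) : C.Mor :=
  ⟨((q.1.1.2, q.1.1.1), O.gr.inv q.1.2), by
    change O.gr.src (O.gr.inv q.1.2) ∈ (C.φ q.1.1.2).source ∧
      O.gr.tgt (O.gr.inv q.1.2) ∈ (C.φ q.1.1.1).source ∧ O.gr.src (O.gr.inv q.1.2) ∈ X
    rw [O.gr.src_inv, O.gr.tgt_inv]
    exact ⟨q.2.2.1, q.2.1, (C.embedded.src_mem_iff _).mp q.2.2.2⟩⟩

/-- The unit morphisms. -/
def unitMap (p : C.Obj) : C.Mor :=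
  ⟨((p.1.1, p.1.1), O.gr.unit p.1.2), by
    change O.gr.src (O.gr.unit p.1.2) ∈ (C.φ p.1.1).source ∧
      O.gr.tgt (O.gr.unit p.1.2) ∈ (C.φ p.1.1).source ∧ O.gr.src (O.gr.unit p.1.2) ∈ X
    rw [O.gr.src_unit, O.gr.tgt_unit]
    exact ⟨p.2.1, p.2.1, p.2.2⟩⟩

theorem src_eq_tgt_of_srcMap_eq {g f : C.Mor} (h : srcMap g = tgtMap f) :
    O.gr.src g.1.2 = O.gr.tgt f.1.2 := congrArg (fun p : C.Obj => p.1.2) h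

theorem idx_eq_of_srcMap_eq {g f : C.Mor} (h : srcMap g = tgtMap f) :
    g.1.1.1 = f.1.1.2 := congrArg (fun p : C.Obj => p.1.1) h

/-- The composite of morphisms; its value for morphisms which are not composable is irrelevant. -/
noncomputable def compMap (g f : C.Mor) : C.Mor :=
  open Classical in
  if h : srcMap g = tgtMap f then ⟨((f.1.1.1, g.1.1.2), O.gr.comp g.1.2 f.1.2), by
    have h' := src_eq_tgt_of_srcMap_eq h
    change O.gr.src (O.gr.comp g.1.2 f.1.2) ∈ (C.φ f.1.1.1).source ∧
      O.gr.tgt (O.gr.comp g.1.2 f.1.2) ∈ (C.φ g.1.1.2).source ∧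
      O.gr.src (O.gr.comp g.1.2 f.1.2) ∈ X
    rw [O.gr.src_comp _ _ h', O.gr.tgt_comp _ _ h']
    exact ⟨f.2.1, g.2.2.1, f.2.2.2⟩⟩
  else g

theorem val_compMap {g f : C.Mor} (h : srcMap g = tgtMap f) :
    (compMap g f).1 = ((f.1.1.1, g.1.1.2), O.gr.comp g.1.2 f.1.2) := by
  unfold compMap
  exact congrArg Subtype.val (dif_pos h)

variable (C) in
/-- The groupoid structure. -/
noncomputable def gr : GroupoidOn C.Obj C.Mor where
  src := srcMap
  tgt := tgtMap
  unit := unitMap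
  inv := invMap
  comp := compMap
  src_unit p := Subtype.ext (Prod.ext rfl (O.gr.src_unit _))
  tgt_unit p := Subtype.ext (Prod.ext rfl (O.gr.tgt_unit _))
  src_inv q := Subtype.ext (Prod.ext rfl (O.gr.src_inv _))
  tgt_inv q := Subtype.ext (Prod.ext rfl (O.gr.tgt_inv _))
  src_comp g f h := by
    have h' := src_eq_tgt_of_srcMap_eq h
    refine Subtype.ext (Prod.ext ?_ ?_)
    · change (compMap g f).1.1.1 = _
      rw [val_compMap h]
      rfl
    · change O.gr.src (compMap g f).1.2 = _
      rw [val_compMap h]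
      exact O.gr.src_comp _ _ h'
  tgt_comp g f h := by
    have h' := src_eq_tgt_of_srcMap_eq h
    refine Subtype.ext (Prod.ext ?_ ?_)
    · change (compMap g f).1.1.2 = _
      rw [val_compMap h]
      rfl
    · change O.gr.tgt (compMap g f).1.2 = _
      rw [val_compMap h]
      exact O.gr.tgt_comp _ _ h'
  comp_assoc h g f hhg hgf := by
    have h1 := src_eq_tgt_of_srcMap_eq hhg
    have h2 := src_eq_tgt_of_srcMap_eq hgf
    have h3 : srcMap (compMap h g) = tgtMap f := by
      refine Subtype.ext (Prod.ext ?_ ?_)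
      · change (compMap h g).1.1.1 = _
        rw [val_compMap hhg]
        exact idx_eq_of_srcMap_eq hgf
      · change O.gr.src (compMap h g).1.2 = _
        rw [val_compMap hhg]
        exact (O.gr.src_comp _ _ h1).trans h2
    have h4 : srcMap h = tgtMap (compMap g f) := by
      refine Subtype.ext (Prod.ext ?_ ?_)
      · change _ = (compMap g f).1.1.2
        rw [val_compMap hgf]
        exact idx_eq_of_srcMap_eq hhg
      · change _ = O.gr.tgt (compMap g f).1.2
        rw [val_compMap hgf]
        exact h1.trans (O.gr.tgt_comp _ _ h2).symm
    refine Subtype.ext ?_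
    rw [val_compMap h3, val_compMap h4, val_compMap hhg, val_compMap hgf]
    exact Prod.ext rfl (O.gr.comp_assoc _ _ _ h1 h2)
  comp_unit g := by
    have h : srcMap g = tgtMap (unitMap (srcMap g)) :=
      Subtype.ext (Prod.ext rfl (O.gr.tgt_unit _).symm)
    exact Subtype.ext ((val_compMap h).trans (Prod.ext rfl (O.gr.comp_unit _)))
  unit_comp g := by
    have h : srcMap (unitMap (tgtMap g)) = tgtMap g :=
      Subtype.ext (Prod.ext rfl (O.gr.src_unit _))
    exact Subtype.ext ((val_compMap h).trans (Prod.ext rfl (O.gr.unit_comp _)))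
  comp_inv g := by
    have h : srcMap g = tgtMap (invMap g) := Subtype.ext (Prod.ext rfl (O.gr.tgt_inv _).symm)
    exact Subtype.ext ((val_compMap h).trans (Prod.ext rfl (O.gr.comp_inv _)))
  inv_comp g := by
    have h : srcMap (invMap g) = tgtMap g := Subtype.ext (Prod.ext rfl (O.gr.src_inv _))
    exact Subtype.ext ((val_compMap h).trans (Prod.ext rfl (O.gr.inv_comp _)))

theorem continuous_incl : Continuous (incl : C.Obj → O.Obj) :=
  continuous_snd.comp continuous_subtype_val

theorem continuous_inclMor : Continuous (inclMor : C.Mor → O.Mor) :=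
  continuous_snd.comp continuous_subtype_val

theorem continuous_idx : Continuous (idx : C.Obj → Fin C.N) :=
  continuous_fst.comp continuous_subtype_val

theorem isOpen_idx (m : Fin C.N) : IsOpen {p : C.Obj | idx p = m} :=
  (isOpen_discrete {m}).preimage continuous_idx

theorem continuous_srcMap : Continuous (srcMap : C.Mor → C.Obj) :=
  Continuous.subtype_mk ((continuous_fst.comp (continuous_fst.comp continuous_subtype_val)).prodMk
    (O.continuous_src.comp continuous_inclMor)) _

theorem continuous_tgtMap : Continuous (tgtMap : C.Mor → C.Obj) :=
  Continuous.subtype_mk ((continuous_snd.comp (continuous_fst.comp continuous_subtype_val)).prodMk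
    (O.continuous_tgt.comp continuous_inclMor)) _

theorem continuous_invMap : Continuous (invMap : C.Mor → C.Mor) :=
  Continuous.subtype_mk (((continuous_snd.comp (continuous_fst.comp continuous_subtype_val)).prodMk
    (continuous_fst.comp (continuous_fst.comp continuous_subtype_val))).prodMk
    (O.continuous_inv.comp continuous_inclMor)) _

theorem continuous_unitMap : Continuous (unitMap : C.Obj → C.Mor) :=
  Continuous.subtype_mk ((continuous_idx.prodMk continuous_idx).prodMk
    (O.continuous_unit.comp continuous_incl)) _

theorem continuousOn_compMap : ContinuousOn (fun p : C.Mor × C.Mor => compMap p.1 p.2)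
    {p | srcMap p.1 = tgtMap p.2} := by
  refine IsInducing.subtypeVal.continuousOn_iff.mpr ?_
  have h1 : ContinuousOn (fun p : C.Mor × C.Mor => O.gr.comp p.1.1.2 p.2.1.2)
      {p | srcMap p.1 = tgtMap p.2} :=
    O.continuousOn_comp.comp ((continuous_inclMor.comp continuous_fst).prodMk
      (continuous_inclMor.comp continuous_snd)).continuousOn
      fun p hp => src_eq_tgt_of_srcMap_eq hp
  have h2 : Continuous fun p : C.Mor × C.Mor => (p.2.1.1.1, p.1.1.1.2) :=
    (continuous_fst.comp (continuous_fst.comp (continuous_subtype_val.comp continuous_snd))).prodMk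
      (continuous_snd.comp (continuous_fst.comp (continuous_subtype_val.comp continuous_fst)))
  exact (h2.continuousOn.prodMk h1).congr fun p hp => val_compMap hp

/-- The étale map of the object space to `ℝ^k`. -/
noncomputable def coord (p : C.Obj) : EuclideanSpace ℝ (Fin k) := C.κ (idx p) (C.φ (idx p) (incl p))

/-- The inverse of `coord` in the slice chart of the object `p`. -/
noncomputable def coordInv (p : C.Obj) (e : EuclideanSpace ℝ (Fin k)) : EuclideanSpace ℝ (Fin n) :=
  C.φ (idx p) (incl p) + C.ι (idx p) (e - coord p)

theorem coordInv_coord {p p' : C.Obj} (h : idx p' = idx p) :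
    coordInv p (coord p') = C.φ (idx p) (incl p') := by
  have h1 : C.φ (idx p) (incl p') ∈ C.L (idx p) :=
    ((C.slice _).mem_iff (h ▸ incl_mem_source p')).mp (incl_mem p')
  have h2 := ((C.slice _).mem_iff (incl_mem_source p)).mp (incl_mem p)
  have h3 : C.φ (idx p) (incl p') - C.φ (idx p) (incl p) ∈ (C.L (idx p)).direction :=
    AffineSubspace.vsub_mem_direction h1 h2
  rw [coordInv, coord, coord, h, ← map_sub, C.ι_κ _ _ h3, add_sub_cancel]

theorem contDiff_coordInv (p : C.Obj) : ContDiff ℝ ∞ (coordInv p) :=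
  contDiff_const.add ((C.ι _).contDiff.comp (contDiff_id.sub contDiff_const))

theorem isLocalHomeomorph_coord : IsLocalHomeomorph (coord : C.Obj → _) := by
  intro p
  set m := idx p with hm
  have hV : IsOpen (coordInv p ⁻¹' (C.φ m).target) :=
    (C.φ m).open_target.preimage (contDiff_coordInv p).continuous
  refine exists_openPartialHomeomorph_of_inverse (isOpen_idx m) hV
    (fun e => (m, (C.φ m).symm (coordInv p e))) ?_ ?_ ?_ ?_ ?_ hm.symm
  · have h1 : ContinuousOn (fun p' : C.Obj => C.κ m (C.φ m (incl p'))) {p' : C.Obj | idx p' = m} :=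
      (C.κ m).continuous.comp_continuousOn ((C.φ m).continuousOn.comp continuous_incl.continuousOn
        fun p' hp' => by
          have h2 : idx p' = m := hp'
          exact h2 ▸ incl_mem_source p')
    refine h1.congr fun p' hp' => ?_
    have h2 : idx p' = m := hp'
    rw [← h2]
    rfl
  · exact continuousOn_const.prodMk ((C.φ m).continuousOn_symm.comp
      (contDiff_coordInv p).continuous.continuousOn fun e he => he)
  · intro p' hp'
    rw [mem_preimage, coordInv_coord hp']
    have h2 : idx p' = m := hp'
    exact (C.φ m).map_source (h2 ▸ incl_mem_source p')
  · intro e he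
    have h1 : (C.φ m) ((C.φ m).symm (coordInv p e)) = coordInv p e := (C.φ m).right_inv he
    have h2 : (C.φ m).symm (coordInv p e) ∈ (C.φ m).source := (C.φ m).map_target he
    have h3 : (C.φ m).symm (coordInv p e) ∈ X := by
      refine ((C.slice m).mem_iff h2).mpr ?_
      rw [h1, coordInv, add_comm]
      exact AffineSubspace.vadd_mem_of_mem_direction (C.ι_mem m _)
        (((C.slice _).mem_iff (incl_mem_source p)).mp (incl_mem p))
    refine ⟨⟨h2, h3⟩, rfl, ?_⟩
    change C.κ m (C.φ m ((C.φ m).symm (coordInv p e))) = e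
    rw [h1, coordInv, map_add, C.κ_ι]
    exact add_sub_cancel _ _
  · intro p' hp'
    have h2 : idx p' = m := hp'
    refine Prod.ext hp'.symm ?_
    change (C.φ m).symm (coordInv p (coord p')) = incl p'
    rw [coordInv_coord hp']
    exact (C.φ m).left_inv (h2 ▸ incl_mem_source p')

noncomputable instance : ChartedSpace (EuclideanSpace ℝ (Fin k)) C.Obj :=
  isLocalHomeomorph_coord.etaleChartedSpace

instance : IsManifold (𝓡 k) ∞ C.Obj := isLocalHomeomorph_coord.isManifold_etale

theorem isLocalDiffeomorph_coord : IsLocalDiffeomorph (𝓡 k) (𝓡 k) ∞ (coord : C.Obj → _) :=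
  isLocalHomeomorph_coord.isLocalDiffeomorph_etale

theorem contMDiff_incl : ContMDiff (𝓡 k) (𝓡 n) ∞ (incl : C.Obj → O.Obj) := by
  intro p
  set m := idx p with hm
  have h0 : coordInv p (coord p) ∈ (C.φ m).target := by
    rw [coordInv_coord rfl]
    exact (C.φ m).map_source (incl_mem_source p)
  have h1 : ContMDiffAt (𝓡 k) (𝓡 n) ∞ ((C.φ m).symm ∘ coordInv p ∘ coord) p :=
    ((C.slice m).diffeo.symm.contMDiffAt h0).comp p
      ((contDiff_coordInv p).contMDiff.contMDiffAt.comp p (isLocalDiffeomorph_coord.contMDiff p))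
  refine h1.congr_of_eventuallyEq ?_
  filter_upwards [(isOpen_idx m).mem_nhds hm.symm] with p' hp'
  have h2 : idx p' = m := hp'
  simp only [Function.comp_apply]
  rw [coordInv_coord hp']
  exact ((C.φ m).left_inv (h2 ▸ incl_mem_source p')).symm

theorem injective_tderiv_incl (p : C.Obj) : Function.Injective
    (tderiv (EuclideanSpace ℝ (Fin k)) (EuclideanSpace ℝ (Fin n)) (incl : C.Obj → O.Obj) p) := by
  set m := idx p with hm
  have hd : MDifferentiableAt (𝓡 k) (𝓡 n) (incl : C.Obj → O.Obj) p :=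
    (contMDiff_incl p).mdifferentiableAt (by simp)
  have hφ : MDifferentiableAt (𝓡 n) (𝓡 n) (C.φ m) (incl p) :=
    (C.slice m).diffeo.mdifferentiableAt (incl_mem_source p)
  have hκ : MDifferentiableAt (𝓡 n) (𝓡 k) (C.κ m) (C.φ m (incl p)) :=
    mdifferentiableAt_iff_differentiableAt.mpr (C.κ m).differentiableAt
  have e1 := tderiv_comp (E := EuclideanSpace ℝ (Fin k)) (E' := EuclideanSpace ℝ (Fin n))
    (E'' := EuclideanSpace ℝ (Fin n)) (x := p) (f := incl) (g := C.φ m) hφ hd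
  have e2 := tderiv_comp (E := EuclideanSpace ℝ (Fin k)) (E' := EuclideanSpace ℝ (Fin n))
    (E'' := EuclideanSpace ℝ (Fin k)) (x := p) (f := C.φ m ∘ incl) (g := C.κ m) hκ (hφ.comp p hd)
  have e3 : tderiv (EuclideanSpace ℝ (Fin k)) (EuclideanSpace ℝ (Fin k)) (coord : C.Obj → _) p =
      tderiv (EuclideanSpace ℝ (Fin k)) (EuclideanSpace ℝ (Fin k)) (C.κ m ∘ (C.φ m ∘ incl)) p := by
    refine tderiv_congr ?_
    filter_upwards [(isOpen_idx m).mem_nhds hm.symm] with p' hp'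
    have h2 : idx p' = m := hp'
    simp only [Function.comp_apply]
    rw [← h2]
    rfl
  obtain ⟨ψ, hpψ, hψ, hψd⟩ := IsPartialDiffeo.exists_of_isLocalDiffeomorphAt
    (isLocalDiffeomorph_coord p)
  have e4 := hψd.tderiv_injective hpψ
  rw [tderiv_congr (g := coord) (by
    filter_upwards [ψ.open_source.mem_nhds hpψ] with p' hp'
    exact hψ p' hp'), e3, e2, e1] at e4
  exact Function.Injective.of_comp (Function.Injective.of_comp e4)

theorem isLocalHomeomorph_srcMap : IsLocalHomeomorph (srcMap : C.Mor → C.Obj) := by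
  rintro q
  obtain ⟨⟨⟨m, m'⟩, h⟩, hq⟩ := q
  -- the local inverse is given by the local section of the source map through `h`
  have hU : IsOpen {q : C.Mor | q.1.1 = (m, m') ∧ q.1.2 ∈ O.biNhd h} :=
    ((isOpen_discrete {(m, m')}).preimage (continuous_fst.comp continuous_subtype_val)).inter
      ((O.isOpen_biNhd h).preimage continuous_inclMor)
  have hVo : IsOpen ((O.transport h).source ∩ O.sec h ⁻¹'
      (O.biNhd h ∩ O.gr.tgt ⁻¹' (C.φ m').source)) :=
    (EpGroupoid.continuousOn_sec h).isOpen_inter_preimage (O.transport h).open_source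
      ((O.isOpen_biNhd h).inter ((C.φ m').open_source.preimage O.continuous_tgt))
  have hV : IsOpen {p : C.Obj | idx p = m ∧ incl p ∈ (O.transport h).source ∩ O.sec h ⁻¹'
      (O.biNhd h ∩ O.gr.tgt ⁻¹' (C.φ m').source)} :=
    (isOpen_idx m).inter (hVo.preimage continuous_incl)
  refine exists_openPartialHomeomorph_of_inverse hU hV (fun p => ((m, m'), O.sec h (incl p)))
    continuous_srcMap.continuousOn ?_ ?_ ?_ ?_ ⟨rfl, O.mem_biNhd h⟩
  · exact continuousOn_const.prodMk ((EpGroupoid.continuousOn_sec h).comp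
      continuous_incl.continuousOn fun p hp => hp.2.1)
  · rintro ⟨⟨⟨l, l'⟩, g⟩, hg⟩ ⟨hl, hgb⟩
    obtain ⟨rfl, rfl⟩ : l = m ∧ l' = m' := Prod.ext_iff.mp hl
    refine ⟨rfl, EpGroupoid.src_mem_transport hgb, ?_⟩
    have h1 : O.sec h (O.gr.src g) = g := EpGroupoid.sec_src hgb
    change O.sec h (O.gr.src g) ∈ O.biNhd h ∩ O.gr.tgt ⁻¹' (C.φ l').source
    rw [h1]
    exact ⟨hgb, hg.2.1⟩
  · rintro ⟨⟨l, z⟩, hz⟩ ⟨hl, hzs, hzb, hzt⟩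
    have hl : l = m := hl
    subst hl
    have h1 : O.gr.src (O.sec h z) = z := EpGroupoid.src_sec hzs
    refine ⟨⟨?_, hzt, ?_⟩, ⟨rfl, hzb⟩, ?_⟩
    · change O.gr.src (O.sec h z) ∈ _
      rw [h1]
      exact hz.1
    · change O.gr.src (O.sec h z) ∈ _
      rw [h1]
      exact hz.2
    · exact Subtype.ext (Prod.ext rfl h1)
  · rintro ⟨⟨⟨l, l'⟩, g⟩, hg⟩ ⟨hl, hgb⟩
    exact Prod.ext hl.symm (EpGroupoid.sec_src hgb)

theorem isLocalHomeomorph_coord_srcMap : IsLocalHomeomorph (coord ∘ srcMap : C.Mor → _) :=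
  isLocalHomeomorph_coord.comp isLocalHomeomorph_srcMap

noncomputable instance : ChartedSpace (EuclideanSpace ℝ (Fin k)) C.Mor :=
  isLocalHomeomorph_coord_srcMap.etaleChartedSpace

instance : IsManifold (𝓡 k) ∞ C.Mor := isLocalHomeomorph_coord_srcMap.isManifold_etale

theorem isLocalDiffeomorph_coord_srcMap :
    IsLocalDiffeomorph (𝓡 k) (𝓡 k) ∞ (coord ∘ srcMap : C.Mor → _) :=
  isLocalHomeomorph_coord_srcMap.isLocalDiffeomorph_etale

theorem isLocalDiffeomorph_srcMap : IsLocalDiffeomorph (𝓡 k) (𝓡 k) ∞ (srcMap : C.Mor → C.Obj) :=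
  isLocalHomeomorph_srcMap.isLocalDiffeomorph_of_comp isLocalDiffeomorph_coord
    isLocalDiffeomorph_coord_srcMap

theorem contMDiff_incl_tgtMap : ContMDiff (𝓡 k) (𝓡 n) ∞ (incl ∘ tgtMap : C.Mor → O.Obj) := by
  intro q
  have h1 : ContMDiffAt (𝓡 k) (𝓡 n) ∞ (O.transport (inclMor q) ∘ (incl ∘ srcMap)) q :=
    ((O.isPartialDiffeo_transport _).contMDiffAt (EpGroupoid.src_mem_transport_self _)).comp q
      ((contMDiff_incl _).comp q (isLocalDiffeomorph_srcMap.contMDiff q))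
  refine h1.congr_of_eventuallyEq ?_
  filter_upwards [continuous_inclMor.continuousAt (O.biNhd_mem_nhds (inclMor q))] with q' hq'
  exact (EpGroupoid.transport_src hq').symm

theorem contMDiff_coord_tgtMap : ContMDiff (𝓡 k) (𝓡 k) ∞ (coord ∘ tgtMap : C.Mor → _) := by
  intro q
  set m := idx (tgtMap q) with hm
  have h1 : ContMDiffAt (𝓡 k) (𝓡 k) ∞ (C.κ m ∘ (C.φ m ∘ (incl ∘ tgtMap))) q :=
    (C.κ m).contMDiff.contMDiffAt.comp q
      (((C.slice m).diffeo.contMDiffAt (incl_mem_source _)).comp q (contMDiff_incl_tgtMap q))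
  refine h1.congr_of_eventuallyEq ?_
  filter_upwards [continuous_tgtMap.continuousAt ((isOpen_idx m).mem_nhds hm.symm)] with q' hq'
  have h2 : idx (tgtMap q') = m := hq'
  simp only [Function.comp_apply]
  rw [← h2]
  rfl

theorem contMDiff_invMap : ContMDiff (𝓡 k) (𝓡 k) ∞ (invMap : C.Mor → C.Mor) := by
  refine contMDiff_of_comp_localDiffeo continuous_invMap isLocalDiffeomorph_coord_srcMap ?_
  convert contMDiff_coord_tgtMap using 1
  funext q
  exact congrArg coord (C.gr.src_inv q)

theorem contMDiff_inclMor : ContMDiff (𝓡 k) (𝓡 n) ∞ (inclMor : C.Mor → O.Mor) :=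
  contMDiff_of_comp_localDiffeo continuous_inclMor O.etale_src
    (contMDiff_incl.comp isLocalDiffeomorph_srcMap.contMDiff)

theorem isLocalDiffeomorph_tgtMap : IsLocalDiffeomorph (𝓡 k) (𝓡 k) ∞ (tgtMap : C.Mor → C.Obj) := by
  intro q
  let Θ : OpenPartialHomeomorph C.Mor C.Mor := Homeomorph.toOpenPartialHomeomorph
    { toFun := invMap
      invFun := invMap
      left_inv := C.gr.inv_inv
      right_inv := C.gr.inv_inv
      continuous_toFun := continuous_invMap
      continuous_invFun := continuous_invMap }
  have hΘ : IsPartialDiffeo (E := EuclideanSpace ℝ (Fin k)) Θ :=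
    ⟨contMDiff_invMap.contMDiffOn, contMDiff_invMap.contMDiffOn⟩
  obtain ⟨ψ, hq, hψ, hψd⟩ := IsPartialDiffeo.exists_of_isLocalDiffeomorphAt
    (isLocalDiffeomorph_srcMap (invMap q))
  refine (hΘ.trans hψd).isLocalDiffeomorphAt (x := q) ⟨mem_univ _, hq⟩ fun q' hq' => ?_
  have h1 : ψ (invMap q') = srcMap (invMap q') := hψ _ hq'.2
  exact (C.gr.src_inv q').symm.trans h1.symm

theorem isSigmaCompact_prod_singleton {ι Z : Type*} [TopologicalSpace ι] [TopologicalSpace Z]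
    {i : ι} {K : Set Z} (hK : IsSigmaCompact K) : IsSigmaCompact ({i} ×ˢ K : Set (ι × Z)) := by
  rw [singleton_prod]
  exact hK.image (Continuous.prodMk_right i)

theorem isSigmaCompact_piece (C : SliceCover O k X) (m : Fin C.N) :
    IsSigmaCompact ((C.φ m).source ∩ X) := by
  have h1 : (C.φ m).source ∩ X = (C.φ m).symm '' ((C.L m : Set _) ∩ (C.φ m).target) := by
    rw [← (C.slice m).image, inter_comm X]
    ext z
    constructor
    · exact fun hz => ⟨_, ⟨z, hz, rfl⟩, (C.φ m).left_inv hz.1⟩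
    · rintro ⟨_, ⟨z', hz', rfl⟩, rfl⟩
      rwa [(C.φ m).left_inv hz'.1]
  rw [h1]
  refine IsSigmaCompact.image_of_continuousOn ?_
    ((C.φ m).continuousOn_symm.mono inter_subset_right)
  obtain ⟨K, hK, hKt⟩ := (C.φ m).open_target.isSigmaCompact
  have hcl : IsClosed (C.L m : Set (EuclideanSpace ℝ (Fin n))) :=
    (C.L m).closed_of_finiteDimensional
  rw [← hKt, inter_iUnion]
  exact isSigmaCompact_iUnion_of_isCompact _ fun i => (hK i).inter_left hcl

/-- Together with local compactness, this gives paracompactness.  The family of charts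
being finite, it follows from the second countability of `ℝ^n`. -/
instance : SigmaCompactSpace C.Obj := by
  refine isSigmaCompact_iff_sigmaCompactSpace.mp ?_
  have : {p : Fin C.N × O.Obj | p.2 ∈ (C.φ p.1).source ∧ p.2 ∈ X} =
      ⋃ m, {m} ×ˢ ((C.φ m).source ∩ X) := by
    ext ⟨m, z⟩
    simp
  rw [this]
  exact isSigmaCompact_iUnion _ fun m => isSigmaCompact_prod_singleton (C.isSigmaCompact_piece m)

instance : SigmaCompactSpace C.Mor := by
  refine isSigmaCompact_iff_sigmaCompactSpace.mp ?_
  have : {q : (Fin C.N × Fin C.N) × O.Mor | O.gr.src q.2 ∈ (C.φ q.1.1).source ∧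
      O.gr.tgt q.2 ∈ (C.φ q.1.2).source ∧ O.gr.src q.2 ∈ X} =
      ⋃ m : Fin C.N × Fin C.N, {m} ×ˢ {h | O.gr.src h ∈ (C.φ m.1).source ∩ X ∧
        O.gr.tgt h ∈ (C.φ m.2).source ∩ X} := by
    ext ⟨m, h⟩
    have := C.embedded.src_mem_iff h
    simp only [mem_ofPred_eq, mem_iUnion, mem_prod, mem_singleton_iff, mem_inter_iff]
    constructor
    · exact fun hh => ⟨m, rfl, ⟨hh.1, hh.2.2⟩, hh.2.1, this.mp hh.2.2⟩
    · rintro ⟨_, rfl, hh⟩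
      exact ⟨hh.1.1, hh.2.1, hh.1.2⟩
  rw [this]
  exact isSigmaCompact_iUnion _ fun m => isSigmaCompact_prod_singleton
    (EpGroupoid.isSigmaCompact_arrows (C.isSigmaCompact_piece _) (C.isSigmaCompact_piece _))

instance : LocallyCompactSpace C.Obj :=
  ChartedSpace.locallyCompactSpace (EuclideanSpace ℝ (Fin k)) C.Obj

instance : LocallyCompactSpace C.Mor :=
  ChartedSpace.locallyCompactSpace (EuclideanSpace ℝ (Fin k)) C.Mor

theorem isCompact_incl_image {K : Set C.Obj} (hK : IsCompact K) (m : Fin C.N) :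
    IsCompact (incl '' (K ∩ {p | idx p = m})) :=
  (hK.inter_right (isClosed_discrete {m} |>.preimage continuous_idx)).image continuous_incl

theorem isCompact_arrows {K K' : Set C.Obj} (hK : IsCompact K) (hK' : IsCompact K') :
    IsCompact {q : C.Mor | srcMap q ∈ K ∧ tgtMap q ∈ K'} := by
  refine Subtype.isCompact_iff.mpr ?_
  have : (Subtype.val '' {q : C.Mor | srcMap q ∈ K ∧ tgtMap q ∈ K'} :
      Set ((Fin C.N × Fin C.N) × O.Mor)) =
      ⋃ m : Fin C.N × Fin C.N, {m} ×ˢ {h | O.gr.src h ∈ incl '' (K ∩ {p | idx p = m.1}) ∧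
        O.gr.tgt h ∈ incl '' (K' ∩ {p | idx p = m.2})} := by
    ext ⟨⟨m, m'⟩, h⟩
    simp only [mem_iUnion, mem_prod, mem_singleton_iff]
    constructor
    · rintro ⟨q, ⟨hs, ht⟩, hq⟩
      refine ⟨(m, m'), rfl, ⟨srcMap q, ⟨hs, ?_⟩, ?_⟩, ⟨tgtMap q, ⟨ht, ?_⟩, ?_⟩⟩
      · exact congrArg (fun x => x.1.1) hq
      · exact congrArg (fun x => O.gr.src x.2) hq
      · exact congrArg (fun x => x.1.2) hq
      · exact congrArg (fun x => O.gr.tgt x.2) hq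
    · rintro ⟨_, rfl, ⟨p, ⟨hp, hpm⟩, hps⟩, ⟨p', ⟨hp', hpm'⟩, hpt⟩⟩
      have hpm : idx p = m := hpm
      have hpm' : idx p' = m' := hpm'
      have hps : incl p = O.gr.src h := hps
      have hpt : incl p' = O.gr.tgt h := hpt
      have h1 := incl_mem_source p
      have h2 := incl_mem_source p'
      have h3 := incl_mem p
      rw [hpm, hps] at h1
      rw [hpm', hpt] at h2
      rw [hps] at h3
      refine ⟨⟨((m, m'), h), h1, h2, h3⟩, ⟨?_, ?_⟩, rfl⟩
      · convert hp using 1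
        exact Subtype.ext (Prod.ext hpm.symm hps.symm)
      · convert hp' using 1
        exact Subtype.ext (Prod.ext hpm'.symm hpt.symm)
  refine this ▸ isCompact_iUnion fun m => isCompact_singleton.prod
    (EpGroupoid.isCompact_arrows (isCompact_incl_image hK _) (isCompact_incl_image hK' _))

theorem isProper_gr : C.gr.IsProper := by
  intro p
  obtain ⟨K, hK, hp⟩ := exists_compact_mem_nhds p
  refine ⟨interior K, isOpen_interior, mem_interior_iff_mem_nhds.mpr hp, ?_⟩
  have hcl : IsCompact (closure (interior K)) :=
    hK.of_isClosed_subset isClosed_closure (closure_minimal interior_subset hK.isClosed)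
  refine isProperMap_iff_isCompact_preimage.mpr
    ⟨continuous_tgtMap.comp continuous_subtype_val, fun K' hK' => ?_⟩
  refine Subtype.isCompact_iff.mpr ?_
  convert isCompact_arrows hcl hK' using 1
  ext q
  constructor
  · rintro ⟨⟨q, hq⟩, hq', rfl⟩
    exact ⟨hq, hq'⟩
  · exact fun hq => ⟨⟨q, hq.1⟩, hq.2, rfl⟩

variable (C) in
/-- The ep-groupoid of a finite family of slice charts. -/
noncomputable def epGroupoid : EpGroupoid.{a, b} k where
  Obj := C.Obj
  Mor := C.Mor
  gr := C.gr
  smooth_unit := by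
    refine contMDiff_of_comp_localDiffeo continuous_unitMap isLocalDiffeomorph_coord_srcMap ?_
    convert isLocalDiffeomorph_coord.contMDiff using 1
    funext p
    exact congrArg coord (C.gr.src_unit p)
  smooth_inv := contMDiff_invMap
  smooth_comp := by
    intro p hp
    refine contMDiffWithinAt_of_comp_localDiffeo (continuousOn_compMap p hp)
      (isLocalDiffeomorph_coord_srcMap _) ?_
    have h1 : ContMDiffWithinAt ((𝓡 k).prod (𝓡 k)) (𝓡 k) ∞
        (fun p : C.Mor × C.Mor => (coord ∘ srcMap) p.2) {p | srcMap p.1 = tgtMap p.2} p :=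
      (isLocalDiffeomorph_coord_srcMap.contMDiff.comp contMDiff_snd).contMDiffAt.contMDiffWithinAt
    refine h1.congr (fun p' hp' => ?_) ?_
    · exact congrArg coord (C.gr.src_comp _ _ hp')
    · exact congrArg coord (C.gr.src_comp _ _ hp)
  etale_src := isLocalDiffeomorph_srcMap
  etale_tgt := isLocalDiffeomorph_tgtMap
  proper := isProper_gr

variable (C) in
/-- The inclusion functor. -/
noncomputable def inclFunctor : SmoothFunctor C.epGroupoid O where
  obj := incl
  mor := inclMor
  smooth_obj := contMDiff_incl
  smooth_mor := contMDiff_inclMor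
  src_mor _ := rfl
  tgt_mor _ := rfl
  mor_unit _ := rfl
  mor_comp _ _ h := congrArg Prod.snd (val_compMap h)

theorem exists_incl_proj_eq {x : O.Obj} (hx : x ∈ X) :
    ∃ p : C.Obj, O.gr.proj (incl p) = O.gr.proj x := by
  obtain ⟨m, z, hz, he⟩ := C.meets x hx
  exact ⟨⟨(m, z), hz, (C.embedded.mem_iff_of_proj_eq he).mpr hx⟩, he⟩

theorem isEquivalenceOnto_inclFunctor : IsEquivalenceOnto C.inclFunctor X where
  maps := incl_mem
  immersion := injective_tderiv_incl
  essSurj x hx := by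
    obtain ⟨p, hp⟩ := C.exists_incl_proj_eq hx
    exact ⟨p, O.gr.proj_eq_iff.mp hp⟩
  fullyFaithful p q g hs ht := by
    have hs : O.gr.src g = incl p := hs
    have ht : O.gr.tgt g = incl q := ht
    refine ⟨⟨((idx p, idx q), g), ?_, ?_, ?_⟩, ⟨?_, ?_, rfl⟩, ?_⟩
    · change O.gr.src g ∈ _
      rw [hs]
      exact incl_mem_source p
    · change O.gr.tgt g ∈ _
      rw [ht]
      exact incl_mem_source q
    · change O.gr.src g ∈ _
      rw [hs]
      exact incl_mem p
    · exact Subtype.ext (Prod.ext rfl hs)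
    · exact Subtype.ext (Prod.ext rfl ht)
    · rintro h ⟨rfl, rfl, rfl⟩
      rfl

end SliceCover

end SliceCover

/-! ### The equivalences onto a suborbifold and onto its image -/

section SmoothInclusion

variable {n k : ℕ} {O : EpGroupoid.{a, b} n} {X : Set O.Obj}

/-- Linear coordinates on the subspace `D`: the restriction to `D` of `κ`, with inverse `ι`. -/
theorem exists_linear_coordinates {V : Type*} [NormedAddCommGroup V] [NormedSpace ℝ V]
    [FiniteDimensional ℝ V] (D : Submodule ℝ V) (hD : Module.finrank ℝ D = k) :
    ∃ (κ : V →L[ℝ] EuclideanSpace ℝ (Fin k)) (ι : EuclideanSpace ℝ (Fin k) →L[ℝ] V),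
      (∀ e, κ (ι e) = e) ∧ (∀ e, ι e ∈ D) ∧ ∀ v ∈ D, ι (κ v) = v := by
  let e : EuclideanSpace ℝ (Fin k) ≃ₗ[ℝ] D :=
    LinearEquiv.ofFinrankEq _ _ (by rw [hD, finrank_euclideanSpace_fin])
  obtain ⟨κ, hκ⟩ := LinearMap.exists_leftInverse_of_injective (D.subtype ∘ₗ e.toLinearMap)
    (LinearMap.ker_eq_bot.mpr (D.injective_subtype.comp e.injective))
  have h1 : ∀ x, κ (e x) = x := fun x => LinearMap.congr_fun hκ x
  refine ⟨LinearMap.toContinuousLinearMap κ,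
    LinearMap.toContinuousLinearMap (D.subtype ∘ₗ e.toLinearMap), h1, fun x => (e x).2,
    fun v hv => ?_⟩
  obtain ⟨x, hx⟩ := e.surjective ⟨v, hv⟩
  have hx : (e x : V) = v := congrArg Subtype.val hx
  change (e (κ v) : V) = v
  rw [← hx, h1]

/-- A compact suborbifold has a finite family of slice charts subordinate to a given open cover. -/
theorem IsEmbeddedFullSuborbifold.exists_sliceCover (hX : IsEmbeddedFullSuborbifold O k X)
    (hXc : IsCompact (O.gr.proj '' X)) {ι : Type*} {D : ι → Set O.Obj} (hD : ∀ i, IsOpen (D i))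
    (hDX : ∀ x, ∃ i, x ∈ D i) :
    ∃ C : SliceCover O k X, ∃ i : Fin C.N → ι, ∀ m, (C.φ m).source ⊆ D (i m) := by
  have h1 : ∀ x : X, ∃ φ L, ∃ i : ι, x.1 ∈ φ.source ∧ IsSliceChart k X φ L ∧ φ.source ⊆ D i := by
    intro x
    obtain ⟨φ, L, hxφ, h⟩ := hX.exists_sliceChart x.2
    obtain ⟨i, hi⟩ := hDX x
    refine ⟨φ.restrOpen (D i) (hD i), L, i, ?_, h.restrOpen _ _, ?_⟩
    · rw [φ.restrOpen_source]
      exact ⟨hxφ, hi⟩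
    · rw [φ.restrOpen_source]
      exact inter_subset_right
  choose φ L i hxφ hs hi using h1
  obtain ⟨t, ht⟩ := hXc.elim_finite_subcover (fun x : X => O.gr.proj '' (φ x).source)
    (fun x => O.isOpenMap_proj _ (φ x).open_source) (by
      rintro _ ⟨x, hx, rfl⟩
      exact mem_iUnion.mpr ⟨⟨x, hx⟩, x, hxφ ⟨x, hx⟩, rfl⟩)
  choose κ κ' h1 h2 h3 using fun x : X => exists_linear_coordinates _ (hs x).finrank
  refine ⟨{ N := t.card
            φ := fun m => φ (t.equivFin.symm m)
            L := fun m => L (t.equivFin.symm m)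
            slice := fun m => hs _
            embedded := hX
            κ := fun m => κ (t.equivFin.symm m)
            ι := fun m => κ' (t.equivFin.symm m)
            κ_ι := fun m => h1 _
            ι_mem := fun m => h2 _
            ι_κ := fun m => h3 _
            meets := fun x hx => ?_ }, fun m => i (t.equivFin.symm m), fun m => hi _⟩
  obtain ⟨y, hy, z, hz, he⟩ := mem_iUnion₂.mp (ht ⟨x, hx, rfl⟩)
  refine ⟨t.equivFin ⟨y, hy⟩, z, ?_, he⟩
  rwa [Equiv.symm_apply_apply]

namespace SliceCover

variable {C : SliceCover O k X} {Ψ : CocycleAut O} {i : Fin C.N → Ψ.ι}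

variable (Ψ i) in
/-- The composite of the inclusion with a generalised automorphism, on objects. -/
noncomputable def imageObj (p : C.Obj) : O.Obj := Ψ.G (i (idx p)) (incl p)

variable (Ψ i) in
/-- The composite of the inclusion with a generalised automorphism, on morphisms. -/
noncomputable def imageMor (q : C.Mor) : O.Mor :=
  Ψ.μ (i (idx (srcMap q))) (i (idx (tgtMap q))) (inclMor q)

theorem eventuallyEq_imageObj (p : C.Obj) :
    imageObj Ψ i =ᶠ[𝓝 p] Ψ.G (i (idx p)) ∘ incl := by
  filter_upwards [(isOpen_idx (idx p)).mem_nhds rfl] with p' hp'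
  have h : idx p' = idx p := hp'
  rw [imageObj, h]
  rfl

section

variable (hi : ∀ m, (C.φ m).source ⊆ (Ψ.G (i m)).source)

include hi

theorem incl_mem_source_G (p : C.Obj) : incl p ∈ (Ψ.G (i (idx p))).source :=
  hi _ (incl_mem_source p)

theorem src_imageMor (q : C.Mor) : O.gr.src (imageMor Ψ i q) = imageObj Ψ i (srcMap q) :=
  Ψ.src_μ _ _ _ (incl_mem_source_G hi (srcMap q)) (incl_mem_source_G hi (tgtMap q))

theorem tgt_imageMor (q : C.Mor) : O.gr.tgt (imageMor Ψ i q) = imageObj Ψ i (tgtMap q) :=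
  Ψ.tgt_μ _ _ _ (incl_mem_source_G hi (srcMap q)) (incl_mem_source_G hi (tgtMap q))

theorem contMDiff_imageObj : ContMDiff (𝓡 k) (𝓡 n) ∞ (imageObj Ψ i : C.Obj → O.Obj) := fun p =>
  (((Ψ.diffeo _).contMDiffAt (incl_mem_source_G hi p)).comp p
    (contMDiff_incl p)).congr_of_eventuallyEq (eventuallyEq_imageObj p)

theorem injective_tderiv_imageObj (p : C.Obj) : Function.Injective
    (tderiv (EuclideanSpace ℝ (Fin k)) (EuclideanSpace ℝ (Fin n))
      (imageObj Ψ i : C.Obj → O.Obj) p) := by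
  rw [tderiv_congr (eventuallyEq_imageObj p),
    tderiv_comp (E := EuclideanSpace ℝ (Fin k)) (E' := EuclideanSpace ℝ (Fin n))
      (E'' := EuclideanSpace ℝ (Fin n)) (x := p) (f := incl) (g := Ψ.G (i (idx p)))
      ((Ψ.diffeo _).mdifferentiableAt (incl_mem_source_G hi p))
      ((contMDiff_incl p).mdifferentiableAt (by simp))]
  exact ((Ψ.diffeo _).tderiv_injective (incl_mem_source_G hi p)).comp (injective_tderiv_incl p)

theorem continuous_imageMor : Continuous (imageMor Ψ i : C.Mor → O.Mor) := by
  refine continuous_iff_continuousAt.mpr fun q => ?_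
  have hV : IsOpen {h | O.gr.src h ∈ (Ψ.G (i (idx (srcMap q)))).source ∧
      O.gr.tgt h ∈ (Ψ.G (i (idx (tgtMap q)))).source} :=
    ((Ψ.G _).open_source.preimage O.continuous_src).inter
      ((Ψ.G _).open_source.preimage O.continuous_tgt)
  have h1 : ContinuousAt (Ψ.μ (i (idx (srcMap q))) (i (idx (tgtMap q)))) (inclMor q) :=
    (Ψ.continuousOn_μ _ _).continuousAt (hV.mem_nhds
      ⟨incl_mem_source_G hi (srcMap q), incl_mem_source_G hi (tgtMap q)⟩)
  refine (ContinuousAt.comp (g := Ψ.μ (i (idx (srcMap q))) (i (idx (tgtMap q)))) h1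
    continuous_inclMor.continuousAt).congr ?_
  filter_upwards [continuous_srcMap.continuousAt ((isOpen_idx (idx (srcMap q))).mem_nhds rfl),
    continuous_tgtMap.continuousAt ((isOpen_idx (idx (tgtMap q))).mem_nhds rfl)] with q' hs ht
  have hs : idx (srcMap q') = idx (srcMap q) := hs
  have ht : idx (tgtMap q') = idx (tgtMap q) := ht
  rw [imageMor, hs, ht]
  rfl

theorem contMDiff_imageMor : ContMDiff (𝓡 k) (𝓡 n) ∞ (imageMor Ψ i : C.Mor → O.Mor) := by
  refine contMDiff_of_comp_localDiffeo (continuous_imageMor hi) O.etale_src ?_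
  convert (contMDiff_imageObj hi).comp isLocalDiffeomorph_srcMap.contMDiff using 1
  funext q
  exact src_imageMor hi q

theorem imageMor_comp {g f : C.Mor} (h : srcMap g = tgtMap f) :
    imageMor Ψ i (compMap g f) = O.gr.comp (imageMor Ψ i g) (imageMor Ψ i f) := by
  have h1 : srcMap (compMap g f) = srcMap f := C.gr.src_comp _ _ h
  have h2 : tgtMap (compMap g f) = tgtMap g := C.gr.tgt_comp _ _ h
  have h3 : inclMor (compMap g f) = O.gr.comp (inclMor g) (inclMor f) :=
    congrArg Prod.snd (val_compMap h)
  rw [imageMor, h1, h2, h3]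
  refine (Ψ.comp_μ _ (i (idx (tgtMap f))) _ _ _ (src_eq_tgt_of_srcMap_eq h)
    (incl_mem_source_G hi (srcMap f)) (incl_mem_source_G hi (tgtMap f))
    (incl_mem_source_G hi (tgtMap g))).trans ?_
  have h4 : imageMor Ψ i g = Ψ.μ (i (idx (tgtMap f))) (i (idx (tgtMap g))) (inclMor g) := by
    rw [imageMor, h]
  rw [h4]
  rfl

theorem imageMor_unit (p : C.Obj) :
    imageMor Ψ i (unitMap p) = O.gr.unit (imageObj Ψ i p) := by
  have hs : srcMap (unitMap p) = p := C.gr.src_unit p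
  have ht : tgtMap (unitMap p) = p := C.gr.tgt_unit p
  have h1 : srcMap (unitMap p) = tgtMap (unitMap p) := by rw [hs, ht]
  have h2 : compMap (unitMap p) (unitMap p) = unitMap p := by
    have := C.gr.comp_unit (unitMap p)
    rwa [show C.gr.src (unitMap p) = p from hs] at this
  -- An idempotent of a groupoid is a unit.
  have h3 := imageMor_comp hi h1
  rw [h2] at h3
  have h4 : O.gr.src (imageMor Ψ i (unitMap p)) = imageObj Ψ i p := by rw [src_imageMor hi, hs]
  have h5 : O.gr.tgt (imageMor Ψ i (unitMap p)) = imageObj Ψ i p := by rw [tgt_imageMor hi, ht]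
  refine (O.gr.comp_left_cancel (h := imageMor Ψ i (unitMap p)) ?_ ?_ ?_)
  · rw [h4, h5]
  · rw [h4, O.gr.tgt_unit]
  · rw [← h3, ← h4, O.gr.comp_unit]

/-- The composite of the inclusion functor with a generalised automorphism. -/
noncomputable def imageFunctor : SmoothFunctor C.epGroupoid O where
  obj := imageObj Ψ i
  mor := imageMor Ψ i
  smooth_obj := contMDiff_imageObj hi
  smooth_mor := contMDiff_imageMor hi
  src_mor := src_imageMor hi
  tgt_mor := tgt_imageMor hi
  mor_unit := imageMor_unit hi
  mor_comp _ _ h := imageMor_comp hi h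

theorem isEquivalenceOnto_imageFunctor :
    IsEquivalenceOnto (imageFunctor hi) (Ψ.image X) where
  maps p := (CocycleAut.G_mem_image_iff C.embedded (incl_mem_source_G hi p)).mpr (incl_mem p)
  immersion := injective_tderiv_imageObj hi
  essSurj z' hz' := by
    obtain ⟨z, hz, j, hj, g, hs, ht⟩ := CocycleAut.exists_of_mem_image hz'
    obtain ⟨p, hp⟩ := C.exists_incl_proj_eq hz
    refine ⟨p, O.gr.proj_eq_iff.mp ?_⟩
    change O.gr.proj (Ψ.G (i (idx p)) (incl p)) = _
    rw [← ht, ← O.gr.proj_src_eq_proj_tgt, hs, ← Ψ.orb_proj _ _ hj, ← hp,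
      Ψ.orb_proj _ _ (incl_mem_source_G hi p)]
  fullyFaithful p q g hs ht := by
    obtain ⟨h, ⟨h1, h2, h3⟩, hu⟩ := Ψ.existsUnique_μ _ _ _ (incl_mem_source_G hi p) _
      (incl_mem_source_G hi q) g hs ht
    obtain ⟨h', ⟨rfl, rfl, rfl⟩, -⟩ :=
      C.isEquivalenceOnto_inclFunctor.fullyFaithful p q h h1 h2
    refine ⟨h', ⟨rfl, rfl, h3⟩, ?_⟩
    rintro h'' ⟨hs'', ht'', h3''⟩
    refine (C.isEquivalenceOnto_inclFunctor.fullyFaithful _ _ _ h1 h2).unique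
      ⟨hs'', ht'', ?_⟩ ⟨rfl, rfl, rfl⟩
    refine hu _ ⟨congrArg incl hs'', congrArg incl ht'', ?_⟩
    have hs'' : srcMap h'' = C.epGroupoid.gr.src h' := hs''
    have ht'' : tgtMap h'' = C.epGroupoid.gr.tgt h' := ht''
    rw [← hs'', ← ht'']
    exact h3''

end

end SliceCover

namespace CocycleAut

variable (Ψ : CocycleAut O)

/-- The restriction to a suborbifold of the map of orbit spaces given by a generalised
automorphism. -/
def restrict (X : Set O.Obj) : C(underlying O X, O.gr.Orbit) := Ψ.orb.comp (inclusionMap O X)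

theorem preimage_range_restrict (X : Set O.Obj) :
    O.gr.proj ⁻¹' range (Ψ.restrict X) = Ψ.image X := by
  have : range (Ψ.restrict X) = Ψ.orb '' (O.gr.proj '' X) := by
    ext y
    constructor
    · rintro ⟨⟨x, hx⟩, rfl⟩
      exact ⟨x, hx, rfl⟩
    · rintro ⟨x, hx, rfl⟩
      exact ⟨⟨x, hx⟩, rfl⟩
  rw [this]
  rfl

theorem homotopic_restrict (X : Set O.Obj) : (inclusionMap O X).Homotopic (Ψ.restrict X) :=
  ContinuousMap.Homotopic.comp Ψ.homotopic (ContinuousMap.Homotopic.refl (inclusionMap O X))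

/-- The two functors, from the ep-groupoid of a slice cover subordinate to the sources of the
partial diffeomorphisms of `Ψ`, are the inclusion and its composite with `Ψ`. -/
theorem isSmoothInclusion_restrict (hX : IsEmbeddedFullSuborbifold O k X)
    (hXc : IsCompact (O.gr.proj '' X)) : IsSmoothInclusion O k X (Ψ.restrict X) := by
  obtain ⟨C, i, hi⟩ := hX.exists_sliceCover hXc (fun i => (Ψ.G i).open_source) Ψ.cover
  refine ⟨?_, C.epGroupoid, C.inclFunctor, SliceCover.imageFunctor hi,
    C.isEquivalenceOnto_inclFunctor, ?_, fun p hp => ?_⟩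
  · rw [preimage_range_restrict]
    exact isEmbeddedFullSuborbifold_image hX
  · rw [preimage_range_restrict]
    exact SliceCover.isEquivalenceOnto_imageFunctor hi
  · exact Ψ.orb_proj _ _ (SliceCover.incl_mem_source_G hi p)

end CocycleAut

end SmoothInclusion

/-! ### Comparison of the branches of a weighted branched suborbifold -/

/-- If finitely many relatively closed sets cover the open set `N`, then every point of `N` is a
limit of interior points of one of them. -/
theorem exists_mem_closure_interior {E : Type*} [TopologicalSpace E] [BaireSpace E] {N : Set E}
    (hN : IsOpen N) {ι : Type*} [Finite ι] {A : ι → Set E}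
    (hA : ∀ j, ∀ z ∈ N, z ∈ closure (A j) → z ∈ A j) (hNA : ∀ z ∈ N, ∃ j, z ∈ A j) {q : E}
    (hq : q ∈ N) : ∃ j I, IsOpen I ∧ I ⊆ N ∩ A j ∧ q ∈ closure I := by
  let f : Option ι → Set E := fun o => o.elim Nᶜ fun j => closure (A j)
  have hf : ∀ o, IsClosed (f o) := by
    rintro (_ | j)
    · exact hN.isClosed_compl
    · exact isClosed_closure
  have hU : ⋃ o, f o = univ := by
    refine eq_univ_of_forall fun z => mem_iUnion.mpr ?_
    by_cases hz : z ∈ N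
    · obtain ⟨j, hj⟩ := hNA z hz
      exact ⟨some j, subset_closure hj⟩
    · exact ⟨none, hz⟩
  have h1 := (dense_iUnion_interior_of_closed hf hU).open_subset_closure_inter hN hq
  have h2 : N ∩ ⋃ o, interior (f o) ⊆ ⋃ j, N ∩ interior (closure (A j)) := by
    rintro z ⟨hz, hz'⟩
    obtain ⟨o, ho⟩ := mem_iUnion.mp hz'
    cases o with
    | none => exact absurd hz (interior_subset ho)
    | some j => exact mem_iUnion.mpr ⟨j, hz, ho⟩
  have h3 := closure_mono h2 h1
  rw [closure_iUnion_of_finite] at h3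
  obtain ⟨j, hj⟩ := mem_iUnion.mp h3
  exact ⟨j, _, hN.inter isOpen_interior, fun z hz => ⟨hz.1, hA j z hz.1 (interior_subset hz.2)⟩, hj⟩

/-- Two maps of class `C¹` near `q` which agree on an open set with `q` in its closure have the
same differential at `q`. -/
theorem fderiv_eq_of_eventually_eq {E F : Type*} [NormedAddCommGroup E] [NormedSpace ℝ E]
    [NormedAddCommGroup F] [NormedSpace ℝ F] {f g : E → F} {q : E} (hf : ContDiffAt ℝ 1 f q)
    (hg : ContDiffAt ℝ 1 g q) {I : Set E} (hI : IsOpen I) (hq : q ∈ closure I)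
    (h : ∀ᶠ z in 𝓝 q, z ∈ I → f z = g z) : fderiv ℝ f q = fderiv ℝ g q := by
  have : (𝓝[I] q).NeBot := mem_closure_iff_nhdsWithin_neBot.mp hq
  refine tendsto_nhds_unique_of_eventuallyEq
    ((hf.continuousAt_fderiv one_ne_zero).mono_left nhdsWithin_le_nhds)
    ((hg.continuousAt_fderiv one_ne_zero).mono_left (nhdsWithin_le_nhds (s := I))) ?_
  filter_upwards [self_mem_nhdsWithin, nhdsWithin_le_nhds h.eventually_nhds] with z hz hz'
  refine EventuallyEq.fderiv_eq ?_
  filter_upwards [hz', hI.mem_nhds hz] with w hw hwI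
  exact hw hwI

/-- The version of `fderiv_eq_of_eventually_eq` for maps to a manifold. -/
theorem tderiv_eq_of_eventually_eq {E F : Type*} [NormedAddCommGroup E] [NormedSpace ℝ E]
    [NormedAddCommGroup F] [NormedSpace ℝ F] {M : Type*} [TopologicalSpace M] [ChartedSpace F M]
    [IsManifold 𝓘(ℝ, F) ∞ M] {f g : E → M} {q : E} (hf : ContMDiffAt 𝓘(ℝ, E) 𝓘(ℝ, F) 1 f q)
    (hg : ContMDiffAt 𝓘(ℝ, E) 𝓘(ℝ, F) 1 g q) (hfg : f q = g q) {I : Set E} (hI : IsOpen I)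
    (hq : q ∈ closure I) (h : ∀ᶠ z in 𝓝 q, z ∈ I → f z = g z) :
    tderiv E F f q = tderiv E F g q := by
  set φ := chartAt F (f q) with hφ
  have hqφ : f q ∈ φ.source := mem_chart_source F (f q)
  have hφd : IsPartialDiffeo (E := F) φ :=
    .of_mem_maximalAtlas (IsManifold.chart_mem_maximalAtlas (f q))
  have h1 := fun {u : E → M} (hu : ContMDiffAt 𝓘(ℝ, E) 𝓘(ℝ, F) 1 u q) (he : u q = f q) =>
    (((hφd.contMDiffAt (he ▸ hqφ)).of_le (by simp)).comp q hu : ContMDiffAt _ _ 1 (φ ∘ u) q)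
  have h2 := fderiv_eq_of_eventually_eq (h1 hf rfl).contDiffAt (h1 hg hfg.symm).contDiffAt hI hq
    (h.mono fun z hz hzI => congrArg φ (hz hzI))
  have h3 := tderiv_comp (E := E) (E' := F) (E'' := F) (x := q) (f := f) (g := φ)
    (hφd.mdifferentiableAt hqφ) (hf.mdifferentiableAt (by simp))
  have h4 := tderiv_comp (E := E) (E' := F) (E'' := F) (x := q) (f := g) (g := φ)
    (hφd.mdifferentiableAt (hfg ▸ hqφ)) (hg.mdifferentiableAt (by simp))
  rw [tderiv_eq_fderiv] at h3 h4
  rw [← h2, h3, ← hfg] at h4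
  ext1 v
  exact hφd.tderiv_injective hqφ (congrArg (fun L : E →L[ℝ] F => L v) h4)

section Branches

variable {Y : Type a} [TopologicalSpace Y]

/-- Finitely many parametrized `d`-dimensional submanifolds, relatively closed in `U` and with
union `S` there. -/
structure BranchFamily (A : ScAtlas.{a, c} Y) (S : Set Y) (d : ℕ) where
  U : Set Y
  openU : IsOpen U
  ι : Type
  fin : Finite ι
  M : ι → Set Y
  p : ∀ j, SubmanifoldParam A d (M j)
  subset_V : ∀ j, U ⊆ (p j).V
  subset_S : ∀ j, M j ⊆ S
  exists_mem : ∀ z ∈ S ∩ U, ∃ j, z ∈ M j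
  closed : ∀ j, ∀ z ∈ U, z ∈ closure (M j) → z ∈ M j

attribute [instance] BranchFamily.fin

/-- The branches through the base point of a local branching structure. -/
theorem LocalBranching.exists_branchFamily {Z : ScEpGroupoid.{a, b, c}} {θ : Z.Obj → ℚ≥0}
    {x : Z.Obj} (β : LocalBranching Z θ x) :
    ∃ F : BranchFamily Z.scObj {y | 0 < θ y} β.dim, x ∈ F.U ∧
      ∀ {n : ℕ} (O : EpGroupoid.{d, e} n) (h : Z.Obj → O.Obj), SmoothOnBranches O β h →
        ∀ j, ContMDiffOn (𝓡 β.dim) (𝓡 n) ∞ (h ∘ (F.p j).Φ) (F.p j).Q := by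
  choose p hp using fun j : {j // x ∈ β.M j} => β.submanifold j.1 x j.2
  have hcl : ∀ j, ∀ z ∈ β.U, z ∈ closure (β.M j) → z ∈ β.M j := by
    intro j z hz hzc
    obtain ⟨C, hC, hCM⟩ := isClosed_induced_iff.mp (β.proper j).isClosedMap.isClosed_range
    have h1 : ∀ y (hy : y ∈ β.U), y ∈ C ↔ y ∈ β.M j := by
      intro y hy
      have h2 : (⟨y, hy⟩ : β.U) ∈ Subtype.val ⁻¹' C ↔
          (⟨y, hy⟩ : β.U) ∈ range (Set.inclusion (β.subset j)) := by rw [hCM]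
      refine h2.trans ⟨?_, fun h => ⟨⟨y, h⟩, rfl⟩⟩
      rintro ⟨w, hw⟩
      have hw : w.1 = y := congrArg Subtype.val hw
      exact hw ▸ w.2
    refine (h1 z hz).mp (closure_minimal (fun y hy => (h1 y (β.subset j hy)).mpr hy) hC hzc)
  -- The neighbourhood is shrunk so as to avoid the branches which do not contain `x`.
  let U : Set Z.Obj := (β.U ∩ ⋂ j : {j // x ∈ β.M j}, (p j).V) ∩
    ⋂ j : {j // x ∉ β.M j}, (closure (β.M j.1))ᶜ
  have hU : IsOpen U := (β.openU.inter (isOpen_iInter_of_finite fun j => (p j).openV)).inter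
    (isOpen_iInter_of_finite fun j => isClosed_closure.isOpen_compl)
  refine ⟨{ U := U
            openU := hU
            ι := {j // x ∈ β.M j}
            fin := inferInstance
            M := fun j => β.M j.1
            p := p
            subset_V := fun j z hz => mem_iInter.mp hz.1.2 j
            subset_S := fun j z hz => (β.union.superset (mem_iUnion.mpr ⟨j.1, hz⟩)).1
            exists_mem := ?_
            closed := fun j z hz => hcl j.1 z hz.1.1 }, ⟨⟨β.mem, mem_iInter.mpr hp⟩, ?_⟩,
          fun O h hβ j => hβ j.1 (p j)⟩
  · rintro z ⟨hzS, hzU⟩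
    obtain ⟨j, hj⟩ := mem_iUnion.mp (β.union.subset ⟨hzS, hzU.1.1⟩)
    by_cases hx : x ∈ β.M j
    · exact ⟨⟨j, hx⟩, hj⟩
    · exact absurd (subset_closure hj) (mem_iInter.mp hzU.2 ⟨j, hx⟩)
  · exact mem_iInter.mpr fun j hj => j.2 (hcl j.1 x β.mem hj)

variable {A : ScAtlas.{a, c} Y} {S : Set Y} {k k' : ℕ} {M : Set Y}

/-- Near every parameter of a branch, that branch, transported by `σ`, is contained in one of the
branches of the family over an open set which accumulates at the parameter: finitely many relatively
closed sets cover a neighbourhood, and the Baire category theorem applies. -/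
theorem BranchFamily.exists_subset (F : BranchFamily A S k') (p : SubmanifoldParam A k M)
    (hM : M ⊆ S) {σ : OpenPartialHomeomorph Y Y} (hσS : ∀ z ∈ σ.source, z ∈ S → σ z ∈ S)
    {q : EuclideanSpace ℝ (Fin k)} (hq : q ∈ p.Q) (hqσ : p.Φ q ∈ σ.source)
    (hqF : σ (p.Φ q) ∈ F.U) :
    ∃ j I, IsOpen I ∧ q ∈ closure I ∧ (∀ z ∈ I, σ (p.Φ z) ∈ F.M j) ∧ σ (p.Φ q) ∈ F.M j := by
  have hO : IsOpen (σ.source ∩ σ ⁻¹' F.U) := σ.isOpen_inter_preimage F.openU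
  have hN : IsOpen (p.Q ∩ p.Φ ⁻¹' (σ.source ∩ σ ⁻¹' F.U)) :=
    p.smoothΦ.1.isOpen_inter_preimage p.openQ hO
  have hc : ∀ z ∈ p.Q ∩ p.Φ ⁻¹' (σ.source ∩ σ ⁻¹' F.U), ContinuousAt (σ ∘ p.Φ) z := fun z hz =>
    (σ.continuousAt hz.2.1).comp (p.smoothΦ.1.continuousAt (p.openQ.mem_nhds hz.1))
  have hcl : ∀ j, ∀ z ∈ p.Q ∩ p.Φ ⁻¹' (σ.source ∩ σ ⁻¹' F.U),
      z ∈ closure {z | σ (p.Φ z) ∈ F.M j} → σ (p.Φ z) ∈ F.M j := by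
    intro j z hz hzc
    refine F.closed j _ hz.2.2 ?_
    exact closure_mono (image_preimage_subset (σ ∘ p.Φ) (F.M j))
      (mem_closure_image (hc z hz) hzc)
  obtain ⟨j, I, hI, hIN, hqI⟩ := exists_mem_closure_interior hN hcl (fun z hz => F.exists_mem _
    ⟨hσS _ hz.2.1 (hM (p.image.subset ⟨z, hz.1, rfl⟩).1), hz.2.2⟩) ⟨hq, hqσ, hqF⟩
  exact ⟨j, I, hI, hqI, fun z hz => (hIN hz).2,
    hcl j q ⟨hq, hqσ, hqF⟩ (closure_mono (fun z hz => (hIN hz).2) hqI)⟩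

/-- The dimension of a branch is at most that of any family of branches it meets, as transition maps
have injective differentials. -/
theorem BranchFamily.dim_le (F : BranchFamily A S k') (p : SubmanifoldParam A k M)
    (hM : M ⊆ S) {σ : OpenPartialHomeomorph Y Y} (hσ : IsScOneEquiv A A σ)
    (hσS : ∀ z ∈ σ.source, z ∈ S → σ z ∈ S)
    {q : EuclideanSpace ℝ (Fin k)} (hq : q ∈ p.Q) (hqσ : p.Φ q ∈ σ.source)
    (hqF : σ (p.Φ q) ∈ F.U) : k ≤ k' := by
  obtain ⟨j, I, hI, hqI, hIM, hqM⟩ := F.exists_subset p hM hσS hq hqσ hqF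
  obtain ⟨-, h, -⟩ := p.transition (F.p j) hσ hq hqσ (F.subset_V j hqF) hqM hI hIM hqI
  have := LinearMap.finrank_le_finrank_of_injective (f := (fderiv ℝ _ q).toLinearMap) h
  simpa only [finrank_euclideanSpace_fin] using this

/-- The differentials of a map along two branches which are related by `σ` have the same image, if
the map is equivariant with respect to `σ` and a diffeomorphism `Λ`. -/
theorem BranchFamily.exists_range_tderiv_eq {n : ℕ} {O : EpGroupoid.{d, e} n}
    (F : BranchFamily A S k') (p : SubmanifoldParam A k M)
    (hM : M ⊆ S) (hk : k = k') {σ : OpenPartialHomeomorph Y Y} (hσ : IsScOneEquiv A A σ)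
    (hσS : ∀ z ∈ σ.source, z ∈ S → σ z ∈ S) {q : EuclideanSpace ℝ (Fin k)} (hq : q ∈ p.Q)
    (hqσ : p.Φ q ∈ σ.source) (hqF : σ (p.Φ q) ∈ F.U) {h : Y → O.Obj}
    (hp : ContMDiffOn (𝓡 k) (𝓡 n) ∞ (h ∘ p.Φ) p.Q)
    (hF : ∀ j, ContMDiffOn (𝓡 k') (𝓡 n) ∞ (h ∘ (F.p j).Φ) (F.p j).Q)
    {Λ : OpenPartialHomeomorph O.Obj O.Obj}
    (hΛ : IsPartialDiffeo (E := EuclideanSpace ℝ (Fin n)) Λ) (hqΛ : h (p.Φ q) ∈ Λ.source)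
    (hσΛ : ∀ᶠ z in 𝓝[S] p.Φ q, h (σ z) = Λ (h z)) :
    ∃ j, ∃ q' ∈ (F.p j).Q, (F.p j).Φ q' = σ (p.Φ q) ∧
      LinearMap.range (tderiv (EuclideanSpace ℝ (Fin k')) (EuclideanSpace ℝ (Fin n))
        (h ∘ (F.p j).Φ) q').toLinearMap =
      Submodule.map (tderiv (EuclideanSpace ℝ (Fin n)) (EuclideanSpace ℝ (Fin n)) Λ
        (h (p.Φ q))).toLinearMap (LinearMap.range (tderiv (EuclideanSpace ℝ (Fin k))
          (EuclideanSpace ℝ (Fin n)) (h ∘ p.Φ) q).toLinearMap) := by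
  obtain ⟨j, I, hI, hqI, hIM, hqM⟩ := F.exists_subset p hM hσS hq hqσ hqF
  obtain ⟨hτ, hinj, ⟨hq'Q, hq'⟩, hev⟩ :=
    p.transition (F.p j) hσ hq hqσ (F.subset_V j hqF) hqM hI hIM hqI
  set τ := (F.p j).ρ ∘ σ ∘ p.Φ with hτ_def
  have hsurj : Function.Surjective (fderiv ℝ τ q) :=
    (LinearMap.injective_iff_surjective_of_finrank_eq_finrank (f := (fderiv ℝ τ q).toLinearMap)
      (by simp only [finrank_euclideanSpace_fin, hk])).mp hinj
  have hcont : ContinuousAt p.Φ q := p.smoothΦ.1.continuousAt (p.openQ.mem_nhds hq)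
  have hpS : ∀ᶠ z in 𝓝 q, p.Φ z ∈ S := by
    filter_upwards [p.openQ.mem_nhds hq] with z hz
    exact hM (p.image.subset ⟨z, hz, rfl⟩).1
  have hσΛ' : ∀ᶠ z in 𝓝 q, h (σ (p.Φ z)) = Λ (h (p.Φ z)) :=
    (tendsto_nhdsWithin_iff.mpr ⟨hcont, hpS⟩).eventually hσΛ
  have hu' : ContMDiffAt (𝓡 k') (𝓡 n) ∞ (h ∘ (F.p j).Φ) (τ q) :=
    (hF j).contMDiffAt ((F.p j).openQ.mem_nhds hq'Q)
  have hu : ContMDiffAt (𝓡 k) (𝓡 n) ∞ (h ∘ p.Φ) q := hp.contMDiffAt (p.openQ.mem_nhds hq)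
  have hd : tderiv (EuclideanSpace ℝ (Fin k)) (EuclideanSpace ℝ (Fin n)) ((h ∘ (F.p j).Φ) ∘ τ) q =
      tderiv (EuclideanSpace ℝ (Fin k)) (EuclideanSpace ℝ (Fin n)) (Λ ∘ (h ∘ p.Φ)) q := by
    refine tderiv_eq_of_eventually_eq ((hu'.of_le (by simp)).comp q hτ.contMDiffAt)
      (((hΛ.contMDiffAt hqΛ).comp q hu).of_le (by simp)) ?_ hI hqI ?_
    · exact (congrArg h hq').trans hσΛ'.self_of_nhds
    · filter_upwards [hev, hσΛ'] with z h1 h2 hzI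
      exact (congrArg h (h1 hzI)).trans h2
  rw [tderiv_comp (E := EuclideanSpace ℝ (Fin k)) (E' := EuclideanSpace ℝ (Fin k'))
      (E'' := EuclideanSpace ℝ (Fin n)) (x := q) (f := τ) (g := h ∘ (F.p j).Φ)
      (hu'.mdifferentiableAt (by simp)) (hτ.contMDiffAt.mdifferentiableAt (by simp)),
    tderiv_comp (E := EuclideanSpace ℝ (Fin k)) (E' := EuclideanSpace ℝ (Fin n))
      (E'' := EuclideanSpace ℝ (Fin n)) (x := q) (f := h ∘ p.Φ) (g := Λ)
      (hΛ.mdifferentiableAt hqΛ) (hu.mdifferentiableAt (by simp)), tderiv_eq_fderiv] at hd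
  refine ⟨j, τ q, hq'Q, hq', ?_⟩
  rw [← LinearMap.range_comp]
  refine Eq.trans ?_ (congrArg (fun L : EuclideanSpace ℝ (Fin k) →L[ℝ] EuclideanSpace ℝ (Fin n) =>
    LinearMap.range L.toLinearMap) hd)
  exact (LinearMap.range_comp_of_range_eq_top _ (LinearMap.range_eq_top.mpr hsurj)).symm

end Branches

/-! ### Transversality of a map on a weighted branched suborbifold -/

namespace ScEpGroupoid

variable (Z : ScEpGroupoid.{a, b, c})

theorem continuous_src : Continuous Z.gr.src := continuous_iff_continuousAt.mpr fun g => by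
  obtain ⟨ψ, hg, he, -⟩ := Z.etale_src g
  exact (ψ.continuousAt hg).congr (he.eventuallyEq_of_mem (ψ.open_source.mem_nhds hg)).symm

theorem isOpenMap_tgt : IsOpenMap Z.gr.tgt := by
  refine IsOpenMap.of_nhds_le fun g => ?_
  obtain ⟨ψ, hg, he, -⟩ := Z.etale_tgt g
  rw [Filter.map_congr (he.eventuallyEq_of_mem (ψ.open_source.mem_nhds hg)),
    ψ.map_nhds_eq hg, he hg]

theorem isOpenMap_proj : IsOpenMap Z.gr.proj :=
  Z.gr.isOpenMap_proj Z.continuous_src Z.isOpenMap_tgt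

end ScEpGroupoid

variable {Z : ScEpGroupoid.{a, b, c}} {B : WeightedBranchedSuborbifold Z}

theorem WeightedBranchedSuborbifold.src_mem_iff (g : Z.Mor) :
    Z.gr.src g ∈ B.S ↔ Z.gr.tgt g ∈ B.S := by
  change 0 < B.θ _ ↔ 0 < B.θ _
  rw [B.invariant]

/-- Every morphism of `Z` extends to a local sc-diffeomorphism of the objects which preserves `S`
and with respect to which a smooth functor is equivariant. -/
theorem ScEpGroupoid.exists_transport (g : Z.Mor) :
    ∃ σ : OpenPartialHomeomorph Z.Obj Z.Obj, IsScOneEquiv Z.scObj Z.scObj σ ∧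
      Z.gr.src g ∈ σ.source ∧ σ (Z.gr.src g) = Z.gr.tgt g ∧
      (∀ (B : WeightedBranchedSuborbifold Z), ∀ z ∈ σ.source, z ∈ B.S ↔ σ z ∈ B.S) ∧
      ∀ {n : ℕ} {O : EpGroupoid.{d, e} n} (B : WeightedBranchedSuborbifold Z)
        (f : BranchedSmoothFunctor B O), Z.gr.src g ∈ B.S →
        ∀ᶠ z in 𝓝[B.S] Z.gr.src g, f.obj (σ z) = O.transport (f.mor g) (f.obj z) := by
  obtain ⟨ψ, hg, he, hψ, hψ'⟩ := Z.etale_src g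
  obtain ⟨χ, hg', he', hχ, hχ'⟩ := Z.etale_tgt g
  have hs : ∀ z ∈ (ψ.symm.trans χ).source, Z.gr.src (ψ.symm z) = z ∧
      Z.gr.tgt (ψ.symm z) = (ψ.symm.trans χ) z := fun z hz =>
    ⟨(he (ψ.map_target hz.1)).trans (ψ.right_inv hz.1), he' hz.2⟩
  have hinv : ψ.symm (Z.gr.src g) = g := by rw [he hg, ψ.left_inv hg]
  have hgs : Z.gr.src g ∈ ψ.target := by
    rw [he hg]
    exact ψ.map_source hg
  have hgσ : Z.gr.src g ∈ (ψ.symm.trans χ).source := by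
    refine ⟨hgs, ?_⟩
    change ψ.symm (Z.gr.src g) ∈ χ.source
    rwa [hinv]
  refine ⟨ψ.symm.trans χ, ⟨?_, ?_⟩, hgσ, ?_, ?_, ?_⟩
  · intro k u q hu hq
    exact (hu.comp ψ.open_target hψ' hq.1).comp χ.open_source hχ hq.2
  · intro k u q hu hq
    exact (hu.comp χ.open_target hχ' hq.1).comp ψ.open_source hψ hq.2
  · rw [← (hs _ hgσ).2, hinv]
  · intro B z hz
    rw [← (hs z hz).2, ← B.src_mem_iff, (hs z hz).1]
  · intro n O B f hgS
    have h1 : ContinuousWithinAt (fun z => f.mor (ψ.symm z)) (B.S ∩ (ψ.symm.trans χ).source)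
        (Z.gr.src g) := by
      have h2 : ContinuousWithinAt f.mor (Z.gr.src ⁻¹' B.S) (ψ.symm (Z.gr.src g)) := by
        rw [hinv]
        exact f.cont_mor g hgS
      refine h2.comp (ψ.symm.continuousAt hgs).continuousWithinAt fun z hz => ?_
      rw [mem_preimage, (hs z hz.2).1]
      exact hz.1
    have h3 : O.biNhd (f.mor g) ∈ 𝓝 (f.mor (ψ.symm (Z.gr.src g))) := by
      rw [hinv]
      exact O.biNhd_mem_nhds _
    have h4 : 𝓝[B.S ∩ (ψ.symm.trans χ).source] (Z.gr.src g) = 𝓝[B.S] (Z.gr.src g) :=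
      nhdsWithin_inter_of_mem' (nhdsWithin_le_nhds ((ψ.symm.trans χ).open_source.mem_nhds hgσ))
    rw [← h4]
    filter_upwards [h1 h3, self_mem_nhdsWithin] with z hz hzS
    obtain ⟨e1, e2⟩ := hs z hzS.2
    have hzS' : Z.gr.src (ψ.symm z) ∈ B.S := by
      rw [e1]
      exact hzS.1
    have e3 := EpGroupoid.transport_src (O := O) hz
    rw [f.src_mor _ hzS', f.tgt_mor _ hzS', e1, e2] at e3
    exact e3.symm

variable {n : ℕ} {O : EpGroupoid.{d, e} n}

/-- Two branches through equivalent points `x` and `y` of `S`, suitably chosen: the images of the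
differentials of `f` correspond under transport along `f.mor g`, where `g` is a morphism from `x`
to `y`. -/
theorem BranchedSmoothFunctor.exists_range_tderiv_eq (f : BranchedSmoothFunctor B O) {x : Z.Obj}
    (β : LocalBranching Z B.θ x) (hβ : SmoothOnBranches O β f.obj) {i : Fin β.N}
    (p : SubmanifoldParam Z.scObj β.dim (β.M i)) {q : EuclideanSpace ℝ (Fin β.dim)} (hq : q ∈ p.Q)
    (hqx : p.Φ q = x) {d' : ℕ} (F : BranchFamily Z.scObj B.S d')
    (hF : ∀ j, ContMDiffOn (𝓡 d') (𝓡 n) ∞ (f.obj ∘ (F.p j).Φ) (F.p j).Q) {g : Z.Mor}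
    (hs : Z.gr.src g = x) (ht : Z.gr.tgt g ∈ F.U) :
    ∃ j, ∃ q' ∈ (F.p j).Q, (F.p j).Φ q' = Z.gr.tgt g ∧
      LinearMap.range (tderiv (EuclideanSpace ℝ (Fin d')) (EuclideanSpace ℝ (Fin n))
        (f.obj ∘ (F.p j).Φ) q').toLinearMap =
      Submodule.map (tderiv (EuclideanSpace ℝ (Fin n)) (EuclideanSpace ℝ (Fin n))
        (O.transport (f.mor g)) (f.obj x)).toLinearMap
        (LinearMap.range (tderiv (EuclideanSpace ℝ (Fin β.dim))
          (EuclideanSpace ℝ (Fin n)) (f.obj ∘ p.Φ) q).toLinearMap) := by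
  have hM : ∀ i, β.M i ⊆ B.S := fun i z hz => (β.union.superset (mem_iUnion.mpr ⟨i, hz⟩)).1
  have hxS : x ∈ B.S := hqx.subst (motive := (· ∈ B.S)) (hM i (p.image.subset ⟨q, hq, rfl⟩).1)
  obtain ⟨σ, hσ, hgσ, hσg, hσS, hσf⟩ := ScEpGroupoid.exists_transport.{a, b, c, d, e} g
  rw [hs] at hgσ hσg hσf
  have hσS' : ∀ z ∈ σ.source, z ∈ B.S → σ z ∈ B.S := fun z hz => (hσS B z hz).mp
  have hqσ : p.Φ q ∈ σ.source := by rwa [hqx]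
  have hqF : σ (p.Φ q) ∈ F.U := by rwa [hqx, hσg]
  -- The dimensions agree, by comparison in both directions.
  have hk : β.dim ≤ d' := F.dim_le p (hM i) hσ hσS' hq hqσ hqF
  have hk' : d' ≤ β.dim := by
    obtain ⟨F', hxF', -⟩ := LocalBranching.exists_branchFamily.{a, b, c, d, e} β
    obtain ⟨j, -, -, -, -, hj⟩ := F.exists_subset p (hM i) hσS' hq hqσ hqF
    obtain ⟨q', hq', hq'j⟩ := (F.p j).image.superset ⟨hj, F.subset_V j hqF⟩
    have hq'σ : (F.p j).Φ q' ∈ σ.symm.source := hq'j ▸ σ.map_source hqσ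
    refine F'.dim_le (F.p j) (F.subset_S j) (σ := σ.symm) ⟨hσ.2, hσ.1⟩ ?_ hq' hq'σ ?_
    · intro z hz hzS
      refine (hσS B _ (σ.map_target hz)).mpr ?_
      rwa [σ.right_inv hz]
    · rw [hq'j, σ.left_inv hqσ, hqx]
      exact hxF'
  obtain ⟨j, q', hq', he, hr⟩ := F.exists_range_tderiv_eq p (hM i) (le_antisymm hk hk') hσ hσS'
    hq hqσ hqF (hβ i p) hF (O.isPartialDiffeo_transport (f.mor g)) (by
      rw [hqx, ← hs, ← f.src_mor g (hs ▸ hxS)]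
      exact EpGroupoid.src_mem_transport_self _) (hqx.symm ▸ hσf B f hxS)
  rw [hqx] at hr he
  exact ⟨j, q', hq', he.trans hσg, hr⟩

/-- Transversality of `R` and `T'` follows from that of their images under an isomorphism `L₁`. -/
theorem sup_eq_top_of_map_eq {E : Type*} [NormedAddCommGroup E] [NormedSpace ℝ E]
    {L₁ L₂ L₃ : E →L[ℝ] E} (hL₁ : Function.Bijective L₁) {R R' T T' : Submodule ℝ E}
    (hT : T' = T.map (L₂.comp L₃).toLinearMap) (hR : R' = R.map L₁.toLinearMap)
    (h : R' ⊔ (T.map L₃.toLinearMap).map (L₁.comp L₂).toLinearMap = ⊤) : R ⊔ T' = ⊤ := by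
  have h1 : (T.map L₃.toLinearMap).map (L₁.comp L₂).toLinearMap = T'.map L₁.toLinearMap := by
    rw [hT, ← Submodule.map_comp, ← Submodule.map_comp]
    rfl
  rw [h1, hR, ← Submodule.map_sup] at h
  refine Submodule.map_injective_of_injective (f := L₁.toLinearMap) hL₁.1 (h.trans ?_)
  rw [Submodule.map_top]
  exact (LinearMap.range_eq_top.mpr hL₁.2).symm

/-- If the cocycle `Ψ` is in general position to families of branches which meet all orbits of
`S`, then `f` is transverse to the image of `X`, as all branches of all local branching structures
can be compared to these. -/
theorem BranchedSmoothFunctor.transverse_image {k : ℕ} {X : Set O.Obj}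
    (hX : IsEmbeddedFullSuborbifold O k X) (f : BranchedSmoothFunctor B O) (Ψ : CocycleAut O)
    {κ : Type*} (d' : κ → ℕ) (F : ∀ l, BranchFamily Z.scObj B.S (d' l))
    (hF : ∀ l j, ContMDiffOn (𝓡 (d' l)) (𝓡 n) ∞ (f.obj ∘ ((F l).p j).Φ) ((F l).p j).Q)
    (hcov : ∀ x ∈ B.S, ∃ l, ∃ g, Z.gr.src g = x ∧ Z.gr.tgt g ∈ (F l).U)
    (hΨ : ∀ z ∈ X, ∀ l j, Ψ.TransverseAt X
      ⟨d' l, ((F l).p j).Q, f.obj ∘ ((F l).p j).Φ, ((F l).p j).openQ, hF l j⟩ z) :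
    Transverse f (Ψ.image X) := by
  rintro x hxS hfx β hβ i p q hq hqx
  obtain ⟨l, g, hs, ht⟩ := hcov x hxS
  obtain ⟨j, q', hq', he, hr⟩ := f.exists_range_tderiv_eq β hβ p hq hqx (F l) (hF l) hs ht
  obtain ⟨z, hz, i', hi', h, hhs, hht⟩ := CocycleAut.exists_of_mem_image hfx
  have hgs : O.gr.src (f.mor g) = f.obj x := (f.src_mor g (hs ▸ hxS)).trans (congrArg f.obj hs)
  have hgt : O.gr.tgt (f.mor g) = f.obj (Z.gr.tgt g) := f.tgt_mor g (hs ▸ hxS)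
  have hgh : O.gr.src (f.mor g) = O.gr.tgt h := hgs.trans hht.symm
  have h1 := hΨ z hz l j i' hi' (O.gr.comp (f.mor g) h) ((O.gr.src_comp _ _ hgh).trans hhs) q' hq'
    ((O.gr.tgt_comp _ _ hgh).trans (hgt.trans (congrArg f.obj he.symm)))
  have h2 := EpGroupoid.tderiv_transport_comp hgh
  rw [hhs, hgs] at h2
  have h3 := CocycleAut.tangentAlong_image hX hz hi' hhs
  rw [hht] at h3
  rw [h2] at h1
  have hsrc : f.obj x ∈ (O.transport (f.mor g)).source := by
    rw [← hgs]
    exact EpGroupoid.src_mem_transport_self _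
  rw [hqx]
  exact sup_eq_top_of_map_eq
    ⟨(O.isPartialDiffeo_transport (f.mor g)).tderiv_injective hsrc,
      (O.isPartialDiffeo_transport (f.mor g)).tderiv_surjective hsrc⟩ h3 hr h1

theorem proposition3p7 {n k : ℕ}
    (Z : ScEpGroupoid.{a, b, c}) [T2Space Z.gr.Orbit] [SecondCountableTopology Z.gr.Orbit]
    [ParacompactSpace Z.gr.Orbit]
    (B : WeightedBranchedSuborbifold Z) (hB : IsCompact (Z.gr.proj '' B.S))
    (O : EpGroupoid.{d, e} n) [T2Space O.gr.Orbit] [SecondCountableTopology O.gr.Orbit]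
    [ParacompactSpace O.gr.Orbit]
    (X : Set O.Obj) (hX : IsEmbeddedFullSuborbifold O k X) (hXc : IsCompact (O.gr.proj '' X))
    (hN : HasTrivialNormalIsotropy O X)
    (f : BranchedSmoothFunctor B O) :
    ∃ i' : C(underlying O X, O.gr.Orbit),
      (inclusionMap O X).Homotopic i' ∧
      IsSmoothInclusion O k X i' ∧
      HasTrivialNormalIsotropy O (O.gr.proj ⁻¹' range i') ∧
      Transverse f (O.gr.proj ⁻¹' range i') := by
  -- One local branching structure at each point of `S`; by compactness of the orbit space of `S`,
  -- finitely many of them reach all orbits, and their branches give finitely many test maps.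
  choose β hβ using fun x : B.S => f.smooth x x.2
  choose F hxF hF using fun x : B.S => LocalBranching.exists_branchFamily.{a, b, c, d, e} (β x)
  obtain ⟨t, ht⟩ := hB.elim_finite_subcover (fun x : B.S => Z.gr.proj '' (F x).U)
    (fun x => Z.isOpenMap_proj _ (F x).openU) (by
      rintro _ ⟨x, hx, rfl⟩
      exact mem_iUnion.mpr ⟨⟨x, hx⟩, x, hxF ⟨x, hx⟩, rfl⟩)
  let y : Fin t.card → B.S := fun m => t.equivFin.symm m
  obtain ⟨Ψ, hΨ⟩ := exists_cocycleAut_transverse hX hXc hN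
    (κ := Σ m : Fin t.card, (F (y m)).ι) fun l =>
      ⟨(β (y l.1)).dim, ((F (y l.1)).p l.2).Q, f.obj ∘ ((F (y l.1)).p l.2).Φ,
        ((F (y l.1)).p l.2).openQ, hF _ O f.obj (hβ _) l.2⟩
  refine ⟨Ψ.restrict X, Ψ.homotopic_restrict X, Ψ.isSmoothInclusion_restrict hX hXc, ?_, ?_⟩
  · rw [Ψ.preimage_range_restrict]
    exact CocycleAut.hasTrivialNormalIsotropy_image hX hN
  · rw [Ψ.preimage_range_restrict]
    refine f.transverse_image hX Ψ (fun m : Fin t.card => (β (y m)).dim) (fun m => F (y m))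
      (fun m => hF _ O f.obj (hβ _)) ?_ fun z hz m j => hΨ z hz ⟨m, j⟩
    intro x hx
    obtain ⟨x', hx', z, hz, he⟩ := mem_iUnion₂.mp (ht ⟨x, hx, rfl⟩)
    obtain ⟨g, hs, hgt⟩ := Z.gr.proj_eq_iff.mp he.symm
    refine ⟨t.equivFin ⟨x', hx'⟩, g, hs, ?_⟩
    have hy : y (t.equivFin ⟨x', hx'⟩) = x' :=
      congrArg Subtype.val (t.equivFin.symm_apply_apply ⟨x', hx'⟩)
    rwa [hgt, hy]
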